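/- Let $k\ge 1$ and let $(X^{N},g_0)$, $N=n+1$, be a compact smooth Riemannian manifold with non-empty boundary $M=\partial X$ and inclusion $i\colon M\to X$, where $2k\le N$. If $k\ge 3$, assume additionally that $g_0$ is locally conformally flat. For a Riemannian metric $g$ on $X$ let $\overline g=i^\ast g$, let $\eta$ be the outward-pointing unit normal along $M$, let $A(Y,Z)=g(\nabla_Y\eta,Z)$ be the second fundamental form of $M$, and let $P=\frac{1}{N-2}(\mathrm{Ric}-Jg)$, $J=\frac{R}{2(N-1)}$, be the Schouten tensor (if $N=2$, put $P=\frac{J}{2}g$, so that $J=\mathrm{tr}_gP$ in all cases). For $d\times d$ matrices $B,C$ and $0\le\ell\le m$ put $$\sigma_{m,\ell}(B,C)=\frac{1}{m!}\,\delta^{j_1\cdots j_m}_{i_1\cdots i_m}B^{i_1}_{j_1}\cdots B^{i_\ell}_{j_\ell}C^{i_{\ell+1}}_{j_{\ell+1}}\cdots C^{i_m}_{j_m},\qquad \sigma_m(B)=\sigma_{m,m}(B,B),$$ where $\delta$ is the generalized Kronecker delta, so that $\sigma_m(B)$ is the $m$-th elementary symmetric function of the eigenvalues of $B$. Define $\sigma_k^g=\sigma_k(g^{-1}P)$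 on $X$ and $$H_k^g=\sum_{j=0}^{k-1}\frac{(2k-j-1)!\,(N-2k+j)!}{(N-k)!\,(2k-2j-1)!!\,j!}\,\sigma_{2k-j-1,j}\left(\overline g^{-1}i^\ast P,\overline g^{-1}A\right)\quad\text{on }M.$$ Let $\mathfrak C=\{e^{2u}g_0 : u\in C^\infty(X)\}$ and define $\mathcal S_k\colon\mathfrak C\to\mathbb R$ by $$\mathcal S_k(g)=\frac{1}{N-2k}\left[\int_X\sigma_k^g\,\mathrm{dvol}_g+\oint_M H_k^g\,\mathrm{dvol}_{\overline g}\right]\quad\text{if }N\neq 2k,$$ $$\mathcal S_k(g)=\int_0^1\left\{\int_X u\,\sigma_k^{g_s}\,\mathrm{dvol}_{g_s}+\oint_M u\,H_k^{g_s}\,\mathrm{dvol}_{\overline g_s}\right\}ds\quad\text{if }N=2k,$$ where $g=e^{2u}g_0$ and $g_s=e^{2su}g_0$ in the second case. Then for all $g\in\mathfrak C$ and all $\Upsilon\in C^\infty(X)$ the function $t\mapsto\mathcal S_k(e^{2t\Upsilon}g)$ is differentiable at $t=0$ and $$\left.\frac{d}{dt}\right|_{t=0}\mathcal S_k\left(e^{2t\Upsilon}g\right)=\int_X\Upsilon\,\sigma_k^g\,\mathrm{dvol}_g+\oint_M\Upsilon\,H_k^g\,\mathrm{dvol}_{\overline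 g}.$$ -/

import Mathlib

open Set Bundle Manifold MeasureTheory
open scoped ContDiff

noncomputable section

namespace BdryCurv

/-! ## Mixed elementary symmetric functions of endomorphisms -/

/-- The generalized Kronecker delta `δ_{i₁ … i_m}^{j₁ … j_m}`, written as a determinant of ordinary
Kronecker deltas: it is the sign of the permutation taking `i` to `j` if `i` has distinct entries
and `j` is a rearrangement of `i`, and it is `0` otherwise. -/
def kroneckerDelta {m d : ℕ} (i j : Fin m → Fin d) : ℝ :=
  Matrix.det (Matrix.of fun a b : Fin m => if i a = j b then (1 : ℝ) else 0)

/-- `σ_{m,ℓ}(B, C)`: the polarization of the `m`-th elementary symmetric function, evaluated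
at `ℓ` factors `B` and `m - ℓ` factors `C`. -/
def mixedSigma {d : ℕ} (m ℓ : ℕ) (B C : Matrix (Fin d) (Fin d) ℝ) : ℝ :=
  (1 / (m.factorial : ℝ)) * ∑ i : Fin m → Fin d, ∑ j : Fin m → Fin d,
    kroneckerDelta i j * ∏ a : Fin m, if (a : ℕ) < ℓ then B (i a) (j a) else C (i a) (j a)

/-- `σ_m(B)`, the `m`-th elementary symmetric function of the eigenvalues of `B`, through
`σ_m(B) = (1/m!) δ_{i₁ … i_m}^{j₁ … j_m} B_{j₁}^{i₁} ⋯ B_{j_m}^{i_m}`. -/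
def sigma {d : ℕ} (m : ℕ) (B : Matrix (Fin d) (Fin d) ℝ) : ℝ :=
  mixedSigma m m B B

/-! ## Riemannian geometry in local coordinates

In this section `G` is the coordinate matrix of a metric on (an open subset of) the closed
half-space `{y | 0 ≤ y 0}` of `ℝ^{n+1}`; its dimension is `N = n + 1`.  Derivatives at points
of the hyperplane `y 0 = 0` are taken within the half-space. -/

/-- The coordinate space `ℝ^{n+1}`. -/
abbrev Coord (n : ℕ) := EuclideanSpace ℝ (Fin (n + 1))

variable {n : ℕ}

/-- The partial derivative `∂_i f` within the closed half-space. -/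
def partialDeriv (i : Fin (n + 1)) (f : Coord n → ℝ) (y : Coord n) : ℝ :=
  fderivWithin ℝ f {z : Coord n | 0 ≤ z 0} y (EuclideanSpace.single i 1)

/-- The Christoffel symbol `Γ^k_{ij}`. -/
def christoffel (G : Coord n → Matrix (Fin (n + 1)) (Fin (n + 1)) ℝ)
    (k i j : Fin (n + 1)) (y : Coord n) : ℝ :=
  (1 / 2) * ∑ l, (G y)⁻¹ k l *
    (partialDeriv i (fun z => G z j l) y + partialDeriv j (fun z => G z i l) y
      - partialDeriv l (fun z => G z i j) y)

/-- The `∂_l`-component of `R(∂_k, ∂_i) ∂_j = ∇_k ∇_i ∂_j - ∇_i ∇_k ∂_j`. -/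
def riemann (G : Coord n → Matrix (Fin (n + 1)) (Fin (n + 1)) ℝ)
    (l k i j : Fin (n + 1)) (y : Coord n) : ℝ :=
  partialDeriv k (christoffel G l i j) y - partialDeriv i (christoffel G l k j) y
    + ∑ m, (christoffel G l k m y * christoffel G m i j y
      - christoffel G l i m y * christoffel G m k j y)

/-- The Ricci tensor (positive on round spheres). -/
def ricci (G : Coord n → Matrix (Fin (n + 1)) (Fin (n + 1)) ℝ) (y : Coord n) :
    Matrix (Fin (n + 1)) (Fin (n + 1)) ℝ :=
  Matrix.of fun i j => ∑ k, riemann G k k i j y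

/-- `J = R / (2 (N - 1))`, where `R` is the scalar curvature and `N = n + 1`. -/
def traceSchouten (G : Coord n → Matrix (Fin (n + 1)) (Fin (n + 1)) ℝ) (y : Coord n) : ℝ :=
  ((G y)⁻¹ * ricci G y).trace / (2 * (n : ℝ))

/-- The Schouten tensor `P = (Ric - J g) / (N - 2)`, where `N = n + 1`.

In dimension `N = 2` this formula reads `0 / 0`, and `P` stands for `(J / 2) g`, a solution of
`(N - 2) P = Ric - J g` and `tr P = J`. -/
def schouten (G : Coord n → Matrix (Fin (n + 1)) (Fin (n + 1)) ℝ) (y : Coord n) :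
    Matrix (Fin (n + 1)) (Fin (n + 1)) ℝ :=
  if n = 1 then (traceSchouten G y / 2) • G y
  else (1 / ((n : ℝ) - 1)) • (ricci G y - traceSchouten G y • G y)

/-- The restriction of a bilinear form to the hyperplanes `y 0 = const`, spanned
by `∂_1, …, ∂_n`. -/
def tangential (B : Matrix (Fin (n + 1)) (Fin (n + 1)) ℝ) : Matrix (Fin n) (Fin n) ℝ :=
  B.submatrix Fin.succ Fin.succ

/-- The components of the unit normal field of the hyperplanes `y 0 = const` on the side
where `y 0` decreases.  On `y 0 = 0` it is the outward-pointing unit normal `η`. -/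
def unitNormal (G : Coord n → Matrix (Fin (n + 1)) (Fin (n + 1)) ℝ) (i : Fin (n + 1))
    (y : Coord n) : ℝ :=
  -((G y)⁻¹ i 0) / Real.sqrt ((G y)⁻¹ 0 0)

/-- The second fundamental form `A(Y, Z) = g(∇_Y η, Z)` on the vectors `∂_1, …, ∂_n`. -/
def secondFundForm (G : Coord n → Matrix (Fin (n + 1)) (Fin (n + 1)) ℝ) (y : Coord n) :
    Matrix (Fin n) (Fin n) ℝ :=
  Matrix.of fun a b => ∑ i, G y i b.succ *
    (partialDeriv a.succ (unitNormal G i) y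
      + ∑ j, christoffel G i a.succ j y * unitNormal G j y)

/-! ## Smooth Riemannian metrics on a manifold with boundary -/

section

variable (n) in
/-- A smooth Riemannian metric on a smooth `(n + 1)`-manifold `X` with boundary. -/
abbrev Metric (X : Type*) [TopologicalSpace X] [ChartedSpace (EuclideanHalfSpace (n + 1)) X]
    [IsManifold (𝓡∂ (n + 1)) ∞ X] :=
  ContMDiffRiemannianMetric (𝓡∂ (n + 1)) ∞ (Coord n)
    (fun x : X => TangentSpace (𝓡∂ (n + 1)) x)

variable {X : Type*} [TopologicalSpace X] [ChartedSpace (EuclideanHalfSpace (n + 1)) X]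
  [IsManifold (𝓡∂ (n + 1)) ∞ X]

set_option synthInstance.maxHeartbeats 200000 in
/-- The conformal metric `e^{2u} g`. -/
def conformal (u : C^∞⟮𝓡∂ (n + 1), X; ℝ⟯) (g : Metric n X) : Metric n X where
  inner x := Real.exp (2 * u x) • g.inner x
  symm x v w := by
    simp [g.symm x v w]
  pos x v hv := by
    simpa using mul_pos (Real.exp_pos (2 * u x)) (g.pos x v hv)
  isVonNBounded x := by
    have h := (g.isVonNBounded x).image (Real.exp (-u x) • ContinuousLinearMap.id ℝ _)
    refine Bornology.IsVonNBounded.subset ?_ h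
    intro v hv
    refine ⟨Real.exp (u x) • v, ?_, ?_⟩
    · have e : Real.exp (2 * u x) = Real.exp (u x) * Real.exp (u x) := by
        rw [← Real.exp_add]; ring_nf
      simpa [e, mul_assoc] using hv
    · simp [smul_smul, ← Real.exp_add]
  contMDiff := by
    have h : ContMDiff (𝓡∂ (n + 1)) 𝓘(ℝ) ∞ fun x : X => Real.exp (2 * u x) :=
      Real.contDiff_exp.contMDiff.comp (contMDiff_const.mul u.contMDiff)
    exact ContMDiff.smul_section
      (V := fun x : X => TangentSpace (𝓡∂ (n + 1)) x →L[ℝ] TangentSpace (𝓡∂ (n + 1)) x →L[ℝ] ℝ)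
      h g.contMDiff

/-- The conformal class `{e^{2u} g₀ | u ∈ C^∞(X)}`. -/
def conformalClass (g₀ : Metric n X) : Set (Metric n X) :=
  {g | ∃ u : C^∞⟮𝓡∂ (n + 1), X; ℝ⟯, g = conformal u g₀}

open Classical in
/-- The function `u` with `g = e^{2u} g₀`, for `g` in the conformal class of `g₀`. -/
def logFactor (g₀ g : Metric n X) : C^∞⟮𝓡∂ (n + 1), X; ℝ⟯ :=
  if h : ∃ u : C^∞⟮𝓡∂ (n + 1), X; ℝ⟯, g = conformal u g₀ then h.choose else 0

/-- `u` is determined by `e^{2u} g₀`. -/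
theorem logFactor_conformal (g₀ : Metric n X) (u : C^∞⟮𝓡∂ (n + 1), X; ℝ⟯) :
    logFactor g₀ (conformal u g₀) = u := by
  have h : ∃ w : C^∞⟮𝓡∂ (n + 1), X; ℝ⟯, conformal u g₀ = conformal w g₀ := ⟨u, rfl⟩
  have hw := h.choose_spec
  have e : logFactor g₀ (conformal u g₀) = h.choose := dif_pos h
  rw [e]
  ext x
  set w := h.choose
  obtain ⟨v, hv⟩ : ∃ v : TangentSpace (𝓡∂ (n + 1)) x, v ≠ 0 :=
    exists_ne (0 : Coord n)
  have h1 : Real.exp (2 * u x) * g₀.inner x v v = Real.exp (2 * w x) * g₀.inner x v v :=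
    congrArg (fun m : Metric n X => m.inner x v v) hw
  have h2 := Real.exp_injective (mul_right_cancel₀ (g₀.pos x v hv).ne' h1)
  linarith

/-- `g` is locally conformally flat: near every point, boundary points included, there is a smooth
map to `ℝ^{n+1}` which pulls the Euclidean metric back to a positive multiple of `g`. -/
def LocallyConformallyFlat (g : Metric n X) : Prop :=
  ∀ p : X, ∃ U : Set X, IsOpen U ∧ p ∈ U ∧
    ∃ (F : X → Coord n) (c : X → ℝ),
      ContMDiffOn (𝓡∂ (n + 1)) 𝓘(ℝ, Coord n) ∞ F U ∧
      ∀ q ∈ U, 0 < c q ∧ ∀ v w : TangentSpace (𝓡∂ (n + 1)) q,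
        inner ℝ (E := Coord n) (mfderiv (𝓡∂ (n + 1)) 𝓘(ℝ, Coord n) F q v)
          (mfderiv (𝓡∂ (n + 1)) 𝓘(ℝ, Coord n) F q w) = c q * g.inner q v w

/-- The coordinate vector field `∂_i` of the chart at `p`, at the point with coordinates `y`. -/
def coordVector (p : X) (i : Fin (n + 1)) (y : Coord n) :
    TangentSpace (𝓡∂ (n + 1)) ((extChartAt (𝓡∂ (n + 1)) p).symm y) :=
  mfderivWithin 𝓘(ℝ, Coord n) (𝓡∂ (n + 1)) (extChartAt (𝓡∂ (n + 1)) p).symm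
    (range (𝓡∂ (n + 1))) y (EuclideanSpace.single i 1 : Coord n)

/-- The matrix of `g` in the chart at `p`, as a function of the coordinates. -/
def chartMetric (g : Metric n X) (p : X) (y : Coord n) :
    Matrix (Fin (n + 1)) (Fin (n + 1)) ℝ :=
  Matrix.of fun i j => g.inner ((extChartAt (𝓡∂ (n + 1)) p).symm y)
    (coordVector p i y) (coordVector p j y)

/-- The `σ_k`-curvature `σ_k(g⁻¹ P)`, computed at `p` in the chart at `p`. -/
def sigmaCurv (k : ℕ) (g : Metric n X) (p : X) : ℝ :=
  let G := chartMetric g p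
  let y := extChartAt (𝓡∂ (n + 1)) p p
  sigma k ((G y)⁻¹ * schouten G y)

/-- The `H_k`-curvature of the boundary (meant at boundary points `p`), with `N = n + 1`:
`∑_{j<k} (2k-j-1)! (N-2k+j)! / ((N-k)! (2k-2j-1)!! j!) σ_{2k-j-1,j}(ḡ⁻¹ i^*P, ḡ⁻¹ A)`.

The coefficients are meaningful for `2k ≤ N` only. -/
def hCurv (k : ℕ) (g : Metric n X) (p : X) : ℝ :=
  let G := chartMetric g p
  let y := extChartAt (𝓡∂ (n + 1)) p p
  ∑ j ∈ Finset.range k,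
    (((2 * k - j - 1).factorial : ℝ) * ((n + 1 - 2 * k + j).factorial : ℝ) /
      (((n + 1 - k).factorial : ℝ) * ((2 * k - 2 * j - 1).doubleFactorial : ℝ)
        * (j.factorial : ℝ))) *
    mixedSigma (2 * k - j - 1) j
      ((tangential (G y))⁻¹ * tangential (schouten G y))
      ((tangential (G y))⁻¹ * secondFundForm G y)

variable [MeasurableSpace X]

/-- The Riemannian measure `dvol_g`.  The measure attached to a chart is `√(det g_ij) dy` on the
chart domain (and zero outside); these agree on overlaps, and their supremum is the measure that
restricts to each of them. -/
def vol (g : Metric n X) : Measure X :=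
  ⨆ p : X, Measure.map (extChartAt (𝓡∂ (n + 1)) p).symm
    ((volume.restrict (extChartAt (𝓡∂ (n + 1)) p).target).withDensity
      fun y => ENNReal.ofReal (Real.sqrt (chartMetric g p y).det))

/-- The inclusion `ℝ^n → ℝ^{n+1}` of the hyperplane `y 0 = 0`. -/
def hyperplane (z : EuclideanSpace ℝ (Fin n)) : Coord n :=
  WithLp.toLp 2 (Fin.cons 0 fun i => z i)

/-- The Riemannian measure `dvol_ḡ` of the boundary with its induced metric `ḡ`, as a measure
on `X` carried by `∂X`.  In a chart it is `√(det ḡ_ab) dz` on the hyperplane `y 0 = 0`. -/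
def bdryVol (g : Metric n X) : Measure X :=
  ⨆ p : X, Measure.map (fun z => (extChartAt (𝓡∂ (n + 1)) p).symm (hyperplane z))
    ((volume.restrict
        (hyperplane ⁻¹' (extChartAt (𝓡∂ (n + 1)) p).target)).withDensity
      fun z => ENNReal.ofReal (Real.sqrt (tangential (chartMetric g p (hyperplane z))).det))

/-- `∫_X f σ_k^g dvol_g + ∮_{∂X} f H_k^g dvol_ḡ`. -/
def curvPairing (k : ℕ) (g : Metric n X) (f : X → ℝ) : ℝ :=
  (∫ x, f x * sigmaCurv k g x ∂(vol g)) + ∫ x, f x * hCurv k g x ∂(bdryVol g)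

/-- The functional `S_k` on the conformal class of `g₀`, with `N = n + 1`.  If `N ≠ 2k` it is
`(N - 2k)⁻¹ (∫ σ_k^g dvol_g + ∮ H_k^g dvol_ḡ)`.  If `N = 2k` and `g = e^{2u} g₀` it is
`∫_0^1 (∫ u σ_k^{g_s} dvol_{g_s} + ∮ u H_k^{g_s} dvol_{ḡ_s}) ds`, where `g_s = e^{2su} g₀`. -/
def functionalS (k : ℕ) (g₀ g : Metric n X) : ℝ :=
  if n + 1 = 2 * k then
    ∫ s in (0 : ℝ)..1,
      curvPairing k (conformal (s • logFactor g₀ g) g₀) (fun x => logFactor g₀ g x)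
  else
    (((n : ℝ) + 1) - 2 * (k : ℝ))⁻¹ * curvPairing k g (fun _ => 1)

end

end BdryCurv

end

open scoped Matrix Topology

set_option linter.unusedSectionVars false
set_option linter.unusedSimpArgs false

noncomputable section

namespace BdryCurv

section

open Polynomial

/-! ## Derivations, determinants and adjugates -/

section DerivationMatrix

variable {S A : Type*} [CommRing S] [CommRing A] [Algebra S A]
  {ι : Type*} [Fintype ι] [DecidableEq ι]

/-! For a metric g in the conformal class and a function f, let F_g(f) = ∫ f σ_k + ∮ f H_k
(`curvPairing`). It is linear in f, so it is a one-form on the conformal class, viewed as an affine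
space modelled on C^∞(X), and the theorem says that S_k is a primitive of it. The point is therefore
closedness: the bilinear form B(v, f), the derivative of F at e^{2εv}g tested on f at ε = 0, is
symmetric (`exists_symmetric_variation`). Put m = N - 2k. Constant rescaling multiplies F by e^{mε}
(`curvPairing_const`). If m > 0, the derivative of F_g(1)/m in the direction Υ is B(Υ, 1)/m = B(1,
Υ)/m = F_g(Υ). If m = 0, S_k is the integral of the one-form along the ray from g₀, and closedness
in the plane spanned by u and Υ gives the derivative as in the Poincaré lemma
(`hasDerivAt_ray_integral`).

Symmetry in the interior. To first order the Schouten tensor P changes by minus the Hessian of v, so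
by Jacobi's formula the interior density changes by -T^{ij}∇_i∇_j v + m v σ_k, where T is the Newton
tensor, a coefficient of the adjugate of the pencil r g + P. This T is divergence free
(`sum_derivation_newton`): for k = 1 it is the inverse metric, for k = 2 this is the contracted
Bianchi identity, and for k ≥ 3 conformal flatness makes the Cotton tensor vanish
(`IsLeviCivita.cotton_eq_zero`), so that P is a Codazzi tensor. Hence the antisymmetric part of B
is, in the interior, the flux of T(f dv - v df) through the boundary.

Symmetry at the boundary. H_k is a weighted sum of coefficients of det(r ḡ + P̄ + t A), where P̄ is
the restriction of P (`sum_mixedSigma_eq_hFun`). The weights make the functional `hFun` telescope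
against the derivation D = t ∂_r - ∂_t, leaving one coefficient (`hFun_rotDer`). Now D(r ḡ + P̄ + t
A) = t ḡ - A occurs twice. By the Gauss formula, P̄ + t A changes to first order by minus the
tangential Hessian of v plus η(v)(t ḡ - A). By the Codazzi equations, the antisymmetrised derivative
of the pencil is t ḡ - A wedged with the covector P(η, ·), up to sign. Thus the boundary Newton
tensor has as divergence the Newton tensor of P̄ applied to this covector
(`sum_derivation_bdryNewton`), and the same expression is found in the normal row of T
(`sum_newton_zero`). So the flux and the boundary variation cancel up to a tangential divergence
(`current_zero_add_bdryVar`), and integration gives `IsMetricOn.integral_green`.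

All these identities are algebraic. They are proved over a commutative ring with commuting
derivations and then applied to the smooth functions on relatively open subsets of the half-space.
Along a line ε w of conformal factors each density is a polynomial in ε times e^{mεw}, which makes
differentiation under the integral elementary. Transformation laws show that the curvatures and
measures do not depend on the chart, and a partition of unity reduces symmetry on X to symmetry in a
chart. -/

theorem derivation_prod (δ : Derivation S A A) {κ : Type*} [DecidableEq κ] (s : Finset κ)
    (f : κ → A) : δ (∏ i ∈ s, f i) = ∑ i ∈ s, δ (f i) * ∏ j ∈ s.erase i, f j := by
  induction s using Finset.induction_on with
  | empty => simp
  | insert a s ha ih =>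
    rw [Finset.prod_insert ha, Derivation.leibniz, ih, Finset.sum_insert ha,
      Finset.erase_insert ha, smul_eq_mul, smul_eq_mul, Finset.mul_sum, mul_comm (∏ i ∈ s, f i),
      add_comm]
    congr 1
    refine Finset.sum_congr rfl fun i hi => ?_
    have hia : a ≠ i := fun h => ha (h ▸ hi)
    rw [Finset.erase_insert_of_ne hia, Finset.prod_insert (by simp [ha])]
    ring

theorem derivation_map_mul {κ μ ν : Type*} [Fintype κ] (δ : Derivation S A A)
    (M : Matrix μ κ A) (N : Matrix κ ν A) :
    (M * N).map δ = M.map δ * N + M * N.map δ := by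
  ext i j
  simp only [Matrix.map_apply, Matrix.mul_apply, Matrix.add_apply, map_sum, Derivation.leibniz,
    smul_eq_mul, ← Finset.sum_add_distrib]
  exact Finset.sum_congr rfl fun k _ => by ring

theorem derivation_map_one (δ : Derivation S A A) : (1 : Matrix ι ι A).map δ = 0 := by
  ext i j
  by_cases h : i = j <;> simp [h, Matrix.one_apply]

/-- Jacobi's formula. -/
theorem derivation_det (δ : Derivation S A A) (M : Matrix ι ι A) :
    δ M.det = (M.adjugate * M.map δ).trace := by
  -- Cramer's rule: the diagonal entries are determinants of M with one column differentiated, and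
  -- their sum is the Leibniz rule for the determinant.
  have h1 : (M.adjugate * M.map δ).trace = ∑ i, (M.updateCol i fun j => δ (M j i)).det := by
    simp only [Matrix.trace, Matrix.diag_apply]
    refine Finset.sum_congr rfl fun i _ => ?_
    rw [← Matrix.cramer_apply, Matrix.cramer_eq_adjugate_mulVec]
    rfl
  rw [h1]
  simp only [Matrix.det_apply, map_sum]
  rw [Finset.sum_comm]
  refine Finset.sum_congr rfl fun σ _ => ?_
  rw [← Finset.smul_sum]
  have : δ (Equiv.Perm.sign σ • ∏ i, M (σ i) i) = Equiv.Perm.sign σ • δ (∏ i, M (σ i) i) := by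
    rcases Int.units_eq_one_or (Equiv.Perm.sign σ) with h | h <;> simp [h]
  rw [this, derivation_prod]
  congr 1
  refine Finset.sum_congr rfl fun i _ => ?_
  rw [← Finset.mul_prod_erase _ _ (Finset.mem_univ i)]
  simp only [Matrix.updateCol_self]
  congr 1
  refine Finset.prod_congr rfl fun j hj => ?_
  rw [Matrix.updateCol_ne (Finset.ne_of_mem_erase hj)]

/-- Apply δ to M · adj M = det M · 1 and multiply by adj M from the left. The factor det M is kept
because M will be a pencil, whose determinant is regular but not a unit. -/
theorem derivation_adjugate (δ : Derivation S A A) (M : Matrix ι ι A) :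
    M.det • M.adjugate.map δ =
      (M.adjugate * M.map δ).trace • M.adjugate - M.adjugate * M.map δ * M.adjugate := by
  have h : (M * M.adjugate).map δ = (M.adjugate * M.map δ).trace • 1 := by
    rw [Matrix.mul_adjugate, ← derivation_det]
    ext i j
    by_cases h : i = j <;> simp [h, Matrix.one_apply]
  rw [derivation_map_mul] at h
  have h2 := congrArg (fun X => M.adjugate * X) h
  simp only [mul_add, ← mul_assoc, Matrix.adjugate_mul] at h2
  simp only [Matrix.smul_mul, one_mul, Matrix.mul_smul, mul_one] at h2
  rw [← h2]; abel

/-- The derivative of the inverse matrix. -/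
theorem derivation_inv (δ : Derivation S A A) (M : Matrix ι ι A) (hM : IsUnit M.det) :
    M⁻¹.map δ = -(M⁻¹ * M.map δ * M⁻¹) := by
  have h : (M * M⁻¹).map δ = 0 := by rw [Matrix.mul_nonsing_inv _ hM, derivation_map_one]
  rw [derivation_map_mul] at h
  have h2 := congrArg (fun X => M⁻¹ * X) h
  simp only [mul_add, ← mul_assoc, Matrix.nonsing_inv_mul _ hM, one_mul, mul_zero] at h2
  rw [add_comm] at h2
  exact eq_neg_of_add_eq_zero_left h2

end DerivationMatrix

/-! ## Polynomials with coefficients in a differential ring -/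

section PolyDer

variable {S A : Type*} [CommRing S] [CommRing A] [Algebra S A]

/-- The derivation of `A[X]` which acts on the coefficients. -/
def polyDer (δ : Derivation S A A) : Derivation S A[X] A[X] :=
  Derivation.mk'
    { toFun := fun p => ∑ i ∈ p.support, monomial i (δ (p.coeff i))
      map_add' := fun p q => by
        ext n
        simp only [finsetSum_coeff, coeff_monomial, coeff_add, Finset.sum_ite_eq', mem_support_iff]
        split_ifs <;> simp_all [← map_add]
      map_smul' := fun c p => by
        ext n
        simp only [finsetSum_coeff, coeff_monomial, coeff_smul, Finset.sum_ite_eq',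
          mem_support_iff, RingHom.id_apply, Derivation.map_smul]
        split_ifs with h1 h2 h2
        · rfl
        · simp_all
        · have : δ (c • p.coeff n) = 0 := by simp_all
          rw [← this, Derivation.map_smul]
        · simp }
    (fun p q => by
      have key : ∀ (p : A[X]) (n : ℕ),
          (∑ i ∈ p.support, monomial i (δ (p.coeff i))).coeff n = δ (p.coeff n) := by
        intro p n
        simp only [finsetSum_coeff, coeff_monomial, Finset.sum_ite_eq', mem_support_iff]
        split_ifs with h <;> simp_all
      ext n
      simp only [LinearMap.coe_mk, AddHom.coe_mk, smul_eq_mul, coeff_add]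
      rw [key, coeff_mul, coeff_mul, coeff_mul]
      simp only [key, map_sum, Derivation.leibniz, Finset.sum_add_distrib, smul_eq_mul]
      rw [← Finset.Nat.sum_antidiagonal_swap (f := fun x => q.coeff x.1 * δ (p.coeff x.2))]
      rfl)

@[simp]
theorem coeff_polyDer (δ : Derivation S A A) (p : A[X]) (n : ℕ) :
    (polyDer δ p).coeff n = δ (p.coeff n) := by
  change (∑ i ∈ p.support, monomial i (δ (p.coeff i))).coeff n = _
  simp only [finsetSum_coeff, coeff_monomial, Finset.sum_ite_eq', mem_support_iff]
  split_ifs with h <;> simp_all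

@[simp]
theorem polyDer_C (δ : Derivation S A A) (a : A) : polyDer δ (C a) = C (δ a) := by
  ext n; by_cases h : n = 0 <;> simp [coeff_C, h]

@[simp]
theorem polyDer_X (δ : Derivation S A A) : polyDer δ (X : A[X]) = 0 := by
  ext n; by_cases h : 1 = n <;> simp [coeff_X, h]

end PolyDer

/-! ### Matrix pencils and the regularity of their determinants. -/

section Pencil

variable {A : Type*} [CommRing A] {ι : Type*} [Fintype ι] [DecidableEq ι]

/-- The matrix pencil `X G + B`. -/
def pencil (G B : Matrix ι ι A) : Matrix ι ι A[X] := (X : A[X]) • G.map C + B.map C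

theorem pencil_apply (G B : Matrix ι ι A) (i j : ι) :
    pencil G B i j = X * C (G i j) + C (B i j) := by
  simp [pencil]

/-- Up to the unit det G this is the characteristic polynomial of `-(G⁻¹ * B)`, which is monic.
Regularity replaces division by the determinant in the adjugate identities. -/
theorem isRegular_det_pencil (G B : Matrix ι ι A) (hG : IsUnit G.det) :
    IsRegular (pencil G B).det := by
  have h : pencil G B = G.map C * ((X : A[X]) • (1 : Matrix ι ι A[X]) - (-(G⁻¹ * B)).map C) := by
    have : (-(G⁻¹ * B)).map (C : A →+* A[X]) = -((G⁻¹ * B).map (C : A →+* A[X])) := by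
      ext i j : 2
      simp only [Matrix.map_apply, Matrix.neg_apply, map_neg]
    rw [this, sub_neg_eq_add, mul_add, Matrix.mul_smul, mul_one, pencil, ← Matrix.map_mul,
      ← mul_assoc, Matrix.mul_nonsing_inv _ hG, one_mul]
  have h2 : ((X : A[X]) • (1 : Matrix ι ι A[X]) - (-(G⁻¹ * B)).map C) = Matrix.charmatrix (-(G⁻¹ * B)) := by
    rw [Matrix.charmatrix]
    congr 1
    ext i j; by_cases hij : i = j <;> simp [hij, Matrix.one_apply]
  rw [h, h2, Matrix.det_mul]
  refine IsRegular.mul ?_ (Matrix.charpoly_monic (-(G⁻¹ * B))).isRegular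
  have : (G.map C).det = C G.det := (RingHom.map_det C G).symm
  rw [this]
  exact (hG.map C).isRegular

theorem map_pencil {B : Type*} [CommRing B] (φ : A →+* B) (G H : Matrix ι ι A) :
    (pencil G H).map (mapRingHom φ) = pencil (G.map φ) (H.map φ) := by
  ext i j : 1
  simp [pencil_apply]

end Pencil

/-- The coefficient of `r^a t^b` of an element of `A[t][r]`. -/
def cf {A : Type*} [CommRing A] (a b : ℕ) (f : A[X][X]) : A := (f.coeff a).coeff b

/-! ### Total degree in two variables, and the derivation t ∂_r - ∂_t. -/

section Bivariate

variable {A : Type*} [CommRing A] {ι : Type*} [Fintype ι] [DecidableEq ι]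

theorem cf_add (a b : ℕ) (f g : A[X][X]) : cf a b (f + g) = cf a b f + cf a b g := by simp [cf]
theorem cf_sub (a b : ℕ) (f g : A[X][X]) : cf a b (f - g) = cf a b f - cf a b g := by simp [cf]
theorem cf_sum {κ : Type*} (s : Finset κ) (a b : ℕ) (f : κ → A[X][X]) :
    cf a b (∑ i ∈ s, f i) = ∑ i ∈ s, cf a b (f i) := by simp [cf]
theorem cf_CC_mul (a b : ℕ) (c : A) (f : A[X][X]) : cf a b (C (C c) * f) = c * cf a b f := by
  simp [cf]

/-- `f` has total degree at most `m`. -/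
def TDegLE (m : ℕ) (f : A[X][X]) : Prop := ∀ a b, m < a + b → cf a b f = 0

theorem TDegLE.sum {m : ℕ} {κ : Type*} {s : Finset κ} {f : κ → A[X][X]}
    (h : ∀ i ∈ s, TDegLE m (f i)) : TDegLE m (∑ i ∈ s, f i) := fun a b hab => by
  rw [cf_sum]; exact Finset.sum_eq_zero fun i hi => h i hi a b hab

theorem TDegLE.mul {m l : ℕ} {f g : A[X][X]} (hf : TDegLE m f) (hg : TDegLE l g) :
    TDegLE (m + l) (f * g) := fun a b hab => by
  simp only [cf, coeff_mul, finsetSum_coeff]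
  refine Finset.sum_eq_zero fun x hx => Finset.sum_eq_zero fun y hy => ?_
  rw [Finset.HasAntidiagonal.mem_antidiagonal] at hx hy
  by_cases h : m < x.1 + y.1
  · have := hf _ _ h
    rw [cf] at this; rw [this, zero_mul]
  · have := hg x.2 y.2 (by omega)
    rw [cf] at this; rw [this, mul_zero]

theorem TDegLE.prod {κ : Type*} (s : Finset κ) {f : κ → A[X][X]}
    (h : ∀ i ∈ s, TDegLE 1 (f i)) : TDegLE s.card (∏ i ∈ s, f i) := by
  classical
  induction s using Finset.induction_on with
  | empty =>
    intro a b hab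
    simp only [cf, Finset.prod_empty, coeff_one]
    split_ifs with h
    · rw [coeff_one, if_neg]; simp at hab; omega
    · simp
  | insert i s hi ih =>
    rw [Finset.prod_insert hi, Finset.card_insert_of_notMem hi, add_comm]
    exact (h i (by simp)).mul (ih fun j hj => h j (by simp [hj]))

theorem TDegLE.det {M : Matrix ι ι A[X][X]} (h : ∀ i j, TDegLE 1 (M i j)) :
    TDegLE (Fintype.card ι) M.det := by
  rw [Matrix.det_apply]
  refine TDegLE.sum fun σ _ a b hab => ?_
  have := TDegLE.prod Finset.univ (f := fun i => M (σ i) i) (fun i _ => h _ _) a b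
    (by simpa using hab)
  rcases Int.units_eq_one_or (Equiv.Perm.sign σ) with h | h
  · simpa [h] using this
  · rw [h]; simp only [cf] at this ⊢; simp [this]

/-- An entry of the adjugate is the determinant with one row replaced by a unit vector. The bound is
one more than the true degree; `cfMat_adjugate_eq_zero` recovers the missing one when G is
invertible. -/
theorem TDegLE.adjugate {M : Matrix ι ι A[X][X]} (h : ∀ i j, TDegLE 1 (M i j)) (i j : ι) :
    TDegLE (Fintype.card ι) (M.adjugate i j) := by
  rw [Matrix.adjugate_apply]
  refine TDegLE.det fun a b => ?_
  rw [Matrix.updateRow_apply]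
  split_ifs with hj
  · intro c d hcd
    rw [Pi.single_apply]
    split_ifs
    · simp only [cf, coeff_one]
      split_ifs
      · rw [coeff_one, if_neg]; omega
      · simp
    · simp [cf]
  · exact h a b

/-- The derivation `t ∂_r - ∂_t` of `A[t][r]`. -/
def rotDer (A : Type*) [CommRing A] : Derivation A A[X][X] A[X][X] :=
  (C (X : A[X])) • (derivative' (R := A[X])).restrictScalars A - polyDer (derivative' (R := A))

theorem rotDer_apply (f : A[X][X]) :
    rotDer A f = C (X : A[X]) * derivative f - polyDer (derivative' (R := A)) f := rfl

/-- Positive powers of t suffice, because `hFun` reads off odd powers only. -/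
theorem cf_rotDer (a b : ℕ) (f : A[X][X]) :
    cf a (b + 1) (rotDer A f) = (a + 1) * cf (a + 1) b f - (b + 2) * cf a (b + 2) f := by
  rw [rotDer_apply]
  simp only [cf, coeff_sub, coeff_C_mul, coeff_X_mul, coeff_derivative, coeff_polyDer]
  have : (derivative' (f.coeff a)) = derivative (f.coeff a) := rfl
  rw [this, coeff_derivative]
  have h2 : ((f.coeff (a + 1)) * ((a : A[X]) + 1)).coeff b = (f.coeff (a+1)).coeff b * (a + 1) := by
    have : ((a : A[X]) + 1) = C ((a : A) + 1) := by simp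
    rw [this, coeff_mul_C]
  rw [h2]
  push_cast
  ring

end Bivariate

/-! ## The coefficients of the boundary curvature -/

/-- The coefficient of `σ_{2k-j-1,j}` in `H_k` (with `m = N - 2k`), relative to the coefficient
of `r^{m+j} t^{2k-1-2j}` in `det (r + B + t C)`. -/
def hWeight (m k j : ℕ) : ℝ :=
  ((m + j).factorial : ℝ) * 2 ^ (k - 1 - j) * ((k - 1 - j).factorial : ℝ) / ((m + k).factorial : ℝ)

section HFunctional

variable {A : Type*} [CommRing A] [Algebra ℝ A]

/-- The linear functional on `A[t][r]` which takes `det (r + B + t C)` to `H_k`. -/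
def hFun (m k : ℕ) (f : A[X][X]) : A :=
  ∑ j ∈ Finset.range k, hWeight m k j • cf (m + j) (2 * k - 1 - 2 * j) f

theorem hFun_add (m k : ℕ) (f g : A[X][X]) : hFun m k (f + g) = hFun m k f + hFun m k g := by
  simp [hFun, cf_add, Finset.sum_add_distrib]

theorem hFun_sub (m k : ℕ) (f g : A[X][X]) : hFun m k (f - g) = hFun m k f - hFun m k g := by
  simp [hFun, cf_sub, smul_sub, Finset.sum_sub_distrib]

theorem hFun_sum {κ : Type*} (s : Finset κ) (m k : ℕ) (f : κ → A[X][X]) :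
    hFun m k (∑ i ∈ s, f i) = ∑ i ∈ s, hFun m k (f i) := by
  simp only [hFun, cf_sum, Finset.smul_sum]
  exact Finset.sum_comm

theorem hFun_CC_mul (m k : ℕ) (c : A) (f : A[X][X]) :
    hFun m k (C (C c) * f) = c * hFun m k f := by
  simp [hFun, cf_CC_mul, Finset.mul_sum]

theorem hFun_mul_CC (m k : ℕ) (c : A) (f : A[X][X]) :
    hFun m k (f * C (C c)) = hFun m k f * c := by
  rw [mul_comm, hFun_CC_mul, mul_comm]

theorem hFun_polyDer (m k : ℕ) (δ : Derivation ℝ A A) (f : A[X][X]) :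
    hFun m k (polyDer (polyDer δ) f) = δ (hFun m k f) := by
  simp [hFun, cf]

theorem map_hFun {B : Type*} [CommRing B] [Algebra ℝ B] (φ : A →ₐ[ℝ] B) (m k : ℕ) (f : A[X][X]) :
    φ (hFun m k f) = hFun m k (f.map (mapRingHom (φ : A →+* B))) := by
  simp [hFun, cf, coeff_map]

/-- The functional `H_k` of `(t ∂_r - ∂_t) f` is a single coefficient of `f`. -/
theorem hFun_rotDer (m k : ℕ) (hk : 1 ≤ k) (f : A[X][X]) (hf : cf m (2 * k) f = 0) :
    hFun m k (rotDer A f) = cf (m + k) 0 f := by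
  -- These numbers make the sum telescope: (m + j + 1) times `hWeight m k j` is `w (j + 1)`, and (2k
  -- - 2j) times it is `w j`.
  let w : ℕ → ℝ := fun j =>
    ((m + j).factorial : ℝ) * 2 ^ (k - j) * ((k - j).factorial : ℝ) / ((m + k).factorial : ℝ)
  have h : ∀ j ∈ Finset.range k,
      hWeight m k j • cf (m + j) (2 * k - 1 - 2 * j) (rotDer A f) =
        w (j + 1) • cf (m + (j + 1)) (2 * k - 2 * (j + 1)) f
          - w j • cf (m + j) (2 * k - 2 * j) f := by
    intro j hj
    rw [Finset.mem_range] at hj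
    obtain ⟨l, rfl⟩ : ∃ l, k = j + l + 1 := ⟨k - j - 1, by omega⟩
    have e1 : 2 * (j + l + 1) - 1 - 2 * j = 2 * l + 1 := by omega
    have e2 : 2 * (j + l + 1) - 2 * (j + 1) = 2 * l := by omega
    have e3 : 2 * (j + l + 1) - 2 * j = 2 * l + 2 := by omega
    have e4 : j + l + 1 - 1 - j = l := by omega
    have e5 : j + l + 1 - j = l + 1 := by omega
    have e6 : j + l + 1 - (j + 1) = l := by omega
    rw [e1, e2, e3, cf_rotDer, smul_sub]
    have h1 : ((m + j : ℕ) : A) + 1 = algebraMap ℝ A ((m + j : ℕ) + 1) := by simp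
    have h2 : ((2 * l : ℕ) : A) + 2 = algebraMap ℝ A ((2 * l : ℕ) + 2) := by
      rw [map_add, map_natCast, map_ofNat]
    rw [h1, h2, ← Algebra.smul_def, ← Algebra.smul_def, smul_smul, smul_smul, ← add_assoc m j 1]
    have hfac : ((m + (j + l + 1)).factorial : ℝ) ≠ 0 := by positivity
    congr 2
    · simp only [hWeight, w, e4, e6]
      rw [← add_assoc m j 1, Nat.factorial_succ (m + j)]
      push_cast
      field_simp
    · simp only [hWeight, w, e4, e5]
      rw [Nat.factorial_succ l, pow_succ]
      push_cast
      field_simp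
  rw [hFun, Finset.sum_congr rfl h,
    Finset.sum_range_sub (fun j => w j • cf (m + j) (2 * k - 2 * j) f)]
  -- The upper end of the telescoping sum has weight one and is the asserted coefficient; the lower
  -- end is the coefficient of r^m t^{2k}, which `hf` excludes.
  have hw : w k = 1 := by
    simp only [w, Nat.sub_self, pow_zero, Nat.factorial_zero, Nat.cast_one, mul_one]
    exact div_self (by positivity)
  simp [hf, hw]

end HFunctional

end

section

open Polynomial

/-! ## The generating function of the mixed elementary symmetric functions -/

section Generating

variable {d m : ℕ}

/-- `∑_j δ_i^j ∏ X_a(i_a, j_a)` is a determinant. -/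
theorem sum_kroneckerDelta (i : Fin m → Fin d) (Y : Fin m → Matrix (Fin d) (Fin d) ℝ) :
    ∑ j : Fin m → Fin d, kroneckerDelta i j * ∏ a, Y a (i a) (j a) =
      (Matrix.of fun a b => Y a (i a) (i b)).det := by
  rw [← Matrix.det_transpose]
  simp only [kroneckerDelta, Matrix.det_apply', Matrix.of_apply, Matrix.transpose_apply,
    Finset.sum_mul]
  rw [Finset.sum_comm]
  refine Finset.sum_congr rfl fun σ _ => ?_
  simp only [mul_assoc, ← Finset.mul_sum, ← Finset.prod_mul_distrib]
  congr 1
  rw [Finset.sum_eq_single (fun a => i (σ a))]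
  · simp
  · intro j _ hj
    obtain ⟨a, ha⟩ := Function.ne_iff.mp hj
    refine Finset.prod_eq_zero (Finset.mem_univ a) ?_
    rw [if_neg (fun h => ha h.symm), zero_mul]
  · simp

theorem mixedSigma_eq_sum_det (ℓ : ℕ) (B D : Matrix (Fin d) (Fin d) ℝ) :
    mixedSigma m ℓ B D = (1 / (m.factorial : ℝ)) * ∑ i : Fin m → Fin d,
      (Matrix.of fun a b : Fin m => if (a : ℕ) < ℓ then B (i a) (i b) else D (i a) (i b)).det := by
  rw [mixedSigma]
  congr 1
  refine Finset.sum_congr rfl fun i _ => ?_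
  have := sum_kroneckerDelta i (fun a => if (a : ℕ) < ℓ then B else D)
  refine (Finset.sum_congr rfl fun j _ => ?_).trans (this.trans ?_)
  · congr 1
    refine Finset.prod_congr rfl fun a _ => ?_
    split_ifs <;> rfl
  · congr 1
    ext a b
    simp only [Matrix.of_apply]
    split_ifs <;> rfl

variable {A : Type*} [CommRing A]

/-- A multi-index with a repetition gives two equal rows. The injective ones are grouped by their
image: each m-element set is the image of m! of them, all with the same principal minor. -/
theorem sum_det_submatrix (Y : Matrix (Fin d) (Fin d) A) :
    ∑ i : Fin m → Fin d, (Y.submatrix i i).det =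
      m.factorial • ∑ s ∈ Finset.univ.powersetCard m,
        (Y.submatrix (Subtype.val : s → Fin d) (Subtype.val : s → Fin d)).det := by
  classical
  have h0 : ∑ i : Fin m → Fin d, (Y.submatrix i i).det =
      ∑ i ∈ Finset.univ.filter (fun i : Fin m → Fin d => Function.Injective i),
        (Y.submatrix i i).det := by
    rw [Finset.sum_filter]
    refine Finset.sum_congr rfl fun i _ => ?_
    split_ifs with h
    · rfl
    · simp only [Function.Injective, not_forall] at h
      obtain ⟨a, b, hab, hne⟩ := h
      exact Matrix.det_zero_of_row_eq hne (by ext c; simp [hab])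
  rw [h0, ← Finset.sum_fiberwise_of_maps_to (t := Finset.univ.powersetCard m)
    (g := fun i => Finset.univ.image i)]
  · rw [Finset.smul_sum]
    refine Finset.sum_congr rfl fun s hs => ?_
    rw [Finset.mem_powersetCard_univ] at hs
    have hc : ∀ i ∈ (Finset.univ.filter (fun i : Fin m → Fin d => Function.Injective i)).filter
        (fun i => Finset.univ.image i = s), (Y.submatrix i i).det =
          (Y.submatrix (Subtype.val : s → Fin d) (Subtype.val : s → Fin d)).det := by
      intro i hi
      simp only [Finset.mem_filter, Finset.mem_univ, true_and] at hi
      let e : Fin m ≃ s := Equiv.ofBijective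
        (fun a => ⟨i a, hi.2 ▸ Finset.mem_image_of_mem i (Finset.mem_univ a)⟩)
        ⟨fun a b hab => hi.1 (congrArg Subtype.val hab), fun x => by
          obtain ⟨y, hy⟩ := x
          rw [← hi.2, Finset.mem_image] at hy
          obtain ⟨a, _, ha⟩ := hy
          exact ⟨a, Subtype.ext ha⟩⟩
      rw [← Matrix.det_submatrix_equiv_self e]
      rfl
    rw [Finset.sum_congr rfl hc, Finset.sum_const]
    congr 1
    have hcard : Fintype.card (Fin m ≃ s) = m.factorial := by
      rw [Fintype.card_equiv (s.equivFinOfCardEq hs).symm, Fintype.card_fin]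
    rw [← hcard, ← Finset.card_univ]
    symm
    refine Finset.card_bij (fun e _ => fun a => (e a : Fin d)) ?_ ?_ ?_
    · intro e _
      simp only [Finset.mem_filter, Finset.mem_univ, true_and]
      refine ⟨Subtype.val_injective.comp e.injective, ?_⟩
      ext x
      simp only [Finset.mem_image, Finset.mem_univ, true_and]
      constructor
      · rintro ⟨a, rfl⟩; exact (e a).2
      · intro hx; exact ⟨e.symm ⟨x, hx⟩, by simp⟩
    · intro e _ e' _ h
      ext a
      simpa using congrArg Fin.val (congrFun h a)
    · intro i hi
      simp only [Finset.mem_filter, Finset.mem_univ, true_and] at hi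
      refine ⟨Equiv.ofBijective
        (fun a => ⟨i a, hi.2 ▸ Finset.mem_image_of_mem i (Finset.mem_univ a)⟩)
        ⟨fun a b hab => hi.1 (congrArg Subtype.val hab), fun x => by
          obtain ⟨y, hy⟩ := x
          rw [← hi.2, Finset.mem_image] at hy
          obtain ⟨a, _, ha⟩ := hy
          exact ⟨a, Subtype.ext ha⟩⟩, Finset.mem_univ _, rfl⟩
  · intro i hi
    simp only [Finset.mem_filter, Finset.mem_univ, true_and] at hi
    rw [Finset.mem_powersetCard_univ, Finset.card_image_of_injective _ hi, Finset.card_univ,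
      Fintype.card_fin]

/-- The pencil is the characteristic matrix of -Y, whose coefficients are signed sums of principal
minors; the sign from -Y cancels the sign of the coefficient. -/
theorem coeff_det_pencil_one (Y : Matrix (Fin d) (Fin d) A) (hm : m ≤ d) :
    (pencil 1 Y).det.coeff (d - m) = ∑ s ∈ Finset.univ.powersetCard m,
        (Y.submatrix (Subtype.val : s → Fin d) (Subtype.val : s → Fin d)).det := by
  have h : pencil 1 Y = Matrix.charmatrix (-Y) := by
    ext i j : 1
    rw [pencil_apply, Matrix.charmatrix_apply]
    by_cases hij : i = j <;> simp [hij, Matrix.one_apply]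
  have h2 := Matrix.charpoly_coeff_eq_sum_minors (-Y) m (by simpa using hm)
  rw [Fintype.card_fin] at h2
  rw [h]
  change (-Y).charpoly.coeff (d - m) = _
  rw [h2, Finset.mul_sum]
  refine Finset.sum_congr rfl fun s hs => ?_
  rw [Finset.mem_powersetCard_univ] at hs
  rw [Matrix.submatrix_neg, Pi.neg_apply, Pi.neg_apply, Matrix.det_neg, Fintype.card_coe, hs,
    ← mul_assoc, ← mul_pow]
  simp

/-- Multilinearity in the rows: S is the set of rows taken from the summand with X, and each of them
contributes one power of X. -/
theorem coeff_det_add_X (B D : Matrix (Fin m) (Fin m) ℝ) (l : ℕ) :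
    (B.map C + (X : ℝ[X]) • D.map C).det.coeff l =
      ∑ S ∈ (Finset.univ : Finset (Fin m)).powersetCard l,
        (Matrix.of fun a b => if a ∈ S then D a b else B a b).det := by
  let F := (Matrix.detRowAlternating : ((Fin m) → ℝ[X]) [⋀^(Fin m)]→ₗ[ℝ[X]] ℝ[X])
  have h1 : (B.map C + (X : ℝ[X]) • D.map C).det =
      ∑ S : Finset (Fin m), (X : ℝ[X]) ^ S.card *
        C (Matrix.of fun a b => if a ∈ S then D a b else B a b).det := by
    rw [add_comm]
    change F ((fun i => ((X : ℝ[X]) • D.map C) i) + (fun i => (B.map C) i)) = _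
    rw [F.map_add_univ]
    refine Finset.sum_congr rfl fun S _ => ?_
    have h_smul : S.piecewise (fun i ↦ ((X : ℝ[X]) • D.map C) i) (fun i ↦ (B.map C) i) =
        fun i => (if i ∈ S then (X : ℝ[X]) else 1) •
          S.piecewise (fun i ↦ (D.map C) i) (fun i ↦ (B.map C) i) i := by
      funext i j
      simp only [Finset.piecewise, Pi.smul_apply, smul_eq_mul]
      split_ifs <;> simp
    rw [h_smul, F.map_smul_univ]
    simp only [Finset.prod_ite_mem, Finset.univ_inter, Finset.prod_const, smul_eq_mul]
    congr 1
    rw [RingHom.map_det]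
    change Matrix.det _ = _
    congr 1
    ext i j : 2
    simp only [Finset.piecewise, RingHom.mapMatrix_apply, Matrix.map_apply, Matrix.of_apply]
    split_ifs <;> rfl
  rw [h1, finsetSum_coeff]
  simp only [mul_comm (X ^ _), C_mul_X_pow_eq_monomial, coeff_monomial]
  rw [← Finset.sum_filter]
  congr 1
  ext S; simp [Finset.mem_powersetCard]

/-- The position of the rows carrying D is irrelevant after summation over all multi-indices. A
permutation of `Fin m` that moves S to the last m - ℓ places reindexes the sum and permutes rows and
columns simultaneously. -/
theorem sum_det_piecewise (B D : Matrix (Fin d) (Fin d) ℝ) {ℓ : ℕ} (hℓ : ℓ ≤ m)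
    (S : Finset (Fin m)) (hS : S.card = m - ℓ) :
    ∑ i : Fin m → Fin d,
        (Matrix.of fun a b => if a ∈ S then D (i a) (i b) else B (i a) (i b)).det =
      ∑ i : Fin m → Fin d,
        (Matrix.of fun a b : Fin m => if (a : ℕ) < ℓ then B (i a) (i b) else D (i a) (i b)).det := by
  classical
  have hc : Fintype.card {a : Fin m // a ∈ S} = Fintype.card {a : Fin m // ¬ ((a : ℕ) < ℓ)} := by
    rw [Fintype.card_coe, hS, Fintype.card_subtype_compl, Fintype.card_fin,
      Fintype.card_subtype]
    congr 1
    have : (Finset.univ.filter fun a : Fin m => (a : ℕ) < ℓ).card = min ℓ m := by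
      rw [← Fintype.card_subtype, ← Fintype.card_fin (min ℓ m)]
      refine Fintype.card_congr ⟨fun a => ⟨a.1, lt_min a.2 a.1.2⟩,
        fun a => ⟨⟨a, a.2.trans_le (min_le_right _ _)⟩, a.2.trans_le (min_le_left _ _)⟩,
        fun a => rfl, fun a => rfl⟩
    rw [this, min_eq_left hℓ]
  obtain ⟨e⟩ : Nonempty ({a : Fin m // a ∈ S} ≃ {a : Fin m // ¬ ((a : ℕ) < ℓ)}) :=
    ⟨Fintype.equivOfCardEq hc⟩
  let q : Equiv.Perm (Fin m) := e.extendSubtype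
  have hq : ∀ a, a ∈ S ↔ ¬ ((q a : ℕ) < ℓ) := by
    intro a
    constructor
    · intro ha
      have := e.extendSubtype_mem a ha
      exact this
    · intro h
      by_contra ha
      exact (e.extendSubtype_not_mem a ha) h
  rw [← Equiv.sum_comp (Equiv.arrowCongr q (Equiv.refl (Fin d)))
    (fun i => (Matrix.of fun a b : Fin m =>
      if (a : ℕ) < ℓ then B (i a) (i b) else D (i a) (i b)).det)]
  refine Finset.sum_congr rfl fun i _ => ?_
  refine Eq.trans ?_ (Matrix.det_submatrix_equiv_self q _)
  congr 1
  ext a b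
  have := hq a
  by_cases ha : a ∈ S
  · simp_all [Equiv.arrowCongr]
  · simp_all [Equiv.arrowCongr]

/-- The matrix `r G + B + t D` over `A[t][r]`. -/
def pencil2 {ι : Type*} (G B D : Matrix ι ι A) : Matrix ι ι A[X][X] :=
  pencil (G.map C) (B.map C + (X : A[X]) • D.map C)

/-- The binomial coefficient counts the sets of m - ℓ rows from which the factor t is taken; by
`sum_det_piecewise` they all contribute the same amount. -/
theorem mixedSigma_eq_cf {ℓ : ℕ} (hm : m ≤ d) (hℓ : ℓ ≤ m) (B D : Matrix (Fin d) (Fin d) ℝ) :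
    (m.choose ℓ : ℝ) * mixedSigma m ℓ B D = cf (d - m) (m - ℓ) (pencil2 1 B D).det := by
  have h1 : (1 : Matrix (Fin d) (Fin d) ℝ).map (C : ℝ → ℝ[X]) = 1 :=
    Matrix.map_one _ (map_zero C) (map_one C)
  have hf : (m.factorial : ℝ) ≠ 0 := by positivity
  rw [cf, pencil2, h1, coeff_det_pencil_one _ hm, mixedSigma_eq_sum_det, ← mul_right_inj' hf]
  have h2 := congrArg (fun p : ℝ[X] => p.coeff (m - ℓ))
    (sum_det_submatrix (m := m) (B.map C + (X : ℝ[X]) • D.map C))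
  simp only [nsmul_eq_mul, finsetSum_coeff, coeff_natCast_mul] at h2
  rw [finsetSum_coeff, ← h2]
  have h3 : ∀ i : Fin m → Fin d,
      ((B.map C + (X : ℝ[X]) • D.map C).submatrix i i).det.coeff (m - ℓ) =
        ∑ S ∈ (Finset.univ : Finset (Fin m)).powersetCard (m - ℓ),
          (Matrix.of fun a b => if a ∈ S then D (i a) (i b) else B (i a) (i b)).det := by
    intro i
    exact coeff_det_add_X (B.submatrix i i) (D.submatrix i i) (m - ℓ)
  simp only [h3]
  rw [Finset.sum_comm, Finset.sum_congr rfl fun S hS => sum_det_piecewise B D hℓ S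
    (Finset.mem_powersetCard_univ.mp hS), Finset.sum_const, Finset.card_powersetCard,
    Finset.card_univ, Fintype.card_fin, Nat.choose_symm hℓ, nsmul_eq_mul]
  field_simp

theorem sigma_eq_coeff (hm : m ≤ d) (B : Matrix (Fin d) (Fin d) ℝ) :
    sigma m B = (pencil 1 B).det.coeff (d - m) := by
  have hf : (m.factorial : ℝ) ≠ 0 := by positivity
  rw [sigma, coeff_det_pencil_one _ hm, mixedSigma_eq_sum_det, ← mul_right_inj' hf]
  have h2 := sum_det_submatrix (m := m) B
  rw [nsmul_eq_mul] at h2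
  rw [← h2]
  simp only [Fin.is_lt, if_true]
  field_simp
  rfl

end Generating

/-! ### H_k as a linear functional of the generating determinant. -/

section HCoefficient

/-- The polynomial in two matrices underlying `H_k`, with `m = N - 2k`. -/
theorem sum_mixedSigma_eq_hFun (m k : ℕ) (B D : Matrix (Fin (2 * k + m - 1)) (Fin (2 * k + m - 1)) ℝ) :
    ∑ j ∈ Finset.range k,
      (((2 * k - j - 1).factorial : ℝ) * ((m + j).factorial : ℝ) /
        (((m + k).factorial : ℝ) * ((2 * k - 2 * j - 1).doubleFactorial : ℝ)
          * (j.factorial : ℝ))) * mixedSigma (2 * k - j - 1) j B D =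
      hFun m k (pencil2 1 B D).det := by
  refine Finset.sum_congr rfl fun j hj => ?_
  rw [Finset.mem_range] at hj
  have h := mixedSigma_eq_cf (d := 2 * k + m - 1) (m := 2 * k - j - 1) (ℓ := j) (by omega)
    (by omega) B D
  have e1 : 2 * k + m - 1 - (2 * k - j - 1) = m + j := by omega
  have e2 : 2 * k - j - 1 - j = 2 * k - 1 - 2 * j := by omega
  rw [e1, e2] at h
  rw [← h, smul_eq_mul, ← mul_assoc]
  congr 1
  obtain ⟨l, rfl⟩ : ∃ l, k = j + l + 1 := ⟨k - j - 1, by omega⟩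
  have e3 : 2 * (j + l + 1) - j - 1 = 2 * l + 1 + j := by omega
  have e4 : 2 * (j + l + 1) - 2 * j - 1 = 2 * l + 1 := by omega
  have e5 : j + l + 1 - 1 - j = l := by omega
  rw [e3, e4, hWeight, e5]
  -- With l = k - 1 - j, dividing by the binomial coefficient turns the leading factorial into (2l +
  -- 1)! j!, and (2l + 1)! = (2l + 1)!! 2^l l! then cancels the double factorial and leaves
  -- `hWeight`.
  have hch : ((2 * l + 1 + j).choose j : ℝ) * (2 * l + 1).factorial * j.factorial =
      (2 * l + 1 + j).factorial := by
    exact_mod_cast Nat.add_choose_mul_factorial_mul_factorial (2 * l + 1) j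
  have hdf : ((2 * l + 1).factorial : ℝ) =
      (2 * l + 1).doubleFactorial * (2 ^ l * l.factorial) := by
    rw [Nat.factorial_eq_mul_doubleFactorial (2 * l), Nat.doubleFactorial_two_mul]
    push_cast; ring
  have p1 : ((2 * l + 1).doubleFactorial : ℝ) ≠ 0 := by
    exact_mod_cast (Nat.doubleFactorial_pos _).ne'
  have p2 : ((m + (j + l + 1)).factorial : ℝ) ≠ 0 := by positivity
  have p3 : (j.factorial : ℝ) ≠ 0 := by positivity
  rw [← hch, hdf]
  field_simp

end HCoefficient

end

/-! ## Riemannian geometry over a commutative ring with commuting derivations -/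

section Abstract

variable {R : Type*} [CommRing R] [Algebra ℝ R] {ι : Type*} [Fintype ι] [DecidableEq ι]
  (d : ι → Derivation ℝ R R) (G : Matrix ι ι R)

/-- The Christoffel symbols `Γ^k_{ij}` as matrices `(k, j)`, indexed by `i`. -/
def chris (i : ι) : Matrix ι ι R := Matrix.of fun k j =>
  (1 / 2 : ℝ) • ∑ l, G⁻¹ k l * (d i (G j l) + d j (G i l) - d l (G i j))

variable {d G}

theorem two_smul_half (x : R) : (1 / 2 : ℝ) • x + (1 / 2 : ℝ) • x = x := by
  rw [← add_smul]; norm_num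

/-- The ring need not be a domain, but 2 is invertible because real scalars act. -/
theorem eq_of_add_self_eq {x y : R} (h : x + x = y + y) : x = y := by
  rw [← two_smul_half x, ← two_smul_half y, ← smul_add, ← smul_add, h]

/-- `Γ` is a symmetric connection which preserves the metric `G`. -/
structure IsLeviCivita (d : ι → Derivation ℝ R R) (G : Matrix ι ι R) (Γ : ι → Matrix ι ι R) :
    Prop where
  symm : ∀ i j k, Γ i k j = Γ j k i
  compat : ∀ a, G.map (d a) = (Γ a)ᵀ * G + G * Γ a

/-- Compatibility is read off from the Koszul formula for G Γ, that is, after lowering an index. -/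
theorem isLeviCivita_chris (hG : IsUnit G.det) (hs : G.IsSymm) : IsLeviCivita d G (chris d G) := by
  have hlow : ∀ a, G * chris d G a =
      Matrix.of fun l j => (1 / 2 : ℝ) • (d a (G j l) + d j (G a l) - d l (G a j)) := by
    intro a
    have : chris d G a = G⁻¹ * Matrix.of fun l j =>
        (1 / 2 : ℝ) • (d a (G j l) + d j (G a l) - d l (G a j)) := by
      ext k j
      simp [chris, Matrix.mul_apply, Finset.smul_sum]
    rw [this, ← mul_assoc, Matrix.mul_nonsing_inv _ hG, one_mul]
  constructor
  · intro i j k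
    simp only [chris, Matrix.of_apply]
    congr 1
    refine Finset.sum_congr rfl fun l _ => ?_
    rw [hs.apply i j]; ring
  · intro a
    have h2 : (chris d G a)ᵀ * G = (G * chris d G a)ᵀ := by
      rw [Matrix.transpose_mul, hs.eq]
    rw [h2, hlow]
    ext i j
    simp only [Matrix.map_apply, Matrix.add_apply, Matrix.transpose_apply, Matrix.of_apply,
      ← smul_add]
    rw [hs.apply i j]
    conv_lhs => rw [← two_smul_half (d a (G i j))]
    rw [← smul_add]
    congr 1
    ring

/-- Symmetry and compatibility force the Koszul formula for 2 G Γ. This identifies connections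
obtained by a conformal or coordinate change with the Christoffel symbols without recomputing the
latter. -/
theorem IsLeviCivita.unique (hG : IsUnit G.det) {Γ Γ' : ι → Matrix ι ι R}
    (h : IsLeviCivita d G Γ) (h' : IsLeviCivita d G Γ') (hs : G.IsSymm) : Γ = Γ' := by
  have key : ∀ Δ : ι → Matrix ι ι R, IsLeviCivita d G Δ → ∀ i l j,
      (G * Δ i) l j + (G * Δ i) l j = d i (G j l) + d j (G i l) - d l (G i j) := by
    intro Δ hΔ i l j
    have hc : ∀ a b c, d a (G b c) = (G * Δ a) c b + (G * Δ a) b c := by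
      intro a b c
      have := congrFun (congrFun (hΔ.compat a) b) c
      have h2 : (Δ a)ᵀ * G = (G * Δ a)ᵀ := by rw [Matrix.transpose_mul, hs.eq]
      rw [h2] at this
      simpa only [Matrix.map_apply, Matrix.add_apply, Matrix.transpose_apply] using this
    have hsy : ∀ a b c, (G * Δ a) b c = (G * Δ c) b a := by
      intro a b c
      simp only [Matrix.mul_apply]
      exact Finset.sum_congr rfl fun k _ => by rw [hΔ.symm]
    rw [hc i j l, hc j i l, hc l i j, hsy j l i, hsy i j l, hsy j i l]
    ring
  funext i
  have : G * Γ i = G * Γ' i := by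
    ext l j
    exact eq_of_add_self_eq (by rw [key Γ h, key Γ' h'])
  have h2 := congrArg (fun X => G⁻¹ * X) this
  simpa [← mul_assoc, Matrix.nonsing_inv_mul _ hG] using h2

variable (d) (Γ : ι → Matrix ι ι R)

/-- The curvature matrix `R(∂_k, ∂_i)` of a connection. -/
def curv (k i : ι) : Matrix ι ι R :=
  (Γ i).map (d k) - (Γ k).map (d i) + (Γ k * Γ i - Γ i * Γ k)

/-- The Ricci tensor of a connection. -/
def ric : Matrix ι ι R := Matrix.of fun i j => ∑ k, curv d Γ k i k j

/-- The Hessian `∇²v`. -/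
def hess (v : R) : Matrix ι ι R := Matrix.of fun i j => d i (d j v) - ∑ k, Γ i k j * d k v

/-- The covariant derivative `∇_a M` of a covariant two-tensor. -/
def covD (M : Matrix ι ι R) (a : ι) : Matrix ι ι R := M.map (d a) - (Γ a)ᵀ * M - M * Γ a

variable {d Γ}

theorem covD_apply (M : Matrix ι ι R) (a i j : ι) :
    covD d Γ M a i j = d a (M i j) - ∑ p, Γ a p i * M p j - ∑ p, Γ a p j * M i p := by
  simp [covD, Matrix.mul_apply, mul_comm]

theorem curv_neg (k i : ι) : curv d Γ k i = -curv d Γ i k := by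
  simp only [curv]; abel

theorem derivation_map_transpose {κ μ : Type*} (δ : Derivation ℝ R R) (M : Matrix κ μ R) :
    Mᵀ.map δ = (M.map δ)ᵀ := rfl

theorem derivation_map_add {κ μ : Type*} (δ : Derivation ℝ R R) (M N : Matrix κ μ R) :
    (M + N).map δ = M.map δ + N.map δ := by ext; simp

theorem derivation_map_sub {κ μ : Type*} (δ : Derivation ℝ R R) (M N : Matrix κ μ R) :
    (M - N).map δ = M.map δ - N.map δ := by ext; simp

/-- Differentiate the compatibility equation a second time and commute the two derivations: what
survives is the action of the curvature on G. -/
theorem IsLeviCivita.curv_antisymm (h : IsLeviCivita d G Γ) (hd : ∀ i j f, d i (d j f) = d j (d i f))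
    (k i : ι) : G * curv d Γ k i = -((curv d Γ k i)ᵀ * G) := by
  have e : ∀ a b, (G.map (d a)).map (d b) =
      ((Γ a).map (d b))ᵀ * G + (Γ a)ᵀ * ((Γ b)ᵀ * G + G * Γ b) +
        (((Γ b)ᵀ * G + G * Γ b) * Γ a + G * (Γ a).map (d b)) := by
    intro a b
    rw [h.compat a, derivation_map_add, derivation_map_mul, derivation_map_mul, h.compat b,
      derivation_map_transpose]
  have h1 : (G.map (d i)).map (d k) = (G.map (d k)).map (d i) := by
    ext; simp [hd k i]
  rw [e, e] at h1
  have h2 := sub_eq_zero.mpr h1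
  rw [eq_neg_iff_add_eq_zero, ← h2]
  simp only [curv, Matrix.transpose_add, Matrix.transpose_sub, Matrix.transpose_mul]
  noncomm_ring

theorem IsLeviCivita.trace_curv (hG : IsUnit G.det) (h : IsLeviCivita d G Γ)
    (hd : ∀ i j f, d i (d j f) = d j (d i f)) (k i : ι) : (curv d Γ k i).trace = 0 := by
  have h1 := congrArg (fun X => (G⁻¹ * X).trace) (h.curv_antisymm hd k i)
  simp only [← mul_assoc, Matrix.nonsing_inv_mul _ hG, one_mul, mul_neg, Matrix.trace_neg] at h1
  rw [Matrix.trace_mul_comm, ← mul_assoc, Matrix.mul_nonsing_inv _ hG, one_mul,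
    Matrix.trace_transpose] at h1
  exact eq_of_add_self_eq (by rw [add_zero]; nth_rewrite 1 [h1]; simp)

theorem first_bianchi (hs : ∀ i j k, Γ i k j = Γ j k i) (k i j l : ι) :
    curv d Γ k i l j + curv d Γ i j l k + curv d Γ j k l i = 0 := by
  simp only [curv, Matrix.add_apply, Matrix.sub_apply, Matrix.map_apply, Matrix.mul_apply]
  rw [hs i j l, hs k j l, hs i k l]
  have e1 : ∑ p, Γ k l p * Γ i p j = ∑ p, Γ k l p * Γ j p i :=
    Finset.sum_congr rfl fun p _ => by rw [hs i j p]
  have e2 : ∑ p, Γ i l p * Γ k p j = ∑ p, Γ i l p * Γ j p k :=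
    Finset.sum_congr rfl fun p _ => by rw [hs k j p]
  have e3 : ∑ p, Γ j l p * Γ i p k = ∑ p, Γ j l p * Γ k p i :=
    Finset.sum_congr rfl fun p _ => by rw [hs i k p]
  rw [e1, e2, e3]
  ring

/-- In the contracted first Bianchi identity the third term is the trace of a curvature
endomorphism, which vanishes by skewness. -/
theorem IsLeviCivita.ric_symm (hG : IsUnit G.det) (h : IsLeviCivita d G Γ)
    (hd : ∀ i j f, d i (d j f) = d j (d i f)) : (ric d Γ).IsSymm := by
  ext i j
  simp only [ric, Matrix.transpose_apply, Matrix.of_apply]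
  have h1 : ∑ k, (curv d Γ k i k j + curv d Γ i j k k + curv d Γ j k k i) = 0 :=
    Finset.sum_eq_zero fun k _ => first_bianchi h.symm k i j k
  have h2 : ∑ k, curv d Γ i j k k = 0 := h.trace_curv hG hd i j
  rw [Finset.sum_add_distrib, Finset.sum_add_distrib, h2, add_zero] at h1
  have h3 : ∑ k, curv d Γ j k k i = -∑ k, curv d Γ k j k i := by
    rw [← Finset.sum_neg_distrib]
    exact Finset.sum_congr rfl fun k _ => by rw [curv_neg]; rfl
  rw [h3] at h1
  linear_combination -h1

variable (d Γ) in
/-- The covariant derivative of the curvature, `∇_m R(∂_k, ∂_i)`. -/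
def covCurv (m k i : ι) : Matrix ι ι R :=
  (curv d Γ k i).map (d m) + (Γ m * curv d Γ k i - curv d Γ k i * Γ m)
    - ∑ p, Γ m p k • curv d Γ p i - ∑ p, Γ m p i • curv d Γ k p

/-- In the cyclic sum the connection terms attached to the two form indices cancel in pairs by the
symmetry of Γ; the rest is the Jacobi identity together with the commutation of the derivations. -/
theorem second_bianchi (hs : ∀ i j k, Γ i k j = Γ j k i) (hd : ∀ i j f, d i (d j f) = d j (d i f))
    (m k i : ι) : covCurv d Γ m k i + covCurv d Γ k i m + covCurv d Γ i m k = 0 := by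
  have hdm : ∀ a b c, ((Γ a).map (d b)).map (d c) = ((Γ a).map (d c)).map (d b) := by
    intro a b c; ext; simp [hd c b]
  have e1 : ∑ p, Γ m p i • curv d Γ k p = -∑ p, Γ i p m • curv d Γ p k := by
    rw [← Finset.sum_neg_distrib]
    exact Finset.sum_congr rfl fun p _ => by rw [curv_neg, hs m i, smul_neg]
  have e2 : ∑ p, Γ k p m • curv d Γ i p = -∑ p, Γ m p k • curv d Γ p i := by
    rw [← Finset.sum_neg_distrib]
    exact Finset.sum_congr rfl fun p _ => by rw [curv_neg, hs k m, smul_neg]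
  have e3 : ∑ p, Γ i p k • curv d Γ m p = -∑ p, Γ k p i • curv d Γ p m := by
    rw [← Finset.sum_neg_distrib]
    exact Finset.sum_congr rfl fun p _ => by rw [curv_neg, hs i k, smul_neg]
  simp only [covCurv, e1, e2, e3]
  simp only [curv, derivation_map_add, derivation_map_sub, derivation_map_mul]
  rw [hdm i k m, hdm k i m, hdm m i k]
  noncomm_ring

/-- Covariant differentiation commutes with contraction: the connection terms of the upper and lower
contracted index cancel. -/
theorem sum_covCurv (m i j : ι) :
    ∑ k, covCurv d Γ m k i k j = covD d Γ (ric d Γ) m i j := by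
  have hr : ∀ i j, ric d Γ i j = ∑ k, curv d Γ k i k j := fun _ _ => rfl
  rw [covD_apply]
  simp only [covCurv, Matrix.add_apply, Matrix.sub_apply, Matrix.map_apply, Matrix.mul_apply,
    Matrix.sum_apply, Matrix.smul_apply, smul_eq_mul, Finset.sum_add_distrib,
    Finset.sum_sub_distrib, hr, map_sum, Finset.mul_sum]
  have e1 : ∑ k, ∑ p, Γ m k p * curv d Γ k i p j = ∑ k, ∑ p, Γ m p k * curv d Γ p i k j :=
    Finset.sum_comm
  have e2 : ∑ k, ∑ p, curv d Γ k i k p * Γ m p j = ∑ p, ∑ k, Γ m p j * curv d Γ k i k p := by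
    rw [Finset.sum_comm]
    exact Finset.sum_congr rfl fun p _ => Finset.sum_congr rfl fun k _ => mul_comm _ _
  have e3 : ∑ k, ∑ p, Γ m p i * curv d Γ k p k j = ∑ p, ∑ k, Γ m p i * curv d Γ k p k j :=
    Finset.sum_comm
  rw [e1, e2, e3]
  ring

/-- Skewness with respect to G survives covariant differentiation because G is parallel. -/
theorem IsLeviCivita.covCurv_antisymm (h : IsLeviCivita d G Γ)
    (hd : ∀ i j f, d i (d j f) = d j (d i f)) (m k i : ι) :
    G * covCurv d Γ m k i = -((covCurv d Γ m k i)ᵀ * G) := by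
  have h1 := congrArg (fun X : Matrix ι ι R => X.map (d m)) (h.curv_antisymm hd k i)
  have hneg : ∀ X : Matrix ι ι R, (-X).map (d m) = -(X.map (d m)) := fun X => by ext; simp
  simp only [derivation_map_mul, hneg, derivation_map_transpose, h.compat m] at h1
  have hA : ∀ f : ι → Matrix ι ι R, ∀ c : ι → R, (∀ p, G * f p = -((f p)ᵀ * G)) →
      G * ∑ p, c p • f p = -((∑ p, c p • f p)ᵀ * G) := by
    intro f c hf
    rw [Finset.mul_sum, Matrix.transpose_sum, Finset.sum_mul, ← Finset.sum_neg_distrib]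
    refine Finset.sum_congr rfl fun p _ => ?_
    rw [Matrix.mul_smul, hf, Matrix.transpose_smul, Matrix.smul_mul, smul_neg]
  have h2 := hA (fun p => curv d Γ p i) (fun p => Γ m p k) (fun p => h.curv_antisymm hd p i)
  have h3 := hA (fun p => curv d Γ k p) (fun p => Γ m p i) (fun p => h.curv_antisymm hd k p)
  have h4 := h.curv_antisymm hd k i
  simp only [covCurv, mul_sub, mul_add, Matrix.transpose_sub, Matrix.transpose_add, sub_mul,
    add_mul, h2, h3, Matrix.transpose_mul]
  have a1 : (Γ m)ᵀ * (G * curv d Γ k i) = (Γ m)ᵀ * -((curv d Γ k i)ᵀ * G) := by rw [h4]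
  have a2 : (G * curv d Γ k i) * Γ m = -((curv d Γ k i)ᵀ * G) * Γ m := by rw [h4]
  linear_combination (norm := noncomm_ring) h1 - a1 - a2

end Abstract

/-! ### Contracted Bianchi identities, the Schouten tensor and the Cotton tensor. -/

section Abstract

variable {R : Type*} [CommRing R] [Algebra ℝ R] {ι : Type*} [Fintype ι] [DecidableEq ι]
  {d : ι → Derivation ℝ R R} {G : Matrix ι ι R} {Γ : ι → Matrix ι ι R}

theorem covCurv_neg (m k i : ι) : covCurv d Γ m k i = -covCurv d Γ m i k := by
  have hneg : ∀ X : Matrix ι ι R, (-X).map (d m) = -(X.map (d m)) := fun X => by ext; simp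
  have e1 : ∑ p, Γ m p k • curv d Γ p i = -∑ p, Γ m p k • curv d Γ i p := by
    rw [← Finset.sum_neg_distrib]
    exact Finset.sum_congr rfl fun p _ => by rw [curv_neg, smul_neg]
  have e2 : ∑ p, Γ m p i • curv d Γ k p = -∑ p, Γ m p i • curv d Γ p k := by
    rw [← Finset.sum_neg_distrib]
    exact Finset.sum_congr rfl fun p _ => by rw [curv_neg, smul_neg]
  simp only [covCurv]
  rw [e1, e2, curv_neg k i, hneg]
  noncomm_ring

theorem isSymm_inv (hs : G.IsSymm) : G⁻¹.IsSymm := by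
  rw [Matrix.IsSymm, Matrix.transpose_nonsing_inv, hs.eq]

theorem IsLeviCivita.covD_self (h : IsLeviCivita d G Γ) (a : ι) : covD d Γ G a = 0 := by
  rw [covD, h.compat]; abel

theorem IsLeviCivita.inv_map (hG : IsUnit G.det) (h : IsLeviCivita d G Γ) (a : ι) :
    G⁻¹.map (d a) = -(Γ a * G⁻¹) - G⁻¹ * (Γ a)ᵀ := by
  rw [derivation_inv _ _ hG, h.compat]
  have h1 := Matrix.mul_nonsing_inv _ hG
  have h2 := Matrix.nonsing_inv_mul _ hG
  rw [mul_add, add_mul, ← mul_assoc G⁻¹ G, h2, one_mul, ← mul_assoc, mul_assoc _ G, h1, mul_one]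
  abel

theorem IsLeviCivita.trace_inv_mul_map (hG : IsUnit G.det) (h : IsLeviCivita d G Γ)
    (M : Matrix ι ι R) (a : ι) : d a (G⁻¹ * M).trace = (G⁻¹ * covD d Γ M a).trace := by
  have h1 : d a (G⁻¹ * M).trace = ((G⁻¹ * M).map (d a)).trace := by
    simp [Matrix.trace, map_sum]
  rw [h1, derivation_map_mul, h.inv_map hG, covD]
  simp only [sub_mul, neg_mul, mul_sub, Matrix.trace_add, Matrix.trace_sub, Matrix.trace_neg]
  rw [mul_assoc (Γ a), Matrix.trace_mul_comm (Γ a), mul_assoc G⁻¹ (Γ a)ᵀ, mul_assoc G⁻¹ M]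
  ring

theorem IsLeviCivita.covD_symm {M : Matrix ι ι R} (hM : M.IsSymm) (a : ι) :
    (covD d Γ M a).IsSymm := by
  rw [Matrix.IsSymm, covD, Matrix.transpose_sub, Matrix.transpose_sub, Matrix.transpose_mul,
    Matrix.transpose_mul, Matrix.transpose_transpose, hM.eq, ← derivation_map_transpose, hM.eq]
  abel

/-- The twice contracted second Bianchi identity. -/
theorem IsLeviCivita.contracted_bianchi (hG : IsUnit G.det) (hs : G.IsSymm)
    (h : IsLeviCivita d G Γ) (hd : ∀ i j f, d i (d j f) = d j (d i f)) (m : ι) :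
    ∑ i, ∑ j, G⁻¹ i j * covD d Γ (ric d Γ) m i j =
      2 * ∑ i, ∑ j, G⁻¹ i j * covD d Γ (ric d Γ) i m j := by
  -- One contraction of the second Bianchi identity: two terms become derivatives of Ricci, the
  -- third is the divergence of the curvature.
  have hb : ∀ i j, covD d Γ (ric d Γ) m i j + ∑ k, covCurv d Γ k i m k j
      - covD d Γ (ric d Γ) i m j = 0 := by
    intro i j
    rw [← sum_covCurv, ← sum_covCurv, ← Finset.sum_add_distrib, ← Finset.sum_sub_distrib]
    refine Finset.sum_eq_zero fun k _ => ?_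
    have := congrFun (congrFun (second_bianchi h.symm hd m k i) k) j
    rw [covCurv_neg i m k] at this
    simpa [sub_eq_add_neg] using this
  -- Skewness with an index raised; after the second contraction it turns the divergence of the
  -- curvature into minus the divergence of Ricci.
  have hS : ∀ k i l, ∑ j, covCurv d Γ k i m l j * G⁻¹ j i =
      -∑ j, G⁻¹ l j * covCurv d Γ k i m i j := by
    intro k i l
    have h1 := congrArg (fun X => G⁻¹ * X * G⁻¹) (h.covCurv_antisymm hd k i m)
    simp only [← mul_assoc, Matrix.nonsing_inv_mul _ hG, one_mul, mul_neg, neg_mul] at h1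
    rw [mul_assoc _ G, Matrix.mul_nonsing_inv _ hG, mul_one] at h1
    have h2 := congrFun (congrFun h1 l) i
    simpa [Matrix.mul_apply] using h2
  have hmid : ∑ i, ∑ j, G⁻¹ i j * ∑ k, covCurv d Γ k i m k j =
      -∑ i, ∑ j, G⁻¹ i j * covD d Γ (ric d Γ) i m j := by
    calc ∑ i, ∑ j, G⁻¹ i j * ∑ k, covCurv d Γ k i m k j
        = ∑ i, ∑ k, ∑ j, covCurv d Γ k i m k j * G⁻¹ j i := by
          refine Finset.sum_congr rfl fun i _ => ?_
          simp only [Finset.mul_sum]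
          rw [Finset.sum_comm]
          refine Finset.sum_congr rfl fun k _ => Finset.sum_congr rfl fun j _ => ?_
          rw [(isSymm_inv hs).apply i j, mul_comm]
      _ = ∑ k, ∑ i, -∑ j, G⁻¹ k j * covCurv d Γ k i m i j := by
          rw [Finset.sum_comm]
          exact Finset.sum_congr rfl fun k _ => Finset.sum_congr rfl fun i _ => hS k i k
      _ = _ := by
          simp only [← sum_covCurv, Finset.mul_sum, Finset.sum_neg_distrib]
          congr 1
          exact Finset.sum_congr rfl fun k _ => Finset.sum_comm
  have hz : ∑ i, ∑ j, G⁻¹ i j * (covD d Γ (ric d Γ) m i j + ∑ k, covCurv d Γ k i m k j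
      - covD d Γ (ric d Γ) i m j) = 0 := by simp [hb]
  simp only [mul_add, mul_sub, Finset.sum_add_distrib, Finset.sum_sub_distrib, hmid] at hz
  linear_combination hz

theorem trace_mul_eq_sum (M N : Matrix ι ι R) (hM : M.IsSymm) :
    (M * N).trace = ∑ i, ∑ j, M i j * N i j := by
  simp only [Matrix.trace, Matrix.diag_apply, Matrix.mul_apply]
  rw [Finset.sum_comm]
  exact Finset.sum_congr rfl fun i _ => Finset.sum_congr rfl fun j _ => by rw [hM.apply]

theorem covD_add (M N : Matrix ι ι R) (a : ι) :
    covD d Γ (M + N) a = covD d Γ M a + covD d Γ N a := by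
  simp only [covD, derivation_map_add, mul_add, add_mul]; abel

theorem covD_smul (c : R) (M : Matrix ι ι R) (a : ι) :
    covD d Γ (c • M) a = c • covD d Γ M a + d a c • M := by
  have : (c • M).map (d a) = c • M.map (d a) + d a c • M := by
    ext; simp [mul_comm]
  simp only [covD, this, Matrix.mul_smul, Matrix.smul_mul, smul_sub]; abel

theorem covD_real_smul (c : ℝ) (M : Matrix ι ι R) (a : ι) :
    covD d Γ (c • M) a = c • covD d Γ M a := by
  have : (c • M).map (d a) = c • M.map (d a) := by
    ext; simp
  simp only [covD, this, Matrix.mul_smul, Matrix.smul_mul, smul_sub]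

theorem real_smul_cancel {c : ℝ} (hc : c ≠ 0) {x : R} (h : c • x = 0) : x = 0 := by
  have := congrArg (fun y => c⁻¹ • y) h
  simpa [smul_smul, inv_mul_cancel₀ hc] using this

/-- The divergence of the Schouten tensor is the gradient of its trace. -/
theorem IsLeviCivita.div_schouten (hG : IsUnit G.det) (hs : G.IsSymm)
    (h : IsLeviCivita d G Γ) (hd : ∀ i j f, d i (d j f) = d j (d i f)) {P : Matrix ι ι R}
    (hN : (Fintype.card ι : ℝ) - 2 ≠ 0)
    (hP : ric d Γ = ((Fintype.card ι : ℝ) - 2) • P + (G⁻¹ * P).trace • G) (m : ι) :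
    ∑ i, ∑ j, G⁻¹ i j * covD d Γ P i m j = d m (G⁻¹ * P).trace := by
  have hb := h.contracted_bianchi hG hs hd m
  have hc : ∀ a, covD d Γ (ric d Γ) a =
      ((Fintype.card ι : ℝ) - 2) • covD d Γ P a + d a (G⁻¹ * P).trace • G := by
    intro a
    rw [hP, covD_add, covD_real_smul, covD_smul, h.covD_self, smul_zero, zero_add]
  rw [← trace_mul_eq_sum _ _ (isSymm_inv hs), hc, mul_add, Matrix.trace_add, Matrix.mul_smul,
    Matrix.mul_smul, Matrix.nonsing_inv_mul _ hG, Matrix.trace_smul, Matrix.trace_smul,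
    Matrix.trace_one, ← h.trace_inv_mul_map hG P] at hb
  simp only [hc, Matrix.add_apply, Matrix.smul_apply, mul_add, Finset.sum_add_distrib,
    smul_eq_mul] at hb
  have e1 : ∑ i, ∑ j, G⁻¹ i j * (d i (G⁻¹ * P).trace * G m j) = d m (G⁻¹ * P).trace := by
    have : ∀ i, ∑ j, G⁻¹ i j * (d i (G⁻¹ * P).trace * G m j) =
        d i (G⁻¹ * P).trace * (G⁻¹ * G) i m := by
      intro i
      rw [Matrix.mul_apply, Finset.mul_sum]
      exact Finset.sum_congr rfl fun j _ => by rw [hs.apply m j]; ring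
    simp only [this, Matrix.nonsing_inv_mul _ hG, Matrix.one_apply]
    simp
  have e2 : ∑ i, ∑ j, G⁻¹ i j * (((Fintype.card ι : ℝ) - 2) • covD d Γ P i m j) =
      ((Fintype.card ι : ℝ) - 2) • ∑ i, ∑ j, G⁻¹ i j * covD d Γ P i m j := by
    simp only [Finset.smul_sum, mul_smul_comm]
  rw [e1, e2] at hb
  -- With J = tr P the identity reads (2N - 2) dJ = 2 (N - 2) div P + 2 dJ, so what has to be
  -- cancelled is the factor N - 2.
  have h3 : ((Fintype.card ι : ℝ) - 2) •
      (∑ i, ∑ j, G⁻¹ i j * covD d Γ P i m j - d m (G⁻¹ * P).trace) = 0 := by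
    have hcast : (Fintype.card ι : R) = algebraMap ℝ R (Fintype.card ι : ℝ) := by simp
    rw [hcast, Algebra.smul_def] at hb
    rw [Algebra.smul_def] at hb
    rw [Algebra.smul_def, map_sub, map_ofNat]
    rw [map_sub, map_ofNat] at hb
    refine eq_of_add_self_eq ?_
    linear_combination -hb
  exact sub_eq_zero.mp (real_smul_cancel hN h3)

variable (G Γ) in
/-- The curvature is `P ∧ G`: the metric has Schouten tensor `P` and vanishing Weyl tensor. -/
def WeylFree (d : ι → Derivation ℝ R R) (P : Matrix ι ι R) : Prop :=
  ∀ k i l j, curv d Γ k i l j = (1 : Matrix ι ι R) l k * P i j - (1 : Matrix ι ι R) l i * P k j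
    + (G⁻¹ * P) l k * G i j - (G⁻¹ * P) l i * G k j

/-- Contracting the four terms of P ∧ G gives N P, -P, (tr P) G and -P. Hence a tensor P
representing the curvature in this form must be the Schouten tensor. -/
theorem WeylFree.ric_eq (hG : IsUnit G.det) (hs : G.IsSymm) {P : Matrix ι ι R}
    (hPs : P.IsSymm) (hW : WeylFree G Γ d P) :
    ric d Γ = ((Fintype.card ι : ℝ) - 2) • P + (G⁻¹ * P).trace • G := by
  ext i j
  have e1 : ∑ k, (G⁻¹ * P) k i * G k j = P i j := by
    have : (G * (G⁻¹ * P)) j i = P i j := by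
      rw [← mul_assoc, Matrix.mul_nonsing_inv _ hG, one_mul, hPs.apply]
    rw [← this, Matrix.mul_apply]
    exact Finset.sum_congr rfl fun k _ => by rw [hs.apply j k]; ring
  simp only [ric, Matrix.of_apply, hW _ _ _ _, Finset.sum_add_distrib, Finset.sum_sub_distrib, e1,
    ← Finset.sum_mul, Matrix.one_apply]
  simp only [if_true, Finset.sum_const, Finset.card_univ, nsmul_eq_mul, ite_mul, one_mul, zero_mul,
    Finset.sum_ite_eq', Finset.mem_univ, Matrix.add_apply, Matrix.smul_apply, smul_eq_mul,
    Matrix.trace, Matrix.diag_apply]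
  rw [Algebra.smul_def, map_sub, map_natCast, map_ofNat]
  ring

/-- The Leibniz rule for U ⊗ V, with U of type (1,1) and V of type (0,2), in components so that it
applies to each of the four terms of P ∧ G. -/
theorem covariant_tensor (Γm U V : Matrix ι ι R) (δ : Derivation ℝ R R) (k i l j : ι) :
    δ (U l k * V i j) + (∑ p, Γm l p * (U p k * V i j) - ∑ p, U l k * V i p * Γm p j)
      - ∑ p, Γm p k * (U l p * V i j) - ∑ p, Γm p i * (U l k * V p j) =
    (U.map δ + Γm * U - U * Γm) l k * V i j + U l k * (V.map δ - Γmᵀ * V - V * Γm) i j := by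
  simp only [Derivation.leibniz, Matrix.add_apply, Matrix.sub_apply, Matrix.map_apply,
    Matrix.mul_apply, Matrix.transpose_apply, smul_eq_mul, add_mul, sub_mul, mul_sub,
    Finset.sum_mul, Finset.mul_sum]
  have e1 : ∑ p, Γm l p * (U p k * V i j) = ∑ p, Γm l p * U p k * V i j :=
    Finset.sum_congr rfl fun p _ => by ring
  have e2 : ∑ p, U l k * V i p * Γm p j = ∑ p, U l k * (V i p * Γm p j) :=
    Finset.sum_congr rfl fun p _ => by ring
  have e3 : ∑ p, Γm p k * (U l p * V i j) = ∑ p, U l p * Γm p k * V i j :=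
    Finset.sum_congr rfl fun p _ => by ring
  have e4 : ∑ p, Γm p i * (U l k * V p j) = ∑ p, U l k * (Γm p i * V p j) :=
    Finset.sum_congr rfl fun p _ => by ring
  rw [e1, e2, e3, e4]
  ring

/-- Both G and the identity endomorphism are parallel, so the derivative falls on P alone. -/
theorem IsLeviCivita.covCurv_of_weylFree (hG : IsUnit G.det) (h : IsLeviCivita d G Γ)
    {P : Matrix ι ι R} (hW : WeylFree G Γ d P) (m k i l j : ι) :
    covCurv d Γ m k i l j = (1 : Matrix ι ι R) l k * covD d Γ P m i j
      - (1 : Matrix ι ι R) l i * covD d Γ P m k j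
      + (G⁻¹ * covD d Γ P m) l k * G i j - (G⁻¹ * covD d Γ P m) l i * G k j := by
  have hU : (G⁻¹ * P).map (d m) + Γ m * (G⁻¹ * P) - G⁻¹ * P * Γ m = G⁻¹ * covD d Γ P m := by
    rw [derivation_map_mul, h.inv_map hG, covD]
    noncomm_ring
  have h1 : (1 : Matrix ι ι R).map (d m) + Γ m * 1 - 1 * Γ m = 0 := by
    rw [derivation_map_one]; simp
  have hG0 : G.map (d m) - (Γ m)ᵀ * G - G * Γ m = 0 := h.covD_self m
  have t1 := covariant_tensor (Γ m) 1 P (d m) k i l j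
  have t2 := covariant_tensor (Γ m) 1 P (d m) i k l j
  have t3 := covariant_tensor (Γ m) (G⁻¹ * P) G (d m) k i l j
  have t4 := covariant_tensor (Γ m) (G⁻¹ * P) G (d m) i k l j
  rw [h1] at t1 t2
  rw [hU, hG0] at t3 t4
  simp only [covCurv, Matrix.add_apply, Matrix.sub_apply, Matrix.map_apply,
    Matrix.sum_apply, Matrix.smul_apply, smul_eq_mul]
  rw [Matrix.mul_apply, Matrix.mul_apply]
  simp only [hW _ _ _ _, map_add, map_sub, mul_add, mul_sub, add_mul, sub_mul,
    Finset.sum_add_distrib, Finset.sum_sub_distrib]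
  simp only [Matrix.zero_apply, zero_mul, mul_zero, zero_add, add_zero] at t1 t2 t3 t4
  simp only [covD] at t1 t2 t3 t4 ⊢
  linear_combination t1 - t2 + t3 - t4

/-- In dimension at least four, a metric with vanishing Weyl tensor has vanishing Cotton tensor. -/
theorem IsLeviCivita.cotton_eq_zero (hG : IsUnit G.det) (hs : G.IsSymm)
    (h : IsLeviCivita d G Γ) (hd : ∀ i j f, d i (d j f) = d j (d i f)) {P : Matrix ι ι R}
    (hPs : P.IsSymm) (hN : 4 ≤ Fintype.card ι) (hW : WeylFree G Γ d P) (m i j : ι) :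
    covD d Γ P m i j = covD d Γ P i m j := by
  have hN' : (4 : ℝ) ≤ Fintype.card ι := by exact_mod_cast hN
  have hN2 : (Fintype.card ι : ℝ) - 2 ≠ 0 := by linarith
  have hN3 : (Fintype.card ι : ℝ) - 3 ≠ 0 := by linarith
  have hP := hW.ric_eq hG hs hPs
  have hdiv := h.div_schouten hG hs hd hN2 hP
  have hc : ∀ a, covD d Γ (ric d Γ) a =
      ((Fintype.card ι : ℝ) - 2) • covD d Γ P a + d a (G⁻¹ * P).trace • G := by
    intro a
    rw [hP, covD_add, covD_real_smul, covD_smul, h.covD_self, smul_zero, zero_add]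
  have hb : covD d Γ (ric d Γ) m i j + ∑ k, covCurv d Γ k i m k j
      - covD d Γ (ric d Γ) i m j = 0 := by
    rw [← sum_covCurv, ← sum_covCurv, ← Finset.sum_add_distrib, ← Finset.sum_sub_distrib]
    refine Finset.sum_eq_zero fun k _ => ?_
    have := congrFun (congrFun (second_bianchi h.symm hd m k i) k) j
    rw [covCurv_neg i m k] at this
    simpa [sub_eq_add_neg] using this
  have hq : ∀ a, ∑ k, (G⁻¹ * covD d Γ P k) k a = d a (G⁻¹ * P).trace := by
    intro a
    rw [← hdiv a]
    refine Finset.sum_congr rfl fun k _ => ?_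
    rw [Matrix.mul_apply]
    exact Finset.sum_congr rfl fun l _ => by rw [(IsLeviCivita.covD_symm hPs k).apply a l]
  have hmid : ∑ k, covCurv d Γ k i m k j = covD d Γ P i m j - covD d Γ P m i j
      + d i (G⁻¹ * P).trace * G m j - d m (G⁻¹ * P).trace * G i j := by
    simp only [h.covCurv_of_weylFree hG hW, Finset.sum_add_distrib, Finset.sum_sub_distrib,
      ← Finset.sum_mul, hq, Matrix.one_apply, ite_mul, one_mul, zero_mul, Finset.sum_ite_eq',
      Finset.mem_univ, if_true]
  rw [hmid, hc, hc] at hb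
  simp only [Matrix.add_apply, Matrix.smul_apply, smul_eq_mul] at hb
  simp only [Algebra.smul_def, map_sub, map_natCast, map_ofNat] at hb
  -- The Ricci terms contribute N - 2 times the Cotton tensor and the divergence of the curvature
  -- contributes -1 times it, while the gradients of J cancel. This is where N ≥ 4 enters.
  have : ((Fintype.card ι : ℝ) - 3) • (covD d Γ P m i j - covD d Γ P i m j) = 0 := by
    rw [Algebra.smul_def, map_sub, map_natCast, map_ofNat]
    linear_combination hb
  exact sub_eq_zero.mp (real_smul_cancel hN3 this)

end Abstract

/-! ### Gauge transformations, flat metrics and changes of coordinates. -/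

section Gauge

variable {R : Type*} [CommRing R] [Algebra ℝ R] {ι : Type*} [Fintype ι] [DecidableEq ι]
  {d : ι → Derivation ℝ R R} {G : Matrix ι ι R} {Γ : ι → Matrix ι ι R}

/-- The hypothesis says that h intertwines the connections d + Γ and d + B; it therefore intertwines
their commutators. No invertibility of h is needed. -/
theorem curv_gauge (hd : ∀ i j f, d i (d j f) = d j (d i f)) {B : ι → Matrix ι ι R}
    {h : Matrix ι ι R} (hΓ : ∀ i, h * Γ i = B i * h + h.map (d i)) (k i : ι) :
    h * curv d Γ k i = curv d B k i * h := by
  have hdd : (h.map (d i)).map (d k) = (h.map (d k)).map (d i) := by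
    ext; simp [hd k i]
  have e : ∀ a b, h.map (d b) * Γ a + h * (Γ a).map (d b) =
      (B a).map (d b) * h + B a * h.map (d b) + (h.map (d a)).map (d b) := by
    intro a b
    rw [← derivation_map_mul, hΓ, derivation_map_add, derivation_map_mul]
  have e1 := e i k
  have e2 := e k i
  rw [hdd] at e1
  have m1 : h * Γ k * Γ i = (B k * h + h.map (d k)) * Γ i := by rw [hΓ]
  have m2 : h * Γ i * Γ k = (B i * h + h.map (d i)) * Γ k := by rw [hΓ]
  have m3 : B k * (h * Γ i) = B k * (B i * h + h.map (d i)) := by rw [hΓ]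
  have m4 : B i * (h * Γ k) = B i * (B k * h + h.map (d k)) := by rw [hΓ]
  simp only [curv]
  linear_combination (norm := noncomm_ring) e1 - e2 + m1 - m2 + m3 - m4

/-- Pulling back the Euclidean metric by a local diffeomorphism with Jacobian `J` gives a flat
metric. -/
theorem flat_of_jacobian (hd : ∀ i j f, d i (d j f) = d j (d i f)) {J : Matrix ι ι R}
    (hJ : ∀ i j a, d i (J j a) = d j (J i a)) (hJu : IsUnit J.det) (hGJ : G = J * Jᵀ) :
    ∃ Γ, IsLeviCivita d G Γ ∧ ∀ k i, curv d Γ k i = 0 := by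
  have hu : IsUnit (Jᵀ).det := by rwa [Matrix.det_transpose]
  -- The pullback of the trivial connection. It is torsion free because the columns of J are closed
  -- one-forms (`hJ`), and gauge equivalent to zero through Jᵀ, hence flat.
  refine ⟨fun i => (Jᵀ)⁻¹ * (Jᵀ).map (d i), ?_, ?_⟩
  · constructor
    · intro i j k
      simp only [Matrix.mul_apply, Matrix.map_apply, Matrix.transpose_apply, hJ i j]
    · intro a
      have h1 : ((Jᵀ)⁻¹ * (Jᵀ).map (d a))ᵀ = J.map (d a) * J⁻¹ := by
        rw [Matrix.transpose_mul, Matrix.transpose_nonsing_inv, Matrix.transpose_transpose]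
        rfl
      have h2 : J * Jᵀ * ((Jᵀ)⁻¹ * (Jᵀ).map (d a)) = J * (Jᵀ).map (d a) := by
        rw [mul_assoc, ← mul_assoc Jᵀ, Matrix.mul_nonsing_inv _ hu, one_mul]
      have h3 : J.map (d a) * J⁻¹ * (J * Jᵀ) = J.map (d a) * Jᵀ := by
        rw [mul_assoc, ← mul_assoc J⁻¹, Matrix.nonsing_inv_mul _ hJu, one_mul]
      rw [h1, hGJ, h2, h3, derivation_map_mul]
  · intro k i
    have h := curv_gauge (Γ := fun i => (Jᵀ)⁻¹ * (Jᵀ).map (d i)) (B := fun _ => 0) (h := Jᵀ) hd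
      (fun i => by rw [← mul_assoc, Matrix.mul_nonsing_inv _ hu]; simp) k i
    have hc : curv d (fun _ => (0 : Matrix ι ι R)) k i = 0 := by
      have hz : ∀ a, (0 : Matrix ι ι R).map (d a) = 0 := fun a => by ext; simp
      simp [curv, hz]
    rw [hc, zero_mul] at h
    have h2 := congrArg (fun X => (Jᵀ)⁻¹ * X) h
    simpa [← mul_assoc, Matrix.nonsing_inv_mul _ hu] using h2

variable {R' : Type*} [CommRing R'] [Algebra ℝ R'] {d' : ι → Derivation ℝ R' R'}
  {G' : Matrix ι ι R'} {Γ' : ι → Matrix ι ι R'}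

/-- The Levi-Civita connection in new coordinates, whose Jacobian is `J`. -/
def changeConn (φ : R' →ₐ[ℝ] R) (d : ι → Derivation ℝ R R) (J : Matrix ι ι R)
    (Γ' : ι → Matrix ι ι R') (i : ι) : Matrix ι ι R :=
  (Jᵀ)⁻¹ * ((∑ a, J i a • (Γ' a).map φ) * Jᵀ + (Jᵀ).map (d i))

variable {φ : R' →ₐ[ℝ] R} {J : Matrix ι ι R}

theorem jacobian_mul_changeConn (hJu : IsUnit J.det) (i : ι) :
    Jᵀ * changeConn φ d J Γ' i = (∑ a, J i a • (Γ' a).map φ) * Jᵀ + (Jᵀ).map (d i) := by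
  have hu : IsUnit (Jᵀ).det := by rwa [Matrix.det_transpose]
  rw [changeConn, ← mul_assoc, Matrix.mul_nonsing_inv _ hu, one_mul]

/-- The inhomogeneous term is symmetric by `hJ`, the other one because Γ' is; compatibility is the
chain rule applied to G' in the new coordinates. With uniqueness this yields the transformation law
of the Christoffel symbols. -/
theorem isLeviCivita_changeConn (hJ : ∀ i j a, d i (J j a) = d j (J i a)) (hJu : IsUnit J.det)
    (hchain : ∀ i f, d i (φ f) = ∑ a, J i a * φ (d' a f))
    (hG : G = J * G'.map φ * Jᵀ) (h' : IsLeviCivita d' G' Γ') :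
    IsLeviCivita d G (changeConn φ d J Γ') := by
  constructor
  · intro i j k
    have key : ∀ b, (Jᵀ * changeConn φ d J Γ' i) b j = (Jᵀ * changeConn φ d J Γ' j) b i := by
      intro b
      rw [jacobian_mul_changeConn hJu, jacobian_mul_changeConn hJu]
      simp only [Matrix.add_apply, Matrix.mul_apply, Matrix.map_apply, Matrix.transpose_apply,
        Matrix.sum_apply, Matrix.smul_apply, smul_eq_mul, hJ i j, Finset.sum_mul]
      congr 1
      rw [Finset.sum_comm]
      refine Finset.sum_congr rfl fun a _ => Finset.sum_congr rfl fun c _ => ?_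
      rw [h'.symm a c]; ring
    have hu : IsUnit (Jᵀ).det := by rwa [Matrix.det_transpose]
    have e : ∀ i, changeConn φ d J Γ' i = (Jᵀ)⁻¹ * (Jᵀ * changeConn φ d J Γ' i) := by
      intro i; rw [← mul_assoc, Matrix.nonsing_inv_mul _ hu, one_mul]
    rw [e i, e j, Matrix.mul_apply, Matrix.mul_apply (M := (Jᵀ)⁻¹)]
    exact Finset.sum_congr rfl fun b _ => by rw [key]
  · intro a
    set B := ∑ c, J a c • (Γ' c).map φ with hB
    have h1 : (G'.map φ).map (d a) = Bᵀ * G'.map φ + G'.map φ * B := by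
      have : (G'.map φ).map (d a) = ∑ c, J a c • (G'.map (d' c)).map φ := by
        ext i j
        simp only [Matrix.map_apply, hchain, Matrix.sum_apply, Matrix.smul_apply, smul_eq_mul]
      rw [this, hB, Matrix.transpose_sum, Finset.sum_mul, Finset.mul_sum, ← Finset.sum_add_distrib]
      refine Finset.sum_congr rfl fun c _ => ?_
      rw [h'.compat c, Matrix.transpose_smul, Matrix.smul_mul, Matrix.mul_smul, ← smul_add]
      congr 1
      ext i j
      simp [Matrix.mul_apply]
    have h2 := jacobian_mul_changeConn (φ := φ) (d := d) (Γ' := Γ') hJu a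
    rw [← hB] at h2
    have h3 := congrArg Matrix.transpose h2
    rw [Matrix.transpose_mul, Matrix.transpose_transpose, Matrix.transpose_add,
      Matrix.transpose_mul, Matrix.transpose_transpose] at h3
    rw [hG, derivation_map_mul, derivation_map_mul, h1]
    have h4 : (changeConn φ d J Γ' a)ᵀ * (J * G'.map φ * Jᵀ) =
        (J * Bᵀ + ((Jᵀ).map (d a))ᵀ) * (G'.map φ * Jᵀ) := by
      rw [← h3]; noncomm_ring
    have h5 : J * G'.map φ * Jᵀ * changeConn φ d J Γ' a =
        J * G'.map φ * (B * Jᵀ + (Jᵀ).map (d a)) := by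
      rw [← h2]; noncomm_ring
    have h6 : ((Jᵀ).map (d a))ᵀ = J.map (d a) := rfl
    rw [h4, h5, h6]
    noncomm_ring

/-- The gauge transformation by Jᵀ reduces the curvature to that of the pulled-back connection B,
where the derivatives of J cancel by `hJ`. In the trace one factor J then meets its inverse. -/
theorem ric_changeConn (hd : ∀ i j f, d i (d j f) = d j (d i f))
    (hJ : ∀ i j a, d i (J j a) = d j (J i a)) (hJu : IsUnit J.det)
    (hchain : ∀ i f, d i (φ f) = ∑ a, J i a * φ (d' a f)) :
    ric d (changeConn φ d J Γ') = J * (ric d' Γ').map φ * Jᵀ := by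
  have hu : IsUnit (Jᵀ).det := by rwa [Matrix.det_transpose]
  set B : ι → Matrix ι ι R := fun i => ∑ a, J i a • (Γ' a).map φ with hB
  have hcB : ∀ k i l j, curv d B k i l j =
      ∑ b, ∑ a, J k b * J i a * φ (curv d' Γ' b a l j) := by
    intro k i l j
    have e1 : ∀ k i, d k (B i l j) = ∑ a, d k (J i a) * φ (Γ' a l j) +
        ∑ b, ∑ a, J k b * J i a * φ (d' b (Γ' a l j)) := by
      intro k i
      simp only [hB, Matrix.sum_apply, Matrix.smul_apply, Matrix.map_apply, smul_eq_mul, map_sum,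
        Derivation.leibniz, hchain, Finset.sum_add_distrib, Finset.mul_sum]
      rw [add_comm]
      congr 1
      · exact Finset.sum_congr rfl fun a _ => by ring
      · rw [Finset.sum_comm]
        exact Finset.sum_congr rfl fun b _ => Finset.sum_congr rfl fun a _ => by ring
    have e2 : ∀ k i, (B k * B i) l j = ∑ b, ∑ a, J k b * J i a * φ ((Γ' b * Γ' a) l j) := by
      intro k i
      have : B k * B i = ∑ b, ∑ a, (J k b * J i a) • (Γ' b * Γ' a).map φ := by
        simp only [hB, Finset.sum_mul_sum]
        refine Finset.sum_congr rfl fun b _ => Finset.sum_congr rfl fun a _ => ?_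
        rw [Matrix.smul_mul, Matrix.mul_smul, smul_smul]
        congr 1
        ext; simp [Matrix.mul_apply]
      rw [this]
      simp only [Matrix.sum_apply, Matrix.smul_apply, Matrix.map_apply, smul_eq_mul]
    have e3 : ∀ f : ι → ι → R, ∑ b, ∑ a, J i b * J k a * f b a = ∑ b, ∑ a, J k b * J i a * f a b := by
      intro f
      rw [Finset.sum_comm]
      exact Finset.sum_congr rfl fun b _ => Finset.sum_congr rfl fun a _ => by ring
    simp only [curv, Matrix.add_apply, Matrix.sub_apply, Matrix.map_apply, map_add, map_sub]
    rw [e1, e1, e2, e2, e3, e3, Finset.sum_congr rfl fun a _ => by rw [hJ k i a]]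
    simp only [mul_add, mul_sub, Finset.sum_add_distrib, Finset.sum_sub_distrib]
    ring
  have hg := curv_gauge (B := B) hd (fun i => jacobian_mul_changeConn (φ := φ) (Γ' := Γ') hJu i)
  have hcurv : ∀ k i, curv d (changeConn φ d J Γ') k i = (Jᵀ)⁻¹ * curv d B k i * Jᵀ := by
    intro k i
    rw [mul_assoc, ← hg, ← mul_assoc, Matrix.nonsing_inv_mul _ hu, one_mul]
  ext i j
  have hinv : ∀ b l, ∑ k, (Jᵀ)⁻¹ k l * J k b = (1 : Matrix ι ι R) b l := by
    intro b l
    rw [← Matrix.mul_nonsing_inv _ hu, Matrix.mul_apply]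
    exact Finset.sum_congr rfl fun k _ => by rw [Matrix.transpose_apply, mul_comm]
  calc ric d (changeConn φ d J Γ') i j
      = ∑ k, ∑ m, (∑ l, (Jᵀ)⁻¹ k l * ∑ b, ∑ a, J k b * J i a * φ (curv d' Γ' b a l m)) * J j m := by
        simp only [ric, Matrix.of_apply, hcurv, Matrix.mul_apply, hcB, Matrix.transpose_apply]
    _ = ∑ k, ∑ m, ∑ l, ∑ b, ∑ a, ((Jᵀ)⁻¹ k l * J k b) * (J i a * φ (curv d' Γ' b a l m) * J j m) := by
        simp only [Finset.mul_sum, Finset.sum_mul]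
        refine Finset.sum_congr rfl fun _ _ => Finset.sum_congr rfl fun _ _ =>
          Finset.sum_congr rfl fun _ _ => Finset.sum_congr rfl fun _ _ =>
          Finset.sum_congr rfl fun _ _ => by ring
    _ = ∑ m, ∑ l, ∑ b, ∑ a, (∑ k, (Jᵀ)⁻¹ k l * J k b) *
          (J i a * φ (curv d' Γ' b a l m) * J j m) := by
        rw [Finset.sum_comm]
        refine Finset.sum_congr rfl fun _ _ => ?_
        rw [Finset.sum_comm]
        refine Finset.sum_congr rfl fun _ _ => ?_
        rw [Finset.sum_comm]
        refine Finset.sum_congr rfl fun _ _ => ?_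
        rw [Finset.sum_comm]
        refine Finset.sum_congr rfl fun _ _ => ?_
        rw [Finset.sum_mul]
    _ = ∑ m, ∑ l, ∑ a, J i a * φ (curv d' Γ' l a l m) * J j m := by
        refine Finset.sum_congr rfl fun m _ => Finset.sum_congr rfl fun l _ => ?_
        simp only [hinv, Matrix.one_apply, ite_mul, one_mul, zero_mul]
        rw [Finset.sum_comm]
        simp
    _ = (J * (ric d' Γ').map φ * Jᵀ) i j := by
        simp only [Matrix.mul_apply, ric, Matrix.map_apply, Matrix.of_apply, map_sum,
          Matrix.transpose_apply, Finset.mul_sum, Finset.sum_mul]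
        refine Finset.sum_congr rfl fun m _ => ?_
        rw [Finset.sum_comm]

end Gauge

/-! ### Conformal change of the connection and of the curvature. -/

section ConformalChange

variable {R : Type*} [CommRing R] [Algebra ℝ R] {ι : Type*} [Fintype ι] [DecidableEq ι]
  {d : ι → Derivation ℝ R R} {G : Matrix ι ι R} {Γ : ι → Matrix ι ι R}

variable (d G) in
/-- The gradient `W = ∇w`, with raised index. -/
def grad (w : R) (l : ι) : R := ∑ p, G⁻¹ l p * d p w

variable (d G) in
/-- The difference of the Levi-Civita connections of `e^{2w} G` and `G`. -/
def confConn (w : R) (i : ι) : Matrix ι ι R := Matrix.of fun l j =>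
  (1 : Matrix ι ι R) l i * d j w + (1 : Matrix ι ι R) l j * d i w - G i j * grad d G w l

variable (d G Γ) in
/-- The change of the Schouten tensor under the conformal change `e^{2w} G`. -/
def confSchouten (w : R) : Matrix ι ι R := Matrix.of fun i j =>
  -hess d Γ w i j + d i w * d j w - (1 / 2 : ℝ) • ((∑ p, d p w * grad d G w p) * G i j)

theorem hess_symm (hs : ∀ i j k, Γ i k j = Γ j k i) (hd : ∀ i j f, d i (d j f) = d j (d i f))
    (w : R) : (hess d Γ w).IsSymm := by
  ext i j
  simp only [hess, Matrix.transpose_apply, Matrix.of_apply, hd i j]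
  congr 1
  exact Finset.sum_congr rfl fun k _ => by rw [hs]

theorem confSchouten_symm (hsG : G.IsSymm) (hs : ∀ i j k, Γ i k j = Γ j k i)
    (hd : ∀ i j f, d i (d j f) = d j (d i f)) (w : R) : (confSchouten d G Γ w).IsSymm := by
  ext i j
  simp only [confSchouten, Matrix.transpose_apply, Matrix.of_apply, (hess_symm hs hd w).apply i j,
    hsG.apply i j]
  ring

theorem mul_grad (hG : IsUnit G.det) (w : R) (a : ι) : ∑ l, G a l * grad d G w l = d a w := by
  have h1 : grad d G w = G⁻¹ *ᵥ fun p => d p w := rfl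
  have h2 : ∑ l, G a l * grad d G w l = (G *ᵥ grad d G w) a := rfl
  rw [h2, h1, Matrix.mulVec_mulVec, Matrix.mul_nonsing_inv _ hG, Matrix.one_mulVec]

/-- Here ρ plays the role of e^{2w}; only its logarithmic derivative matters, so no exponential is
required in the ring. -/
theorem isLeviCivita_conformal (hG : IsUnit G.det) (hs : G.IsSymm) (h : IsLeviCivita d G Γ)
    {w ρ : R} (hρ : ∀ i, d i ρ = 2 * ρ * d i w) :
    IsLeviCivita d (ρ • G) (fun i => Γ i + confConn d G w i) := by
  constructor
  · intro i j k
    simp only [Matrix.add_apply, confConn, Matrix.of_apply, h.symm i j, hs.apply i j]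
    ring
  · intro a
    have hc : (confConn d G w a)ᵀ * G + G * confConn d G w a = (2 * d a w) • G := by
      have hl : ∀ l j, (G * confConn d G w a) l j =
          G l a * d j w + G l j * d a w - G a j * d l w := by
        intro l j
        simp only [Matrix.mul_apply, confConn, Matrix.of_apply, mul_add, mul_sub,
          Finset.sum_add_distrib, Finset.sum_sub_distrib, Matrix.one_apply, ite_mul, one_mul,
          zero_mul, mul_ite, mul_zero, Finset.sum_ite_eq', Finset.mem_univ, if_true]
        rw [← mul_grad hG w l, Finset.mul_sum]
        congr 1
        · exact Finset.sum_congr rfl fun p _ => by ring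
      have ht : (confConn d G w a)ᵀ * G = (G * confConn d G w a)ᵀ := by
        rw [Matrix.transpose_mul, hs.eq]
      ext i j
      rw [ht]
      simp only [Matrix.add_apply, Matrix.transpose_apply, hl, Matrix.smul_apply, smul_eq_mul]
      rw [hs.apply i j, hs.apply i a, hs.apply j a]
      ring
    have : (ρ • G).map (d a) = ρ • G.map (d a) + d a ρ • G := by
      ext; simp [mul_comm]
    rw [this, h.compat, hρ, Matrix.transpose_add, Matrix.mul_smul, Matrix.smul_mul, ← smul_add,
      add_mul, mul_add, show 2 * ρ * d a w = ρ * (2 * d a w) by ring, mul_smul, ← hc, ← smul_add]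
    congr 1
    abel

/-- The conformal change of the curvature tensor. -/
theorem curv_conformal (hG : IsUnit G.det) (hs : G.IsSymm) (h : IsLeviCivita d G Γ)
    (hd : ∀ i j f, d i (d j f) = d j (d i f)) (w : R) (k i l j : ι) :
    curv d (fun i => Γ i + confConn d G w i) k i l j = curv d Γ k i l j
      + ((1 : Matrix ι ι R) l k * confSchouten d G Γ w i j
        - (1 : Matrix ι ι R) l i * confSchouten d G Γ w k j
        + (G⁻¹ * confSchouten d G Γ w) l k * G i j
        - (G⁻¹ * confSchouten d G Γ w) l i * G k j) := by
  set W := grad d G w with hW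
  have hU : ∀ k, (G⁻¹ * confSchouten d G Γ w) l k =
      -(∑ p, G⁻¹ l p * hess d Γ w p k) + W l * d k w
        - (1 / 2 : ℝ) • ((∑ p, d p w * W p) * (1 : Matrix ι ι R) l k) := by
    intro k
    have h1 : (1 : Matrix ι ι R) l k = ∑ p, G⁻¹ l p * G p k := by
      rw [← Matrix.mul_apply, Matrix.nonsing_inv_mul _ hG]
    rw [h1, Matrix.mul_apply, hW, grad, Finset.sum_mul, Finset.mul_sum, Finset.smul_sum,
      ← Finset.sum_neg_distrib, ← Finset.sum_add_distrib, ← Finset.sum_sub_distrib]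
    refine Finset.sum_congr rfl fun p _ => ?_
    simp only [confSchouten, Matrix.of_apply, mul_add, mul_sub, mul_smul_comm, mul_neg]
    rw [← hW]
    congr 1
    · ring
    · congr 1; ring
  -- Raising an index commutes with covariant differentiation, so the derivative of the gradient is
  -- the Hessian with one index raised.
  have hdW : ∀ k, d k (W l) + ∑ p, Γ k l p * W p = ∑ p, G⁻¹ l p * hess d Γ w p k := by
    intro k
    have h1 : ∀ p, d k (G⁻¹ l p) = -(∑ q, Γ k l q * G⁻¹ q p) - ∑ q, G⁻¹ l q * Γ k p q := by
      intro p
      have := congrFun (congrFun (h.inv_map hG k) l) p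
      simpa [Matrix.mul_apply] using this
    have h2 : ∑ p, Γ k l p * W p = ∑ p, (∑ q, Γ k l q * G⁻¹ q p) * d p w := by
      simp only [hW, grad, Finset.mul_sum, Finset.sum_mul]
      rw [Finset.sum_comm]
      exact Finset.sum_congr rfl fun p _ => Finset.sum_congr rfl fun q _ => by ring
    have h3 : ∑ p, G⁻¹ l p * ∑ q, Γ k q p * d q w = ∑ p, (∑ q, G⁻¹ l q * Γ k p q) * d p w := by
      simp only [Finset.mul_sum, Finset.sum_mul]
      rw [Finset.sum_comm]
      exact Finset.sum_congr rfl fun p _ => Finset.sum_congr rfl fun q _ => by ring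
    have h4 : ∑ p, G⁻¹ l p * hess d Γ w p k = ∑ p, G⁻¹ l p * d k (d p w)
        - ∑ p, G⁻¹ l p * ∑ q, Γ k q p * d q w := by
      rw [← Finset.sum_sub_distrib]
      refine Finset.sum_congr rfl fun p _ => ?_
      rw [(hess_symm h.symm hd w).apply k p, hess, Matrix.of_apply, mul_sub]
    rw [h4, h3, h2]
    simp only [hW, grad, map_sum, Derivation.leibniz, smul_eq_mul, h1, Finset.sum_add_distrib]
    rw [add_assoc, sub_eq_add_neg]
    congr 1
    rw [← Finset.sum_add_distrib, ← Finset.sum_neg_distrib]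
    exact Finset.sum_congr rfl fun p _ => by ring
  have hdG : ∀ k i, d k (G i j) = ∑ p, G i p * Γ k p j + ∑ p, G j p * Γ k p i := by
    intro k i
    have := congrFun (congrFun (h.compat k) i) j
    rw [Matrix.add_apply, Matrix.mul_apply, Matrix.mul_apply, add_comm] at this
    refine this.trans ?_
    congr 1
    exact Finset.sum_congr rfl fun p _ => by
      rw [Matrix.transpose_apply, hs.apply j p, mul_comm]
  have hC1 : ∀ k i, ∑ p, Γ k l p * confConn d G w i p j =
      Γ k l i * d j w + Γ k l j * d i w - G i j * ∑ p, Γ k l p * W p := by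
    intro k i
    simp only [confConn, Matrix.of_apply, mul_add, mul_sub, Finset.sum_add_distrib,
      Finset.sum_sub_distrib, Matrix.one_apply, ite_mul, one_mul, zero_mul, mul_ite, mul_zero,
      Finset.sum_ite_eq', Finset.sum_ite_eq, Finset.mem_univ, if_true, Finset.mul_sum, ← hW]
    congr 1
    exact Finset.sum_congr rfl fun p _ => by ring
  have hC2 : ∀ k i, ∑ p, confConn d G w i l p * Γ k p j =
      (1 : Matrix ι ι R) l i * ∑ p, Γ k p j * d p w + d i w * Γ k l j
        - W l * ∑ p, G i p * Γ k p j := by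
    intro k i
    simp only [confConn, Matrix.of_apply, add_mul, sub_mul, Finset.sum_add_distrib,
      Finset.sum_sub_distrib, Finset.mul_sum, ← hW]
    congr 1
    · congr 1
      · exact Finset.sum_congr rfl fun p _ => by ring
      · simp [Matrix.one_apply, mul_comm]
    · exact Finset.sum_congr rfl fun p _ => by ring
  have hGW : ∀ k, ∑ p, G k p * W p = d k w := fun k => mul_grad hG w k
  have hCC : ∀ k i, ∑ p, confConn d G w k l p * confConn d G w i p j =
      (1 : Matrix ι ι R) l k * (2 * (d i w * d j w) - G i j * ∑ p, d p w * W p)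
      + d k w * ((1 : Matrix ι ι R) l i * d j w + (1 : Matrix ι ι R) l j * d i w - G i j * W l)
      - W l * (G k i * d j w + G k j * d i w - G i j * d k w) := by
    intro k i
    have e : ∀ p, confConn d G w k l p * confConn d G w i p j =
        (1 : Matrix ι ι R) l k * (d p w * confConn d G w i p j)
        + d k w * ((1 : Matrix ι ι R) l p * confConn d G w i p j)
        - W l * (G k p * confConn d G w i p j) := by
      intro p
      conv_lhs => rw [confConn, Matrix.of_apply, ← hW]
      ring
    rw [Finset.sum_congr rfl fun p _ => e p, Finset.sum_sub_distrib, Finset.sum_add_distrib,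
      ← Finset.mul_sum, ← Finset.mul_sum, ← Finset.mul_sum]
    have s1 : ∑ p, d p w * confConn d G w i p j =
        2 * (d i w * d j w) - G i j * ∑ p, d p w * W p := by
      simp only [confConn, Matrix.of_apply, mul_add, mul_sub, Finset.sum_add_distrib,
        Finset.sum_sub_distrib, Matrix.one_apply, ite_mul, one_mul, zero_mul, mul_ite, mul_zero,
        Finset.sum_ite_eq', Finset.sum_ite_eq, Finset.mem_univ, if_true, Finset.mul_sum, ← hW]
      congr 1
      · ring
      · exact Finset.sum_congr rfl fun p _ => by ring
    have s2 : ∑ p, (1 : Matrix ι ι R) l p * confConn d G w i p j =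
        (1 : Matrix ι ι R) l i * d j w + (1 : Matrix ι ι R) l j * d i w - G i j * W l := by
      rw [← Matrix.mul_apply, one_mul, confConn, Matrix.of_apply]
    have s3 : ∑ p, G k p * confConn d G w i p j =
        G k i * d j w + G k j * d i w - G i j * d k w := by
      rw [← hGW k]
      simp only [confConn, Matrix.of_apply, mul_add, mul_sub, Finset.sum_add_distrib,
        Finset.sum_sub_distrib, Matrix.one_apply, ite_mul, one_mul, zero_mul, mul_ite, mul_zero,
        Finset.sum_ite_eq', Finset.sum_ite_eq, Finset.mem_univ, if_true, Finset.mul_sum, ← hW]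
      congr 1
      exact Finset.sum_congr rfl fun p _ => by ring
    rw [s1, s2, s3]
  have hdC : ∀ k i, d k (confConn d G w i l j) = (1 : Matrix ι ι R) l i * d k (d j w)
      + (1 : Matrix ι ι R) l j * d k (d i w) - (G i j * d k (W l) + W l * d k (G i j)) := by
    intro k i
    have h1 : ∀ a b, d k ((1 : Matrix ι ι R) a b) = 0 := by
      intro a b; by_cases hab : a = b <;> simp [hab, Matrix.one_apply]
    simp only [confConn, Matrix.of_apply, map_add, map_sub, Derivation.leibniz, h1, smul_zero,
      add_zero, smul_eq_mul, mul_zero, ← hW]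
  have hh : ∀ k, ∑ p, Γ k p j * d p w = d k (d j w) - hess d Γ w k j := by
    intro k; simp [hess]
  -- The curvature of Γ + C is the curvature of Γ plus the antisymmetrised covariant derivative of C
  -- plus the commutator of C with itself; the identities above express each piece through the
  -- gradient and Hessian of w.
  have hmain : curv d (fun i => Γ i + confConn d G w i) k i l j = curv d Γ k i l j
      + (d k (confConn d G w i l j) - d i (confConn d G w k l j))
      + (∑ p, Γ k l p * confConn d G w i p j - ∑ p, confConn d G w i l p * Γ k p j)
      - (∑ p, Γ i l p * confConn d G w k p j - ∑ p, confConn d G w k l p * Γ i p j)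
      + (∑ p, confConn d G w k l p * confConn d G w i p j
        - ∑ p, confConn d G w i l p * confConn d G w k p j) := by
    simp only [curv, derivation_map_add, add_mul, mul_add, Matrix.add_apply, Matrix.sub_apply,
      Matrix.map_apply, Matrix.mul_apply]
    ring
  rw [hmain, hdC, hdC, hC1, hC1, hC2, hC2, hCC, hCC, hU, hU, ← hdW, ← hdW, hdG, hdG, hh, hh,
    hd i k, h.symm i k l]
  simp only [h.symm i k]
  simp only [confSchouten, Matrix.of_apply, ← hW]
  set s := ∑ p, d p w * W p
  have hhalf : ∀ x : R, (1 / 2 : ℝ) • x = algebraMap ℝ R (1 / 2) * x := fun x => Algebra.smul_def _ _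
  have hh2 : (algebraMap ℝ R (1 / 2)) + algebraMap ℝ R (1 / 2) = 1 := by
    rw [← map_add]; norm_num
  rw [hs.apply k i]
  simp only [hhalf]
  linear_combination -(s * G k j * (1 : Matrix ι ι R) l i - s * G i j * (1 : Matrix ι ι R) l k) * hh2

end ConformalChange

section

open Polynomial

/-! ### The divergence of the adjugate of a Codazzi tensor. -/

section DivAdjugate

variable {S A : Type*} [CommRing S] [CommRing A] [Algebra S A]
  {ι : Type*} [Fintype ι] [DecidableEq ι]

theorem trace_mul_of_isSymm (M N : Matrix ι ι A) (hM : M.IsSymm) :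
    (M * N).trace = ∑ k, ∑ l, M k l * N k l := by
  simp only [Matrix.trace, Matrix.diag_apply, Matrix.mul_apply]
  rw [Finset.sum_comm]
  exact Finset.sum_congr rfl fun k _ => Finset.sum_congr rfl fun l _ => by rw [hM.apply]

/-- The divergence of a contravariant symmetric two-tensor density of weight two. -/
theorem sum_derivation_of_map (δ : ι → Derivation S A A) {Γ : ι → Matrix ι ι A}
    (hs : ∀ i j k, Γ i k j = Γ j k i) {Z : Matrix ι ι A} {Y : ι → Matrix ι ι A}
    (hZ : ∀ a, Z.map (δ a) = (2 * (Γ a).trace) • Z - Γ a * Z - Z * (Γ a)ᵀ + Y a) (b : ι) :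
    ∑ a, δ a (Z a b) = ∑ a, (Γ a).trace * Z a b - ∑ a, ∑ c, Γ a b c * Z a c + ∑ a, Y a a b := by
  have h1 : ∀ a, δ a (Z a b) = 2 * (Γ a).trace * Z a b - ∑ c, Γ a a c * Z c b
      - ∑ c, Γ a b c * Z a c + Y a a b := by
    intro a
    have := congrFun (congrFun (hZ a) a) b
    simp only [Matrix.map_apply, Matrix.add_apply, Matrix.sub_apply, Matrix.smul_apply,
      Matrix.mul_apply, Matrix.transpose_apply, smul_eq_mul] at this
    rw [this]
    congr 2
    exact Finset.sum_congr rfl fun c _ => mul_comm _ _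
  have h2 : ∑ a, ∑ c, Γ a a c * Z c b = ∑ c, (Γ c).trace * Z c b := by
    rw [Finset.sum_comm]
    refine Finset.sum_congr rfl fun c _ => ?_
    rw [Matrix.trace, Finset.sum_mul]
    exact Finset.sum_congr rfl fun a _ => by rw [Matrix.diag_apply, hs]
  simp only [h1, Finset.sum_add_distrib, Finset.sum_sub_distrib, h2, mul_assoc, ← Finset.mul_sum]
  ring

/-- The divergence of the adjugate of a tensor which satisfies a Codazzi equation. -/
theorem sum_derivation_adjugate {S' : Type*} [CommRing S'] [Algebra S' A]
    (δ : ι → Derivation S A A) (L : Derivation S' A A) {Γ : ι → Matrix ι ι A}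
    (hs : ∀ i j k, Γ i k j = Γ j k i) {M : Matrix ι ι A} (hM : M.IsSymm)
    (hreg : IsRegular M.det) {p : ι → A}
    (hcod : ∀ a c e, ((M.map (δ a)) - (Γ a)ᵀ * M - M * Γ a) c e
        - ((M.map (δ c)) - (Γ c)ᵀ * M - M * Γ c) a e =
      p a * M.map L c e - p c * M.map L a e) (b : ι) :
    ∑ a, δ a (M.adjugate a b) = ∑ a, (Γ a).trace * M.adjugate a b
      - ∑ a, ∑ c, Γ a b c * M.adjugate a c + ∑ c, L (M.adjugate b c) * p c := by
  set Q := M.adjugate with hQ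
  have hQs : Q.IsSymm := hM.adjugate
  set D : ι → Matrix ι ι A := fun a => M.map (δ a) - (Γ a)ᵀ * M - M * Γ a with hD
  -- The covariant derivative of the adjugate, which is a tensor density of weight two.
  set Y : ι → Matrix ι ι A := fun a =>
    Q.map (δ a) - (2 * (Γ a).trace) • Q + Γ a * Q + Q * (Γ a)ᵀ with hY
  have hMQ : M * Q = M.det • 1 := Matrix.mul_adjugate M
  have hQM : Q * M = M.det • 1 := Matrix.adjugate_mul M
  have hYdet : ∀ a, M.det • Y a = (Q * D a).trace • Q - Q * D a * Q := by
    intro a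
    have h1 := derivation_adjugate (δ a) M
    rw [← hQ] at h1
    have h2 : M.map (δ a) = D a + (Γ a)ᵀ * M + M * Γ a := by simp only [hD]; abel
    have t1 : (Q * ((Γ a)ᵀ * M)).trace = M.det * (Γ a).trace := by
      rw [Matrix.trace_mul_comm, mul_assoc, hMQ, Matrix.mul_smul, mul_one, Matrix.trace_smul,
        Matrix.trace_transpose, smul_eq_mul]
    have t2 : (Q * (M * Γ a)).trace = M.det * (Γ a).trace := by
      rw [← mul_assoc, hQM, Matrix.smul_mul, one_mul, Matrix.trace_smul, smul_eq_mul]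
    have t3 : Q * ((Γ a)ᵀ * M) * Q = M.det • (Q * (Γ a)ᵀ) := by
      rw [← mul_assoc, mul_assoc, hMQ, Matrix.mul_smul, mul_one]
    have t4 : Q * (M * Γ a) * Q = M.det • (Γ a * Q) := by
      rw [← mul_assoc, hQM, Matrix.smul_mul, Matrix.smul_mul, one_mul]
    simp only [hY, smul_add, smul_sub, h1]
    rw [h2]
    simp only [mul_add, add_mul, Matrix.trace_add, add_smul, t1, t2, t3, t4, smul_smul]
    rw [show M.det * (2 * (Γ a).trace) = M.det * (Γ a).trace + M.det * (Γ a).trace by ring,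
      add_smul]
    abel
  have hmain := sum_derivation_of_map δ hs (Z := Q) (Y := Y) (fun a => by simp only [hY]; abel) b
  rw [hmain]
  congr 1
  -- After multiplication by the regular element det M both sides can be written through derivatives
  -- of M instead of its adjugate.
  refine hreg.left ?_
  simp only
  have hDs : ∀ a, (D a).IsSymm := by
    intro a
    rw [Matrix.IsSymm, hD]
    simp only [Matrix.transpose_sub, Matrix.transpose_mul, Matrix.transpose_transpose, hM.eq]
    have : (M.map (δ a))ᵀ = M.map (δ a) := by
      ext i j; simp [hM.apply]
    rw [this]; abel
  have hK : M.det • Q.map L = (Q * M.map L).trace • Q - Q * M.map L * Q :=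
    derivation_adjugate L M
  -- Exchanging the names of two contracted indices in the second term makes the product of the two
  -- factors Q common, so that only the Codazzi defect of M remains.
  have lhs : M.det * ∑ a, Y a a b =
      ∑ a, ∑ c, ∑ e, Q c e * Q a b * (D a c e - D c a e) := by
    rw [Finset.mul_sum]
    have h1 : ∀ a, M.det * Y a a b = ∑ c, ∑ e, Q c e * Q a b * D a c e
        - ∑ c, ∑ e, Q a c * D a c e * Q e b := by
      intro a
      have := congrFun (congrFun (hYdet a) a) b
      simp only [Matrix.smul_apply, Matrix.sub_apply, smul_eq_mul] at this
      rw [this, trace_mul_of_isSymm _ _ hQs, Finset.sum_mul]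
      congr 1
      · refine Finset.sum_congr rfl fun c _ => ?_
        rw [Finset.sum_mul]
        exact Finset.sum_congr rfl fun e _ => by ring
      · simp only [Matrix.mul_apply, Finset.sum_mul]
        exact Finset.sum_comm
    simp only [h1, mul_sub, Finset.sum_sub_distrib]
    congr 1
    rw [Finset.sum_comm]
    have h3 : ∀ c, ∑ a, ∑ e, Q a c * D a c e * Q e b = ∑ e, ∑ a, Q a c * D a e c * Q e b := by
      intro c
      rw [Finset.sum_comm]
      exact Finset.sum_congr rfl fun e _ => Finset.sum_congr rfl fun a _ => by
        rw [(hDs a).apply e c]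
    simp only [h3]
    rw [Finset.sum_comm]
    refine Finset.sum_congr rfl fun a _ => ?_
    rw [Finset.sum_comm]
    exact Finset.sum_congr rfl fun c _ => Finset.sum_congr rfl fun e _ => by ring
  have rhs : M.det * ∑ c, L (Q b c) * p c =
      ∑ a, ∑ c, ∑ e, Q c e * Q a b * (p a * M.map L c e - p c * M.map L a e) := by
    rw [Finset.mul_sum]
    have h1 : ∀ c, M.det * (L (Q b c) * p c) = (∑ u, ∑ e, Q u e * M.map L u e) * Q c b * p c
        - (∑ a, ∑ e, Q b a * M.map L a e * Q e c) * p c := by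
      intro c
      have := congrFun (congrFun hK b) c
      simp only [Matrix.smul_apply, Matrix.sub_apply, smul_eq_mul, Matrix.map_apply] at this
      rw [← mul_assoc, this, sub_mul, trace_mul_of_isSymm _ _ hQs, hQs.apply c b]
      congr 2
      simp only [Matrix.mul_apply, Finset.sum_mul]
      exact Finset.sum_comm
    simp only [h1, mul_sub, Finset.sum_sub_distrib]
    congr 1
    · refine Finset.sum_congr rfl fun a _ => ?_
      simp only [Finset.sum_mul]
      exact Finset.sum_congr rfl fun c _ => Finset.sum_congr rfl fun e _ => by ring
    · simp only [Finset.sum_mul]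
      rw [Finset.sum_comm]
      refine Finset.sum_congr rfl fun a _ => Finset.sum_congr rfl fun c _ =>
        Finset.sum_congr rfl fun e _ => ?_
      rw [hQs.apply a b, hQs.apply c e]; ring
  rw [lhs, rhs]
  refine Finset.sum_congr rfl fun a _ => Finset.sum_congr rfl fun c _ =>
    Finset.sum_congr rfl fun e _ => ?_
  rw [← hcod a c e]

end DivAdjugate

/-! ### Coefficients of the adjugate of a pencil. -/

section AdjugateCoeff

variable {A : Type*} [CommRing A] {ι : Type*} [Fintype ι] [DecidableEq ι]

/-- The matrix of coefficients of `X^i`. -/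
def coeffMat (i : ℕ) (M : Matrix ι ι A[X]) : Matrix ι ι A := M.map fun p => p.coeff i

theorem coeffMat_pencil_mul (G B : Matrix ι ι A) (M : Matrix ι ι A[X]) (i : ℕ) :
    coeffMat (i + 1) (pencil G B * M) = G * coeffMat i M + B * coeffMat (i + 1) M := by
  ext a b
  simp only [coeffMat, Matrix.map_apply, Matrix.mul_apply, pencil_apply, Matrix.add_apply,
    finsetSum_coeff, add_mul, coeff_add, mul_assoc, coeff_X_mul, coeff_C_mul,
    Finset.sum_add_distrib]

theorem coeff_det_pencil_card (G B : Matrix ι ι A) :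
    (pencil G B).det.coeff (Fintype.card ι) = G.det :=
  Polynomial.coeff_det_X_add_C_card G B

theorem coeff_det_pencil_eq_zero (G B : Matrix ι ι A) {i : ℕ} (hi : Fintype.card ι < i) :
    (pencil G B).det.coeff i = 0 :=
  coeff_eq_zero_of_natDegree_lt ((Polynomial.natDegree_det_X_add_C_le G B).trans_lt hi)

theorem coeffMat_det_smul_one (M : Matrix ι ι A[X]) (i : ℕ) :
    coeffMat i (M.det • (1 : Matrix ι ι A[X])) = M.det.coeff i • 1 := by
  ext a b
  by_cases h : a = b <;> simp [coeffMat, h, Matrix.one_apply]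

theorem coeffMat_adjugate_rec (G B : Matrix ι ι A) (i : ℕ) :
    G * coeffMat i (pencil G B).adjugate + B * coeffMat (i + 1) (pencil G B).adjugate =
      (pencil G B).det.coeff (i + 1) • 1 := by
  rw [← coeffMat_pencil_mul, Matrix.mul_adjugate, coeffMat_det_smul_one]

/-- Descending induction. The coefficients vanish beyond some crude bound `b0`, and the recursion of
`coeffMat_adjugate_rec` propagates the vanishing downwards because G is invertible. -/
theorem coeffMat_adjugate_eq_zero (G B : Matrix ι ι A) (hG : IsUnit G.det) {i : ℕ}
    (hi : Fintype.card ι ≤ i) : coeffMat i (pencil G B).adjugate = 0 := by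
  set b0 := ∑ x : ι × ι, ((pencil G B).adjugate x.1 x.2).natDegree + 1
  have hlarge : ∀ i, b0 ≤ i → coeffMat i (pencil G B).adjugate = 0 := by
    intro i hi
    ext a b
    refine coeff_eq_zero_of_natDegree_lt (lt_of_lt_of_le ?_ hi)
    have := Finset.single_le_sum (f := fun x : ι × ι => ((pencil G B).adjugate x.1 x.2).natDegree)
      (fun _ _ => Nat.zero_le _) (Finset.mem_univ (a, b))
    exact Nat.lt_succ_of_le this
  have hstep : ∀ j i, b0 ≤ i + j → Fintype.card ι ≤ i →
      coeffMat i (pencil G B).adjugate = 0 := by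
    intro j
    induction j with
    | zero => intro i h _; exact hlarge i h
    | succ j ih =>
      intro i h hc
      have h1 := coeffMat_adjugate_rec G B i
      rw [ih (i + 1) (by omega) (by omega), mul_zero, add_zero,
        coeff_det_pencil_eq_zero G B (by omega), zero_smul] at h1
      have h2 := congrArg (fun X => G⁻¹ * X) h1
      simpa [← mul_assoc, Matrix.nonsing_inv_mul _ hG] using h2
  exact hstep b0 i (by omega) hi

theorem coeffMat_adjugate_top (G B : Matrix ι ι A) (hG : IsUnit G.det) {m : ℕ}
    (hm : Fintype.card ι = m + 1) :
    coeffMat m (pencil G B).adjugate = G.det • G⁻¹ := by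
  have h1 := coeffMat_adjugate_rec G B m
  rw [coeffMat_adjugate_eq_zero G B hG hm.le, mul_zero, add_zero, ← hm,
    coeff_det_pencil_card] at h1
  have h2 := congrArg (fun X => G⁻¹ * X) h1
  simpa [← mul_assoc, Matrix.nonsing_inv_mul _ hG] using h2

/-- The recursion leaves one unknown, the second highest coefficient of the determinant. It is found
by comparing the trace of the recursion with Jacobi's formula for the derivative in X. -/
theorem coeffMat_adjugate_second (G B : Matrix ι ι A) (hG : IsUnit G.det) {m : ℕ}
    (hm : Fintype.card ι = m + 2) :
    coeffMat m (pencil G B).adjugate =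
      G.det • ((G⁻¹ * B).trace • G⁻¹ - G⁻¹ * B * G⁻¹) := by
  have h1 := coeffMat_adjugate_rec G B m
  rw [coeffMat_adjugate_top G B hG hm] at h1
  set D := (pencil G B).det.coeff (m + 1)
  have hD : D = G.det * (G⁻¹ * B).trace := by
    have h2 : derivative (pencil G B).det = ((pencil G B).adjugate * G.map C).trace := by
      have := derivation_det (derivative' (R := A)) (pencil G B)
      have h3 : (pencil G B).map (derivative' (R := A)) = G.map C := by
        refine Matrix.ext fun i j => ?_
        rw [Matrix.map_apply, pencil_apply]
        change derivative (X * C (G i j) + C (B i j)) = _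
        simp
      rw [h3] at this
      exact this
    have h3 := congrArg (fun p : A[X] => p.coeff m) h2
    simp only [coeff_derivative] at h3
    have h4 : ((pencil G B).adjugate * G.map C).trace.coeff m =
        (coeffMat m (pencil G B).adjugate * G).trace := by
      simp [Matrix.trace, Matrix.mul_apply, coeffMat, finsetSum_coeff]
    rw [h4, Matrix.trace_mul_comm] at h3
    have h5 := congrArg Matrix.trace h1
    rw [Matrix.trace_add, Matrix.trace_smul, Matrix.trace_one, hm, Matrix.mul_smul,
      Matrix.trace_smul, Matrix.trace_mul_comm B, ← h3] at h5
    simp only [smul_eq_mul] at h5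
    push_cast at h5
    linear_combination -h5
  rw [hD] at h1
  have h2 := congrArg (fun X => G⁻¹ * X) h1
  simp only [mul_add, ← mul_assoc, Matrix.nonsing_inv_mul _ hG, one_mul, Matrix.mul_smul,
    mul_one] at h2
  rw [smul_sub, smul_smul, ← h2]
  abel

end AdjugateCoeff

/-! ### Divergences of the first two Newton tensor densities. -/

section DivExplicit

variable {R : Type*} [CommRing R] [Algebra ℝ R] {ι : Type*} [Fintype ι] [DecidableEq ι]
  {d : ι → Derivation ℝ R R} {G : Matrix ι ι R} {Γ : ι → Matrix ι ι R}

theorem IsLeviCivita.det_map (h : IsLeviCivita d G Γ) (a : ι) :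
    d a G.det = 2 * (Γ a).trace * G.det := by
  rw [derivation_det, h.compat, mul_add, Matrix.trace_add]
  have t1 : (G.adjugate * ((Γ a)ᵀ * G)).trace = G.det * (Γ a).trace := by
    rw [Matrix.trace_mul_comm, mul_assoc, Matrix.mul_adjugate, Matrix.mul_smul, mul_one,
      Matrix.trace_smul, Matrix.trace_transpose, smul_eq_mul]
  have t2 : (G.adjugate * (G * Γ a)).trace = G.det * (Γ a).trace := by
    rw [← mul_assoc, Matrix.adjugate_mul, Matrix.smul_mul, one_mul, Matrix.trace_smul, smul_eq_mul]
  rw [t1, t2]; ring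

theorem IsLeviCivita.sum_derivation_top (hG : IsUnit G.det) (h : IsLeviCivita d G Γ) (b : ι) :
    ∑ a, d a ((G.det • G⁻¹) a b) = ∑ a, (Γ a).trace * (G.det • G⁻¹) a b
      - ∑ a, ∑ c, Γ a b c * (G.det • G⁻¹) a c := by
  have := sum_derivation_of_map d h.symm (Z := G.det • G⁻¹) (Y := fun _ => 0) (fun a => by
    have e : (G.det • G⁻¹).map (d a) = G.det • G⁻¹.map (d a) + d a G.det • G⁻¹ := by
      ext; simp [mul_comm, add_comm]
    rw [e, h.inv_map hG, h.det_map, Matrix.mul_smul, Matrix.smul_mul, smul_sub, smul_neg,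
      smul_smul]
    abel) b
  simpa using this

/-- Only the trace of the Codazzi defect of B enters, which is why k = 2 requires contracted
identities but no conformal flatness. -/
theorem IsLeviCivita.sum_derivation_second (hG : IsUnit G.det) (hs : G.IsSymm)
    (h : IsLeviCivita d G Γ) {B : Matrix ι ι R} (hB : B.IsSymm) {w : ι → R}
    (hw : ∀ a, ∑ c, ∑ e, G⁻¹ c e * (covD d Γ B a c e - covD d Γ B c a e) = w a) {Z : Matrix ι ι R}
    (hZ : Z = G.det • ((G⁻¹ * B).trace • G⁻¹ - G⁻¹ * B * G⁻¹)) (b : ι) :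
    ∑ a, d a (Z a b) = ∑ a, (Γ a).trace * Z a b - ∑ a, ∑ c, Γ a b c * Z a c
      + ∑ c, (G.det • G⁻¹) b c * w c := by
  set Y : ι → Matrix ι ι R := fun a =>
    G.det • ((G⁻¹ * covD d Γ B a).trace • G⁻¹ - G⁻¹ * covD d Γ B a * G⁻¹) with hY
  have := sum_derivation_of_map d h.symm (Z := Z) (Y := Y) (fun a => by
    set Z' := (G⁻¹ * B).trace • G⁻¹ - G⁻¹ * B * G⁻¹ with hZ'
    have e : Z.map (d a) = G.det • Z'.map (d a) + d a G.det • Z' := by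
      rw [hZ]; ext; simp [mul_comm, add_comm]
    have e2 : ((G⁻¹ * B).trace • G⁻¹).map (d a) =
        (G⁻¹ * B).trace • G⁻¹.map (d a) + d a (G⁻¹ * B).trace • G⁻¹ := by
      ext; simp [mul_comm, add_comm]
    have e3 : B.map (d a) = covD d Γ B a + (Γ a)ᵀ * B + B * Γ a := by rw [covD]; abel
    have e4 : Z'.map (d a) = ((G⁻¹ * covD d Γ B a).trace • G⁻¹ - G⁻¹ * covD d Γ B a * G⁻¹)
        - Γ a * Z' - Z' * (Γ a)ᵀ := by
      rw [hZ', derivation_map_sub, e2, derivation_map_mul, derivation_map_mul, h.inv_map hG,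
        h.trace_inv_mul_map hG, e3]
      simp only [mul_sub, sub_mul, Matrix.mul_smul, Matrix.smul_mul, smul_sub, smul_neg]
      noncomm_ring
    rw [e, e4, h.det_map, hY, hZ]
    simp only [Matrix.mul_smul, Matrix.smul_mul, smul_sub, smul_smul]
    abel) b
  rw [this]
  congr 1
  have hDs : ∀ a, (covD d Γ B a).IsSymm := fun a => IsLeviCivita.covD_symm hB a
  have h1 : ∀ a, Y a a b = ∑ c, ∑ e, G.det * (G⁻¹ a b * (G⁻¹ c e * covD d Γ B a c e))
        - ∑ c, ∑ e, G.det * (G⁻¹ a c * covD d Γ B a c e * G⁻¹ e b) := by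
    intro a
    simp only [hY, Matrix.smul_apply, Matrix.sub_apply, smul_eq_mul,
      trace_mul_eq_sum _ _ (isSymm_inv hs), mul_sub]
    congr 1
    · simp only [Finset.sum_mul, Finset.mul_sum]
      exact Finset.sum_congr rfl fun c _ => Finset.sum_congr rfl fun e _ => by ring
    · simp only [Matrix.mul_apply, Finset.sum_mul, Finset.mul_sum]
      exact Finset.sum_comm
  simp only [h1, Finset.sum_sub_distrib]
  have h2 : ∑ a, ∑ c, ∑ e, G.det * (G⁻¹ a c * covD d Γ B a c e * G⁻¹ e b) =
      ∑ a, ∑ c, ∑ e, G.det * (G⁻¹ a b * (G⁻¹ c e * covD d Γ B c a e)) := by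
    rw [Finset.sum_comm]
    have h3 : ∀ c, ∑ a, ∑ e, G.det * (G⁻¹ a c * covD d Γ B a c e * G⁻¹ e b) =
        ∑ e, ∑ a, G.det * (G⁻¹ a c * covD d Γ B a e c * G⁻¹ e b) := by
      intro c
      rw [Finset.sum_comm]
      exact Finset.sum_congr rfl fun e _ => Finset.sum_congr rfl fun a _ => by
        rw [(hDs a).apply e c]
    simp only [h3]
    rw [Finset.sum_comm]
    refine Finset.sum_congr rfl fun a _ => ?_
    rw [Finset.sum_comm]
    exact Finset.sum_congr rfl fun c _ => Finset.sum_congr rfl fun e _ => by ring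
  rw [h2, ← Finset.sum_sub_distrib]
  refine Finset.sum_congr rfl fun a _ => ?_
  rw [← hw a, Matrix.smul_apply, smul_eq_mul, Finset.mul_sum, ← Finset.sum_sub_distrib,
    (isSymm_inv hs).apply a b]
  refine Finset.sum_congr rfl fun c _ => ?_
  rw [Finset.mul_sum, ← Finset.sum_sub_distrib]
  exact Finset.sum_congr rfl fun e _ => by ring

end DivExplicit

end

/-! ## The geometry of the hypersurfaces `y 0 = const` -/

section Hypersurface

variable {R : Type*} [CommRing R] [Algebra ℝ R] {n : ℕ}

/-- The restriction of a bilinear form to the span of `∂_1, …, ∂_n`. -/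
def tang (B : Matrix (Fin (n + 1)) (Fin (n + 1)) R) : Matrix (Fin n) (Fin n) R :=
  B.submatrix Fin.succ Fin.succ

@[simp]
theorem tang_apply (B : Matrix (Fin (n + 1)) (Fin (n + 1)) R) (a b : Fin n) :
    tang B a b = B a.succ b.succ := rfl

/-- The tangential field `β` for which `∂_0 - β` is normal to the hypersurfaces. -/
def shift (G : Matrix (Fin (n + 1)) (Fin (n + 1)) R) (a : Fin n) : R :=
  ∑ b, (tang G)⁻¹ a b * G b.succ 0

/-- The value of a covector on the normal field `∂_0 - β`. -/
def normalPart (G : Matrix (Fin (n + 1)) (Fin (n + 1)) R) (w : Fin (n + 1) → R) : R :=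
  w 0 - ∑ c, shift G c * w c.succ

/-- The restriction of a bilinear form to normal and tangential vectors. -/
def mixedPart (G B : Matrix (Fin (n + 1)) (Fin (n + 1)) R) (b : Fin n) : R :=
  normalPart G fun i => B i b.succ

variable {G : Matrix (Fin (n + 1)) (Fin (n + 1)) R}

theorem tang_isSymm (hs : G.IsSymm) : (tang G).IsSymm := hs.submatrix _

/-- The (0, 0) cofactor of G. It relates the interior and boundary volume densities through the
lapse. -/
theorem det_tang (hG : IsUnit G.det) : (tang G).det = G.det * G⁻¹ 0 0 := by
  rw [Matrix.inv_def, Matrix.smul_apply, Matrix.adjugate_fin_succ_eq_det_submatrix, smul_eq_mul,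
    ← mul_assoc, Ring.mul_inverse_cancel _ hG]
  simp [tang]

theorem eq_sum_mul_inv {ι : Type*} [Fintype ι] [DecidableEq ι] {H : Matrix ι ι R}
    (hH : IsUnit H.det) {u x : ι → R} (h : ∀ b, ∑ c, u c * H c b = x b) (a : ι) :
    u a = ∑ b, x b * H⁻¹ b a := by
  have h1 : u ᵥ* H = x := funext h
  have h2 : x ᵥ* H⁻¹ = u := by
    rw [← h1, Matrix.vecMul_vecMul, Matrix.mul_nonsing_inv _ hH, Matrix.vecMul_one]
  exact (congrFun h2 a).symm

/-- Row 0 of G⁻¹ G = 1 is a linear system whose matrix is the tangential block. In geometric terms,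
the gradient of y⁰ is g^{00} (∂_0 - β). -/
theorem inv_zero_succ (hG : IsUnit G.det) (hs : G.IsSymm) (hH : IsUnit (tang G).det) (a : Fin n) :
    G⁻¹ 0 a.succ = -(shift G a * G⁻¹ 0 0) := by
  have h := eq_sum_mul_inv hH (u := fun c => G⁻¹ 0 c.succ)
    (x := fun b => -(G⁻¹ 0 0 * G 0 b.succ)) (fun b => by
      have := congrFun (congrFun (Matrix.nonsing_inv_mul _ hG) 0) b.succ
      rw [Matrix.mul_apply, Fin.sum_univ_succ, Matrix.one_apply_ne (Fin.succ_ne_zero b).symm] at this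
      exact eq_neg_of_add_eq_zero_right this) a
  rw [h, shift, Finset.sum_mul, ← Finset.sum_neg_distrib]
  refine Finset.sum_congr rfl fun b _ => ?_
  rw [(isSymm_inv (tang_isSymm hs)).apply a b, hs.apply b.succ 0]
  ring

theorem inv_succ_zero (hG : IsUnit G.det) (hs : G.IsSymm) (hH : IsUnit (tang G).det) (a : Fin n) :
    G⁻¹ a.succ 0 = -(shift G a * G⁻¹ 0 0) := by
  rw [← inv_zero_succ hG hs hH, (isSymm_inv hs).apply]

theorem inv_succ_succ (hG : IsUnit G.det) (hs : G.IsSymm) (hH : IsUnit (tang G).det)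
    (a b : Fin n) :
    G⁻¹ a.succ b.succ = (tang G)⁻¹ a b + shift G a * shift G b * G⁻¹ 0 0 := by
  have h := eq_sum_mul_inv hH (u := fun c => G⁻¹ a.succ c.succ)
    (x := fun b => (1 : Matrix (Fin n) (Fin n) R) a b - G⁻¹ a.succ 0 * G 0 b.succ) (fun b => by
      have := congrFun (congrFun (Matrix.nonsing_inv_mul _ hG) a.succ) b.succ
      rw [Matrix.mul_apply, Fin.sum_univ_succ, Matrix.one_apply] at this
      simp only [Fin.succ_inj] at this
      rw [Matrix.one_apply, ← this]
      simp) b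
  simp only [sub_mul, Finset.sum_sub_distrib, Matrix.one_apply, ite_mul, one_mul, zero_mul,
    Finset.sum_ite_eq, Finset.mem_univ, if_true] at h
  rw [h, inv_succ_zero hG hs hH, shift, shift, sub_eq_add_neg, ← Finset.sum_neg_distrib]
  congr 1
  rw [mul_right_comm, Finset.mul_sum]
  refine Finset.sum_congr rfl fun c _ => ?_
  rw [(isSymm_inv (tang_isSymm hs)).apply b c, hs.apply c.succ 0]
  ring

theorem sum_shift_mul (hs : G.IsSymm) (hH : IsUnit (tang G).det) (b : Fin n) :
    ∑ c, shift G c * G c.succ b.succ = G 0 b.succ := by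
  have h1 : shift G = (tang G)⁻¹ *ᵥ fun b => G b.succ 0 := rfl
  have h2 : (tang G *ᵥ shift G) b = G b.succ 0 := by
    rw [h1, Matrix.mulVec_mulVec, Matrix.mul_nonsing_inv _ hH, Matrix.one_mulVec]
  rw [hs.apply b.succ 0, ← h2]
  exact Finset.sum_congr rfl fun c _ => by
    change _ = tang G b c * _
    rw [mul_comm, tang_apply, hs.apply]

theorem mixedPart_self (hs : G.IsSymm) (hH : IsUnit (tang G).det) (b : Fin n) :
    mixedPart G G b = 0 := by
  rw [mixedPart, normalPart, sum_shift_mul hs hH, sub_self]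

/-- Raising the index `0`. -/
theorem sum_inv_zero (hG : IsUnit G.det) (hs : G.IsSymm) (hH : IsUnit (tang G).det)
    (w : Fin (n + 1) → R) : ∑ i, G⁻¹ 0 i * w i = G⁻¹ 0 0 * normalPart G w := by
  rw [Fin.sum_univ_succ, normalPart, mul_sub, Finset.mul_sum, sub_eq_add_neg,
    ← Finset.sum_neg_distrib]
  congr 1
  refine Finset.sum_congr rfl fun c _ => ?_
  rw [inv_zero_succ hG hs hH]; ring

/-- The inverse metric is the inverse of the tangential metric plus g^{00} times the square of ∂_0 -
β, an orthogonal decomposition. -/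
theorem sum_inv_eq (hG : IsUnit G.det) (hs : G.IsSymm) (hH : IsUnit (tang G).det)
    (B : Matrix (Fin (n + 1)) (Fin (n + 1)) R) :
    ∑ i, ∑ j, G⁻¹ i j * B i j = ∑ b, ∑ c, (tang G)⁻¹ b c * B b.succ c.succ
      + G⁻¹ 0 0 * normalPart G fun i => normalPart G fun j => B i j := by
  have h0 := sum_inv_zero hG hs hH (fun j => B 0 j)
  have h1 : ∀ b : Fin n, ∑ j, G⁻¹ b.succ j * B b.succ j =
      ∑ c, (tang G)⁻¹ b c * B b.succ c.succ
        - shift G b * (G⁻¹ 0 0 * normalPart G fun j => B b.succ j) := by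
    intro b
    rw [← sum_inv_zero hG hs hH, Fin.sum_univ_succ, Fin.sum_univ_succ, mul_add, Finset.mul_sum,
      inv_succ_zero hG hs hH]
    simp only [inv_succ_succ hG hs hH, inv_zero_succ hG hs hH, add_mul, Finset.sum_add_distrib]
    have e : ∑ c, shift G b * shift G c * G⁻¹ 0 0 * B b.succ c.succ =
      -∑ c, shift G b * (-(shift G c * G⁻¹ 0 0) * B b.succ c.succ) := by
      rw [← Finset.sum_neg_distrib]
      exact Finset.sum_congr rfl fun c _ => by ring
    rw [e]; ring
  rw [Fin.sum_univ_succ, h0]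
  simp only [h1, Finset.sum_sub_distrib]
  conv_rhs => rw [normalPart]
  rw [mul_sub, Finset.mul_sum]
  have e : ∑ c, shift G c * (G⁻¹ 0 0 * normalPart G fun j => B c.succ j) =
      ∑ c, G⁻¹ 0 0 * (shift G c * normalPart G fun j => B c.succ j) :=
    Finset.sum_congr rfl fun c _ => by ring
  rw [e]; ring

/-! ### The induced connection, the Gauss formula and the Codazzi equations. -/

section Connection

variable {d : Fin (n + 1) → Derivation ℝ R R}
  {Γ : Fin (n + 1) → Matrix (Fin (n + 1)) (Fin (n + 1)) R}

variable (G) in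
/-- The induced connection of the hypersurfaces `y 0 = const`. -/
def tangConn (Γ : Fin (n + 1) → Matrix (Fin (n + 1)) (Fin (n + 1)) R) (a : Fin n) :
    Matrix (Fin n) (Fin n) R :=
  Matrix.of fun b c => Γ a.succ b.succ c.succ + shift G b * Γ a.succ 0 c.succ

variable (d) in
/-- The derivations tangential to the hypersurfaces `y 0 = const`. -/
def tangDer (a : Fin n) : Derivation ℝ R R := d a.succ

@[simp]
theorem tangDer_apply (a : Fin n) (f : R) : tangDer d a f = d a.succ f := rfl

theorem tangConn_symm (hΓ : ∀ i j k, Γ i k j = Γ j k i) (a b c : Fin n) :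
    tangConn G Γ a c b = tangConn G Γ b c a := by
  simp only [tangConn, Matrix.of_apply]
  rw [hΓ a.succ b.succ, hΓ a.succ b.succ]

/-- Splits ∇_a ∂_b into its tangential part and its component along ∂_0 - β. The formulas for
Hessians and covariant derivatives below are instances. -/
theorem sum_conn_mul (a b : Fin n) (w : Fin (n + 1) → R) :
    ∑ k, Γ a.succ k b.succ * w k =
      ∑ e, tangConn G Γ a e b * w e.succ + Γ a.succ 0 b.succ * normalPart G w := by
  simp only [Fin.sum_univ_succ, tangConn, Matrix.of_apply, normalPart, add_mul,
    Finset.sum_add_distrib, mul_sub, Finset.mul_sum]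
  have e : ∑ c, Γ a.succ 0 b.succ * (shift G c * w c.succ) =
      ∑ c, shift G c * Γ a.succ 0 b.succ * w c.succ :=
    Finset.sum_congr rfl fun c _ => by ring
  rw [e]; ring

theorem hess_succ_succ (v : R) (a b : Fin n) :
    hess d Γ v a.succ b.succ = hess (tangDer d) (tangConn G Γ) v a b
      - Γ a.succ 0 b.succ * normalPart G fun i => d i v := by
  simp only [hess, Matrix.of_apply, tangDer_apply]
  rw [sum_conn_mul (G := G)]; ring

theorem covD_succ_succ {M : Matrix (Fin (n + 1)) (Fin (n + 1)) R} (hM : M.IsSymm)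
    (a b c : Fin n) :
    covD d Γ M a.succ b.succ c.succ = covD (tangDer d) (tangConn G Γ) (tang M) a b c
      - Γ a.succ 0 b.succ * mixedPart G M c - Γ a.succ 0 c.succ * mixedPart G M b := by
  rw [covD_apply, covD_apply, sum_conn_mul (G := G) (w := fun k => M k c.succ),
    sum_conn_mul (G := G) (w := fun k => M b.succ k)]
  simp only [tangDer_apply, tang_apply, mixedPart]
  have : (fun k => M b.succ k) = fun k => M k b.succ := funext fun k => hM.apply k b.succ
  rw [this]
  ring

/-- G has no mixed part, so the tangential components of ∇G = 0 involve the induced connection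
alone. -/
theorem isLeviCivita_tang (hs : G.IsSymm) (hH : IsUnit (tang G).det)
    (h : IsLeviCivita d G Γ) : IsLeviCivita (tangDer d) (tang G) (tangConn G Γ) := by
  refine ⟨fun i j k => tangConn_symm h.symm _ _ _, fun a => ?_⟩
  have h1 : covD (tangDer d) (tangConn G Γ) (tang G) a = 0 := by
    ext b c
    have := covD_succ_succ (d := d) (Γ := Γ) (G := G) hs a b c
    rw [h.covD_self, mixedPart_self hs hH, mixedPart_self hs hH] at this
    simpa using this.symm
  rw [covD, sub_sub, sub_eq_zero] at h1
  exact h1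

variable {ν : R} {A : Matrix (Fin n) (Fin n) R}

/-- This is the (0, 0) component of ∇g⁻¹ = 0, divided by 2ν. -/
theorem lapse_derivation (hG : IsUnit G.det) (hs : G.IsSymm) (hH : IsUnit (tang G).det)
    (h : IsLeviCivita d G Γ) (hν : ν * ν = G⁻¹ 0 0) (hνu : IsUnit ν) (a : Fin n) :
    d a.succ ν = -(normalPart G (fun k => Γ a.succ 0 k) * ν) := by
  have h1 := congrFun (congrFun (h.inv_map hG a.succ) 0) 0
  simp only [Matrix.map_apply, Matrix.sub_apply, Matrix.neg_apply, Matrix.mul_apply,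
    Matrix.transpose_apply] at h1
  rw [sum_inv_zero hG hs hH] at h1
  have e : ∑ x, Γ a.succ 0 x * G⁻¹ x 0 = G⁻¹ 0 0 * normalPart G fun k => Γ a.succ 0 k := by
    rw [← sum_inv_zero hG hs hH]
    exact Finset.sum_congr rfl fun x _ => by rw [(isSymm_inv hs).apply 0 x, mul_comm]
  rw [e, ← hν, Derivation.leibniz] at h1
  refine hνu.mul_left_cancel (eq_of_add_self_eq ?_)
  simp only [smul_eq_mul] at h1
  linear_combination h1

/-- The derivative of the lapse in Γ⁰ = ν A cancels the normal part of the quadratic terms, and the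
Codazzi defect of A remains. -/
theorem curv_zero_succ (hΓ : ∀ i j k, Γ i k j = Γ j k i)
    (hν' : ∀ a : Fin n, d a.succ ν = -(normalPart G (fun k => Γ a.succ 0 k) * ν))
    (hA : ∀ a b : Fin n, Γ a.succ 0 b.succ = ν * A a b) (a b c : Fin n) :
    curv d Γ a.succ b.succ 0 c.succ =
      ν * (covD (tangDer d) (tangConn G Γ) A a b c - covD (tangDer d) (tangConn G Γ) A b a c) := by
  have e1 : ∀ a b : Fin n, ∑ k, Γ a.succ 0 k * Γ b.succ k c.succ =
      ∑ e, tangConn G Γ b e c * (ν * A a e)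
        + ν * A b c * normalPart G fun k => Γ a.succ 0 k := by
    intro a b
    have := sum_conn_mul (Γ := Γ) (G := G) b c (fun k => Γ a.succ 0 k)
    simp only [hA] at this
    rw [← this]
    exact Finset.sum_congr rfl fun k _ => mul_comm _ _
  simp only [curv, Matrix.add_apply, Matrix.sub_apply, Matrix.map_apply, Matrix.mul_apply, e1]
  rw [hA, hA, Derivation.leibniz, Derivation.leibniz, hν', hν', covD_apply, covD_apply]
  have e2 : ∑ p, tangConn G Γ a p b * A p c = ∑ p, tangConn G Γ b p a * A p c :=
    Finset.sum_congr rfl fun p _ => by rw [tangConn_symm hΓ]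
  have e3 : ∀ a b : Fin n, ∑ e, tangConn G Γ b e c * (ν * A a e) =
      ν * ∑ p, tangConn G Γ b p c * A a p := fun a b => by
    rw [Finset.mul_sum]; exact Finset.sum_congr rfl fun p _ => by ring
  rw [e2, e3, e3]
  simp only [tangDer_apply, smul_eq_mul]
  ring

variable {P : Matrix (Fin (n + 1)) (Fin (n + 1)) R}

/-- The Codazzi equation for a metric with vanishing Weyl tensor. -/
theorem codazzi_of_weylFree (hG : IsUnit G.det) (hs : G.IsSymm) (hH : IsUnit (tang G).det)
    (h : IsLeviCivita d G Γ) (hν : ν * ν = G⁻¹ 0 0) (hνu : IsUnit ν)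
    (hA : ∀ a b : Fin n, Γ a.succ 0 b.succ = ν * A a b)
    (hW : WeylFree G Γ d P) (a b c : Fin n) :
    covD (tangDer d) (tangConn G Γ) A a b c - covD (tangDer d) (tangConn G Γ) A b a c =
      ν * (tang G b c * mixedPart G P a - tang G a c * mixedPart G P b) := by
  have h1 := curv_zero_succ h.symm (lapse_derivation hG hs hH h hν hνu) hA a b c
  rw [hW, Matrix.one_apply_ne (Fin.succ_ne_zero a).symm,
    Matrix.one_apply_ne (Fin.succ_ne_zero b).symm, Matrix.mul_apply, Matrix.mul_apply,
    sum_inv_zero hG hs hH, sum_inv_zero hG hs hH, ← hν] at h1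
  refine hνu.mul_left_cancel ?_
  rw [← h1]
  simp only [tang_apply, mixedPart]
  ring

/-- The contracted Codazzi equation. -/
theorem codazzi_trace (hG : IsUnit G.det) (hs : G.IsSymm) (hH : IsUnit (tang G).det)
    (h : IsLeviCivita d G Γ) (hd : ∀ i j f, d i (d j f) = d j (d i f))
    (hν : ν * ν = G⁻¹ 0 0) (hνu : IsUnit ν)
    (hA : ∀ a b : Fin n, Γ a.succ 0 b.succ = ν * A a b) {c : ℝ} {J : R}
    (hP : ric d Γ = c • P + J • G) (a : Fin n) :
    ∑ b, ∑ e, (tang G)⁻¹ b e * (covD (tangDer d) (tangConn G Γ) A a b e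
      - covD (tangDer d) (tangConn G Γ) A b a e) = c • (ν * mixedPart G P a) := by
  have hanti : ∀ k i, curv d Γ k i * G⁻¹ = -(G⁻¹ * (curv d Γ k i)ᵀ) := by
    intro k i
    have h1 := congrArg (fun X => G⁻¹ * X * G⁻¹) (h.curv_antisymm hd k i)
    simp only [mul_neg, neg_mul] at h1
    rwa [← mul_assoc, Matrix.nonsing_inv_mul _ hG, one_mul, mul_assoc, mul_assoc,
      Matrix.mul_nonsing_inv _ hG, mul_one] at h1
  have hanti' : ∀ k i p q, ∑ j, curv d Γ k i p j * G⁻¹ j q = -∑ j, curv d Γ k i q j * G⁻¹ j p := by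
    intro k i p q
    have h1 := congrFun (congrFun (hanti k i) p) q
    simp only [Matrix.mul_apply, Matrix.neg_apply, Matrix.transpose_apply] at h1
    rw [h1]
    congr 1
    exact Finset.sum_congr rfl fun j _ => by rw [(isSymm_inv hs).apply j p, mul_comm]
  have hinv0 : ∀ w : Fin (n + 1) → R, ∑ j, w j * G⁻¹ j 0 = G⁻¹ 0 0 * normalPart G w := by
    intro w
    rw [← sum_inv_zero hG hs hH]
    exact Finset.sum_congr rfl fun x _ => by rw [(isSymm_inv hs).apply 0 x, mul_comm]
  -- The curvature endomorphism is skew, so its component on the normal taken twice is zero; a full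
  -- trace over the remaining pair therefore reduces to a tangential one.
  have hnn : ∀ i, G⁻¹ 0 0 * normalPart G (fun j => curv d Γ a.succ i 0 j) = 0 := by
    intro i
    rw [← hinv0]
    refine eq_of_add_self_eq ?_
    have := hanti' a.succ i 0 0
    rw [add_zero]
    linear_combination this
  have h1 := sum_inv_eq hG hs hH (Matrix.of fun i j => curv d Γ a.succ i 0 j)
  simp only [Matrix.of_apply] at h1
  have h2 : G⁻¹ 0 0 * normalPart G (fun i => normalPart G fun j => curv d Γ a.succ i 0 j) = 0 := by
    conv_lhs => rw [normalPart]
    rw [mul_sub, hnn, Finset.mul_sum, zero_sub, neg_eq_zero]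
    refine Finset.sum_eq_zero fun x _ => ?_
    rw [mul_left_comm, hnn, mul_zero]
  rw [h2, add_zero] at h1
  have h3 : ∑ i, ∑ j, G⁻¹ i j * curv d Γ a.succ i 0 j =
      ν * ν * normalPart G fun j => ric d Γ a.succ j := by
    rw [hν, ← hinv0]
    have e1 : ∀ i, ∑ j, G⁻¹ i j * curv d Γ a.succ i 0 j =
        ∑ j, curv d Γ i a.succ i j * G⁻¹ j 0 := by
      intro i
      have e2 : ∑ j, G⁻¹ i j * curv d Γ a.succ i 0 j = ∑ j, curv d Γ a.succ i 0 j * G⁻¹ j i :=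
        Finset.sum_congr rfl fun j _ => by rw [(isSymm_inv hs).apply i j, mul_comm]
      rw [e2, hanti', ← Finset.sum_neg_distrib]
      refine Finset.sum_congr rfl fun j _ => ?_
      rw [curv_neg]; simp
    simp only [e1]
    rw [Finset.sum_comm]
    exact Finset.sum_congr rfl fun j _ => by
      rw [← Finset.sum_mul]; rfl
  -- G has no mixed part, so the term J g of Ricci disappears and only the multiple of P survives.
  have h4 : normalPart G (fun j => ric d Γ a.succ j) = c • mixedPart G P a := by
    have hrs := h.ric_symm hG hd
    have e1 : (fun j => ric d Γ a.succ j) = fun j => c • P j a.succ + J * G j a.succ := by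
      funext j
      rw [hrs.apply j a.succ, hP]
      simp
    have e2 := mixedPart_self hs hH a
    rw [mixedPart, normalPart] at e2
    rw [e1, mixedPart, normalPart, normalPart, smul_sub, Finset.smul_sum]
    simp only [mul_add, Finset.sum_add_distrib, mul_smul_comm]
    have e3 : ∑ x, shift G x * (J * G x.succ a.succ) = J * ∑ x, shift G x * G x.succ a.succ := by
      rw [Finset.mul_sum]; exact Finset.sum_congr rfl fun x _ => by ring
    rw [e3]
    linear_combination J * e2
  rw [h3, h4] at h1
  refine hνu.mul_left_cancel ?_
  rw [Finset.mul_sum, mul_smul_comm, ← mul_assoc, ← mul_smul_comm, h1]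
  refine Finset.sum_congr rfl fun b _ => ?_
  rw [Finset.mul_sum]
  refine Finset.sum_congr rfl fun e _ => ?_
  rw [curv_zero_succ h.symm (lapse_derivation hG hs hH h hν hνu) hA]
  ring

end Connection

end Hypersurface

section

open Polynomial

/-! ### Coefficients of the adjugate of r G + B + t D. -/

section BivariateAdjugate

variable {A : Type*} [CommRing A] {ι : Type*} [Fintype ι] [DecidableEq ι]

/-- The matrix of coefficients of `r^a t^b`. -/
def cfMat (a b : ℕ) (M : Matrix ι ι A[X][X]) : Matrix ι ι A := M.map (cf a b)

theorem pencil2_apply (G B D : Matrix ι ι A) (i j : ι) :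
    pencil2 G B D i j = X * C (C (G i j)) + C (C (B i j)) + C X * C (C (D i j)) := by
  simp [pencil2, pencil_apply, add_assoc]
  ring

theorem pencil2_eq (G B D : Matrix ι ι A) :
    pencil2 G B D = (X : A[X][X]) • G.map (C.comp C : A →+* A[X][X])
      + B.map (C.comp C : A →+* A[X][X]) + (C X : A[X][X]) • D.map (C.comp C : A →+* A[X][X]) :=
  Matrix.ext fun i j => by simp [pencil2_apply]

theorem pencil2_isSymm {G B D : Matrix ι ι A} (hG : G.IsSymm) (hB : B.IsSymm) (hD : D.IsSymm) :
    (pencil2 G B D).IsSymm := by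
  refine Matrix.ext fun i j => ?_
  rw [Matrix.transpose_apply, pencil2_apply, pencil2_apply, hG.apply, hB.apply, hD.apply]

theorem pencil_isSymm {G B : Matrix ι ι A} (hG : G.IsSymm) (hB : B.IsSymm) :
    (pencil G B).IsSymm := by
  refine Matrix.ext fun i j => ?_
  rw [Matrix.transpose_apply, pencil_apply, pencil_apply, hG.apply, hB.apply]

theorem isUnit_det_map_C {G : Matrix ι ι A} (hG : IsUnit G.det) :
    IsUnit (G.map (C : A → A[X])).det := by
  have := hG.map (C : A →+* A[X])
  rwa [RingHom.map_det] at this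

theorem isRegular_det_pencil2 (G B D : Matrix ι ι A) (hG : IsUnit G.det) :
    IsRegular (pencil2 G B D).det :=
  isRegular_det_pencil _ _ (isUnit_det_map_C hG)

theorem tDegLE_pencil2 (G B D : Matrix ι ι A) (i j : ι) : TDegLE 1 (pencil2 G B D i j) := by
  intro a b hab
  rw [pencil2_apply, mul_comm X]
  simp only [cf, coeff_add, coeff_C_mul, coeff_X, coeff_C, mul_ite, mul_one, mul_zero]
  rcases a with _ | _ | a <;> rcases b with _ | _ | b <;> simp [coeff_C, coeff_X] at * 

theorem map_pencil2_constantCoeff (G B D : Matrix ι ι A) :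
    (pencil2 G B D).map (mapRingHom (constantCoeff : A[X] →+* A)) = pencil G B :=
  Matrix.ext fun i j => by simp [pencil2_apply, pencil_apply]

theorem cf_zero_eq (i : ℕ) (f : A[X][X]) :
    cf i 0 f = (mapRingHom (constantCoeff : A[X] →+* A) f).coeff i := by
  simp [cf]

theorem cfMat_adjugate_zero (G B D : Matrix ι ι A) (i : ℕ) :
    cfMat i 0 (pencil2 G B D).adjugate = coeffMat i (pencil G B).adjugate := by
  rw [← map_pencil2_constantCoeff G B D]
  have := RingHom.map_adjugate (mapRingHom (constantCoeff : A[X] →+* A)) (pencil2 G B D)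
  simp only [RingHom.mapMatrix_apply] at this
  rw [← this]
  refine Matrix.ext fun a b => ?_
  simp only [cfMat, coeffMat, Matrix.map_apply, cf_zero_eq]

theorem cf_det_zero (G B D : Matrix ι ι A) (i : ℕ) :
    cf i 0 (pencil2 G B D).det = (pencil G B).det.coeff i := by
  rw [cf_zero_eq, RingHom.map_det, RingHom.mapMatrix_apply, map_pencil2_constantCoeff]

theorem cfMat_adjugate_rec (G B D : Matrix ι ι A) (i j : ℕ) :
    G * cfMat i (j + 1) (pencil2 G B D).adjugate + B * cfMat (i + 1) (j + 1) (pencil2 G B D).adjugate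
      + D * cfMat (i + 1) j (pencil2 G B D).adjugate =
      cf (i + 1) (j + 1) (pencil2 G B D).det • 1 := by
  have h := coeffMat_adjugate_rec (G.map (C : A → A[X])) (B.map C + (X : A[X]) • D.map C) i
  refine Matrix.ext fun a b => ?_
  have h1 := congrArg (fun p : A[X] => p.coeff (j + 1)) (congrFun (congrFun h a) b)
  simp only [Matrix.add_apply, Matrix.mul_apply, Matrix.map_apply, Matrix.smul_apply,
    coeff_add, finsetSum_coeff, smul_eq_mul, add_mul, coeff_C_mul, mul_assoc, coeff_X_mul,
    Finset.sum_add_distrib] at h1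
  simp only [Matrix.add_apply, Matrix.mul_apply, Matrix.smul_apply, smul_eq_mul]
  refine Eq.trans ?_ (h1.trans ?_)
  · simp only [cfMat, cf, Matrix.map_apply, coeffMat, pencil2, add_assoc]
  · rw [Matrix.one_apply, Matrix.one_apply]
    split_ifs <;> simp [cf, pencil2]

/-- Improves the degree bound of `TDegLE.adjugate` by one. Induction on the power of t: at t = 0
this is the one-variable statement, and in the step every term of the recursion other than the one
multiplied by G is already known to vanish. -/
theorem cfMat_adjugate_eq_zero (G B D : Matrix ι ι A) (hG : IsUnit G.det) (j : ℕ) :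
    ∀ i, Fintype.card ι ≤ i + j → cfMat i j (pencil2 G B D).adjugate = 0 := by
  have hbig : ∀ i j, Fintype.card ι < i + j → cfMat i j (pencil2 G B D).adjugate = 0 := by
    intro i j h
    refine Matrix.ext fun a b => ?_
    exact TDegLE.adjugate (tDegLE_pencil2 G B D) a b i j h
  induction j with
  | zero => intro i h; rw [cfMat_adjugate_zero]; exact coeffMat_adjugate_eq_zero G B hG h
  | succ j ih =>
    intro i h
    rcases h.lt_or_eq with h | h
    · exact hbig _ _ h
    · have h1 := cfMat_adjugate_rec G B D i j
      rw [hbig (i + 1) (j + 1) (by omega), ih (i + 1) (by omega), mul_zero, mul_zero, add_zero,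
        add_zero, TDegLE.det (tDegLE_pencil2 G B D) _ _ (by omega : _ < (i + 1) + (j + 1)),
        zero_smul] at h1
      have h2 := congrArg (fun Y => G⁻¹ * Y) h1
      simpa [← mul_assoc, Matrix.nonsing_inv_mul _ hG] using h2

theorem cf_adjugate_eq_zero (G B D : Matrix ι ι A) (hG : IsUnit G.det) {i j : ℕ}
    (h : Fintype.card ι ≤ i + j) (a b : ι) : cf i j ((pencil2 G B D).adjugate a b) = 0 :=
  congrFun (congrFun (cfMat_adjugate_eq_zero G B D hG j i h) a) b

/-- The same trace argument as in `coeffMat_adjugate_second`, for the part linear in t, with ∂_r as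
the derivation. -/
theorem cfMat_adjugate_second (G B D : Matrix ι ι A) (hG : IsUnit G.det) {m : ℕ}
    (hm : Fintype.card ι = m + 2) :
    cfMat m 1 (pencil2 G B D).adjugate =
      G.det • ((G⁻¹ * D).trace • G⁻¹ - G⁻¹ * D * G⁻¹) := by
  have h1 := cfMat_adjugate_rec G B D m 0
  rw [cfMat_adjugate_eq_zero G B D hG _ (m + 1) (by omega), mul_zero, add_zero,
    cfMat_adjugate_zero, coeffMat_adjugate_top G B hG hm, zero_add] at h1
  set c := cf (m + 1) 1 (pencil2 G B D).det
  have hc : c = G.det * (G⁻¹ * D).trace := by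
    have h2 := derivation_det ((derivative' (R := A[X])).restrictScalars A) (pencil2 G B D)
    have h3 : (pencil2 G B D).map ((derivative' (R := A[X])).restrictScalars A) =
        G.map (C.comp C : A →+* A[X][X]) := by
      refine Matrix.ext fun i j => ?_
      rw [Matrix.map_apply, pencil2_apply]
      change derivative _ = _
      simp
    rw [h3] at h2
    have h4 : cf m 1 (((pencil2 G B D).adjugate * G.map (C.comp C : A →+* A[X][X])).trace) =
        (cfMat m 1 (pencil2 G B D).adjugate * G).trace := by
      simp only [Matrix.trace, Matrix.diag_apply, Matrix.mul_apply, cf_sum, Matrix.map_apply,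
        RingHom.comp_apply, cfMat]
      exact Finset.sum_congr rfl fun x _ => Finset.sum_congr rfl fun i _ => by
        rw [mul_comm, cf_CC_mul, mul_comm]
    have h5 : cf m 1 ((derivative' (R := A[X])).restrictScalars A (pencil2 G B D).det) =
        c * (m + 1) := by
      change ((derivative (pencil2 G B D).det).coeff m).coeff 1 = _
      rw [coeff_derivative, show ((m : A[X]) + 1) = C ((m : A) + 1) by simp, coeff_mul_C]
      rfl
    rw [h2, h4, Matrix.trace_mul_comm] at h5
    have h6 := congrArg Matrix.trace h1
    rw [Matrix.trace_add, Matrix.trace_smul, Matrix.trace_one, hm, Matrix.mul_smul,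
      Matrix.trace_smul, Matrix.trace_mul_comm D, h5] at h6
    simp only [smul_eq_mul] at h6
    push_cast at h6
    linear_combination -h6
  rw [hc] at h1
  have h2 := congrArg (fun Y => G⁻¹ * Y) h1
  simp only [mul_add, ← mul_assoc, Matrix.nonsing_inv_mul _ hG, one_mul, Matrix.mul_smul,
    mul_one] at h2
  rw [smul_sub, smul_smul, ← h2]
  abel

end BivariateAdjugate

/-! ### The Green current and the divergence of the interior Newton tensor. -/

section Current

variable {R : Type*} [CommRing R] [Algebra ℝ R] {ι : Type*} [Fintype ι] [DecidableEq ι]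
  {d : ι → Derivation ℝ R R} {G : Matrix ι ι R} {Γ : ι → Matrix ι ι R}

/-- σ has weight -1 and Z weight 2, so the coordinate divergence of σ Z(f dv - v df) is a covariant
one. The products of first derivatives of f and v are antisymmetric and drop out against the
symmetric Z. -/
theorem sum_derivation_current {Z : Matrix ι ι R} (hZs : Z.IsSymm) {σ : R}
    (hσ : ∀ a, d a σ = -((Γ a).trace * σ)) {Y : ι → R}
    (hZ : ∀ b, ∑ a, d a (Z a b) = ∑ a, (Γ a).trace * Z a b
      - ∑ a, ∑ c, Γ a b c * Z a c + Y b) (f v : R) :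
    ∑ a, d a (σ * ∑ j, Z a j * (f * d j v - v * d j f)) =
      σ * (∑ a, ∑ j, Z a j * (f * hess d Γ v a j - v * hess d Γ f a j)
        + ∑ b, Y b * (f * d b v - v * d b f)) := by
  set θ : ι → R := fun j => f * d j v - v * d j f with hθ
  have h1 : ∀ a, d a (σ * ∑ j, Z a j * θ j) =
      σ * (∑ j, d a (Z a j) * θ j + ∑ j, Z a j * d a (θ j) - ∑ j, (Γ a).trace * Z a j * θ j) := by
    intro a
    rw [Derivation.leibniz, hσ, map_sum]
    simp only [Derivation.leibniz, smul_eq_mul, Finset.sum_add_distrib]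
    have e : ∑ j, (Γ a).trace * Z a j * θ j = (Γ a).trace * ∑ j, Z a j * θ j := by
      rw [Finset.mul_sum]; exact Finset.sum_congr rfl fun j _ => by ring
    have e' : ∑ j, θ j * d a (Z a j) = ∑ j, d a (Z a j) * θ j :=
      Finset.sum_congr rfl fun j _ => mul_comm _ _
    rw [e, e']; ring
  have h2 : ∑ a, ∑ j, d a (Z a j) * θ j = ∑ j, (∑ a, (Γ a).trace * Z a j
      - ∑ a, ∑ c, Γ a j c * Z a c + Y j) * θ j := by
    rw [Finset.sum_comm]
    exact Finset.sum_congr rfl fun j _ => by rw [← hZ, Finset.sum_mul]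
  change ∑ a, d a (σ * ∑ j, Z a j * θ j) = σ * (_ + ∑ b, Y b * θ b)
  simp only [h1]
  rw [← Finset.mul_sum]
  congr 1
  rw [Finset.sum_sub_distrib, Finset.sum_add_distrib, h2]
  simp only [add_mul, sub_mul, Finset.sum_add_distrib, Finset.sum_sub_distrib, Finset.sum_mul]
  rw [Finset.sum_comm (f := fun j a => (Γ a).trace * Z a j * θ j)]
  have h3 : ∑ j, ∑ a, ∑ c, Γ a j c * Z a c * θ j = ∑ a, ∑ c, Z a c * ∑ j, Γ a j c * θ j := by
    rw [Finset.sum_comm]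
    refine Finset.sum_congr rfl fun a _ => ?_
    rw [Finset.sum_comm]
    refine Finset.sum_congr rfl fun c _ => ?_
    rw [Finset.mul_sum]
    exact Finset.sum_congr rfl fun j _ => by ring
  have h4 : ∑ a, ∑ j, Z a j * (d a f * d j v - d a v * d j f) = 0 := by
    refine eq_of_add_self_eq ?_
    rw [add_zero]
    nth_rewrite 2 [Finset.sum_comm]
    rw [← Finset.sum_add_distrib]
    refine Finset.sum_eq_zero fun a _ => ?_
    rw [← Finset.sum_add_distrib]
    refine Finset.sum_eq_zero fun j _ => ?_
    rw [hZs.apply]; ring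
  have h5 : ∑ a, ∑ j, Z a j * (f * hess d Γ v a j - v * hess d Γ f a j) =
      ∑ a, ∑ j, Z a j * d a (θ j) - ∑ a, ∑ c, Z a c * ∑ j, Γ a j c * θ j
      - ∑ a, ∑ j, Z a j * (d a f * d j v - d a v * d j f) := by
    rw [← Finset.sum_sub_distrib, ← Finset.sum_sub_distrib]
    refine Finset.sum_congr rfl fun a _ => ?_
    rw [← Finset.sum_sub_distrib, ← Finset.sum_sub_distrib]
    refine Finset.sum_congr rfl fun j _ => ?_
    have e : ∑ p, Γ a p j * θ p = f * ∑ p, Γ a p j * d p v - v * ∑ p, Γ a p j * d p f := by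
      rw [Finset.mul_sum, Finset.mul_sum, ← Finset.sum_sub_distrib]
      exact Finset.sum_congr rfl fun p _ => by simp only [hθ]; ring
    rw [e]
    simp only [hess, Matrix.of_apply, hθ, map_sub, Derivation.leibniz, smul_eq_mul]
    ring
  rw [h5, h3, h4]
  ring

/-- The `k`-th Newton tensor density is divergence free. -/
theorem sum_derivation_newton {k m : ℕ} (hk : 1 ≤ k) (hN : Fintype.card ι = 2 * k + m)
    (hG : IsUnit G.det) (hs : G.IsSymm) (h : IsLeviCivita d G Γ)
    (hd : ∀ i j f, d i (d j f) = d j (d i f)) {P : Matrix ι ι R} (hPs : P.IsSymm)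
    (hP : 2 ≤ k → ric d Γ = ((Fintype.card ι : ℝ) - 2) • P + (G⁻¹ * P).trace • G)
    (hW : 3 ≤ k → WeylFree G Γ d P) (b : ι) :
    ∑ a, d a (coeffMat (m + k) (pencil G P).adjugate a b) =
      ∑ a, (Γ a).trace * coeffMat (m + k) (pencil G P).adjugate a b
        - ∑ a, ∑ c, Γ a b c * coeffMat (m + k) (pencil G P).adjugate a c := by
  -- For k = 1 the coefficient is det G · G⁻¹. For k = 2 the trace of the Codazzi defect of P is dJ
  -- - div P = 0. For k ≥ 3 the pencil itself is a Codazzi tensor, since G is parallel and the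
  -- Cotton tensor vanishes.
  rcases (by omega : k = 1 ∨ k = 2 ∨ 3 ≤ k) with rfl | rfl | hk3
  · rw [coeffMat_adjugate_top G P hG (by omega)]
    exact h.sum_derivation_top hG b
  · rw [coeffMat_adjugate_second G P hG (by omega)]
    have hN2 : (Fintype.card ι : ℝ) - 2 ≠ 0 := by
      have : (4 : ℝ) ≤ Fintype.card ι := by exact_mod_cast (by omega : 4 ≤ Fintype.card ι)
      linarith
    have := h.sum_derivation_second hG hs hPs (w := fun _ => 0) (fun a => by
      simp only [mul_sub, Finset.sum_sub_distrib]
      rw [h.div_schouten hG hs hd hN2 (hP le_rfl), h.trace_inv_mul_map hG,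
        trace_mul_eq_sum _ _ (isSymm_inv hs), sub_self]) rfl b
    simpa using this
  · have hcot := h.cotton_eq_zero hG hs hd hPs (by omega) (hW hk3)
    have hMC : pencil G P = (X : R[X]) • G.map (C : R →+* R[X]) + P.map (C : R →+* R[X]) := rfl
    have hcov : ∀ a, (pencil G P).map (polyDer (d a)) - ((Γ a).map (C : R →+* R[X]))ᵀ * pencil G P
        - pencil G P * (Γ a).map (C : R →+* R[X]) = (covD d Γ P a).map (C : R →+* R[X]) := by
      intro a
      have e1 : (pencil G P).map (polyDer (d a)) =
          (X : R[X]) • (G.map (d a)).map (C : R →+* R[X]) + (P.map (d a)).map (C : R →+* R[X]) :=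
        Matrix.ext fun i j => by simp [pencil_apply, Derivation.leibniz]
      have e2 : G.map (d a) = (Γ a)ᵀ * G + G * Γ a := h.compat a
      have e3 : (covD d Γ P a).map (C : R →+* R[X]) = (P.map (d a)).map (C : R →+* R[X])
          - ((Γ a).map (C : R →+* R[X]))ᵀ * P.map (C : R →+* R[X])
          - P.map (C : R →+* R[X]) * (Γ a).map (C : R →+* R[X]) := by
        rw [covD, Matrix.map_sub (C : R →+* R[X]) (map_sub _), Matrix.map_sub (C : R →+* R[X]) (map_sub _), Matrix.map_mul, Matrix.map_mul,
          Matrix.transpose_map]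
      rw [e1, e2, e3, Matrix.map_add (C : R →+* R[X]) (map_add _), Matrix.map_mul, Matrix.map_mul, hMC, Matrix.transpose_map]
      simp only [mul_add, add_mul, Matrix.mul_smul, Matrix.smul_mul, smul_add]
      abel
    have hmain := sum_derivation_adjugate (S' := ℝ) (fun a => polyDer (d a)) 0
      (Γ := fun a => (Γ a).map (C : R →+* R[X])) (fun i j l => by
        simp only [Matrix.map_apply, h.symm i j l]) (pencil_isSymm hs hPs)
      (isRegular_det_pencil G P hG) (p := fun _ => 0) (fun a c e => by
        rw [hcov, hcov, Matrix.map_apply, Matrix.map_apply, hcot a c e]; simp) b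
    have h2 := congrArg (fun p : R[X] => p.coeff (m + k)) hmain
    have htr : ∀ a, ((Γ a).map (C : R →+* R[X])).trace = C (Γ a).trace := fun a => by
      simp [Matrix.trace]
    simp only [htr, mul_zero, Finset.sum_const_zero, add_zero, finsetSum_coeff, coeff_polyDer,
      coeff_sub, Matrix.map_apply, coeff_C_mul] at h2
    exact h2

end Current

end

section

open Polynomial

/-! ### The divergence of the boundary Newton tensor, from Codazzi equations. -/

section BoundaryDivergence

variable {R : Type*} [CommRing R] [Algebra ℝ R] {ι : Type*} [Fintype ι] [DecidableEq ι]
  {d : ι → Derivation ℝ R R} {G : Matrix ι ι R} {Γ : ι → Matrix ι ι R}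

/-- The combination t G - D governs both the Codazzi defect of the pencil and the normal part of its
conformal variation; this is what makes the derivation t ∂_r - ∂_t the relevant one. -/
theorem map_rotDer_pencil2 (G B D : Matrix ι ι R) (i j : ι) :
    rotDer R (pencil2 G B D i j) = C X * C (C (G i j)) - C (C (D i j)) := by
  rw [pencil2_apply, rotDer_apply]
  have e : derivative (X * C (C (G i j)) + C (C (B i j)) + C X * C (C (D i j)) : R[X][X]) =
      C (C (G i j)) := by
    simp
  have e2 : polyDer (derivative' (R := R))
      (X * C (C (G i j)) + C (C (B i j)) + C X * C (C (D i j)) : R[X][X]) = C (C (D i j)) := by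
    have e3 : ∀ x : R, (derivative' (R := R)) (C x) = 0 := fun x => by
      change derivative (C x) = 0; simp
    have e4 : (derivative' (R := R)) X = 1 := by change derivative X = 1; simp
    simp [Derivation.leibniz, e3, e4]
  rw [e, e2]

theorem pencil2_covD (B D : Matrix ι ι R) (h : IsLeviCivita d G Γ) (a : ι) :
    (pencil2 G B D).map (polyDer (polyDer (d a)))
      - ((Γ a).map (C.comp C : R →+* R[X][X]))ᵀ * pencil2 G B D
      - pencil2 G B D * (Γ a).map (C.comp C : R →+* R[X][X]) =
    (covD d Γ B a).map (C.comp C : R →+* R[X][X])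
      + (C X : R[X][X]) • (covD d Γ D a).map (C.comp C : R →+* R[X][X]) := by
  have e1 : (pencil2 G B D).map (polyDer (polyDer (d a))) =
      (X : R[X][X]) • (G.map (d a)).map (C.comp C : R →+* R[X][X])
      + (B.map (d a)).map (C.comp C : R →+* R[X][X])
      + (C X : R[X][X]) • (D.map (d a)).map (C.comp C : R →+* R[X][X]) :=
    Matrix.ext fun i j => by simp [pencil2_apply, Derivation.leibniz]
  have e3 : ∀ B : Matrix ι ι R, (covD d Γ B a).map (C.comp C : R →+* R[X][X]) =
      (B.map (d a)).map (C.comp C : R →+* R[X][X])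
      - ((Γ a).map (C.comp C : R →+* R[X][X]))ᵀ * B.map (C.comp C : R →+* R[X][X])
      - B.map (C.comp C : R →+* R[X][X]) * (Γ a).map (C.comp C : R →+* R[X][X]) := by
    intro B
    rw [covD, Matrix.map_sub (C.comp C : R →+* R[X][X]) (map_sub _),
      Matrix.map_sub (C.comp C : R →+* R[X][X]) (map_sub _), Matrix.map_mul, Matrix.map_mul,
      Matrix.transpose_map]
  rw [e1, e3, e3, h.compat a, Matrix.map_add (C.comp C : R →+* R[X][X]) (map_add _),
    Matrix.map_mul, Matrix.map_mul, pencil2_eq, Matrix.transpose_map]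
  simp only [mul_add, add_mul, Matrix.mul_smul, Matrix.smul_mul, smul_add, smul_sub]
  abel

/-- The divergence of the boundary Newton tensor density, under Codazzi equations. -/
theorem sum_derivation_hFun_adjugate {k m : ℕ} (hk : 1 ≤ k) (hN : Fintype.card ι + 1 = 2 * k + m)
    (hG : IsUnit G.det) (hs : G.IsSymm) (h : IsLeviCivita d G Γ) {B D : Matrix ι ι R}
    (hB : B.IsSymm) (hD : D.IsSymm) {p : ι → R}
    (hcB : ∀ a c e, covD d Γ B a c e - covD d Γ B c a e = p c * D a e - p a * D c e)
    (hcD : ∀ a c e, covD d Γ D a c e - covD d Γ D c a e = p a * G c e - p c * G a e) (b : ι) :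
    ∑ a, d a (hFun m k ((pencil2 G B D).adjugate a b)) =
      ∑ a, (Γ a).trace * hFun m k ((pencil2 G B D).adjugate a b)
        - ∑ a, ∑ c, Γ a b c * hFun m k ((pencil2 G B D).adjugate a c)
        + ∑ c, cf (m + k) 0 ((pencil2 G B D).adjugate b c) * p c := by
  have hmain := sum_derivation_adjugate (S := ℝ) (fun a => polyDer (polyDer (d a))) (rotDer R)
    (Γ := fun a => (Γ a).map (C.comp C : R →+* R[X][X])) (fun i j l => by
      simp only [Matrix.map_apply, h.symm i j l]) (pencil2_isSymm hs hB hD)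
    (isRegular_det_pencil2 G B D hG) (p := fun a => C (C (p a))) (fun a c e => by
      rw [pencil2_covD B D h, pencil2_covD B D h]
      simp only [Matrix.add_apply, Matrix.smul_apply, Matrix.map_apply, smul_eq_mul,
        map_rotDer_pencil2, RingHom.comp_apply]
      -- The two Codazzi equations are the coefficients of t⁰ and t¹ of one equation for the pencil.
      have e1 := congrArg (fun x : R => (C (C x) : R[X][X])) (hcB a c e)
      have e2 := congrArg (fun x : R => (C (C x) : R[X][X])) (hcD a c e)
      simp only [map_sub, map_mul] at e1 e2
      linear_combination e1 + C X * e2) b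
  have h2 := congrArg (hFun m k) hmain
  have htr : ∀ a, ((Γ a).map (C.comp C : R →+* R[X][X])).trace = C (C (Γ a).trace) := fun a => by
    simp [Matrix.trace]
  simp only [htr, hFun_add, hFun_sub, hFun_sum, hFun_polyDer, hFun_CC_mul, hFun_mul_CC,
    Matrix.map_apply, RingHom.comp_apply] at h2
  rw [h2]
  congr 1
  refine Finset.sum_congr rfl fun c _ => ?_
  rw [hFun_rotDer m k hk _ (cf_adjugate_eq_zero G B D hG (by omega) _ _)]

/-- For k = 2 the degree bound leaves a single coefficient in `hFun`, of weight 1/(m + 2). This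
weight cancels the factor N - 2 = m + 2 of the contracted Codazzi equation, so the traced equation
suffices. -/
theorem sum_derivation_hFun_adjugate_two {m : ℕ} (hN : Fintype.card ι + 1 = 4 + m)
    (hG : IsUnit G.det) (hs : G.IsSymm) (h : IsLeviCivita d G Γ) {B D : Matrix ι ι R}
    (hD : D.IsSymm) {p : ι → R}
    (hcD : ∀ a, ∑ c, ∑ e, G⁻¹ c e * (covD d Γ D a c e - covD d Γ D c a e) = ((m : ℝ) + 2) • p a)
    (b : ι) :
    ∑ a, d a (hFun m 2 ((pencil2 G B D).adjugate a b)) =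
      ∑ a, (Γ a).trace * hFun m 2 ((pencil2 G B D).adjugate a b)
        - ∑ a, ∑ c, Γ a b c * hFun m 2 ((pencil2 G B D).adjugate a c)
        + ∑ c, cf (m + 2) 0 ((pencil2 G B D).adjugate b c) * p c := by
  have hw : hWeight m 2 1 = ((m : ℝ) + 2)⁻¹ := by
    simp only [hWeight, Nat.factorial_succ, Nat.sub_self, Nat.factorial_zero]
    push_cast
    have : (m.factorial : ℝ) ≠ 0 := by positivity
    field_simp
    ring
  have hm : ((m : ℝ) + 2) ≠ 0 := by positivity
  have hH : ∀ a c, hFun m 2 ((pencil2 G B D).adjugate a c) =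
      ((m : ℝ) + 2)⁻¹ • cfMat (m + 1) 1 (pencil2 G B D).adjugate a c := by
    intro a c
    rw [hFun, Finset.sum_range_succ, Finset.sum_range_one,
      cf_adjugate_eq_zero G B D hG (by omega), smul_zero, zero_add, hw]
    rfl
  have h2 := h.sum_derivation_second hG hs hD hcD
    (cfMat_adjugate_second G B D hG (m := m + 1) (by omega)) b
  have h3 : ∀ c, cf (m + 2) 0 ((pencil2 G B D).adjugate b c) = (G.det • G⁻¹) b c := by
    intro c
    have := congrFun (congrFun (cfMat_adjugate_zero G B D (m + 2)) b) c
    rw [coeffMat_adjugate_top G B hG (by omega)] at this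
    exact this
  have h4 := congrArg (fun x : R => ((m : ℝ) + 2)⁻¹ • x) h2
  simp only [smul_add, smul_sub, Finset.smul_sum] at h4
  simp only [hH, Derivation.map_smul, mul_smul_comm, h3]
  rw [h4]
  congr 1
  refine Finset.sum_congr rfl fun c _ => ?_
  rw [mul_smul_comm, smul_smul, inv_mul_cancel₀ hm, one_smul]

/-- H_1 is a multiple of the mean curvature, hence there is no boundary Newton tensor for k = 1; in
terms of coefficients, the required degree is too high. -/
theorem hFun_adjugate_one {m : ℕ} (hN : Fintype.card ι + 1 = 2 + m)
    (hG : IsUnit G.det) (B D : Matrix ι ι R) (a b : ι) :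
    hFun m 1 ((pencil2 G B D).adjugate a b) = 0 := by
  rw [hFun, Finset.sum_range_one, cf_adjugate_eq_zero G B D hG (by omega), smul_zero]

end BoundaryDivergence

/-! ### The normal row of the interior Newton tensor. -/

section AdjugateRow

variable {R : Type*} [CommRing R] [Algebra ℝ R] {n : ℕ}
  {G P : Matrix (Fin (n + 1)) (Fin (n + 1)) R}

theorem tang_pencil : tang (pencil G P) = pencil (tang G) (tang P) :=
  Matrix.ext fun i j => by simp [pencil_apply]

theorem adjugate_pencil_zero_zero :
    (pencil G P).adjugate 0 0 = (pencil (tang G) (tang P)).det := by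
  rw [Matrix.adjugate_fin_succ_eq_det_submatrix, ← tang_pencil]
  simp [tang]

/-- Row 0 of adj M · M = det M · 1, in the tangential columns, is a linear system for the unknown
entries with the tangential pencil as matrix. It is solved by multiplying with the adjugate and
cancelling the regular determinant. -/
theorem adjugate_pencil_zero_succ (hs : G.IsSymm) (hH : IsUnit (tang G).det)
    (c : Fin n) :
    (pencil G P).adjugate 0 c.succ = -((pencil (tang G) (tang P)).det * C (shift G c))
      - ∑ b, C (mixedPart G P b) * (pencil (tang G) (tang P)).adjugate b c := by
  set M := pencil (tang G) (tang P) with hM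
  set Q := (pencil G P).adjugate with hQ
  have h0 : Q 0 0 = M.det := adjugate_pencil_zero_zero
  have hreg : IsRegular M.det := isRegular_det_pencil _ _ hH
  have hrow : ∀ b, ∑ c, (Q 0 c.succ + M.det * C (shift G c)) * M c b =
      -(M.det * C (mixedPart G P b)) := by
    intro b
    have h1 := congrFun (congrFun (Matrix.adjugate_mul (pencil G P)) 0) b.succ
    rw [Matrix.mul_apply, Fin.sum_univ_succ, Matrix.smul_apply,
      Matrix.one_apply_ne (Fin.succ_ne_zero b).symm, smul_zero, ← hQ, h0] at h1
    have h2 : ∑ c, C (shift G c) * M c b = X * C (G 0 b.succ) + C (P 0 b.succ)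
        - C (mixedPart G P b) := by
      have e : ∑ c, C (shift G c) * M c b = ∑ c, X * C (shift G c * G c.succ b.succ)
          + ∑ c, C (shift G c * P c.succ b.succ) := by
        rw [← Finset.sum_add_distrib]
        refine Finset.sum_congr rfl fun c _ => ?_
        simp only [hM, pencil_apply, tang_apply, map_mul]
        ring
      rw [e, ← sum_shift_mul hs hH b, mixedPart, normalPart, map_sub, map_sum, map_sum,
        Finset.mul_sum]
      ring
    simp only [add_mul, Finset.sum_add_distrib, mul_assoc, ← Finset.mul_sum]
    rw [h2]
    have h3 : ∀ c : Fin n, M c b = pencil G P c.succ b.succ := fun c => by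
      simp [hM, pencil_apply]
    simp only [h3]
    rw [pencil_apply G P 0] at h1
    linear_combination h1
  have h4 : ((fun c => Q 0 c.succ + M.det * C (shift G c)) ᵥ* M) ᵥ* M.adjugate =
      (fun b => -(M.det * C (mixedPart G P b))) ᵥ* M.adjugate :=
    congrArg (fun x => x ᵥ* M.adjugate) (funext hrow)
  rw [Matrix.vecMul_vecMul, Matrix.mul_adjugate] at h4
  have h5 := congrFun h4 c
  rw [Matrix.vecMul_smul, Matrix.vecMul_one, Pi.smul_apply, smul_eq_mul] at h5
  have h6 : ((fun b => -(M.det * C (mixedPart G P b))) ᵥ* M.adjugate) c =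
      M.det * (-∑ b, C (mixedPart G P b) * M.adjugate b c) := by
    change ∑ b, -(M.det * C (mixedPart G P b)) * M.adjugate b c = _
    rw [mul_neg, Finset.mul_sum, ← Finset.sum_neg_distrib]
    exact Finset.sum_congr rfl fun b _ => by ring
  rw [h6] at h5
  have h7 := hreg.left h5
  linear_combination h7

/-- The flux of the interior current through the hypersurface. The normal derivative comes with a
coefficient of the tangential determinant; the second term couples P(∂_0 - β, ·) to the tangential
Newton tensor and is the one to be matched by the divergence of the boundary Newton tensor. -/
theorem sum_newton_zero (hs : G.IsSymm) (hH : IsUnit (tang G).det) (i : ℕ)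
    (w : Fin (n + 1) → R) :
    ∑ j, coeffMat i (pencil G P).adjugate 0 j * w j =
      (pencil (tang G) (tang P)).det.coeff i * normalPart G w
      - ∑ b, ∑ c, coeffMat i (pencil (tang G) (tang P)).adjugate b c
        * mixedPart G P b * w c.succ := by
  rw [Fin.sum_univ_succ]
  simp only [coeffMat, Matrix.map_apply, adjugate_pencil_zero_zero,
    adjugate_pencil_zero_succ hs hH, coeff_sub, coeff_neg, coeff_mul_C, finsetSum_coeff,
    coeff_C_mul, sub_mul, Finset.sum_sub_distrib, Finset.sum_mul, neg_mul,
    Finset.sum_neg_distrib]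
  rw [Finset.sum_comm (f := fun b c => ((pencil (tang G) (tang P)).adjugate b c).coeff i *
    mixedPart G P b * w c.succ)]
  have e1 : ∑ x : Fin n, (pencil (tang G) (tang P)).det.coeff i * shift G x * w x.succ =
      (pencil (tang G) (tang P)).det.coeff i * ∑ x, shift G x * w x.succ := by
    rw [Finset.mul_sum]; exact Finset.sum_congr rfl fun x _ => by ring
  rw [e1, normalPart]
  have e2 : ∑ x : Fin n, ∑ b, mixedPart G P b *
      ((pencil (tang G) (tang P)).adjugate b x).coeff i * w x.succ =
      ∑ x : Fin n, ∑ b, ((pencil (tang G) (tang P)).adjugate b x).coeff i *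
        mixedPart G P b * w x.succ :=
    Finset.sum_congr rfl fun x _ => Finset.sum_congr rfl fun b _ => by ring
  rw [e2]; ring

end AdjugateRow

/-! ### The variation of the boundary density and the cancellation of the flux. -/

section BoundaryVariation

variable {R : Type*} [CommRing R] [Algebra ℝ R] {n : ℕ}
  {d : Fin (n + 1) → Derivation ℝ R R} {G P : Matrix (Fin (n + 1)) (Fin (n + 1)) R}
  {Γ : Fin (n + 1) → Matrix (Fin (n + 1)) (Fin (n + 1)) R} {ν σ : R} {A : Matrix (Fin n) (Fin n) R}

theorem isSymm_of_conn (hΓ : ∀ i j k, Γ i k j = Γ j k i) (hνu : IsUnit ν)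
    (hA : ∀ a b : Fin n, Γ a.succ 0 b.succ = ν * A a b) : A.IsSymm :=
  Matrix.ext fun a b => hνu.mul_left_cancel (by
    rw [Matrix.transpose_apply, ← hA, ← hA, hΓ])

/-- The divergence of the boundary Newton tensor density. -/
theorem sum_derivation_bdryNewton {k m : ℕ} (hk : 1 ≤ k) (hN : n + 1 = 2 * k + m)
    (hG : IsUnit G.det) (hs : G.IsSymm) (hH : IsUnit (tang G).det) (h : IsLeviCivita d G Γ)
    (hd : ∀ i j f, d i (d j f) = d j (d i f)) (hPs : P.IsSymm)
    (hP : 2 ≤ k → ric d Γ = (((n + 1 : ℕ) : ℝ) - 2) • P + (G⁻¹ * P).trace • G)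
    (hW : 3 ≤ k → WeylFree G Γ d P) (hν : ν * ν = G⁻¹ 0 0) (hνu : IsUnit ν)
    (hA : ∀ a b : Fin n, Γ a.succ 0 b.succ = ν * A a b) (b : Fin n) :
    ∑ a, tangDer d a (hFun m k ((pencil2 (tang G) (tang P) A).adjugate a b)) =
      ∑ a, (tangConn G Γ a).trace * hFun m k ((pencil2 (tang G) (tang P) A).adjugate a b)
        - ∑ a, ∑ c, tangConn G Γ a b c * hFun m k ((pencil2 (tang G) (tang P) A).adjugate a c)
        + ∑ c, coeffMat (m + k) (pencil (tang G) (tang P)).adjugate b c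
          * (ν * mixedPart G P c) := by
  have hAs := isSymm_of_conn h.symm hνu hA
  have hLC := isLeviCivita_tang hs hH h
  have hcard : Fintype.card (Fin n) = n := Fintype.card_fin n
  rw [← cfMat_adjugate_zero (tang G) (tang P) A (m + k)]
  change _ = _ - _ + ∑ c, cf (m + k) 0 ((pencil2 (tang G) (tang P) A).adjugate b c)
    * (ν * mixedPart G P c)
  -- The cases parallel the interior: for k = 1 everything vanishes by degree, for k = 2 the
  -- contracted Codazzi equation is enough, and for k ≥ 3 the untraced equations for P̄ and A are
  -- used.
  rcases (by omega : k = 1 ∨ k = 2 ∨ 3 ≤ k) with rfl | rfl | hk3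
  · simp only [hFun_adjugate_one (show Fintype.card (Fin n) + 1 = 2 + m by omega) hH,
      cf_adjugate_eq_zero (tang G) (tang P) A hH
        (show Fintype.card (Fin n) ≤ (m + 1) + 0 by omega), map_zero, mul_zero, zero_mul,
      Finset.sum_const_zero, sub_zero, add_zero]
  · refine sum_derivation_hFun_adjugate_two (by omega) hH (tang_isSymm hs) hLC hAs
      (p := fun c => ν * mixedPart G P c) (fun a => ?_) b
    rw [codazzi_trace hG hs hH h hd hν hνu hA (hP le_rfl)]
    congr 1
    rw [hN]; push_cast; ring
  · refine sum_derivation_hFun_adjugate hk (by omega) hH (tang_isSymm hs) hLC (tang_isSymm hPs)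
      hAs (p := fun c => ν * mixedPart G P c) (fun a c e => ?_) (fun a c e => ?_) b
    -- In the tangential components of Cotton = 0, passing to the induced connection produces
    -- products of A with the mixed part of P; the other two such products cancel by the symmetry of
    -- A.
    · have hcot := h.cotton_eq_zero hG hs hd hPs (by rw [Fintype.card_fin]; omega) (hW hk3)
        a.succ c.succ e.succ
      rw [covD_succ_succ (G := G) hPs, covD_succ_succ (G := G) hPs, hA, hA, hA, hA,
        hAs.apply a c] at hcot
      linear_combination hcot
    · rw [codazzi_of_weylFree hG hs hH h hν hνu hA (hW hk3)]
      ring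

variable (d G Γ P ν A σ) in
/-- The variation of the boundary density under the conformal variation `v`, apart from scaling. -/
def bdryVar (m k : ℕ) (v : R) : R :=
  σ * hFun m k (((pencil2 (tang G) (tang P) A).adjugate *
    pencil2 0 (-tang (hess d Γ v)) (-(ν * normalPart G fun i => d i v) • tang G)).trace)

/-- By the Gauss formula the varied pencil is minus the tangential Hessian plus η(v) times the
derivative of the pencil under t ∂_r - ∂_t. By Jacobi's formula the latter differentiates the
determinant, and `hFun_rotDer` reduces it to one coefficient. -/
theorem bdryVar_eq {k m : ℕ} (hk : 1 ≤ k) (hN : n + 1 = 2 * k + m) (hs : G.IsSymm)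
    (hPs : P.IsSymm) (hAs : A.IsSymm)
    (hA : ∀ a b : Fin n, Γ a.succ 0 b.succ = ν * A a b) (v : R) :
    bdryVar d G P Γ ν σ A m k v =
      σ * (-(∑ a, ∑ b, hFun m k ((pencil2 (tang G) (tang P) A).adjugate a b)
        * hess (tangDer d) (tangConn G Γ) v a b)
        - ν * (normalPart G fun i => d i v) * (pencil (tang G) (tang P)).det.coeff (m + k)) := by
  set M := pencil2 (tang G) (tang P) A
  set x := normalPart G fun i => d i v
  have hMs : M.adjugate.IsSymm := (pencil2_isSymm (tang_isSymm hs) (tang_isSymm hPs) hAs).adjugate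
  have e1 : pencil2 0 (-tang (hess d Γ v)) (-(ν * x) • tang G) =
      -(hess (tangDer d) (tangConn G Γ) v).map (C.comp C : R →+* R[X][X])
        + (C (C (-(ν * x))) : R[X][X]) • M.map (rotDer R) := by
    refine Matrix.ext fun a b => ?_
    rw [pencil2_apply]
    simp only [Matrix.add_apply, Matrix.neg_apply, Matrix.smul_apply, Matrix.map_apply, M,
      map_rotDer_pencil2, tang_apply, hess_succ_succ (G := G), hA, RingHom.comp_apply, smul_eq_mul,
      map_neg, map_mul, map_sub, Matrix.zero_apply, map_zero, mul_zero, zero_add]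
    simp only [x]
    ring
  rw [bdryVar, e1, mul_add, Matrix.trace_add, Matrix.mul_smul, Matrix.trace_smul,
    ← derivation_det, hFun_add, smul_eq_mul, hFun_CC_mul, hFun_rotDer m k hk,
    cf_det_zero]
  · rw [Matrix.mul_neg, Matrix.trace_neg, trace_mul_of_isSymm _ _ hMs]
    congr 1
    have e2 : hFun m k (-∑ a, ∑ b, M.adjugate a b *
        (hess (tangDer d) (tangConn G Γ) v).map (C.comp C : R →+* R[X][X]) a b) =
        -∑ a, ∑ b, hFun m k (M.adjugate a b) * hess (tangDer d) (tangConn G Γ) v a b := by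
      rw [← zero_sub, hFun_sub, hFun_sum]
      simp only [hFun_sum, Matrix.map_apply, RingHom.comp_apply, hFun_mul_CC]
      rw [show hFun m k (0 : R[X][X]) = 0 by simp [hFun, cf], zero_sub]
    rw [e2]; ring
  -- The hypothesis of `hFun_rotDer`: m + 2k = n + 1 exceeds the size n of the tangential matrices.
  · exact TDegLE.det (tDegLE_pencil2 _ _ _) _ _ (by rw [Fintype.card_fin]; omega)

/-- The normal derivatives cancel between the flux and `bdryVar_eq`. The mixed terms of the flux are
the inhomogeneous part in the divergence of the boundary Newton tensor, so only a tangential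
divergence is left over. -/
theorem current_zero_add_bdryVar {k m : ℕ} (hk : 1 ≤ k) (hN : n + 1 = 2 * k + m)
    (hG : IsUnit G.det) (hs : G.IsSymm) (hH : IsUnit (tang G).det) (h : IsLeviCivita d G Γ)
    (hd : ∀ i j f, d i (d j f) = d j (d i f)) (hPs : P.IsSymm)
    (hP : 2 ≤ k → ric d Γ = (((n + 1 : ℕ) : ℝ) - 2) • P + (G⁻¹ * P).trace • G)
    (hW : 3 ≤ k → WeylFree G Γ d P) (hν : ν * ν = G⁻¹ 0 0) (hνu : IsUnit ν)
    (hA : ∀ a b : Fin n, Γ a.succ 0 b.succ = ν * A a b)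
    (hσ : ∀ a, tangDer d a σ = -((tangConn G Γ a).trace * σ)) (f v : R) :
    ν * σ * (∑ j, coeffMat (m + k) (pencil G P).adjugate 0 j * (f * d j v - v * d j f))
      + f * bdryVar d G P Γ ν σ A m k v - v * bdryVar d G P Γ ν σ A m k f =
      -∑ a : Fin n, d a.succ (σ * ∑ b : Fin n,
        hFun m k ((pencil2 (tang G) (tang P) A).adjugate a b)
          * (f * d b.succ v - v * d b.succ f)) := by
  have hAs := isSymm_of_conn h.symm hνu hA
  have hMs := (pencil2_isSymm (tang_isSymm hs) (tang_isSymm hPs) hAs).adjugate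
  have hcur := sum_derivation_current (d := tangDer d) (Γ := tangConn G Γ) (σ := σ)
    (Z := Matrix.of fun a b => hFun m k ((pencil2 (tang G) (tang P) A).adjugate a b))
    (Matrix.ext fun a b => by simp only [Matrix.transpose_apply, Matrix.of_apply, hMs.apply a b])
    hσ (Y := fun b => ∑ c, coeffMat (m + k) (pencil (tang G) (tang P)).adjugate b c
          * (ν * mixedPart G P c))
    (sum_derivation_bdryNewton hk hN hG hs hH h hd hPs hP hW hν hνu hA) f v
  simp only [Matrix.of_apply, tangDer_apply] at hcur
  have hZs : ∀ b c, coeffMat (m + k) (pencil (tang G) (tang P)).adjugate b c =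
      coeffMat (m + k) (pencil (tang G) (tang P)).adjugate c b := fun b c => by
    have := (pencil_isSymm (tang_isSymm hs) (tang_isSymm hPs)).adjugate
    simp only [coeffMat, Matrix.map_apply, this.apply b c]
  rw [hcur, bdryVar_eq hk hN hs hPs hAs hA, bdryVar_eq hk hN hs hPs hAs hA,
    sum_newton_zero hs hH]
  have e1 : normalPart G (fun j => f * d j v - v * d j f) =
      f * (normalPart G fun i => d i v) - v * normalPart G fun i => d i f := by
    simp only [normalPart, mul_sub, Finset.sum_sub_distrib, Finset.mul_sum]
    have : ∀ x y : R, ∀ c : Fin n, shift G c * (x * y) = x * (shift G c * y) := fun x y c => by ring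
    simp only [this]
    ring
  have e2 : ∑ a, ∑ b, hFun m k ((pencil2 (tang G) (tang P) A).adjugate a b) *
      (f * hess (tangDer d) (tangConn G Γ) v a b - v * hess (tangDer d) (tangConn G Γ) f a b) =
      f * ∑ a, ∑ b, hFun m k ((pencil2 (tang G) (tang P) A).adjugate a b)
        * hess (tangDer d) (tangConn G Γ) v a b
      - v * ∑ a, ∑ b, hFun m k ((pencil2 (tang G) (tang P) A).adjugate a b)
        * hess (tangDer d) (tangConn G Γ) f a b := by
    simp only [Finset.mul_sum, ← Finset.sum_sub_distrib]
    exact Finset.sum_congr rfl fun a _ => Finset.sum_congr rfl fun b _ => by ring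
  have e3 : ∑ b : Fin n, (∑ c, coeffMat (m + k) (pencil (tang G) (tang P)).adjugate b c
          * (ν * mixedPart G P c)) * (f * d b.succ v - v * d b.succ f) =
      ν * ∑ b, ∑ c, coeffMat (m + k) (pencil (tang G) (tang P)).adjugate b c
        * mixedPart G P b * (f * d c.succ v - v * d c.succ f) := by
    simp only [Finset.mul_sum, Finset.sum_mul]
    rw [Finset.sum_comm]
    exact Finset.sum_congr rfl fun a _ => Finset.sum_congr rfl fun b _ => by rw [hZs b a]; ring
  rw [e1, e2, e3]
  ring

end BoundaryVariation

end

section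

/-! ## Smooth functions on relatively open subsets of the half-space -/

open TopologicalSpace (Opens)

section HalfSpace

variable {n : ℕ}

variable (n) in
/-- The closed half-space. -/
abbrev halfSpace : Set (Coord n) := {z | 0 ≤ z 0}

theorem convex_halfSpace : Convex ℝ (halfSpace n) := by
  intro x hx y hy a b ha hb _
  simp only [halfSpace, mem_ofPred_eq, PiLp.add_apply, PiLp.smul_apply, smul_eq_mul] at *
  positivity

theorem isOpen_pos : IsOpen {z : Coord n | 0 < z 0} :=
  isOpen_lt continuous_const (by fun_prop)

theorem isClosed_halfSpace : IsClosed (halfSpace n) :=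
  isClosed_le continuous_const (by fun_prop)

theorem pos_subset_interior : {z : Coord n | 0 < z 0} ⊆ interior (halfSpace n) :=
  interior_maximal (fun z (hz : 0 < z 0) => show 0 ≤ z 0 from hz.le) isOpen_pos

theorem halfSpace_subset_closure_interior : halfSpace n ⊆ closure (interior (halfSpace n)) := by
  intro y hy
  have h1 : Filter.Tendsto (fun t : ℝ => y + t • (EuclideanSpace.single 0 1 : Coord n)) (𝓝[>] 0)
      (𝓝 y) := by
    have : Filter.Tendsto (fun t : ℝ => y + t • (EuclideanSpace.single 0 1 : Coord n)) (𝓝 0)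
        (𝓝 (y + (0 : ℝ) • (EuclideanSpace.single 0 1 : Coord n))) :=
      (Continuous.tendsto (by fun_prop) 0)
    rw [zero_smul, add_zero] at this
    exact this.mono_left nhdsWithin_le_nhds
  refine mem_closure_of_tendsto h1 ?_
  filter_upwards [self_mem_nhdsWithin] with t ht
  refine pos_subset_interior ?_
  have hy' : 0 ≤ y 0 := hy
  have ht' : 0 < t := ht
  simp only [mem_ofPred_eq, PiLp.add_apply, PiLp.smul_apply, smul_eq_mul, PiLp.single_apply,
    if_true, mul_one]
  linarith

theorem uniqueDiffOn_halfSpace : UniqueDiffOn ℝ (halfSpace n) := by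
  refine uniqueDiffOn_convex convex_halfSpace ⟨EuclideanSpace.single 0 1, pos_subset_interior ?_⟩
  simp

/-- The relatively open subset of the half-space cut out by an open set. -/
def half (O : Opens (Coord n)) : Set (Coord n) := halfSpace n ∩ O

variable {O : Opens (Coord n)} {y : Coord n}

theorem uniqueDiffOn_half : UniqueDiffOn ℝ (half O) := uniqueDiffOn_halfSpace.inter O.isOpen

theorem half_mem_nhdsWithin (hy : y ∈ half O) : half O ∈ 𝓝[halfSpace n] y :=
  inter_mem_nhdsWithin _ (O.isOpen.mem_nhds hy.2)

theorem fderivWithin_half {E : Type*} [NormedAddCommGroup E] [NormedSpace ℝ E] (f : Coord n → E)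
    (hy : y ∈ half O) : fderivWithin ℝ f (half O) y = fderivWithin ℝ f (halfSpace n) y :=
  fderivWithin_inter (O.isOpen.mem_nhds hy.2)

theorem partialDeriv_congr {f g : Coord n → ℝ} (hy : y ∈ half O) (h : EqOn f g (half O))
    (i : Fin (n + 1)) : partialDeriv i f y = partialDeriv i g y := by
  have : fderivWithin ℝ f (half O) y = fderivWithin ℝ g (half O) y :=
    fderivWithin_congr h (h hy)
  simp only [partialDeriv]
  rw [← fderivWithin_half f hy, ← fderivWithin_half g hy, this]

theorem contDiffOn_partialDeriv {f : Coord n → ℝ} (hf : ContDiffOn ℝ ∞ f (half O))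
    (i : Fin (n + 1)) : ContDiffOn ℝ ∞ (partialDeriv i f) (half O) := by
  have h1 : ContDiffOn ℝ ∞ (fderivWithin ℝ f (half O)) (half O) :=
    hf.fderivWithin uniqueDiffOn_half (by simp)
  have h2 : ContDiffOn ℝ ∞
      (fun y => fderivWithin ℝ f (half O) y (EuclideanSpace.single i 1)) (half O) :=
    h1.clm_apply contDiffOn_const
  exact h2.congr fun y hy => by rw [fderivWithin_half f hy]; rfl

theorem differentiableWithinAt_half {E : Type*} [NormedAddCommGroup E] [NormedSpace ℝ E]
    {f : Coord n → E} (hf : ContDiffOn ℝ ∞ f (half O))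
    (hy : y ∈ half O) : DifferentiableWithinAt ℝ f (halfSpace n) y :=
  ((hf.differentiableOn (by simp)) y hy).mono_of_mem_nhdsWithin (half_mem_nhdsWithin hy)

/-- Second derivatives within a set are symmetric at points in the closure of its interior, so the
coordinate derivations commute up to and including the boundary. -/
theorem partialDeriv_comm {f : Coord n → ℝ} (hf : ContDiffOn ℝ ∞ f (half O))
    (hy : y ∈ half O) (i j : Fin (n + 1)) :
    partialDeriv i (partialDeriv j f) y = partialDeriv j (partialDeriv i f) y := by
  have hfy : ContDiffWithinAt ℝ ∞ f (halfSpace n) y :=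
    (hf y hy).mono_of_mem_nhdsWithin (half_mem_nhdsWithin hy)
  have hsymm := hfy.isSymmSndFDerivWithinAt
    (by rw [minSmoothness_of_isRCLikeNormedField]; exact WithTop.coe_le_coe.2 (le_top (a := (2 : ℕ∞)))) uniqueDiffOn_halfSpace
    (halfSpace_subset_closure_interior hy.1) hy.1
  have h1 : ContDiffOn ℝ ∞ (fderivWithin ℝ f (halfSpace n)) (half O) :=
    (hf.fderivWithin uniqueDiffOn_half (by simp)).congr fun z hz => (fderivWithin_half f hz).symm
  have hd := differentiableWithinAt_half h1 hy
  have key : ∀ i j : Fin (n + 1), partialDeriv i (partialDeriv j f) y =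
      fderivWithin ℝ (fderivWithin ℝ f (halfSpace n)) (halfSpace n) y (EuclideanSpace.single i 1)
        (EuclideanSpace.single j 1) := by
    intro i j
    change fderivWithin ℝ (fun z => fderivWithin ℝ f (halfSpace n) z (EuclideanSpace.single j 1))
      (halfSpace n) y (EuclideanSpace.single i 1) = _
    rw [fderivWithin_clm_apply (uniqueDiffOn_halfSpace y hy.1) hd
      (differentiableWithinAt_const _)]
    simp
  rw [key, key]
  exact hsymm _ _

/-- Extension by zero. -/
def zext (O : Opens (Coord n)) (f : half O → ℝ) : Coord n → ℝ := Function.extend Subtype.val f 0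

theorem zext_apply (f : half O → ℝ) (hy : y ∈ half O) : zext O f y = f ⟨y, hy⟩ :=
  Subtype.val_injective.extend_apply f 0 ⟨y, hy⟩

/-- The algebra of smooth functions on a relatively open subset of the half-space. -/
def smoothFun (O : Opens (Coord n)) : Subalgebra ℝ (half O → ℝ) where
  carrier := {f | ContDiffOn ℝ ∞ (zext O f) (half O)}
  mul_mem' {f g} hf hg := (ContDiffOn.mul hf hg).congr fun y hy => by simp [zext_apply _ hy]
  add_mem' {f g} hf hg := (ContDiffOn.add hf hg).congr fun y hy => by simp [zext_apply _ hy]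
  algebraMap_mem' c := (contDiffOn_const (c := c)).congr fun y hy => by simp [zext_apply _ hy]

/-- The element of the algebra given by a smooth function. -/
def toSmooth (f : Coord n → ℝ) (hf : ContDiffOn ℝ ∞ f (half O)) : smoothFun O :=
  ⟨fun y => f y, hf.congr fun y hy => by simp [zext_apply _ hy]⟩

/-- Evaluation at a point. -/
def evalAt (y : half O) : smoothFun O →ₐ[ℝ] ℝ :=
  (Pi.evalAlgHom ℝ (fun _ : half O => ℝ) y).comp (smoothFun O).val

@[simp]
theorem evalAt_toSmooth (y : half O) (f : Coord n → ℝ) (hf : ContDiffOn ℝ ∞ f (half O)) :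
    evalAt y (toSmooth f hf) = f y := rfl

theorem smoothFun_ext {f g : smoothFun O} (h : ∀ y, evalAt y f = evalAt y g) : f = g :=
  Subtype.ext (funext h)

/-- The smooth function underlying an element of the algebra. -/
def extFun (f : smoothFun O) : Coord n → ℝ := zext O f.1

theorem contDiffOn_extFun (f : smoothFun O) : ContDiffOn ℝ ∞ (extFun f) (half O) := f.2

theorem extFun_apply (f : smoothFun O) (hy : y ∈ half O) : extFun f y = evalAt ⟨y, hy⟩ f :=
  zext_apply _ hy

theorem extFun_of_notMem (f : smoothFun O) (hy : y ∉ half O) : extFun f y = 0 :=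
  Function.extend_apply' _ _ _ (by rintro ⟨z, rfl⟩; exact hy z.2)

theorem toSmooth_extFun (f : smoothFun O) : toSmooth (extFun f) (contDiffOn_extFun f) = f :=
  smoothFun_ext fun y => by rw [evalAt_toSmooth, extFun_apply _ y.2]

/-- The coordinate derivations. -/
def coordDer (O : Opens (Coord n)) (i : Fin (n + 1)) :
    Derivation ℝ (smoothFun O) (smoothFun O) :=
  Derivation.mk'
    { toFun := fun f => toSmooth (partialDeriv i (extFun f))
        (contDiffOn_partialDeriv (contDiffOn_extFun f) i)
      map_add' := fun f g => smoothFun_ext fun y => by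
        have h : partialDeriv i (extFun (f + g)) y = partialDeriv i (extFun f + extFun g) y :=
          partialDeriv_congr y.2 (fun z hz => by
            simp [extFun_apply _ hz]) i
        rw [evalAt_toSmooth, h, map_add, evalAt_toSmooth, evalAt_toSmooth, partialDeriv,
          fderivWithin_add (uniqueDiffOn_halfSpace _ y.2.1)
            (differentiableWithinAt_half (contDiffOn_extFun f) y.2)
            (differentiableWithinAt_half (contDiffOn_extFun g) y.2)]
        rfl
      map_smul' := fun c f => smoothFun_ext fun y => by
        have h : partialDeriv i (extFun (c • f)) y = partialDeriv i (c • extFun f) y :=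
          partialDeriv_congr y.2 (fun z hz => by
            simp [extFun_apply _ hz]) i
        rw [evalAt_toSmooth, h, RingHom.id_apply, map_smul, evalAt_toSmooth, partialDeriv,
          fderivWithin_const_smul (uniqueDiffOn_halfSpace _ y.2.1)
            (differentiableWithinAt_half (contDiffOn_extFun f) y.2)]
        rfl }
    (fun f g => smoothFun_ext fun y => by
      have h : partialDeriv i (extFun (f * g)) y =
          partialDeriv i (fun z => extFun f z * extFun g z) y :=
        partialDeriv_congr y.2 (fun z hz => by
          simp [extFun_apply _ hz]) i
      change partialDeriv i (extFun (f * g)) y = evalAt y (f * _ + g * _)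
      rw [h, partialDeriv, fderivWithin_fun_mul (uniqueDiffOn_halfSpace _ y.2.1)
            (differentiableWithinAt_half (contDiffOn_extFun f) y.2)
            (differentiableWithinAt_half (contDiffOn_extFun g) y.2)]
      simp only [map_add, map_mul, LinearMap.coe_mk, AddHom.coe_mk, evalAt_toSmooth,
        _root_.add_apply, _root_.smul_apply, smul_eq_mul,
        extFun_apply _ y.2]
      rfl)

theorem evalAt_coordDer (i : Fin (n + 1)) (f : smoothFun O) (y : half O) :
    evalAt y (coordDer O i f) = partialDeriv i (extFun f) y := rfl

theorem evalAt_coordDer_toSmooth (i : Fin (n + 1)) (f : Coord n → ℝ)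
    (hf : ContDiffOn ℝ ∞ f (half O)) (y : half O) :
    evalAt y (coordDer O i (toSmooth f hf)) = partialDeriv i f y :=
  partialDeriv_congr y.2 (fun z hz => by simp [extFun_apply _ hz]) i

/-- Partial derivatives are computed by the derivations. -/
theorem partialDeriv_eq {F : Coord n → ℝ} {f : smoothFun O}
    (h : ∀ y : half O, F y = evalAt y f) (i : Fin (n + 1)) (y : half O) :
    partialDeriv i F y = evalAt y (coordDer O i f) :=
  partialDeriv_congr y.2 (fun z hz => by rw [extFun_apply _ hz, ← h ⟨z, hz⟩]) i

theorem coordDer_comm (i j : Fin (n + 1)) (f : smoothFun O) :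
    coordDer O i (coordDer O j f) = coordDer O j (coordDer O i f) :=
  smoothFun_ext fun y => by
    rw [← partialDeriv_eq (F := partialDeriv j (extFun f)) (fun y => rfl) i y,
      ← partialDeriv_eq (F := partialDeriv i (extFun f)) (fun y => rfl) j y]
    exact partialDeriv_comm (contDiffOn_extFun f) y.2 i j

/-- This makes determinants of metrics, conformal factors and lapses units, as the algebraic
sections require. -/
theorem isUnit_smoothFun {f : smoothFun O} (h : ∀ y, evalAt y f ≠ 0) : IsUnit f := by
  have hs : ContDiffOn ℝ ∞ (fun y => (extFun f y)⁻¹) (half O) :=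
    (contDiffOn_extFun f).inv fun y hy => by rw [extFun_apply _ hy]; exact h _
  refine IsUnit.of_mul_eq_one (toSmooth _ hs) (smoothFun_ext fun y => ?_)
  rw [map_mul, evalAt_toSmooth, extFun_apply _ y.2, map_one]
  exact mul_inv_cancel₀ (h y)

end HalfSpace

end

section

open TopologicalSpace (Opens)

/-! ## The Schouten tensor over a differential ring -/

section AbstractSchouten

variable {R : Type*} [CommRing R] [Algebra ℝ R] {n : ℕ}

theorem map_nonsing_inv {S : Type*} [CommRing S] {ι : Type*} [Fintype ι] [DecidableEq ι]
    (φ : R →+* S) (M : Matrix ι ι R) (hM : IsUnit M.det) : M⁻¹.map φ = (M.map φ)⁻¹ := by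
  refine (Matrix.inv_eq_right_inv ?_).symm
  rw [← Matrix.map_mul, Matrix.mul_nonsing_inv _ hM]
  exact Matrix.map_one _ (map_zero φ) (map_one φ)

/-- The normalized scalar curvature `J`, from the metric and the Ricci tensor. -/
def traceSchoutenOf (G Ric : Matrix (Fin (n + 1)) (Fin (n + 1)) R) : R :=
  (1 / (2 * (n : ℝ))) • (G⁻¹ * Ric).trace

/-- The Schouten tensor, from the metric and the Ricci tensor. -/
def schoutenOf (G Ric : Matrix (Fin (n + 1)) (Fin (n + 1)) R) :
    Matrix (Fin (n + 1)) (Fin (n + 1)) R :=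
  if n = 1 then (1 / 2 : ℝ) • traceSchoutenOf G Ric • G
  else (1 / ((n : ℝ) - 1)) • (Ric - traceSchoutenOf G Ric • G)

variable {G Ric : Matrix (Fin (n + 1)) (Fin (n + 1)) R}

theorem schoutenOf_isSymm (hG : G.IsSymm) (hR : Ric.IsSymm) : (schoutenOf G Ric).IsSymm := by
  rw [schoutenOf]
  split_ifs
  · exact (hG.smul _).smul _
  · exact (hR.sub (hG.smul _)).smul _

theorem trace_schoutenOf (hG : IsUnit G.det) (hn : 1 ≤ n) :
    (G⁻¹ * schoutenOf G Ric).trace = traceSchoutenOf G Ric := by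
  have hn0 : (n : ℝ) ≠ 0 := by positivity
  have h1 : (G⁻¹ * Ric).trace = (2 * (n : ℝ)) • traceSchoutenOf G Ric := by
    rw [traceSchoutenOf, smul_smul, mul_one_div_cancel (by positivity), one_smul]
  have h2 : (((n + 1 : ℕ)) : R) = algebraMap ℝ R ((n : ℝ) + 1) := by simp
  rw [schoutenOf]
  split_ifs with h
  · subst h
    rw [Matrix.mul_smul, Matrix.mul_smul, Matrix.nonsing_inv_mul _ hG, Matrix.trace_smul,
      Matrix.trace_smul, Matrix.trace_one, Fintype.card_fin, smul_eq_mul, h2, mul_comm,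
      ← Algebra.smul_def, smul_smul]
    norm_num
  · have hn1 : (n : ℝ) - 1 ≠ 0 := sub_ne_zero.2 (by exact_mod_cast h)
    rw [Matrix.mul_smul, mul_sub, Matrix.mul_smul, Matrix.nonsing_inv_mul _ hG, Matrix.trace_smul,
      Matrix.trace_sub, Matrix.trace_smul, Matrix.trace_one, Fintype.card_fin, smul_eq_mul, h2,
      h1, mul_comm (traceSchoutenOf G Ric) (algebraMap ℝ R _), ← Algebra.smul_def, ← sub_smul, smul_smul]
    rw [show 1 / ((n : ℝ) - 1) * (2 * n - (n + 1)) = 1 by field_simp; ring, one_smul]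

/-- The restriction to N ≥ 3 is needed because in dimension two Ricci does not see the trace-free
part of P. -/
theorem ric_eq_schoutenOf (hG : IsUnit G.det) (hn : 2 ≤ n) :
    Ric = (((n + 1 : ℕ) : ℝ) - 2) • schoutenOf G Ric + (G⁻¹ * schoutenOf G Ric).trace • G := by
  rw [trace_schoutenOf hG (by omega)]
  have hn1 : (n : ℝ) - 1 ≠ 0 := sub_ne_zero.2 (by exact_mod_cast (by omega : n ≠ 1))
  rw [schoutenOf, if_neg (by omega), smul_smul]
  rw [show (((n + 1 : ℕ) : ℝ) - 2) * (1 / ((n : ℝ) - 1)) = 1 by push_cast; field_simp; ring,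
    one_smul, sub_add_cancel]

/-- Taking traces gives J = tr P, since (N - 2) + N = 2n is the normalisation of J; then N ≥ 3
allows P to be solved for. -/
theorem schoutenOf_unique (hn : 2 ≤ n) (hG : IsUnit G.det)
    {P : Matrix (Fin (n + 1)) (Fin (n + 1)) R}
    (hP : Ric = (((n + 1 : ℕ) : ℝ) - 2) • P + (G⁻¹ * P).trace • G) : schoutenOf G Ric = P := by
  have hn1 : (n : ℝ) - 1 ≠ 0 := sub_ne_zero.2 (by exact_mod_cast (by omega : n ≠ 1))
  have hn0 : (n : ℝ) ≠ 0 := by positivity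
  have h2 : (((n + 1 : ℕ)) : R) = algebraMap ℝ R ((n : ℝ) + 1) := by simp
  have ht : traceSchoutenOf G Ric = (G⁻¹ * P).trace := by
    rw [traceSchoutenOf, hP, mul_add, Matrix.mul_smul, Matrix.mul_smul,
      Matrix.nonsing_inv_mul _ hG, Matrix.trace_add, Matrix.trace_smul, Matrix.trace_smul,
      Matrix.trace_one, Fintype.card_fin, smul_eq_mul, h2, mul_comm _ (algebraMap ℝ R _),
      ← Algebra.smul_def, ← add_smul, smul_smul]
    rw [show 1 / (2 * (n : ℝ)) * (((n + 1 : ℕ) : ℝ) - 2 + ((n : ℝ) + 1)) = 1 by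
      push_cast; field_simp; ring, one_smul]
  rw [schoutenOf, if_neg (by omega), ht, hP, add_sub_cancel_right, smul_smul]
  rw [show (1 / ((n : ℝ) - 1)) * (((n + 1 : ℕ) : ℝ) - 2) = 1 by push_cast; field_simp; ring,
    one_smul]

theorem map_schoutenOf {S : Type*} [CommRing S] [Algebra ℝ S] (φ : R →ₐ[ℝ] S)
    (hG : IsUnit G.det) : (schoutenOf G Ric).map φ = schoutenOf (G.map φ) (Ric.map φ) := by
  have h1 : φ (traceSchoutenOf G Ric) = traceSchoutenOf (G.map φ) (Ric.map φ) := by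
    have := map_nonsing_inv (φ : R →+* S) G hG
    simp only [RingHom.coe_coe] at this
    rw [traceSchoutenOf, traceSchoutenOf, map_smul, ← this]
    congr 1
    simp [Matrix.trace, Matrix.mul_apply]
  refine Matrix.ext fun i j => ?_
  rw [schoutenOf, schoutenOf]
  split_ifs
  · simp [h1]
  · simp [h1]

theorem schoutenOf_congr (J : Matrix (Fin (n + 1)) (Fin (n + 1)) R) (hJ : IsUnit J.det) :
    schoutenOf (J * G * Jᵀ) (J * Ric * Jᵀ) = J * schoutenOf G Ric * Jᵀ := by
  have hJt : IsUnit (Jᵀ).det := by rwa [Matrix.det_transpose]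
  have h1 : traceSchoutenOf (J * G * Jᵀ) (J * Ric * Jᵀ) = traceSchoutenOf G Ric := by
    rw [traceSchoutenOf, traceSchoutenOf, Matrix.mul_inv_rev, Matrix.mul_inv_rev]
    congr 1
    rw [mul_assoc, Matrix.trace_mul_comm]
    congr 1
    calc G⁻¹ * J⁻¹ * (J * Ric * Jᵀ) * (Jᵀ)⁻¹ = G⁻¹ * (J⁻¹ * J) * Ric * (Jᵀ * (Jᵀ)⁻¹) := by
          simp only [mul_assoc]
      _ = G⁻¹ * Ric := by
          rw [Matrix.nonsing_inv_mul _ hJ, Matrix.mul_nonsing_inv _ hJt, mul_one, mul_one]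
  rw [schoutenOf, schoutenOf, h1]
  split_ifs
  · simp only [Matrix.mul_smul, Matrix.smul_mul]
  · simp only [Matrix.mul_smul, Matrix.smul_mul, mul_sub, sub_mul]

variable {d : Fin (n + 1) → Derivation ℝ R R}
  {Γ : Fin (n + 1) → Matrix (Fin (n + 1)) (Fin (n + 1)) R}

theorem ric_conformal (hG : IsUnit G.det) (hs : G.IsSymm) (h : IsLeviCivita d G Γ)
    (hd : ∀ i j f, d i (d j f) = d j (d i f)) (w : R) :
    ric d (fun i => Γ i + confConn d G w i) = ric d Γ
      + ((((n + 1 : ℕ) : ℝ) - 2) • confSchouten d G Γ w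
        + (G⁻¹ * confSchouten d G Γ w).trace • G) := by
  set E := confSchouten d G Γ w
  have hE : E.IsSymm := confSchouten_symm hs h.symm hd w
  refine Matrix.ext fun i j => ?_
  have e1 : ∑ k, (G⁻¹ * E) k i * G k j = E i j := by
    have : (G * (G⁻¹ * E)) j i = E i j := by
      rw [← mul_assoc, Matrix.mul_nonsing_inv _ hG, one_mul, hE.apply]
    rw [← this, Matrix.mul_apply]
    exact Finset.sum_congr rfl fun k _ => by rw [hs.apply j k, mul_comm]
  have e2 : ∑ k, (1 : Matrix (Fin (n + 1)) (Fin (n + 1)) R) k k * E i j =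
      ((n + 1 : ℕ) : ℝ) • E i j := by
    simp [Matrix.one_apply_eq, Algebra.smul_def]
  have e3 : ∑ k, (1 : Matrix (Fin (n + 1)) (Fin (n + 1)) R) k i * E k j = E i j := by
    simp [Matrix.one_apply]
  simp only [ric, Matrix.of_apply, Matrix.add_apply, Matrix.smul_apply,
    curv_conformal hG hs h hd w, Finset.sum_add_distrib, Finset.sum_sub_distrib]
  rw [e1, e2, e3, ← Finset.sum_mul, smul_eq_mul, sub_smul, two_smul, Matrix.trace]
  simp only [Matrix.diag_apply]
  ring

theorem traceSchoutenOf_conformal (hG : IsUnit G.det) (hn : 1 ≤ n) {ρ : R} (hρ : IsUnit ρ)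
    (E : Matrix (Fin (n + 1)) (Fin (n + 1)) R) :
    ρ * traceSchoutenOf (ρ • G) (Ric + ((((n + 1 : ℕ) : ℝ) - 2) • E + (G⁻¹ * E).trace • G)) =
      traceSchoutenOf G Ric + (G⁻¹ * E).trace := by
  have hinv : ρ • (ρ • G)⁻¹ = G⁻¹ := by
    refine (Matrix.inv_eq_left_inv ?_).symm
    have hu : IsUnit (ρ • G).det := by
      rw [Matrix.det_smul]; exact (hρ.pow _).mul hG
    rw [Matrix.smul_mul, ← Matrix.mul_smul, Matrix.nonsing_inv_mul _ hu]
  have hn0 : (n : ℝ) ≠ 0 := by positivity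
  have h2 : (((n + 1 : ℕ)) : R) = algebraMap ℝ R ((n : ℝ) + 1) := by simp
  have hmul : ∀ Y, ρ * ((ρ • G)⁻¹ * Y).trace = (G⁻¹ * Y).trace := fun Y => by
    rw [← hinv, Matrix.smul_mul, Matrix.trace_smul, smul_eq_mul]
  rw [traceSchoutenOf, mul_smul_comm, hmul, traceSchoutenOf, mul_add, mul_add, Matrix.mul_smul, Matrix.mul_smul,
    Matrix.nonsing_inv_mul _ hG, Matrix.trace_add, Matrix.trace_add, Matrix.trace_smul,
    Matrix.trace_smul, Matrix.trace_one, Fintype.card_fin, smul_eq_mul, h2,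
    mul_comm _ (algebraMap ℝ R _), ← Algebra.smul_def, ← add_smul, smul_add, smul_smul]
  rw [show 1 / (2 * (n : ℝ)) * (((n + 1 : ℕ) : ℝ) - 2 + ((n : ℝ) + 1)) = 1 by
      push_cast; field_simp; ring, one_smul]

/-- In dimension two the Schouten tensor is pure trace by convention, so only the trace of E can
appear there. -/
theorem schoutenOf_conformal (hG : IsUnit G.det) (hn : 1 ≤ n) {ρ : R} (hρ : IsUnit ρ)
    (E : Matrix (Fin (n + 1)) (Fin (n + 1)) R) :
    schoutenOf (ρ • G) (Ric + ((((n + 1 : ℕ) : ℝ) - 2) • E + (G⁻¹ * E).trace • G)) =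
      if n = 1 then schoutenOf G Ric + (1 / 2 : ℝ) • (G⁻¹ * E).trace • G
      else schoutenOf G Ric + E := by
  have ht := traceSchoutenOf_conformal (Ric := Ric) hG hn hρ E
  rw [schoutenOf, schoutenOf]
  split_ifs with h
  · rw [smul_smul, mul_comm, ht, add_smul, smul_add]
  · have hn1 : (n : ℝ) - 1 ≠ 0 := sub_ne_zero.2 (by exact_mod_cast h)
    rw [smul_smul, mul_comm, ht, add_smul, show ((n + 1 : ℕ) : ℝ) - 2 = (n : ℝ) - 1 by
      push_cast; ring]
    have : Ric + (((n : ℝ) - 1) • E + (G⁻¹ * E).trace • G)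
        - (traceSchoutenOf G Ric • G + (G⁻¹ * E).trace • G) =
        (Ric - traceSchoutenOf G Ric • G) + ((n : ℝ) - 1) • E := by abel
    rw [this, smul_add, smul_smul, one_div_mul_cancel hn1, one_smul]

end AbstractSchouten

/-! ## Curvature of a metric on the half-space -/

section Bridge

variable {n : ℕ} {O : Opens (Coord n)}

/-- A matrix of smooth functions, as a matrix over the algebra of smooth functions. -/
def liftMat (O : Opens (Coord n)) {κ μ : Type*} (G : Coord n → Matrix κ μ ℝ)
    (hG : ∀ i j, ContDiffOn ℝ ∞ (fun y => G y i j) (half O)) : Matrix κ μ (smoothFun O) :=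
  Matrix.of fun i j => toSmooth (fun y => G y i j) (hG i j)

theorem matrix_ext_evalAt {κ μ : Type*} {M N : Matrix κ μ (smoothFun O)}
    (h : ∀ y, M.map (evalAt y) = N.map (evalAt y)) : M = N :=
  Matrix.ext fun i j => smoothFun_ext fun y => congrFun (congrFun (h y) i) j

theorem evalAt_det {κ : Type*} [Fintype κ] [DecidableEq κ] (M : Matrix κ κ (smoothFun O))
    (y : half O) : evalAt y M.det = (M.map (evalAt y)).det := by
  have := RingHom.map_det (evalAt y : smoothFun O →+* ℝ) M
  simpa using this

/-- A smooth Riemannian metric on a relatively open subset of the half-space. -/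
structure IsMetricOn (O : Opens (Coord n)) (G : Coord n → Matrix (Fin (n + 1)) (Fin (n + 1)) ℝ) :
    Prop where
  smooth : ∀ i j, ContDiffOn ℝ ∞ (fun y => G y i j) (half O)
  posDef : ∀ y ∈ half O, (G y).PosDef

variable {G : Coord n → Matrix (Fin (n + 1)) (Fin (n + 1)) ℝ} (hG : IsMetricOn O G)

namespace IsMetricOn

include hG in
theorem isSymm {y : Coord n} (hy : y ∈ half O) : (G y).IsSymm := by
  have := (hG.posDef y hy).isHermitian
  rwa [Matrix.IsHermitian, Matrix.conjTranspose_eq_transpose_of_trivial] at this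

/-- The metric as a matrix over the algebra of smooth functions. -/
def mat : Matrix (Fin (n + 1)) (Fin (n + 1)) (smoothFun O) := liftMat O G hG.smooth

theorem map_mat (y : half O) : hG.mat.map (evalAt y) = G y := rfl

theorem isUnit_det : IsUnit hG.mat.det :=
  isUnit_smoothFun fun y => by
    rw [evalAt_det, map_mat]; exact (hG.posDef y y.2).det_pos.ne'

theorem mat_isSymm : hG.mat.IsSymm :=
  matrix_ext_evalAt fun y => by
    rw [Matrix.transpose_map, map_mat, (hG.isSymm y.2).eq]

theorem map_inv (y : half O) : hG.mat⁻¹.map (evalAt y) = (G y)⁻¹ := by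
  have := map_nonsing_inv (evalAt y : smoothFun O →+* ℝ) hG.mat hG.isUnit_det
  simp only [RingHom.coe_coe] at this
  rw [this, map_mat]

/-- The Levi-Civita connection over the algebra of smooth functions. -/
def conn : Fin (n + 1) → Matrix (Fin (n + 1)) (Fin (n + 1)) (smoothFun O) :=
  chris (coordDer O) hG.mat

theorem isLeviCivita : IsLeviCivita (coordDer O) hG.mat hG.conn :=
  isLeviCivita_chris hG.isUnit_det hG.mat_isSymm

theorem christoffel_eq (k i j : Fin (n + 1)) (y : half O) :
    christoffel G k i j y = evalAt y (hG.conn i k j) := by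
  simp only [christoffel, conn, chris, Matrix.of_apply, map_smul, map_sum, map_mul, map_sub,
    map_add, smul_eq_mul]
  congr 1
  refine Finset.sum_congr rfl fun l _ => ?_
  rw [← hG.map_inv y, partialDeriv_eq (F := fun z => G z j l) (f := hG.mat j l) (fun y => rfl),
    partialDeriv_eq (F := fun z => G z i l) (f := hG.mat i l) (fun y => rfl),
    partialDeriv_eq (F := fun z => G z i j) (f := hG.mat i j) (fun y => rfl)]
  rfl

theorem riemann_eq (l k i j : Fin (n + 1)) (y : half O) :
    riemann G l k i j y = evalAt y (curv (coordDer O) hG.conn k i l j) := by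
  rw [riemann, partialDeriv_eq (fun y => hG.christoffel_eq l i j y),
    partialDeriv_eq (fun y => hG.christoffel_eq l k j y)]
  simp only [hG.christoffel_eq, curv, Matrix.add_apply, Matrix.sub_apply, Matrix.map_apply,
    Matrix.mul_apply, map_add, map_sub, map_sum, map_mul, Finset.sum_sub_distrib]

/-- The Ricci tensor over the algebra of smooth functions. -/
def ricMat : Matrix (Fin (n + 1)) (Fin (n + 1)) (smoothFun O) := ric (coordDer O) hG.conn

theorem map_ricMat (y : half O) : hG.ricMat.map (evalAt y) = ricci G y :=
  Matrix.ext fun i j => by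
    simp only [ricMat, ric, ricci, Matrix.map_apply, Matrix.of_apply, map_sum, hG.riemann_eq]

theorem ricMat_isSymm : hG.ricMat.IsSymm := hG.isLeviCivita.ric_symm hG.isUnit_det coordDer_comm

/-- The Schouten tensor over the algebra of smooth functions. -/
def schoutenMat : Matrix (Fin (n + 1)) (Fin (n + 1)) (smoothFun O) := schoutenOf hG.mat hG.ricMat

theorem schoutenMat_isSymm : hG.schoutenMat.IsSymm :=
  schoutenOf_isSymm hG.mat_isSymm hG.ricMat_isSymm

end IsMetricOn

theorem schouten_eq_schoutenOf (y : Coord n) : schouten G y = schoutenOf (G y) (ricci G y) := by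
  have h : traceSchouten G y = traceSchoutenOf (G y) (ricci G y) := by
    rw [traceSchouten, traceSchoutenOf, smul_eq_mul, div_eq_inv_mul, one_div]
  rw [schouten, schoutenOf, h]
  split_ifs
  · rw [smul_smul]; congr 1; ring
  · rfl

theorem IsMetricOn.map_schoutenMat (y : half O) : hG.schoutenMat.map (evalAt y) = schouten G y := by
  rw [IsMetricOn.schoutenMat, map_schoutenOf _ hG.isUnit_det, hG.map_mat, hG.map_ricMat,
    schouten_eq_schoutenOf]

namespace IsMetricOn

include hG in
theorem inv_zero_zero_pos {y : Coord n} (hy : y ∈ half O) : 0 < (G y)⁻¹ 0 0 :=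
  (hG.posDef y hy).inv.diag_pos

include hG in
theorem tangential_posDef {y : Coord n} (hy : y ∈ half O) : (tangential (G y)).PosDef :=
  (hG.posDef y hy).submatrix (Fin.succ_injective n)

theorem isUnit_det_tang : IsUnit (tang hG.mat).det :=
  isUnit_smoothFun fun y => by
    rw [evalAt_det]; exact (hG.tangential_posDef y.2).det_pos.ne'

include hG in
theorem contDiffOn_inv (i j : Fin (n + 1)) : ContDiffOn ℝ ∞ (fun y => (G y)⁻¹ i j) (half O) :=
  (contDiffOn_extFun (hG.mat⁻¹ i j)).congr fun y hy => by
    rw [extFun_apply _ hy, ← hG.map_inv ⟨y, hy⟩]; rfl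

include hG in
theorem contDiffOn_lapse : ContDiffOn ℝ ∞ (fun y => Real.sqrt ((G y)⁻¹ 0 0)) (half O) :=
  (hG.contDiffOn_inv 0 0).sqrt fun _ hy => (hG.inv_zero_zero_pos hy).ne'

/-- The function `ν = (g^{00})^{1/2}`. -/
def lapse : smoothFun O := toSmooth _ hG.contDiffOn_lapse

theorem evalAt_lapse (y : half O) : evalAt y hG.lapse = Real.sqrt ((G y)⁻¹ 0 0) := rfl

theorem lapse_pos (y : half O) : 0 < evalAt y hG.lapse :=
  Real.sqrt_pos.2 (hG.inv_zero_zero_pos y.2)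

theorem isUnit_lapse : IsUnit hG.lapse := isUnit_smoothFun fun y => (hG.lapse_pos y).ne'

theorem lapse_mul_self : hG.lapse * hG.lapse = hG.mat⁻¹ 0 0 :=
  smoothFun_ext fun y => by
    rw [map_mul, evalAt_lapse, Real.mul_self_sqrt (hG.inv_zero_zero_pos y.2).le]
    exact (congrFun (congrFun (hG.map_inv y) 0) 0).symm

/-- The second fundamental form of the hypersurfaces `y 0 = const`. -/
def sffMat : Matrix (Fin n) (Fin n) (smoothFun O) :=
  Matrix.of fun a b => hG.isUnit_lapse.unit⁻¹.1 * hG.conn a.succ 0 b.succ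

theorem conn_zero (a b : Fin n) : hG.conn a.succ 0 b.succ = hG.lapse * hG.sffMat a b := by
  rw [sffMat, Matrix.of_apply, ← mul_assoc]
  simp

/-- Differentiate g(η, ∂_b) = 0 along the hypersurface: g(∇_a η, ∂_b) = -g(η, ∇_a ∂_b), and the
right-hand side is Γ⁰_{ab} / ν because g(η, ·) = -dy⁰/ν. The algebraic form Γ⁰ = ν A thus agrees
with the definition of A. -/
theorem map_sffMat (y : half O) : hG.sffMat.map (evalAt y) = secondFundForm G y := by
  refine Matrix.ext fun a b => ?_
  set η : Fin (n + 1) → smoothFun O := fun i => -(hG.mat⁻¹ i 0) * hG.isUnit_lapse.unit⁻¹.1 with hη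
  have hνinv : ∀ y, evalAt y hG.isUnit_lapse.unit⁻¹.1 = (Real.sqrt ((G y)⁻¹ 0 0))⁻¹ := by
    intro y
    refine eq_inv_of_mul_eq_one_left ?_
    rw [← hG.evalAt_lapse, ← map_mul]
    simp
  have hηe : ∀ i (y : half O), unitNormal G i y = evalAt y (η i) := by
    intro i y
    rw [unitNormal, hη, map_mul, hνinv, map_neg, ← hG.map_inv y, div_eq_mul_inv]
    rfl
  have hGη : ∀ b : Fin (n + 1), ∑ i, hG.mat i b * η i =
      -((1 : Matrix (Fin (n + 1)) (Fin (n + 1)) (smoothFun O)) b 0 * hG.isUnit_lapse.unit⁻¹.1) := by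
    intro b
    rw [← Matrix.mul_nonsing_inv _ hG.isUnit_det, Matrix.mul_apply, Finset.sum_mul,
      ← Finset.sum_neg_distrib]
    refine Finset.sum_congr rfl fun i _ => ?_
    rw [hη, hG.mat_isSymm.apply b i]; ring
  have h0 : ∑ i, hG.mat i b.succ * η i = 0 := by
    rw [hGη, Matrix.one_apply_ne (Fin.succ_ne_zero b)]; simp
  have h1 := congrArg (coordDer O a.succ) h0
  simp only [map_sum, map_zero, Derivation.leibniz, smul_eq_mul, Finset.sum_add_distrib] at h1
  have h2 : ∀ i, coordDer O a.succ (hG.mat i b.succ) =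
      ∑ p, hG.conn a.succ p i * hG.mat p b.succ + ∑ p, hG.mat i p * hG.conn a.succ p b.succ := by
    intro i
    have := congrFun (congrFun (hG.isLeviCivita.compat a.succ) i) b.succ
    simpa only [Matrix.map_apply, Matrix.add_apply, Matrix.mul_apply, Matrix.transpose_apply]
      using this
  have h3 : ∑ i, η i * coordDer O a.succ (hG.mat i b.succ) =
      ∑ i, hG.mat i b.succ * ∑ j, hG.conn a.succ i j * η j - hG.sffMat a b := by
    simp only [h2, mul_add, Finset.sum_add_distrib, Finset.mul_sum]
    have e1 : ∑ i, ∑ p, η i * (hG.mat i p * hG.conn a.succ p b.succ) = -hG.sffMat a b := by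
      rw [Finset.sum_comm]
      have e2 : ∀ p, ∑ i, η i * (hG.mat i p * hG.conn a.succ p b.succ) =
          (∑ i, hG.mat i p * η i) * hG.conn a.succ p b.succ := fun p => by
        rw [Finset.sum_mul]; exact Finset.sum_congr rfl fun i _ => by ring
      simp only [e2, hGη]
      rw [Finset.sum_eq_single 0 (fun p _ hp => by rw [Matrix.one_apply_ne hp]; simp) (by simp)]
      simp [sffMat]
      ring
    rw [e1, Finset.sum_comm, sub_eq_add_neg]
    congr 1
    exact Finset.sum_congr rfl fun i _ => Finset.sum_congr rfl fun j _ => by ring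
  rw [Matrix.map_apply, secondFundForm, Matrix.of_apply]
  have h4 : hG.sffMat a b = ∑ i, hG.mat i b.succ * (coordDer O a.succ (η i)
      + ∑ j, hG.conn a.succ i j * η j) := by
    simp only [mul_add, Finset.sum_add_distrib]
    linear_combination h3 - h1
  rw [h4]
  simp only [map_sum, map_mul, map_add]
  refine Finset.sum_congr rfl fun i _ => ?_
  rw [partialDeriv_eq (hηe i)]
  simp only [hG.christoffel_eq, hηe]
  rfl

end IsMetricOn

end Bridge

end

section

open TopologicalSpace (Opens)
open Polynomial (C X coeff_C_mul)

/-! ### Homogeneity of σ_k and H_k, and their expression through pencils. -/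

section SigmaAlgebra

variable {D : ℕ}

theorem mixedSigma_smul (m ℓ : ℕ) (hℓ : ℓ ≤ m) (a b : ℝ) (B E : Matrix (Fin D) (Fin D) ℝ) :
    mixedSigma m ℓ (a • B) (b • E) = a ^ ℓ * b ^ (m - ℓ) * mixedSigma m ℓ B E := by
  have hp : ∀ i j : Fin m → Fin D,
      (∏ x : Fin m, if (x : ℕ) < ℓ then (a • B) (i x) (j x) else (b • E) (i x) (j x)) =
      a ^ ℓ * b ^ (m - ℓ) *
        ∏ x : Fin m, if (x : ℕ) < ℓ then B (i x) (j x) else E (i x) (j x) := by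
    intro i j
    have h1 : ∀ x : Fin m, (if (x : ℕ) < ℓ then (a • B) (i x) (j x) else (b • E) (i x) (j x)) =
        (if (x : ℕ) < ℓ then a else b) * if (x : ℕ) < ℓ then B (i x) (j x) else E (i x) (j x) := by
      intro x; split_ifs <;> simp
    have h2 : (∏ x : Fin m, if (x : ℕ) < ℓ then a else b) = a ^ ℓ * b ^ (m - ℓ) := by
      rw [Finset.prod_ite, Finset.prod_const, Finset.prod_const]
      have c1 : (Finset.univ.filter fun x : Fin m => (x : ℕ) < ℓ).card = ℓ := by
        rw [Fin.card_filter_val_lt, min_eq_right hℓ]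
      have c2 : (Finset.univ.filter fun x : Fin m => ¬ (x : ℕ) < ℓ).card = m - ℓ := by
        have := Finset.card_filter_add_card_filter_not (s := (Finset.univ : Finset (Fin m)))
          (fun x : Fin m => (x : ℕ) < ℓ)
        rw [c1, Finset.card_univ, Fintype.card_fin] at this
        omega
      rw [c1, c2]
    simp only [h1, Finset.prod_mul_distrib, h2]
  simp only [mixedSigma, hp, Finset.mul_sum]
  exact Finset.sum_congr rfl fun i _ => Finset.sum_congr rfl fun j _ => by ring

theorem sigma_smul (m : ℕ) (a : ℝ) (B : Matrix (Fin D) (Fin D) ℝ) :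
    sigma m (a • B) = a ^ m * sigma m B := by
  rw [sigma, mixedSigma_smul m m le_rfl, Nat.sub_self, pow_zero, mul_one, sigma]

theorem mixedSigma_zero_left (m : ℕ) (B B' E : Matrix (Fin D) (Fin D) ℝ) :
    mixedSigma m 0 B E = mixedSigma m 0 B' E := by
  simp [mixedSigma]

theorem sigma_one (B : Matrix (Fin D) (Fin D) ℝ) : sigma 1 B = B.trace := by
  rw [sigma, mixedSigma_eq_sum_det]
  simp only [Matrix.det_fin_one, Matrix.of_apply]
  rw [← (Equiv.funUnique (Fin 1) (Fin D)).symm.sum_comp]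
  simp [Matrix.trace]

theorem pencil_eq_mul {ι : Type*} [Fintype ι] [DecidableEq ι] {A : Type*} [CommRing A] [Algebra ℝ A]
    (G M : Matrix ι ι A) (hG : IsUnit G.det) :
    pencil G M = G.map C * pencil 1 (G⁻¹ * M) := by
  have h1 : (1 : Matrix ι ι A).map C = 1 := Matrix.map_one _ (map_zero C) (map_one C)
  have h2 : G.map (C : A →+* Polynomial A) * (G⁻¹ * M).map (C : A →+* Polynomial A) = M.map C := by
    rw [← Matrix.map_mul, ← mul_assoc, Matrix.mul_nonsing_inv _ hG, one_mul]
  rw [pencil, pencil, mul_add, h1, h2, Matrix.mul_smul, mul_one]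

theorem det_pencil_eq {ι : Type*} [Fintype ι] [DecidableEq ι] {A : Type*} [CommRing A] [Algebra ℝ A]
    (G M : Matrix ι ι A) (hG : IsUnit G.det) :
    (pencil G M).det = C G.det * (pencil 1 (G⁻¹ * M)).det := by
  rw [pencil_eq_mul G M hG, Matrix.det_mul]
  congr 1
  exact (RingHom.map_det (C : A →+* Polynomial A) G).symm

theorem det_pencil2_eq {ι : Type*} [Fintype ι] [DecidableEq ι] {A : Type*} [CommRing A] [Algebra ℝ A]
    (G M E : Matrix ι ι A) (hG : IsUnit G.det) :
    (pencil2 G M E).det = C (C G.det) * (pencil2 1 (G⁻¹ * M) (G⁻¹ * E)).det := by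
  have h1 : (1 : Matrix ι ι A).map C = 1 := Matrix.map_one _ (map_zero C) (map_one C)
  have hinv : (G.map (C : A →+* Polynomial A))⁻¹ = G⁻¹.map (C : A →+* Polynomial A) :=
    (map_nonsing_inv (C : A →+* Polynomial A) G hG).symm
  have h2 : (G.map (C : A →+* Polynomial A)).det = C G.det := (RingHom.map_det (C : A →+* Polynomial A) G).symm
  rw [pencil2, det_pencil_eq _ _ (isUnit_det_map_C hG), pencil2, h1]
  change C (G.map (C : A →+* Polynomial A)).det * (pencil 1 ((G.map (C : A →+* Polynomial A))⁻¹ *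
    (M.map (C : A →+* Polynomial A) + (X : Polynomial A) • E.map (C : A →+* Polynomial A)))).det = _
  rw [h2, hinv, mul_add, Matrix.mul_smul, ← Matrix.map_mul, ← Matrix.map_mul]

theorem sigma_inv_mul {n k m : ℕ} (hN : n + 1 = 2 * k + m)
    {G : Matrix (Fin (n + 1)) (Fin (n + 1)) ℝ} (hG : G.det ≠ 0)
    (M : Matrix (Fin (n + 1)) (Fin (n + 1)) ℝ) :
    sigma k (G⁻¹ * M) = G.det⁻¹ * (pencil G M).det.coeff (m + k) := by
  rw [sigma_eq_coeff (by omega), det_pencil_eq G M (isUnit_iff_ne_zero.2 hG), coeff_C_mul,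
    inv_mul_cancel_left₀ hG, show n + 1 - k = m + k by omega]

/-- The boundary curvature as a function of the endomorphisms `B` and `E`. -/
def hSum {n : ℕ} (k : ℕ) (B E : Matrix (Fin n) (Fin n) ℝ) : ℝ :=
  ∑ j ∈ Finset.range k,
    (((2 * k - j - 1).factorial : ℝ) * ((n + 1 - 2 * k + j).factorial : ℝ) /
      (((n + 1 - k).factorial : ℝ) * ((2 * k - 2 * j - 1).doubleFactorial : ℝ)
        * (j.factorial : ℝ))) * mixedSigma (2 * k - j - 1) j B E

theorem hSum_eq {n k m : ℕ} (hN : n + 1 = 2 * k + m)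
    {G : Matrix (Fin n) (Fin n) ℝ} (hG : G.det ≠ 0) (B E : Matrix (Fin n) (Fin n) ℝ) :
    hSum k (G⁻¹ * B) (G⁻¹ * E) = G.det⁻¹ * hFun m k (pencil2 G B E).det := by
  rw [det_pencil2_eq G B E (isUnit_iff_ne_zero.2 hG), hFun_CC_mul, inv_mul_cancel_left₀ hG, hSum]
  obtain rfl : n = 2 * k + m - 1 := by omega
  rw [← sum_mixedSigma_eq_hFun]
  have h1 : 2 * k + m - 1 + 1 - 2 * k = m := by omega
  have h2 : 2 * k + m - 1 + 1 - k = m + k := by omega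
  rw [h1, h2]

/-- Each term has total weight 2j + (2k - 2j - 1) when B has weight two and E weight one. -/
theorem hSum_smul {n k : ℕ} (a : ℝ) (B E : Matrix (Fin n) (Fin n) ℝ) :
    hSum k (a ^ 2 • B) (a • E) = a ^ (2 * k - 1) * hSum k B E := by
  rw [hSum, hSum, Finset.mul_sum]
  refine Finset.sum_congr rfl fun j hj => ?_
  have hj' := Finset.mem_range.1 hj
  rw [mixedSigma_smul _ _ (by omega), ← pow_mul, ← pow_add,
    show 2 * j + (2 * k - j - 1 - j) = 2 * k - 1 by omega]
  ring

/-- For k = 1 only σ_{1,0} occurs. This disposes of dimension two, where P obeys a different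
conformal law. -/
theorem hSum_one {n : ℕ} (B B' E : Matrix (Fin n) (Fin n) ℝ) : hSum 1 B E = hSum 1 B' E := by
  rw [hSum, hSum, Finset.sum_range_one, Finset.sum_range_one, mixedSigma_zero_left _ B B']

end SigmaAlgebra

/-! ### The curvature densities of a conformal metric. -/

section Conformal

variable {n : ℕ} {O : Opens (Coord n)}

/-- `σ_k(g⁻¹ P)` in coordinates. -/
def locSigma (k : ℕ) (G : Coord n → Matrix (Fin (n + 1)) (Fin (n + 1)) ℝ) (y : Coord n) : ℝ :=
  sigma k ((G y)⁻¹ * schouten G y)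

/-- The boundary curvature `H_k` in coordinates. -/
def locH (k : ℕ) (G : Coord n → Matrix (Fin (n + 1)) (Fin (n + 1)) ℝ) (y : Coord n) : ℝ :=
  hSum k ((tangential (G y))⁻¹ * tangential (schouten G y))
    ((tangential (G y))⁻¹ * secondFundForm G y)

/-- The Hessian of a function in coordinates. -/
def locHess (G : Coord n → Matrix (Fin (n + 1)) (Fin (n + 1)) ℝ) (w : Coord n → ℝ) (y : Coord n) :
    Matrix (Fin (n + 1)) (Fin (n + 1)) ℝ :=
  Matrix.of fun i j => partialDeriv i (partialDeriv j w) y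
    - ∑ k, christoffel G k i j y * partialDeriv k w y

/-- The change of the Schouten tensor under the conformal change `e^{2w}`. -/
def locConf (G : Coord n → Matrix (Fin (n + 1)) (Fin (n + 1)) ℝ) (w : Coord n → ℝ) (y : Coord n) :
    Matrix (Fin (n + 1)) (Fin (n + 1)) ℝ :=
  -locHess G w y + (Matrix.of fun i j => partialDeriv i w y * partialDeriv j w y)
    - ((1 / 2) * ∑ p, ∑ q, (G y)⁻¹ p q * (partialDeriv p w y * partialDeriv q w y)) • G y

/-- The derivative in the direction of the unit normal. -/
def locEta (G : Coord n → Matrix (Fin (n + 1)) (Fin (n + 1)) ℝ) (w : Coord n → ℝ) (y : Coord n) :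
    ℝ :=
  -(Real.sqrt ((G y)⁻¹ 0 0) * normalPart (G y) fun i => partialDeriv i w y)

theorem partialDeriv_exp {w : Coord n → ℝ} (hw : ContDiffOn ℝ ∞ w (half O)) {y : Coord n}
    (hy : y ∈ half O) (i : Fin (n + 1)) :
    partialDeriv i (fun y => Real.exp (2 * w y)) y =
      2 * Real.exp (2 * w y) * partialDeriv i w y := by
  have h1 := (differentiableWithinAt_half hw hy).hasFDerivWithinAt
  have h2 := (h1.const_mul 2).exp
  rw [partialDeriv, h2.fderivWithin (uniqueDiffOn_halfSpace y hy.1)]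
  simp only [_root_.smul_apply, smul_eq_mul, partialDeriv]
  ring

variable {G : Coord n → Matrix (Fin (n + 1)) (Fin (n + 1)) ℝ} (hG : IsMetricOn O G)

namespace IsMetricOn

theorem map_hess {w : Coord n → ℝ} (hw : ContDiffOn ℝ ∞ w (half O)) (y : half O) :
    (hess (coordDer O) hG.conn (toSmooth w hw)).map (evalAt y) = locHess G w y := by
  have h1 : ∀ i (y : half O), partialDeriv i w y = evalAt y (coordDer O i (toSmooth w hw)) :=
    fun i y => (evalAt_coordDer_toSmooth i w hw y).symm
  refine Matrix.ext fun i j => ?_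
  simp only [hess, locHess, Matrix.map_apply, Matrix.of_apply, map_sub, map_sum, map_mul,
    hG.christoffel_eq, h1]
  rw [partialDeriv_eq (h1 j)]

theorem map_confSchouten {w : Coord n → ℝ} (hw : ContDiffOn ℝ ∞ w (half O)) (y : half O) :
    (confSchouten (coordDer O) hG.mat hG.conn (toSmooth w hw)).map (evalAt y) =
      locConf G w y := by
  have h1 : ∀ i (y : half O), partialDeriv i w y = evalAt y (coordDer O i (toSmooth w hw)) :=
    fun i y => (evalAt_coordDer_toSmooth i w hw y).symm
  refine Matrix.ext fun i j => ?_
  have h2 := congrFun (congrFun (hG.map_hess hw y) i) j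
  simp only [Matrix.map_apply] at h2
  simp only [confSchouten, locConf, Matrix.map_apply, Matrix.of_apply, Matrix.sub_apply,
    Matrix.add_apply, Matrix.neg_apply, Matrix.smul_apply, map_sub, map_add, map_neg, map_mul,
    map_smul, map_sum, h2, h1, grad, smul_eq_mul, Finset.mul_sum, Finset.sum_mul]
  congr 1
  refine Finset.sum_congr rfl fun p _ => Finset.sum_congr rfl fun q _ => ?_
  rw [← hG.map_inv y]
  simp only [Matrix.map_apply]
  rw [show evalAt y (hG.mat i j) = G y i j from rfl]
  ring

theorem map_shift (y : half O) (a : Fin n) : evalAt y (shift hG.mat a) = shift (G y) a := by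
  have h := map_nonsing_inv (evalAt y : smoothFun O →+* ℝ) (tang hG.mat) hG.isUnit_det_tang
  simp only [RingHom.coe_coe] at h
  simp only [shift, map_sum, map_mul]
  refine Finset.sum_congr rfl fun b _ => ?_
  have h2 := congrFun (congrFun h a) b
  rw [Matrix.map_apply] at h2
  rw [h2]; rfl

theorem map_normalPart {w : Coord n → ℝ} (hw : ContDiffOn ℝ ∞ w (half O)) (y : half O) :
    evalAt y (normalPart hG.mat fun i => coordDer O i (toSmooth w hw)) =
      normalPart (G y) fun i => partialDeriv i w y := by
  simp only [normalPart, map_sub, map_sum, map_mul, hG.map_shift, evalAt_coordDer_toSmooth]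

include hG in
theorem conformal {w : Coord n → ℝ} (hw : ContDiffOn ℝ ∞ w (half O)) :
    IsMetricOn O fun y => Real.exp (2 * w y) • G y where
  smooth i j := by
    have := ((contDiffOn_const (c := (2 : ℝ))).mul hw).exp.mul (hG.smooth i j)
    exact this
  posDef y hy := (hG.posDef y hy).smul (Real.exp_pos _)

variable {w : Coord n → ℝ} (hw : ContDiffOn ℝ ∞ w (half O))

theorem conn_conformal : (hG.conformal hw).conn =
    fun i => hG.conn i + confConn (coordDer O) hG.mat (toSmooth w hw) i := by
  set ρ : smoothFun O := toSmooth (fun y => Real.exp (2 * w y))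
    ((contDiffOn_const (c := (2 : ℝ))).mul hw).exp
  have hmat : (hG.conformal hw).mat = ρ • hG.mat := rfl
  have h1 := isLeviCivita_conformal (ρ := ρ) (w := toSmooth w hw) hG.isUnit_det hG.mat_isSymm
    hG.isLeviCivita (fun i => smoothFun_ext fun y => by
      rw [evalAt_coordDer_toSmooth, partialDeriv_exp hw y.2, map_mul, map_mul,
        evalAt_coordDer_toSmooth, map_ofNat]
      rfl)
  rw [← hmat] at h1
  exact (hG.conformal hw).isLeviCivita.unique (hG.conformal hw).isUnit_det h1
    (hG.conformal hw).mat_isSymm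

include hG hw in
theorem schouten_conformal (hn : 1 ≤ n) {y : Coord n} (hy : y ∈ half O) :
    schouten (fun y => Real.exp (2 * w y) • G y) y =
      if n = 1 then schouten G y + (1 / 2 : ℝ) • ((G y)⁻¹ * locConf G w y).trace • G y
      else schouten G y + locConf G w y := by
  set ρ : smoothFun O := toSmooth (fun y => Real.exp (2 * w y))
    ((contDiffOn_const (c := (2 : ℝ))).mul hw).exp
  have hρ : IsUnit ρ := isUnit_smoothFun fun y => (Real.exp_pos _).ne'
  have hmat : (hG.conformal hw).mat = ρ • hG.mat := rfl
  have h1 := (hG.conformal hw).map_schoutenMat ⟨y, hy⟩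
  have hric : (hG.conformal hw).ricMat = hG.ricMat + _ :=
    (congrArg (ric (coordDer O)) (hG.conn_conformal hw)).trans
      (ric_conformal hG.isUnit_det hG.mat_isSymm hG.isLeviCivita coordDer_comm (toSmooth w hw))
  rw [schoutenMat, hmat, hric, schoutenOf_conformal hG.isUnit_det hn hρ] at h1
  rw [← h1]
  have h2 := hG.map_confSchouten hw ⟨y, hy⟩
  have h3 := hG.map_schoutenMat ⟨y, hy⟩
  have hadd : ∀ A B : Matrix (Fin (n + 1)) (Fin (n + 1)) (smoothFun O),
      (A + B).map (evalAt ⟨y, hy⟩) = A.map (evalAt ⟨y, hy⟩) + B.map (evalAt ⟨y, hy⟩) :=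
    fun A B => Matrix.map_add _ (map_add _) A B
  split_ifs with h
  · rw [hadd, ← schoutenMat, h3]
    congr 1
    refine Matrix.ext fun i j => ?_
    have h4 := hG.map_inv ⟨y, hy⟩
    simp only [Matrix.map_apply, Matrix.smul_apply, map_smul, smul_eq_mul, map_mul]
    rw [show evalAt ⟨y, hy⟩ (hG.mat i j) = G y i j from rfl]
    congr 2
    rw [← h2, ← h4]
    simp [Matrix.trace, Matrix.mul_apply]
  · rw [hadd, ← schoutenMat, h3, h2]

include hG in
theorem christoffel_zero {y : Coord n} (hy : y ∈ half O) (a b : Fin n) :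
    christoffel G 0 a.succ b.succ y = Real.sqrt ((G y)⁻¹ 0 0) * secondFundForm G y a b := by
  rw [hG.christoffel_eq 0 a.succ b.succ ⟨y, hy⟩, hG.conn_zero, map_mul, hG.evalAt_lapse,
    ← hG.map_sffMat ⟨y, hy⟩]
  rfl

theorem exp_sqrt (x a : ℝ) : Real.sqrt ((Real.exp (2 * x))⁻¹ * a) = Real.exp (-x) * Real.sqrt a := by
  rw [← Real.exp_neg, Real.sqrt_mul (Real.exp_pos _).le, show -(2 * x) = -x + -x by ring,
    Real.exp_add, Real.sqrt_mul_self (Real.exp_pos _).le]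

theorem inv_exp_smul {ι : Type*} [Fintype ι] [DecidableEq ι] (x : ℝ) (M : Matrix ι ι ℝ) :
    (Real.exp (2 * x) • M)⁻¹ = (Real.exp (2 * x))⁻¹ • M⁻¹ := by
  by_cases h : IsUnit M.det
  · refine Matrix.inv_eq_left_inv ?_
    rw [Matrix.smul_mul, Matrix.mul_smul, smul_smul, inv_mul_cancel₀ (Real.exp_pos _).ne', one_smul,
      Matrix.nonsing_inv_mul _ h]
  · have h2 : ¬ IsUnit (Real.exp (2 * x) • M).det := by
      rw [Matrix.det_smul]
      intro h3
      exact h (isUnit_of_mul_isUnit_right h3)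
    rw [Matrix.nonsing_inv_apply_not_isUnit _ h, Matrix.nonsing_inv_apply_not_isUnit _ h2, smul_zero]

include hG hw in
-- Read off from Γ⁰ = ν A in both metrics: ν is multiplied by e^{-w}, and the difference of the
-- connections contributes ν η(w) ḡ to Γ⁰.
theorem secondFundForm_conformal {y : Coord n} (hy : y ∈ half O) :
    secondFundForm (fun y => Real.exp (2 * w y) • G y) y =
      Real.exp (w y) • (secondFundForm G y + locEta G w y • tangential (G y)) := by
  refine Matrix.ext fun a b => ?_
  have h1 := (hG.conformal hw).christoffel_zero hy a b
  have hν := Real.sqrt_pos.2 (hG.inv_zero_zero_pos hy)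
  rw [(hG.conformal hw).christoffel_eq 0 a.succ b.succ ⟨y, hy⟩,
    show (hG.conformal hw).conn a.succ = _ from congrFun (hG.conn_conformal hw) a.succ,
    Matrix.add_apply, map_add, ← hG.christoffel_eq, hG.christoffel_zero hy] at h1
  have h2 : evalAt ⟨y, hy⟩ (confConn (coordDer O) hG.mat (toSmooth w hw) a.succ 0 b.succ) =
      -(G y a.succ b.succ * ((Real.sqrt ((G y)⁻¹ 0 0) * Real.sqrt ((G y)⁻¹ 0 0))
        * normalPart (G y) fun i => partialDeriv i w y)) := by
    rw [confConn, Matrix.of_apply, Matrix.one_apply_ne (Fin.succ_ne_zero a).symm,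
      Matrix.one_apply_ne (Fin.succ_ne_zero b).symm, grad,
      sum_inv_zero hG.isUnit_det hG.mat_isSymm hG.isUnit_det_tang, ← hG.lapse_mul_self,
      zero_mul, zero_mul, zero_add, zero_sub, map_neg, map_mul, map_mul, map_mul, hG.evalAt_lapse,
      hG.map_normalPart hw]
    rfl
  rw [h2, inv_exp_smul, Matrix.smul_apply, smul_eq_mul, exp_sqrt, Real.exp_neg] at h1
  simp only [Matrix.smul_apply, Matrix.add_apply, smul_eq_mul, tangential, Matrix.submatrix_apply,
    locEta]
  have he := Real.exp_pos (w y)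
  field_simp at h1
  linear_combination -h1

variable {k m : ℕ} (hk : 1 ≤ k) (hN : n + 1 = 2 * k + m)

include hk hN in
theorem eq_one_of_dim_two (h : n = 1) : k = 1 ∧ m = 0 := by omega

include hG hw hk hN in
-- The volume density scales by e^{Nw} and σ_k by e^{-2kw}, which leaves e^{mw}; the remaining
-- factor is polynomial in the first and second derivatives of w.
theorem locSigma_conformal {y : Coord n} (hy : y ∈ half O) :
    Real.sqrt (Real.exp (2 * w y) • G y).det * locSigma k (fun y => Real.exp (2 * w y) • G y) y =
      Real.exp (m * w y) * ((Real.sqrt (G y).det)⁻¹ *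
        (pencil (G y) (schouten G y + locConf G w y)).det.coeff (m + k)) := by
  have hdet := (hG.posDef y hy).det_pos
  have h1 : locSigma k (fun y => Real.exp (2 * w y) • G y) y = (Real.exp (2 * w y))⁻¹ ^ k *
      sigma k ((G y)⁻¹ * (schouten G y + locConf G w y)) := by
    rw [locSigma, hG.schouten_conformal hw (by omega) hy, inv_exp_smul, Matrix.smul_mul, sigma_smul]
    split_ifs with h
    -- N = 2 forces k = 1, and σ_1 cannot distinguish a tensor from its pure-trace part; hence the
    -- generic formula for P may be used here as well.
    · obtain ⟨rfl, rfl⟩ := eq_one_of_dim_two hk hN h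
      subst h
      rw [sigma_one, sigma_one, mul_add, mul_add, Matrix.trace_add, Matrix.trace_add,
        Matrix.mul_smul, Matrix.mul_smul, Matrix.nonsing_inv_mul _ (isUnit_iff_ne_zero.2 hdet.ne'),
        Matrix.trace_smul, Matrix.trace_smul, Matrix.trace_one, Fintype.card_fin]
      congr 2
      simp
      ring
    · rfl
  have h2 : Real.sqrt (Real.exp (2 * w y) • G y).det =
      Real.exp (w y) ^ (2 * k + m) * Real.sqrt (G y).det := by
    have h4 : Real.exp (2 * w y) ^ (n + 1) = (Real.exp (w y) ^ (2 * k + m)) ^ 2 := by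
      rw [hN, mul_comm (2 : ℝ), Real.exp_mul, Real.rpow_ofNat, ← pow_mul, ← pow_mul, mul_comm 2]
    rw [Matrix.det_smul, Fintype.card_fin, h4, Real.sqrt_mul (by positivity),
      Real.sqrt_sq (by positivity)]
  have h5 : (Real.exp (2 * w y))⁻¹ ^ k = (Real.exp (w y) ^ (2 * k))⁻¹ := by
    rw [inv_pow, mul_comm (2 : ℝ), Real.exp_mul, Real.rpow_ofNat, ← pow_mul]
  rw [h1, h2, h5, sigma_inv_mul hN hdet.ne', Real.exp_nat_mul]
  have hs := Real.sqrt_pos.2 hdet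
  have he := Real.exp_pos (w y)
  have h3 : (G y).det = Real.sqrt (G y).det * Real.sqrt (G y).det :=
    (Real.mul_self_sqrt hdet.le).symm
  rw [show ((G y).det)⁻¹ = (Real.sqrt (G y).det * Real.sqrt (G y).det)⁻¹ by rw [← h3]]
  field_simp
  ring

include hG hw hk hN in
-- The boundary volume contributes e^{(N-1)w} and H_k contributes e^{-(2k-1)w}, so the weight e^{mw}
-- is the same as in the interior.
theorem locH_conformal {y : Coord n} (hy : y ∈ half O) :
    Real.sqrt (tangential (Real.exp (2 * w y) • G y)).det
        * locH k (fun y => Real.exp (2 * w y) • G y) y =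
      Real.exp (m * w y) * ((Real.sqrt (tangential (G y)).det)⁻¹ *
        hFun m k (pencil2 (tangential (G y)) (tangential (schouten G y + locConf G w y))
          (secondFundForm G y + locEta G w y • tangential (G y))).det) := by
  have hdet := (hG.tangential_posDef hy).det_pos
  have htang : tangential (Real.exp (2 * w y) • G y) = Real.exp (2 * w y) • tangential (G y) := rfl
  have hexp : (Real.exp (2 * w y))⁻¹ = (Real.exp (w y))⁻¹ ^ 2 := by
    rw [mul_comm (2 : ℝ), Real.exp_mul, Real.rpow_ofNat, inv_pow]
  have he := Real.exp_pos (w y)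
  have h5 : ∀ M : Matrix (Fin n) (Fin n) ℝ,
      (Real.exp (2 * w y))⁻¹ • Real.exp (w y) • M = (Real.exp (w y))⁻¹ • M := fun M => by
    rw [hexp, smul_smul]
    congr 1
    field_simp
  have h1 : locH k (fun y => Real.exp (2 * w y) • G y) y = (Real.exp (w y))⁻¹ ^ (2 * k - 1) *
      hSum k ((tangential (G y))⁻¹ * tangential (schouten G y + locConf G w y))
        ((tangential (G y))⁻¹ * (secondFundForm G y + locEta G w y • tangential (G y))) := by
    rw [locH, hG.schouten_conformal hw (by omega) hy, hG.secondFundForm_conformal hw hy, htang,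
      inv_exp_smul, Matrix.smul_mul, Matrix.smul_mul, Matrix.mul_smul, h5, hexp, hSum_smul]
    split_ifs with h
    · obtain ⟨rfl, rfl⟩ := eq_one_of_dim_two hk hN h
      rw [hSum_one]
    · rfl
  have h2 : Real.sqrt (Real.exp (2 * w y) • tangential (G y)).det =
      Real.exp (w y) ^ (2 * k - 1 + m) * Real.sqrt (tangential (G y)).det := by
    have h4 : Real.exp (2 * w y) ^ n = (Real.exp (w y) ^ (2 * k - 1 + m)) ^ 2 := by
      rw [mul_comm (2 : ℝ), Real.exp_mul, Real.rpow_ofNat, ← pow_mul, ← pow_mul, mul_comm 2,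
        show 2 * k - 1 + m = n by omega]
    rw [Matrix.det_smul, Fintype.card_fin, h4, Real.sqrt_mul (by positivity),
      Real.sqrt_sq (by positivity)]
  rw [h1, htang, h2, hSum_eq hN hdet.ne', Real.exp_nat_mul]
  have hs := Real.sqrt_pos.2 hdet
  have h3 : (tangential (G y)).det =
      Real.sqrt (tangential (G y)).det * Real.sqrt (tangential (G y)).det :=
    (Real.mul_self_sqrt hdet.le).symm
  rw [show ((tangential (G y)).det)⁻¹ =
    (Real.sqrt (tangential (G y)).det * Real.sqrt (tangential (G y)).det)⁻¹ by rw [← h3], inv_pow]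
  field_simp
  ring

end IsMetricOn

end Conformal

end

section

open TopologicalSpace (Opens)
open Polynomial (C X coeff_C_mul)

/-! ### Determinants of congruent pencils. -/

section DetCongr

variable {ι : Type*} [Fintype ι] [DecidableEq ι] {A : Type*} [CommRing A]

theorem det_pencil_congr (J G M : Matrix ι ι A) :
    (pencil (J * G * Jᵀ) (J * M * Jᵀ)).det = C (J.det * J.det) * (pencil G M).det := by
  have h : pencil (J * G * Jᵀ) (J * M * Jᵀ) =
      J.map (C : A →+* Polynomial A) * pencil G M * (Jᵀ).map (C : A →+* Polynomial A) := by
    have : ∀ B : Matrix ι ι A, (J * B * Jᵀ).map (C : A →+* Polynomial A) =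
        J.map (C : A →+* Polynomial A) * B.map (C : A →+* Polynomial A) *
          (Jᵀ).map (C : A →+* Polynomial A) := fun B => by rw [Matrix.map_mul, Matrix.map_mul]
    rw [pencil, this, this, pencil, mul_add, add_mul, Matrix.mul_smul, Matrix.smul_mul]
  have h1 : ∀ B : Matrix ι ι A, (B.map (C : A →+* Polynomial A)).det = C B.det := fun B =>
    (RingHom.map_det (C : A →+* Polynomial A) B).symm
  rw [h, Matrix.det_mul, Matrix.det_mul, h1, h1, Matrix.det_transpose, map_mul]
  ring

theorem det_pencil2_congr (J G M E : Matrix ι ι A) :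
    (pencil2 (J * G * Jᵀ) (J * M * Jᵀ) (J * E * Jᵀ)).det =
      C (C (J.det * J.det)) * (pencil2 G M E).det := by
  have : ∀ B : Matrix ι ι A, (J * B * Jᵀ).map (C : A →+* Polynomial A) =
        J.map (C : A →+* Polynomial A) * B.map (C : A →+* Polynomial A) *
          (J.map (C : A →+* Polynomial A))ᵀ := fun B => by
    rw [Matrix.map_mul, Matrix.map_mul, Matrix.transpose_map]
  have h1 : (J.map (C : A →+* Polynomial A)).det = C J.det :=
    (RingHom.map_det (C : A →+* Polynomial A) J).symm
  rw [pencil2, this, this, this, ← Matrix.smul_mul, ← Matrix.mul_smul, ← add_mul, ← mul_add,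
    det_pencil_congr, h1, ← map_mul, pencil2]

end DetCongr

/-! ### Transformation laws under changes of coordinates of the half-space. -/

section Transition

variable {n : ℕ} {O O' : Opens (Coord n)}

theorem hasFDerivWithinAt_half {E : Type*} [NormedAddCommGroup E] [NormedSpace ℝ E]
    {f : Coord n → E} (hf : ContDiffOn ℝ ∞ f (half O)) {y : Coord n} (hy : y ∈ half O) :
    HasFDerivWithinAt f (fderivWithin ℝ f (halfSpace n) y) (halfSpace n) y :=
  (differentiableWithinAt_half hf hy).hasFDerivWithinAt

theorem hasDerivWithinAt_line {f : Coord n → ℝ} (hf : ContDiffOn ℝ ∞ f (half O)) {y : Coord n}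
    (hy : y ∈ half O) (i : Fin (n + 1)) {s : Set ℝ}
    (hs : ∀ t ∈ s, y + t • (EuclideanSpace.single i 1 : Coord n) ∈ halfSpace n) :
    HasDerivWithinAt (fun t : ℝ => f (y + t • (EuclideanSpace.single i 1 : Coord n)))
      (partialDeriv i f y) s 0 := by
  have h1 := hasFDerivWithinAt_half hf hy
  have h2 : HasDerivWithinAt (fun t : ℝ => y + t • (EuclideanSpace.single i 1 : Coord n))
      (EuclideanSpace.single i 1) s 0 := by
    have := ((hasDerivAt_id (0 : ℝ)).smul_const (EuclideanSpace.single i 1 : Coord n)).const_add y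
    simpa using this.hasDerivWithinAt
  have h3 : HasFDerivWithinAt f (fderivWithin ℝ f (halfSpace n) y) (halfSpace n)
      (y + (0 : ℝ) • (EuclideanSpace.single i 1 : Coord n)) := by simpa using h1
  exact h3.comp_hasDerivWithinAt 0 h2 hs

theorem eventually_line_mem (O : Opens (Coord n)) {y : Coord n} (hy : y ∈ half O)
    (i : Fin (n + 1)) :
    ∀ᶠ t : ℝ in 𝓝 0, y + t • (EuclideanSpace.single i 1 : Coord n) ∈ O := by
  have h : Continuous fun t : ℝ => y + t • (EuclideanSpace.single i 1 : Coord n) := by fun_prop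
  exact h.continuousAt.eventually (O.isOpen.mem_nhds (by simpa using hy.2))

/-- Differentiate along a line inside the hyperplane. Applied to the normal component of a
coordinate change and to its tangential derivatives, this makes the Jacobian block triangular at the
boundary and kills the relevant second derivatives. -/
theorem partialDeriv_succ_eq_zero {f : Coord n → ℝ} (hf : ContDiffOn ℝ ∞ f (half O))
    (h0 : ∀ y ∈ half O, y 0 = 0 → f y = 0) {y : Coord n} (hy : y ∈ half O) (hy0 : y 0 = 0)
    (a : Fin n) : partialDeriv a.succ f y = 0 := by
  have hc : ∀ t : ℝ, (y + t • (EuclideanSpace.single a.succ 1 : Coord n)) 0 = 0 := fun t => by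
    simp [hy0, (Fin.succ_ne_zero a).symm]
  have hmem : ∀ t : ℝ, y + t • (EuclideanSpace.single a.succ 1 : Coord n) ∈ halfSpace n :=
    fun t => (hc t).ge
  have h1 := hasDerivWithinAt_univ.1
    (hasDerivWithinAt_line hf hy a.succ (s := univ) (fun t _ => hmem t))
  have h2 : (fun t : ℝ => f (y + t • (EuclideanSpace.single a.succ 1 : Coord n))) =ᶠ[𝓝 0]
      fun _ => (0 : ℝ) := by
    filter_upwards [eventually_line_mem O hy a.succ] with t ht
    exact h0 _ ⟨hmem t, ht⟩ (hc t)
  exact h1.unique ((hasDerivAt_const (0 : ℝ) (0 : ℝ)).congr_of_eventuallyEq h2)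

/-- Difference quotients taken into the half-space are nonnegative. For a coordinate change this
fixes the sign of the normal entry of the Jacobian, so that outward normals correspond. -/
theorem partialDeriv_zero_nonneg {f : Coord n → ℝ} (hf : ContDiffOn ℝ ∞ f (half O))
    (h0 : ∀ y ∈ half O, 0 ≤ f y) {y : Coord n} (hy : y ∈ half O) (hfy : f y = 0) :
    0 ≤ partialDeriv 0 f y := by
  have hmem : ∀ t ∈ Ici (0 : ℝ), y + t • (EuclideanSpace.single 0 1 : Coord n) ∈ halfSpace n := by
    intro t ht
    have h1 : 0 ≤ y 0 := hy.1
    have h2 : 0 ≤ t := ht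
    change 0 ≤ (y + t • (EuclideanSpace.single 0 1 : Coord n)) 0
    simp only [PiLp.add_apply, PiLp.smul_apply, PiLp.single_apply, if_true, smul_eq_mul, mul_one]
    linarith
  have h1 := hasDerivWithinAt_line hf hy 0 hmem
  have h2 : Filter.Tendsto (slope (fun t : ℝ => f (y + t • (EuclideanSpace.single 0 1 : Coord n))) 0)
      (𝓝[Ici (0 : ℝ) \ {0}] 0) (𝓝 (partialDeriv 0 f y)) := hasDerivWithinAt_iff_tendsto_slope.1 h1
  rw [Ici_sdiff_left] at h2
  refine ge_of_tendsto h2 ?_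
  filter_upwards [self_mem_nhdsWithin,
    (eventually_line_mem O hy 0).filter_mono nhdsWithin_le_nhds] with t ht htO
  have ht' : 0 < t := ht
  rw [slope_def_field]
  have : 0 ≤ f (y + t • (EuclideanSpace.single 0 1 : Coord n)) := h0 _ ⟨hmem t ht'.le, htO⟩
  simp only [zero_smul, add_zero, hfy, sub_zero]
  positivity

/-- The Jacobian matrix of a map, with derivatives within the half-space. -/
def jacobian (φ : Coord n → Coord n) (y : Coord n) : Matrix (Fin (n + 1)) (Fin (n + 1)) ℝ :=
  Matrix.of fun i a => partialDeriv i (fun z => φ z a) y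

theorem contDiffOn_coord {φ : Coord n → Coord n} (hφ : ContDiffOn ℝ ∞ φ (half O))
    (a : Fin (n + 1)) : ContDiffOn ℝ ∞ (fun z => φ z a) (half O) := by
  exact (contDiff_euclidean.1 contDiff_id a).comp_contDiffOn hφ

theorem fderivWithin_coord {φ : Coord n → Coord n} (hφ : ContDiffOn ℝ ∞ φ (half O))
    {y : Coord n} (hy : y ∈ half O) (a : Fin (n + 1)) (v : Coord n) :
    fderivWithin ℝ (fun z => φ z a) (halfSpace n) y v =
      fderivWithin ℝ φ (halfSpace n) y v a := by
  have h1 := hasFDerivWithinAt_half hφ hy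
  have h2 := ((EuclideanSpace.proj a : Coord n →L[ℝ] ℝ).hasFDerivAt).comp_hasFDerivWithinAt y h1
  have h3 := h2.fderivWithin (uniqueDiffOn_halfSpace y hy.1)
  have h4 : fderivWithin ℝ (fun z => φ z a) (halfSpace n) y = _ := h3
  rw [h4]; rfl

theorem sum_single (v : Coord n) : v = ∑ a, v a • (EuclideanSpace.single a 1 : Coord n) := by
  ext b
  simp [Finset.sum_apply, Pi.single_apply]

variable {φ : Coord n → Coord n} (hφ : ContDiffOn ℝ ∞ φ (half O))
  (hm : MapsTo φ (half O) (half O'))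

include hφ hm in
theorem partialDeriv_comp {f : Coord n → ℝ} (hf : ContDiffOn ℝ ∞ f (half O'))
    {y : Coord n} (hy : y ∈ half O) (i : Fin (n + 1)) :
    partialDeriv i (fun z => f (φ z)) y =
      ∑ a, jacobian φ y i a * partialDeriv a f (φ y) := by
  have h1 : HasFDerivWithinAt φ (fderivWithin ℝ φ (halfSpace n) y) (half O) y :=
    (hasFDerivWithinAt_half hφ hy).mono inter_subset_left
  have h2 : HasFDerivWithinAt f (fderivWithin ℝ f (halfSpace n) (φ y)) (half O') (φ y) :=
    (hasFDerivWithinAt_half hf (hm hy)).mono inter_subset_left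
  have h3 := (h2.comp y h1 hm).fderivWithin (uniqueDiffOn_half y hy)
  rw [partialDeriv, ← fderivWithin_half _ hy]
  change fderivWithin ℝ (f ∘ φ) (half O) y _ = _
  rw [h3, ContinuousLinearMap.comp_apply]
  conv_lhs => rw [sum_single (fderivWithin ℝ φ (halfSpace n) y (EuclideanSpace.single i 1))]
  rw [map_sum]
  refine Finset.sum_congr rfl fun a _ => ?_
  rw [map_smul, smul_eq_mul, jacobian, Matrix.of_apply, partialDeriv, fderivWithin_coord hφ hy]
  rfl

/-- The pullback of smooth functions. -/
def pullback : smoothFun O' →ₐ[ℝ] smoothFun O where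
  toFun f := toSmooth (fun y => extFun f (φ y)) ((contDiffOn_extFun f).comp hφ hm)
  map_one' := smoothFun_ext fun y => by simp [extFun_apply _ (hm y.2)]
  map_zero' := smoothFun_ext fun y => by simp [extFun_apply _ (hm y.2)]
  map_mul' f g := smoothFun_ext fun y => by simp [extFun_apply _ (hm y.2)]
  map_add' f g := smoothFun_ext fun y => by simp [extFun_apply _ (hm y.2)]
  commutes' c := smoothFun_ext fun y => by simp [extFun_apply _ (hm y.2)]

theorem evalAt_pullback (f : smoothFun O') (y : half O) :
    evalAt y (pullback hφ hm f) = evalAt ⟨φ y, hm y.2⟩ f := by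
  change extFun f (φ y) = _
  rw [extFun_apply _ (hm y.2)]

theorem map_pullback {κ μ : Type*} (M : Matrix κ μ (smoothFun O')) (y : half O) :
    (M.map (pullback hφ hm)).map (evalAt y) = M.map (evalAt ⟨φ y, hm y.2⟩) :=
  Matrix.ext fun _ _ => evalAt_pullback hφ hm _ y

/-- The Jacobian matrix over the algebra of smooth functions. -/
def jacobianMat : Matrix (Fin (n + 1)) (Fin (n + 1)) (smoothFun O) :=
  liftMat O (jacobian φ) fun i a => contDiffOn_partialDeriv (contDiffOn_coord hφ a) i

theorem map_jacobianMat (y : half O) : (jacobianMat hφ).map (evalAt y) = jacobian φ y := rfl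

theorem jacobianMat_comm (i j a : Fin (n + 1)) :
    coordDer O i (jacobianMat hφ j a) = coordDer O j (jacobianMat hφ i a) := by
  have h : ∀ i, jacobianMat hφ i a = coordDer O i (toSmooth _ (contDiffOn_coord hφ a)) := fun i =>
    smoothFun_ext fun y => (evalAt_coordDer_toSmooth i _ (contDiffOn_coord hφ a) y).symm
  rw [h, h, coordDer_comm]

theorem coordDer_pullback (i : Fin (n + 1)) (f : smoothFun O') :
    coordDer O i (pullback hφ hm f) =
      ∑ a, jacobianMat hφ i a * pullback hφ hm (coordDer O' a f) :=
  smoothFun_ext fun y => by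
    simp only [map_sum, map_mul]
    rw [← partialDeriv_eq (F := fun z => extFun f (φ z)) (fun y => rfl),
      partialDeriv_comp hφ hm (contDiffOn_extFun f) y.2]
    refine Finset.sum_congr rfl fun a _ => ?_
    rw [evalAt_pullback]; rfl

variable {G G' : Coord n → Matrix (Fin (n + 1)) (Fin (n + 1)) ℝ} (hG : IsMetricOn O G)
  (hG' : IsMetricOn O' G')
  (hGG : ∀ y ∈ half O, G y = jacobian φ y * G' (φ y) * (jacobian φ y)ᵀ)

include hG hGG in
theorem det_jacobian_ne_zero {y : Coord n} (hy : y ∈ half O) : (jacobian φ y).det ≠ 0 := by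
  intro h
  have h1 := (hG.posDef y hy).det_pos
  rw [hGG y hy, Matrix.det_mul, Matrix.det_mul, h] at h1
  simp at h1

include hG hGG in
theorem isUnit_det_jacobianMat : IsUnit (jacobianMat hφ).det :=
  isUnit_smoothFun fun y => by
    rw [evalAt_det]; exact det_jacobian_ne_zero hG hGG y.2

include hGG in
theorem mat_eq_pullback :
    hG.mat = jacobianMat hφ * hG'.mat.map (pullback hφ hm) * (jacobianMat hφ)ᵀ :=
  matrix_ext_evalAt fun y => by
    have h1 : ∀ M N : Matrix (Fin (n + 1)) (Fin (n + 1)) (smoothFun O),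
      (M * N).map (evalAt y) = M.map (evalAt y) * N.map (evalAt y) := fun M N =>
        Matrix.map_mul (f := (evalAt y : smoothFun O →+* ℝ))
    rw [h1, h1, map_pullback, Matrix.transpose_map, map_jacobianMat]
    exact hGG y y.2

include hGG in
theorem conn_eq_changeConn :
    hG.conn = changeConn (pullback hφ hm) (coordDer O) (jacobianMat hφ) hG'.conn :=
  hG.isLeviCivita.unique hG.isUnit_det (isLeviCivita_changeConn (jacobianMat_comm hφ)
    (isUnit_det_jacobianMat hφ hG hGG) (coordDer_pullback hφ hm)
    (mat_eq_pullback hφ hm hG hG' hGG) hG'.isLeviCivita) hG.mat_isSymm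

include hφ hm hG hG' hGG

theorem ricci_transition {y : Coord n} (hy : y ∈ half O) :
    ricci G y = jacobian φ y * ricci G' (φ y) * (jacobian φ y)ᵀ := by
  have h := ric_changeConn (d := coordDer O) (d' := coordDer O') (Γ' := hG'.conn) coordDer_comm
    (jacobianMat_comm hφ)
    (isUnit_det_jacobianMat hφ hG hGG) (coordDer_pullback hφ hm)
  rw [← conn_eq_changeConn hφ hm hG hG' hGG] at h
  have h1 : ∀ M N : Matrix (Fin (n + 1)) (Fin (n + 1)) (smoothFun O),
    (M * N).map (evalAt ⟨y, hy⟩) = M.map (evalAt ⟨y, hy⟩) * N.map (evalAt ⟨y, hy⟩) := fun M N =>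
      Matrix.map_mul (f := (evalAt ⟨y, hy⟩ : smoothFun O →+* ℝ))
  rw [← hG.map_ricMat ⟨y, hy⟩, IsMetricOn.ricMat, h, h1, h1, map_pullback, Matrix.transpose_map,
    map_jacobianMat]
  rw [← hG'.map_ricMat ⟨φ y, hm hy⟩]
  rfl

theorem schouten_transition {y : Coord n} (hy : y ∈ half O) :
    schouten G y = jacobian φ y * schouten G' (φ y) * (jacobian φ y)ᵀ := by
  rw [schouten_eq_schoutenOf, schouten_eq_schoutenOf, ricci_transition hφ hm hG hG' hGG hy,
    hGG y hy, schoutenOf_congr _ (isUnit_iff_ne_zero.2 (det_jacobian_ne_zero hG hGG hy))]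

theorem locSigma_transition {k m : ℕ} (hN : n + 1 = 2 * k + m) {y : Coord n} (hy : y ∈ half O) :
    locSigma k G y = locSigma k G' (φ y) := by
  have hJ := det_jacobian_ne_zero hG hGG hy
  have h1 := (hG.posDef y hy).det_pos.ne'
  have h2 := (hG'.posDef _ (hm hy)).det_pos.ne'
  rw [locSigma, locSigma, sigma_inv_mul hN h1, sigma_inv_mul hN h2,
    schouten_transition hφ hm hG hG' hGG hy, hGG y hy, det_pencil_congr, coeff_C_mul,
    Matrix.det_mul, Matrix.det_mul, Matrix.det_transpose]
  field_simp

variable (hb : ∀ y ∈ half O, y 0 = 0 → φ y 0 = 0)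
include hb

omit hm hG hG' hGG in
theorem jacobian_succ_zero {y : Coord n} (hy : y ∈ half O) (hy0 : y 0 = 0) (a : Fin n) :
    jacobian φ y a.succ 0 = 0 :=
  partialDeriv_succ_eq_zero (contDiffOn_coord hφ 0) hb hy hy0 a

omit hG' in
theorem jacobian_zero_zero_pos {y : Coord n} (hy : y ∈ half O) (hy0 : y 0 = 0) :
    0 < jacobian φ y 0 0 := by
  have h1 : 0 ≤ jacobian φ y 0 0 :=
    partialDeriv_zero_nonneg (contDiffOn_coord hφ 0) (fun z hz => (hm hz).1) hy (hb y hy hy0)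
  refine lt_of_le_of_ne h1 fun h0 => det_jacobian_ne_zero hG hGG hy ?_
  rw [Matrix.det_succ_column_zero]
  refine Finset.sum_eq_zero fun i _ => ?_
  refine Fin.cases ?_ (fun a => ?_) i
  · rw [← h0]; simp
  · rw [jacobian_succ_zero hφ hb hy hy0]; simp

omit hm hG hG' hGG in
theorem tangential_congr {y : Coord n} (hy : y ∈ half O) (hy0 : y 0 = 0)
    (M : Matrix (Fin (n + 1)) (Fin (n + 1)) ℝ) :
    tangential (jacobian φ y * M * (jacobian φ y)ᵀ) =
      tangential (jacobian φ y) * tangential M * (tangential (jacobian φ y))ᵀ := by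
  refine Matrix.ext fun a b => ?_
  simp only [tangential, Matrix.submatrix_apply, Matrix.mul_apply, Matrix.transpose_apply,
    Fin.sum_univ_succ, jacobian_succ_zero hφ hb hy hy0, zero_mul, mul_zero, zero_add]

omit hG' in
theorem det_tangential_jacobian_ne_zero {y : Coord n} (hy : y ∈ half O) (hy0 : y 0 = 0) :
    (tangential (jacobian φ y)).det ≠ 0 := by
  intro h
  have h1 := (hG.tangential_posDef hy).det_pos
  rw [hGG y hy, tangential_congr hφ hb hy hy0, Matrix.det_mul, Matrix.det_mul, h] at h1
  simp at h1

/-- In the 0-component of the transformation law for Γ the inhomogeneous term is a second tangential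
derivative of φ⁰, zero on the boundary. The common factor is the normal entry of the Jacobian, which
also relates the two lapses; its positivity settles the square root. -/
theorem secondFundForm_transition {y : Coord n} (hy : y ∈ half O) (hy0 : y 0 = 0) :
    secondFundForm G y = tangential (jacobian φ y) * secondFundForm G' (φ y)
      * (tangential (jacobian φ y))ᵀ := by
  have hJ00 := jacobian_zero_zero_pos hφ hm hG hGG hb hy hy0
  have hν := Real.sqrt_pos.2 (hG.inv_zero_zero_pos hy)
  have hinv : (G' (φ y))⁻¹ 0 0 = (jacobian φ y 0 0) ^ 2 * (G y)⁻¹ 0 0 := by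
    have hJ := isUnit_iff_ne_zero.2 (det_jacobian_ne_zero hG hGG hy)
    have hJt : IsUnit (jacobian φ y)ᵀ.det := by rwa [Matrix.det_transpose]
    have h1 : (G' (φ y))⁻¹ = (jacobian φ y)ᵀ * (G y)⁻¹ * jacobian φ y := by
      rw [hGG y hy, Matrix.mul_inv_rev, Matrix.mul_inv_rev, ← mul_assoc, ← mul_assoc,
        Matrix.mul_nonsing_inv _ hJt, one_mul, mul_assoc, Matrix.nonsing_inv_mul _ hJ, mul_one]
    rw [h1]
    simp only [Matrix.mul_apply, Matrix.transpose_apply, Fin.sum_univ_succ,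
      jacobian_succ_zero hφ hb hy hy0, zero_mul, mul_zero, add_zero, Finset.sum_const_zero]
    ring
  have hν' : Real.sqrt ((G' (φ y))⁻¹ 0 0) = jacobian φ y 0 0 * Real.sqrt ((G y)⁻¹ 0 0) := by
    rw [hinv, Real.sqrt_mul (by positivity), Real.sqrt_sq hJ00.le]
  refine Matrix.ext fun a b => ?_
  have h := jacobian_mul_changeConn (φ := pullback hφ hm) (d := coordDer O) (Γ' := hG'.conn)
    (isUnit_det_jacobianMat hφ hG hGG) a.succ
  rw [← conn_eq_changeConn hφ hm hG hG' hGG] at h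
  have h2 := congrArg (evalAt ⟨y, hy⟩) (congrFun (congrFun h 0) b.succ)
  have hJe : ∀ i j, evalAt ⟨y, hy⟩ (jacobianMat hφ i j) = jacobian φ y i j := fun i j => rfl
  have hder : evalAt ⟨y, hy⟩ (coordDer O a.succ (jacobianMat hφ b.succ 0)) = 0 := by
    rw [← partialDeriv_eq (F := fun z => jacobian φ z b.succ 0) (fun y => rfl)]
    exact partialDeriv_succ_eq_zero (O := O)
      (contDiffOn_partialDeriv (contDiffOn_coord hφ 0) b.succ)
      (fun z hz hz0 => jacobian_succ_zero hφ hb hz hz0 b) hy hy0 a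
  simp only [Matrix.mul_apply, Matrix.add_apply, Matrix.transpose_apply, Matrix.map_apply, map_add,
    map_sum, map_mul, Matrix.sum_apply, Matrix.smul_apply, smul_eq_mul, hJe, hder, add_zero,
    evalAt_pullback] at h2
  simp only [Fin.sum_univ_succ, jacobian_succ_zero hφ hb hy hy0, zero_mul, mul_zero, zero_add,
    Finset.sum_const_zero, add_zero] at h2
  have h3 : ∀ c e : Fin n, evalAt ⟨φ y, hm hy⟩ (hG'.conn c.succ 0 e.succ) =
      jacobian φ y 0 0 * Real.sqrt ((G y)⁻¹ 0 0) * secondFundForm G' (φ y) c e := fun c e => by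
    rw [← hν', ← hG'.christoffel_zero (hm hy), ← hG'.christoffel_eq 0 c.succ e.succ ⟨φ y, hm hy⟩]
  simp only [h3] at h2
  rw [← hG.christoffel_eq, hG.christoffel_zero hy] at h2
  have h4 : jacobian φ y 0 0 * Real.sqrt ((G y)⁻¹ 0 0) ≠ 0 := by positivity
  refine mul_left_cancel₀ h4 ?_
  simp only [Matrix.mul_apply, Matrix.transpose_apply, tangential, Matrix.submatrix_apply]
  rw [mul_assoc, h2, Finset.mul_sum]
  refine Finset.sum_congr rfl fun c _ => ?_
  rw [Finset.sum_mul, Finset.sum_mul, Finset.mul_sum]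
  exact Finset.sum_congr rfl fun e _ => by ring

theorem locH_transition {k m : ℕ} (hN : n + 1 = 2 * k + m) {y : Coord n} (hy : y ∈ half O)
    (hy0 : y 0 = 0) : locH k G y = locH k G' (φ y) := by
  have hJ := det_tangential_jacobian_ne_zero hφ hm hG hGG hb hy hy0
  have h1 := (hG.tangential_posDef hy).det_pos.ne'
  have h2 := (hG'.tangential_posDef (hm hy)).det_pos.ne'
  rw [locH, locH, hSum_eq hN h1, hSum_eq hN h2, schouten_transition hφ hm hG hG' hGG hy,
    secondFundForm_transition hφ hm hG hG' hGG hb hy hy0, hGG y hy, tangential_congr hφ hb hy hy0,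
    tangential_congr hφ hb hy hy0, det_pencil2_congr, hFun_CC_mul, Matrix.det_mul, Matrix.det_mul,
    Matrix.det_transpose]
  field_simp

end Transition

/-! ### Conformally flat metrics have vanishing Weyl tensor. -/

section ConformallyFlat

variable {n : ℕ} {O : Opens (Coord n)} {G : Coord n → Matrix (Fin (n + 1)) (Fin (n + 1)) ℝ}

/-- The Weyl tensor vanishes at a point. -/
def WeylFreeAt (G : Coord n → Matrix (Fin (n + 1)) (Fin (n + 1)) ℝ) (y : Coord n) : Prop :=
  ∀ k i l j, riemann G l k i j y = (1 : Matrix (Fin (n + 1)) (Fin (n + 1)) ℝ) l k * schouten G y i j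
    - (1 : Matrix (Fin (n + 1)) (Fin (n + 1)) ℝ) l i * schouten G y k j
    + ((G y)⁻¹ * schouten G y) l k * G y i j - ((G y)⁻¹ * schouten G y) l i * G y k j

theorem weylFree_iff (hG : IsMetricOn O G) :
    WeylFree hG.mat hG.conn (coordDer O) hG.schoutenMat ↔ ∀ y ∈ half O, WeylFreeAt G y := by
  have key : ∀ (y : half O) (k i l j : Fin (n + 1)),
      evalAt y ((1 : Matrix (Fin (n + 1)) (Fin (n + 1)) (smoothFun O)) l k * hG.schoutenMat i j
        - (1 : Matrix (Fin (n + 1)) (Fin (n + 1)) (smoothFun O)) l i * hG.schoutenMat k j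
        + (hG.mat⁻¹ * hG.schoutenMat) l k * hG.mat i j
        - (hG.mat⁻¹ * hG.schoutenMat) l i * hG.mat k j) =
      (1 : Matrix (Fin (n + 1)) (Fin (n + 1)) ℝ) l k * schouten G y i j
    - (1 : Matrix (Fin (n + 1)) (Fin (n + 1)) ℝ) l i * schouten G y k j
    + ((G y)⁻¹ * schouten G y) l k * G y i j - ((G y)⁻¹ * schouten G y) l i * G y k j := by
    intro y k i l j
    have h1 : ∀ a b, evalAt y ((1 : Matrix (Fin (n + 1)) (Fin (n + 1)) (smoothFun O)) a b) =
        (1 : Matrix (Fin (n + 1)) (Fin (n + 1)) ℝ) a b := fun a b => by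
      rw [Matrix.one_apply, Matrix.one_apply]; split_ifs <;> simp
    have h2 : ∀ a b, evalAt y ((hG.mat⁻¹ * hG.schoutenMat) a b) =
        ((G y)⁻¹ * schouten G y) a b := fun a b => by
      rw [← hG.map_inv y, ← hG.map_schoutenMat y]
      simp [Matrix.mul_apply]
    have h3 : ∀ a b, evalAt y (hG.schoutenMat a b) = schouten G y a b := fun a b => by
      rw [← hG.map_schoutenMat y]; rfl
    have h4 : ∀ a b, evalAt y (hG.mat a b) = G y a b := fun a b => rfl
    simp only [map_sub, map_add, map_mul, h1, h2, h3, h4]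
  constructor
  · intro h y hy k i l j
    rw [hG.riemann_eq l k i j ⟨y, hy⟩, h k i l j, key]
  · intro h k i l j
    refine smoothFun_ext fun y => ?_
    rw [key, ← hG.riemann_eq, h y y.2]

/-- In P ∧ G the metric occurs only through products of G⁻¹ with G and through the identity, and
these do not change when G is scaled. -/
theorem WeylFree.congr_metric {R : Type*} [CommRing R] [Algebra ℝ R] {ι : Type*} [Fintype ι]
    [DecidableEq ι] {d : ι → Derivation ℝ R R} {G : Matrix ι ι R} {Γ : ι → Matrix ι ι R}
    {P : Matrix ι ι R} (hG : IsUnit G.det) {ρ : R} (hρ : IsUnit ρ)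
    (h : ∀ k i l j, curv d Γ k i l j = (1 : Matrix ι ι R) l k * P i j - (1 : Matrix ι ι R) l i * P k j
    + (G⁻¹ * P) l k * G i j - (G⁻¹ * P) l i * G k j) : WeylFree (ρ • G) Γ d P := by
  have hu : IsUnit (ρ • G).det := by
    rw [Matrix.det_smul]; exact (hρ.pow _).mul hG
  have hinv : ρ • (ρ • G)⁻¹ = G⁻¹ := by
    refine (Matrix.inv_eq_left_inv ?_).symm
    rw [Matrix.smul_mul, ← Matrix.mul_smul, Matrix.nonsing_inv_mul _ hu]
  intro k i l j
  rw [h, ← hinv, Matrix.smul_mul]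
  simp only [Matrix.smul_apply, smul_eq_mul]
  ring

/-- A metric which is conformal to the pullback of the Euclidean metric has no Weyl tensor. -/
theorem weylFree_of_conformallyFlat (hn : 2 ≤ n) (hG : IsMetricOn O G) {φ : Coord n → Coord n}
    (hφ : ContDiffOn ℝ ∞ φ (half O)) {c : Coord n → ℝ} (hc : ∀ y ∈ half O, 0 < c y)
    (hcG : ∀ y ∈ half O, jacobian φ y * (jacobian φ y)ᵀ = c y • G y) :
    WeylFree hG.mat hG.conn (coordDer O) hG.schoutenMat := by
  set J := jacobianMat hφ
  have hJe : ∀ y : half O, (J * Jᵀ).map (evalAt y) = c y • G y := fun y => by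
    rw [← hcG y y.2]
    exact Matrix.map_mul (f := (evalAt y : smoothFun O →+* ℝ))
  have hJu : IsUnit J.det := isUnit_smoothFun fun y => by
    rw [evalAt_det]
    intro h
    have h1 := congrArg Matrix.det (hcG y y.2)
    rw [Matrix.det_mul, Matrix.det_transpose, Matrix.det_smul] at h1
    have h2 := (hG.posDef y y.2).det_pos
    have h3 := hc y y.2
    rw [show (jacobian φ y).det = 0 from h, zero_mul] at h1
    have : 0 < c y ^ Fintype.card (Fin (n + 1)) * (G y).det := by positivity
    linarith
  have hG0 : IsUnit (J * Jᵀ).det := by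
    rw [Matrix.det_mul, Matrix.det_transpose]; exact hJu.mul hJu
  have hG0s : (J * Jᵀ).IsSymm := by
    rw [Matrix.IsSymm, Matrix.transpose_mul, Matrix.transpose_transpose]
  obtain ⟨Γ, hΓ, hflat⟩ := flat_of_jacobian (coordDer_comm (O := O)) (jacobianMat_comm hφ) hJu rfl
  -- No regularity of c is part of the hypotheses; it is a quotient of two smooth functions with
  -- positive denominator.
  have hc' : ContDiffOn ℝ ∞ c (half O) := by
    have h1 : ContDiffOn ℝ ∞ (fun y => extFun ((J * Jᵀ) 0 0) y / G y 0 0) (half O) :=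
      (contDiffOn_extFun _).div (hG.smooth 0 0) fun y hy => ((hG.posDef y hy).diag_pos).ne'
    refine h1.congr fun y hy => ?_
    have h2 := congrFun (congrFun (hJe ⟨y, hy⟩) 0) 0
    rw [extFun_apply _ hy]
    rw [Matrix.map_apply, Matrix.smul_apply, smul_eq_mul] at h2
    rw [h2, mul_div_cancel_right₀]
    exact ((hG.posDef y hy).diag_pos).ne'
  set w : Coord n → ℝ := fun y => -(1 / 2) * Real.log (c y)
  have hw : ContDiffOn ℝ ∞ w (half O) :=
    contDiffOn_const.mul (hc'.log fun y hy => (hc y hy).ne')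
  have hew : ∀ y ∈ half O, Real.exp (2 * w y) = (c y)⁻¹ := fun y hy => by
    rw [show 2 * w y = -Real.log (c y) by simp only [w]; ring, Real.exp_neg, Real.exp_log (hc y hy)]
  set ρ : smoothFun O := toSmooth (fun y => Real.exp (2 * w y))
    ((contDiffOn_const (c := (2 : ℝ))).mul hw).exp
  have hρ : IsUnit ρ := isUnit_smoothFun fun y => (Real.exp_pos _).ne'
  have hmat : hG.mat = ρ • (J * Jᵀ) := matrix_ext_evalAt fun y => by
    have h1 : (ρ • (J * Jᵀ)).map (evalAt y) = Real.exp (2 * w y) • (J * Jᵀ).map (evalAt y) :=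
      Matrix.ext fun i j => map_mul (evalAt y) _ _
    rw [h1, hJe, hew y y.2, smul_smul, inv_mul_cancel₀ (hc y y.2).ne', one_smul, hG.map_mat]
  have hLC := isLeviCivita_conformal (ρ := ρ) (w := toSmooth w hw) hG0 hG0s hΓ
    (fun i => smoothFun_ext fun y => by
      rw [evalAt_coordDer_toSmooth, partialDeriv_exp hw y.2, map_mul, map_mul,
        evalAt_coordDer_toSmooth, map_ofNat]
      rfl)
  rw [← hmat] at hLC
  have hconn := hG.isLeviCivita.unique hG.isUnit_det hLC hG.mat_isSymm
  -- Starting from a flat metric, the conformal curvature formula leaves exactly E ∧ G. Contraction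
  -- then identifies E with the Schouten tensor.
  set E := confSchouten (coordDer O) (J * Jᵀ) Γ (toSmooth w hw)
  have hW : WeylFree hG.mat hG.conn (coordDer O) E := by
    rw [hmat]
    refine WeylFree.congr_metric hG0 hρ fun k i l j => ?_
    rw [hconn, curv_conformal hG0 hG0s hΓ coordDer_comm, hflat]
    simp [E]
  have hEs : E.IsSymm := confSchouten_symm hG0s hΓ.symm coordDer_comm _
  have hric := hW.ric_eq hG.isUnit_det hG.mat_isSymm hEs
  have hP : hG.schoutenMat = E := by
    rw [IsMetricOn.schoutenMat]
    refine schoutenOf_unique hn hG.isUnit_det ?_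
    rw [IsMetricOn.ricMat, hric, Fintype.card_fin]
  rw [hP]
  exact hW

end ConformallyFlat

end

section

/-! ## The divergence theorem on the half-space -/

open TopologicalSpace (Opens)

section Divergence

variable {n : ℕ}

/-- The inclusion of the boundary hyperplane as a linear map. -/
def hyperplaneCLM (n : ℕ) : EuclideanSpace ℝ (Fin n) →L[ℝ] Coord n :=
  LinearMap.toContinuousLinearMap
    { toFun := hyperplane
      map_add' := fun x y => by
        ext i; refine Fin.cases ?_ (fun i => ?_) i <;> simp [hyperplane]
      map_smul' := fun c x => by
        ext i; refine Fin.cases ?_ (fun i => ?_) i <;> simp [hyperplane] }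

theorem hyperplaneCLM_apply (z : EuclideanSpace ℝ (Fin n)) : hyperplaneCLM n z = hyperplane z := rfl

@[simp]
theorem hyperplane_zero (z : EuclideanSpace ℝ (Fin n)) : hyperplane z 0 = 0 := rfl

@[simp]
theorem hyperplane_succ (z : EuclideanSpace ℝ (Fin n)) (a : Fin n) : hyperplane z a.succ = z a := rfl

theorem hyperplane_mem (z : EuclideanSpace ℝ (Fin n)) : hyperplane z ∈ halfSpace n :=
  (hyperplane_zero z).ge

theorem hyperplaneCLM_single (a : Fin n) :
    hyperplaneCLM n (EuclideanSpace.single a 1) = EuclideanSpace.single a.succ 1 := by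
  ext i
  refine Fin.cases ?_ (fun i => ?_) i <;> simp [hyperplaneCLM_apply, Fin.succ_ne_zero]

theorem continuous_hyperplane : Continuous (hyperplane (n := n)) := (hyperplaneCLM n).continuous

theorem isClosedEmbedding_hyperplane : Topology.IsClosedEmbedding (hyperplane (n := n)) :=
  (hyperplaneCLM n).toLinearMap.isClosedEmbedding_of_injective
    (LinearMap.ker_eq_bot.2 fun x y h => by
      ext a
      have := congrArg (fun y : Coord n => y a.succ) h
      simpa [hyperplaneCLM_apply] using this)

theorem measurableSet_halfSpace : MeasurableSet (halfSpace n) := isClosed_halfSpace.measurableSet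

theorem partialDeriv_eq_zero_of_notMem {F : Coord n → ℝ} {K : Set (Coord n)} (hK : IsCompact K)
    (h0 : ∀ y ∉ K, F y = 0) (i : Fin (n + 1)) {y : Coord n} (hy : y ∉ K) :
    partialDeriv i F y = 0 := by
  have h1 : F =ᶠ[𝓝[halfSpace n] y] fun _ => 0 := by
    filter_upwards [mem_nhdsWithin_of_mem_nhds (hK.isClosed.isOpen_compl.mem_nhds hy)] with z hz
      using h0 z hz
  rw [partialDeriv, h1.fderivWithin_eq (h0 y hy)]
  simp

theorem continuousOn_partialDeriv {F : Coord n → ℝ} (hF : ContDiffOn ℝ ∞ F (halfSpace n))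
    (i : Fin (n + 1)) : ContinuousOn (partialDeriv i F) (halfSpace n) :=
  (hF.continuousOn_fderivWithin uniqueDiffOn_halfSpace (by simp)).clm_apply continuousOn_const

theorem integrableOn_halfSpace {F : Coord n → ℝ} (hF : ContinuousOn F (halfSpace n))
    {K : Set (Coord n)} (hK : IsCompact K) (h0 : ∀ y ∉ K, F y = 0) :
    IntegrableOn F (halfSpace n) := by
  have h1 : IntegrableOn F (K ∩ halfSpace n) :=
    (hF.mono inter_subset_right).integrableOn_compact (hK.inter_right isClosed_halfSpace)
  exact h1.of_forall_sdiff_eq_zero measurableSet_halfSpace fun y hy => h0 y fun h => hy.2 ⟨h, hy.1⟩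

/-- The divergence theorem for a large box standing on the hyperplane, applied to the field with F
in direction i and zero elsewhere. -/
theorem integral_partialDeriv {F : Coord n → ℝ} (hF : ContDiffOn ℝ ∞ F (halfSpace n))
    {K : Set (Coord n)} (hK : IsCompact K) (h0 : ∀ y ∉ K, F y = 0) (i : Fin (n + 1)) :
    ∫ y in halfSpace n, partialDeriv i F y =
      if i = 0 then -∫ z, F (hyperplane z) else 0 := by
  obtain ⟨M, hM, hKM⟩ : ∃ M > 0, ∀ y ∈ K, ∀ j, |y j| < M := by
    obtain ⟨M, hM, h⟩ := hK.isBounded.exists_pos_norm_lt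
    exact ⟨M, hM, fun y hy j => (PiLp.norm_apply_le y j).trans_lt (h y hy)⟩
  have h0' : ∀ (y : Coord n) j, M ≤ |y j| → F y = 0 := fun y j h =>
    h0 y fun hy => (hKM y hy j).not_ge h
  -- The box is [0, M] × [-M, M]^n, and M strictly bounds all coordinates on K, so the only face on
  -- which F can be nonzero is y 0 = 0.
  let a : Fin (n + 1) → ℝ := Fin.cons 0 fun _ => -M
  let b : Fin (n + 1) → ℝ := fun _ => M
  have hab : a ≤ b := fun j => by
    refine Fin.cases ?_ (fun j => ?_) j <;> simp [a, b] <;> linarith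
  let L : (Fin (n + 1) → ℝ) →L[ℝ] Coord n :=
    ((PiLp.continuousLinearEquiv 2 ℝ fun _ : Fin (n + 1) => ℝ).symm :
      (Fin (n + 1) → ℝ) →L[ℝ] Coord n)
  have hL : ∀ x j, L x j = x j := fun x j => rfl
  have hLmem : ∀ x ∈ Icc a b, L x ∈ halfSpace n := fun x hx => hx.1 0
  have hLs : ∀ j, L (Pi.single j 1) = EuclideanSpace.single j 1 := fun j => rfl
  have hcont : ContinuousOn (fun y => partialDeriv i F y) (halfSpace n) :=
    continuousOn_partialDeriv hF i
  have hP0 : ∀ y ∉ K, partialDeriv i F y = 0 := fun y hy =>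
    partialDeriv_eq_zero_of_notMem hK h0 i hy
  have key := integral_divergence_of_hasFDerivAt_off_countable' a b hab
    (fun j x => if j = i then F (L x) else 0)
    (fun j x => if j = i then (fderivWithin ℝ F (halfSpace n) (L x)).comp L else 0) ∅
    countable_empty
    (fun j => by
      by_cases h : j = i
      · simp only [h, if_true]
        exact hF.continuousOn.comp L.continuous.continuousOn hLmem
      · simp only [h, if_false]
        exact continuousOn_const)
    (fun x hx j => by
      by_cases h : j = i
      · simp only [h, if_true]
        have hx0 : 0 < L x 0 := (hx.1 0 (mem_univ _)).1
        have hn : halfSpace n ∈ 𝓝 (L x) :=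
          mem_interior_iff_mem_nhds.1 (pos_subset_interior hx0)
        have hd : DifferentiableAt ℝ F (L x) :=
          ((hF.differentiableOn (by simp)) _ hx0.le).differentiableAt hn
        rw [fderivWithin_of_mem_nhds hn]
        exact hd.hasFDerivAt.comp x L.hasFDerivAt
      · simp only [h, if_false]
        exact hasFDerivAt_const _ _)
    (by
      refine ContinuousOn.integrableOn_compact isCompact_Icc ?_
      have : ContinuousOn (fun x => partialDeriv i F (L x)) (Icc a b) :=
        hcont.comp L.continuous.continuousOn hLmem
      refine this.congr fun x _ => ?_
      rw [Finset.sum_eq_single i (fun j _ hj => by simp [hj]) (by simp)]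
      simp [hLs, partialDeriv])
  have hl : ∫ x in Icc a b, ∑ j, (if j = i then
      (fderivWithin ℝ F (halfSpace n) (L x)).comp L else 0) (Pi.single j 1) =
      ∫ y in halfSpace n, partialDeriv i F y := by
    have e1 : ∀ x : Fin (n + 1) → ℝ, ∑ j, (if j = i then
      (fderivWithin ℝ F (halfSpace n) (L x)).comp L else 0) (Pi.single j 1) =
        partialDeriv i F (L x) := fun x => by
      rw [Finset.sum_eq_single i (fun j _ hj => by simp [hj]) (by simp)]
      simp [hLs, partialDeriv]
    simp only [e1]
    have e2 := (PiLp.volume_preserving_toLp (Fin (n + 1))).setIntegral_preimage_emb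
      (MeasurableEquiv.toLp 2 (Fin (n + 1) → ℝ)).measurableEmbedding
      (partialDeriv i F) (halfSpace n)
    rw [← e2]
    symm
    refine setIntegral_eq_of_subset_of_forall_sdiff_eq_zero
      (measurableSet_halfSpace.preimage (PiLp.volume_preserving_toLp _).measurable)
      (fun x hx => hLmem x hx) fun x hx => ?_
    refine hP0 _ fun hxK => hx.2 ⟨fun j => ?_, fun j => (le_abs_self _).trans (hKM _ hxK j).le⟩
    refine Fin.cases ?_ (fun j => ?_) j
    · exact hx.1
    · exact (neg_lt_of_abs_lt (hKM _ hxK j.succ)).le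
  rw [hl] at key
  rw [key, Finset.sum_eq_single i (fun j _ hj => by simp [hj]) (by simp)]
  simp only [if_true]
  have hfront : ∀ x : Fin n → ℝ, F (L (i.insertNth (b i) x)) = 0 := fun x =>
    h0' _ i (by rw [hL, Fin.insertNth_apply_same]; exact le_abs_self M)
  simp only [hfront, integral_zero, zero_sub]
  by_cases hi : i = 0
  · subst hi
    simp only [if_true, neg_inj]
    have e3 := (PiLp.volume_preserving_toLp (Fin n)).integral_comp
      (MeasurableEquiv.toLp 2 (Fin n → ℝ)).measurableEmbedding
      (fun z => F (hyperplane z))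
    rw [← e3]
    have e4 : ∀ x : Fin n → ℝ, F (L ((0 : Fin (n + 1)).insertNth (a 0) x)) =
        F (hyperplane (WithLp.toLp 2 x)) := fun x => by
      congr 1
      ext j
      rw [hL, Fin.insertNth_zero]
      refine Fin.cases ?_ (fun j => ?_) j <;> simp [a]
    simp only [e4]
    refine setIntegral_eq_integral_of_forall_compl_eq_zero fun x hx => h0 _ fun hxK => hx ?_
    refine ⟨fun j => ?_, fun j => ?_⟩
    · have := neg_lt_of_abs_lt (hKM _ hxK j.succ)
      simpa [a] using this.le
    · have := (le_abs_self _).trans (hKM _ hxK j.succ).le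
      simpa [b] using this
  · obtain ⟨j, rfl⟩ := Fin.exists_succ_eq.2 hi
    have hback : ∀ x : Fin n → ℝ, F (L (j.succ.insertNth (a j.succ) x)) = 0 := fun x =>
      h0' _ j.succ (by rw [hL, Fin.insertNth_apply_same]; simp [a, abs_of_pos hM])
    simp [hback, hi]

/-- Integration by parts against the constant 1. The tangential derivative within the half-space is
the ordinary derivative of the restriction of F to the hyperplane. -/
theorem integral_partialDeriv_hyperplane {F : Coord n → ℝ} (hF : ContDiffOn ℝ ∞ F (halfSpace n))
    {K : Set (Coord n)} (hK : IsCompact K) (h0 : ∀ y ∉ K, F y = 0) (a : Fin n) :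
    ∫ z, partialDeriv a.succ F (hyperplane z) = 0 := by
  let f : EuclideanSpace ℝ (Fin n) → ℝ := fun z => F (hyperplane z)
  have hd : ∀ z, HasFDerivAt f
      ((fderivWithin ℝ F (halfSpace n) (hyperplane z)).comp (hyperplaneCLM n)) z := fun z =>
    (((hF.differentiableOn (by simp)) _ (hyperplane_mem z)).hasFDerivWithinAt.comp_hasFDerivAt z
      (hyperplaneCLM n).hasFDerivAt (Filter.Eventually.of_forall fun z => hyperplane_mem z))
  have hder : ∀ z, fderiv ℝ f z (EuclideanSpace.single a 1) =
      partialDeriv a.succ F (hyperplane z) := fun z => by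
    rw [(hd z).fderiv, ContinuousLinearMap.comp_apply, hyperplaneCLM_single]; rfl
  have hK' : IsCompact (hyperplane ⁻¹' K) := isClosedEmbedding_hyperplane.isCompact_preimage hK
  have hi : ∀ g : Coord n → ℝ, ContinuousOn g (halfSpace n) → (∀ y ∉ K, g y = 0) →
      Integrable (fun z => g (hyperplane z)) := fun g hg hg0 =>
    (hg.comp_continuous continuous_hyperplane hyperplane_mem).integrable_of_hasCompactSupport
      (HasCompactSupport.intro hK' fun z hz => hg0 _ hz)
  have key := integral_mul_fderiv_eq_neg_fderiv_mul_of_integrable (μ := volume)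
    (f := fun _ : EuclideanSpace ℝ (Fin n) => (1 : ℝ)) (g := f) (v := EuclideanSpace.single a 1)
    (by simp) (by
      simp only [hder, one_mul]
      exact hi _ (continuousOn_partialDeriv hF a.succ)
        fun y hy => partialDeriv_eq_zero_of_notMem hK h0 _ hy)
    (by simpa using hi _ hF.continuousOn h0) (fun _ _ => differentiableAt_const _)
    (fun z _ => (hd z).differentiableAt)
  simpa [hder] using key

variable {O : Opens (Coord n)}

/-- Points of K lie in the relatively open set `half O`, where the function is smooth; near every
other point of the half-space the extension is zero. -/
theorem contDiffOn_extFun_halfSpace {V : smoothFun O} {K : Set (Coord n)} (hK : IsCompact K)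
    (hKO : K ⊆ half O) (h0 : ∀ y : half O, (y : Coord n) ∉ K → evalAt y V = 0) :
    (∀ y ∉ K, extFun V y = 0) ∧ ContDiffOn ℝ ∞ (extFun V) (halfSpace n) := by
  have h1 : ∀ y ∉ K, extFun V y = 0 := fun y hy => by
    by_cases h : y ∈ half O
    · rw [extFun_apply V h]; exact h0 ⟨y, h⟩ hy
    · exact extFun_of_notMem V h
  refine ⟨h1, fun y hy => ?_⟩
  by_cases h : y ∈ K
  · exact ((contDiffOn_extFun V) y (hKO h)).mono_of_mem_nhdsWithin (half_mem_nhdsWithin (hKO h))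
  · have h2 : extFun V =ᶠ[𝓝[halfSpace n] y] fun _ => 0 := by
      filter_upwards [mem_nhdsWithin_of_mem_nhds (hK.isClosed.isOpen_compl.mem_nhds h)] with z hz
        using h1 z hz
    exact contDiffWithinAt_const.congr_of_eventuallyEq h2 (h1 y h)

theorem extFun_coordDer {V : smoothFun O} {K : Set (Coord n)} (hK : IsCompact K)
    (hKO : K ⊆ half O) (h0 : ∀ y : half O, (y : Coord n) ∉ K → evalAt y V = 0) (i : Fin (n + 1)) :
    extFun (coordDer O i V) = partialDeriv i (extFun V) := by
  funext y
  by_cases h : y ∈ half O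
  · rw [extFun_apply _ h, evalAt_coordDer]
  · rw [extFun_of_notMem _ h, partialDeriv_eq_zero_of_notMem hK
      (contDiffOn_extFun_halfSpace hK hKO h0).1 i fun hy => h (hKO hy)]

/-- Extension by zero, as a linear map. -/
def extLin (O : Opens (Coord n)) : smoothFun O →ₗ[ℝ] (Coord n → ℝ) where
  toFun := extFun
  map_add' f g := by
    funext y
    by_cases h : y ∈ half O
    · simp [extFun_apply _ h]
    · simp [extFun_of_notMem _ h]
  map_smul' c f := by
    funext y
    by_cases h : y ∈ half O
    · simp [extFun_apply _ h]
    · simp [extFun_of_notMem _ h]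

theorem extLin_apply (f : smoothFun O) : extLin O f = extFun f := rfl

theorem evalAt_coordDer_eq_zero {V : smoothFun O} {K : Set (Coord n)} (hK : IsCompact K)
    (hKO : K ⊆ half O) (h0 : ∀ y : half O, (y : Coord n) ∉ K → evalAt y V = 0) (i : Fin (n + 1))
    (y : half O) (hy : (y : Coord n) ∉ K) : evalAt y (coordDer O i V) = 0 :=
  partialDeriv_eq_zero_of_notMem hK (contDiffOn_extFun_halfSpace hK hKO h0).1 i hy

/-- The divergence theorem for a compactly supported vector field. -/
theorem integral_divergence {V : Fin (n + 1) → smoothFun O} {K : Set (Coord n)}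
    (hK : IsCompact K) (hKO : K ⊆ half O)
    (h0 : ∀ i, ∀ y : half O, (y : Coord n) ∉ K → evalAt y (V i) = 0) :
    ∫ y, extFun (∑ i, coordDer O i (V i)) y = -∫ z, extFun (V 0) (hyperplane z) := by
  have h1 : ∀ y ∉ halfSpace n, extFun (∑ i, coordDer O i (V i)) y = 0 := fun y hy =>
    extFun_of_notMem _ fun h => hy h.1
  rw [← setIntegral_eq_integral_of_forall_compl_eq_zero h1]
  have e : ∀ y, extFun (∑ i, coordDer O i (V i)) y =
      ∑ i, partialDeriv i (extFun (V i)) y := fun y => by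
    rw [← extLin_apply, map_sum, Finset.sum_apply]
    exact Finset.sum_congr rfl fun i _ => by
      rw [extLin_apply, extFun_coordDer hK hKO (h0 i) i]
  simp only [e]
  rw [integral_finsetSum]
  · rw [Finset.sum_congr rfl fun i _ => integral_partialDeriv
      (contDiffOn_extFun_halfSpace hK hKO (h0 i)).2 hK (contDiffOn_extFun_halfSpace hK hKO (h0 i)).1
      i]
    simp
  · intro i _
    have hc := contDiffOn_extFun_halfSpace hK hKO (h0 i)
    exact integrableOn_halfSpace (continuousOn_partialDeriv hc.2 i) hK
      fun y hy => partialDeriv_eq_zero_of_notMem hK hc.1 i hy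

/-- The divergence theorem on the boundary hyperplane. -/
theorem integral_divergence_hyperplane {W : Fin n → smoothFun O} {K : Set (Coord n)}
    (hK : IsCompact K) (hKO : K ⊆ half O)
    (h0 : ∀ a, ∀ y : half O, (y : Coord n) ∉ K → evalAt y (W a) = 0) :
    ∫ z, extFun (∑ a : Fin n, coordDer O a.succ (W a)) (hyperplane z) = 0 := by
  have e : ∀ y, extFun (∑ a : Fin n, coordDer O a.succ (W a)) y =
      ∑ a : Fin n, partialDeriv a.succ (extFun (W a)) y := fun y => by
    rw [← extLin_apply, map_sum, Finset.sum_apply]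
    exact Finset.sum_congr rfl fun a _ => by
      rw [extLin_apply, extFun_coordDer hK hKO (h0 a)]
  simp only [e]
  rw [integral_finsetSum]
  · exact Finset.sum_eq_zero fun a _ => integral_partialDeriv_hyperplane
      (contDiffOn_extFun_halfSpace hK hKO (h0 a)).2 hK (contDiffOn_extFun_halfSpace hK hKO (h0 a)).1
      a
  · intro a _
    have hc := contDiffOn_extFun_halfSpace hK hKO (h0 a)
    have hK' : IsCompact (hyperplane ⁻¹' K) := isClosedEmbedding_hyperplane.isCompact_preimage hK
    exact ((continuousOn_partialDeriv hc.2 a.succ).comp_continuous continuous_hyperplane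
      hyperplane_mem).integrable_of_hasCompactSupport
      (HasCompactSupport.intro hK' fun z hz => partialDeriv_eq_zero_of_notMem hK hc.1 _ hz)

end Divergence

end

section

/-! ## The densities as polynomial functions of the conformal factor -/

open Polynomial

/-- The data of a metric which enter the curvature densities of its conformal class. -/
structure ConfData (n : ℕ) (A : Type*) where
  /-- the inverse metric -/
  inv : Matrix (Fin (n + 1)) (Fin (n + 1)) A
  /-- the metric -/
  met : Matrix (Fin (n + 1)) (Fin (n + 1)) A
  /-- the Schouten tensor -/
  sch : Matrix (Fin (n + 1)) (Fin (n + 1)) A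
  /-- the second fundamental form -/
  sff : Matrix (Fin n) (Fin n) A
  /-- the norm of `d y 0` -/
  lapse : A
  /-- the tangential part of `∂_0` -/
  shift : Fin n → A

namespace ConfData

variable {n : ℕ} {A B : Type*} [CommRing A] [Algebra ℝ A] [CommRing B] [Algebra ℝ B]

/-- Functoriality of the data in the coefficient ring. -/
def map (c : ConfData n A) (φ : A →ₐ[ℝ] B) : ConfData n B where
  inv := c.inv.map φ
  met := c.met.map φ
  sch := c.sch.map φ
  sff := c.sff.map φ
  lapse := φ c.lapse
  shift a := φ (c.shift a)

variable (c : ConfData n A)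

/-- The change of the Schouten tensor, in terms of the Hessian `H` and the differential `D`. -/
def confTerm (H : Matrix (Fin (n + 1)) (Fin (n + 1)) A) (D : Fin (n + 1) → A) :
    Matrix (Fin (n + 1)) (Fin (n + 1)) A := Matrix.of fun i j =>
  -H i j + D i * D j - (1 / 2 : ℝ) • ((∑ p, D p * ∑ q, c.inv p q * D q) * c.met i j)

/-- The value of a covector on the unit normal. -/
def etaTerm (D : Fin (n + 1) → A) : A := -(c.lapse * (D 0 - ∑ a, c.shift a * D a.succ))

/-- The interior density, up to its weight. -/
def bulk (m k : ℕ) (H : Matrix (Fin (n + 1)) (Fin (n + 1)) A) (D : Fin (n + 1) → A) : A :=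
  (pencil c.met (c.sch + c.confTerm H D)).det.coeff (m + k)

/-- The boundary density, up to its weight. -/
def bdry (m k : ℕ) (H : Matrix (Fin (n + 1)) (Fin (n + 1)) A) (D : Fin (n + 1) → A) : A :=
  hFun m k (pencil2 (tang c.met) (tang (c.sch + c.confTerm H D))
    (c.sff + c.etaTerm D • tang c.met)).det

variable (φ : A →ₐ[ℝ] B)

theorem map_confTerm (H : Matrix (Fin (n + 1)) (Fin (n + 1)) A) (D : Fin (n + 1) → A) :
    (c.confTerm H D).map φ = (c.map φ).confTerm (H.map φ) fun i => φ (D i) := by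
  ext i j
  simp [confTerm, map]

theorem map_etaTerm (D : Fin (n + 1) → A) :
    φ (c.etaTerm D) = (c.map φ).etaTerm fun i => φ (D i) := by
  simp [etaTerm, map]

theorem map_bulk (m k : ℕ) (H : Matrix (Fin (n + 1)) (Fin (n + 1)) A) (D : Fin (n + 1) → A) :
    φ (c.bulk m k H D) = (c.map φ).bulk m k (H.map φ) fun i => φ (D i) := by
  have h1 : (pencil c.met (c.sch + c.confTerm H D)).map (mapRingHom (φ : A →+* B)) =
      pencil (c.map φ).met ((c.map φ).sch + (c.map φ).confTerm (H.map φ) fun i => φ (D i)) := by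
    rw [map_pencil, ← map_confTerm]
    congr 1
    exact Matrix.map_add _ (map_add _) _ _
  rw [bulk, bulk, ← h1, ← RingHom.mapMatrix_apply, ← RingHom.map_det, coe_mapRingHom, coeff_map]
  rfl

theorem map_pencil2 (G P E : Matrix (Fin n) (Fin n) A) :
    (pencil2 G P E).map (mapRingHom (mapRingHom (φ : A →+* B))) =
      pencil2 (G.map φ) (P.map φ) (E.map φ) := by
  ext a b : 2
  simp [pencil2_apply]

theorem map_bdry (m k : ℕ) (H : Matrix (Fin (n + 1)) (Fin (n + 1)) A) (D : Fin (n + 1) → A) :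
    φ (c.bdry m k H D) = (c.map φ).bdry m k (H.map φ) fun i => φ (D i) := by
  have h1 : (pencil2 (tang c.met) (tang (c.sch + c.confTerm H D))
      (c.sff + c.etaTerm D • tang c.met)).map (mapRingHom (mapRingHom (φ : A →+* B))) =
      pencil2 (tang (c.map φ).met) (tang ((c.map φ).sch + (c.map φ).confTerm (H.map φ)
        fun i => φ (D i))) ((c.map φ).sff + ((c.map φ).etaTerm fun i => φ (D i)) •
          tang (c.map φ).met) := by
    rw [map_pencil2, ← map_confTerm, ← map_etaTerm]
    congr 1
    · ext a b; simp [map]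
    · ext a b; simp [map]
  rw [bdry, map_hFun, bdry, ← h1, ← coe_mapRingHom, RingHom.map_det, RingHom.mapMatrix_apply]

/-- The derivation `∂/∂X` of `A[X]`. -/
def epsDer (A : Type*) [CommRing A] [Algebra ℝ A] : Derivation ℝ A[X] A[X] :=
  (derivative' (R := A)).restrictScalars ℝ

theorem epsDer_apply (p : A[X]) : epsDer A p = derivative p := rfl

/-- Evaluation at `0`. -/
def evalZero (A : Type*) [CommRing A] [Algebra ℝ A] : A[X] →ₐ[ℝ] A :=
  (aeval (0 : A)).restrictScalars ℝ

theorem evalZero_apply (p : A[X]) : evalZero A p = p.coeff 0 := by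
  simp [evalZero, coeff_zero_eq_eval_zero]

theorem evalZero_epsDer (p : A[X]) : evalZero A (epsDer A p) = p.coeff 1 := by
  rw [evalZero_apply, epsDer_apply, coeff_derivative]; simp

/-- The inclusion of the constants. -/
def constHom (A : Type*) [CommRing A] [Algebra ℝ A] : A →ₐ[ℝ] A[X] := CAlgHom

theorem constHom_apply (a : A) : constHom A a = C a := rfl

theorem map_constHom_evalZero : (c.map (constHom A)).map (evalZero A) = c := by
  have h : ∀ a : A, evalZero A (constHom A a) = a := fun a => by
    rw [evalZero_apply, constHom_apply, coeff_C_zero]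
  cases c
  simp [map, h, Matrix.map_map, Function.comp_def]

variable (H : Matrix (Fin (n + 1)) (Fin (n + 1)) A) (D : Fin (n + 1) → A)

/-- The interior density as a polynomial in a scaling parameter. -/
def bulkPoly (m k : ℕ) : A[X] :=
  (c.map (constHom A)).bulk m k ((X : A[X]) • H.map C) fun i => X * C (D i)

/-- The boundary density as a polynomial in a scaling parameter. -/
def bdryPoly (m k : ℕ) : A[X] :=
  (c.map (constHom A)).bdry m k ((X : A[X]) • H.map C) fun i => X * C (D i)

theorem evalZero_X_smul_map : ((X : A[X]) • H.map C).map (evalZero A) = 0 := by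
  ext i j; simp [evalZero_apply]

theorem bulkPoly_coeff_zero (m k : ℕ) : (c.bulkPoly H D m k).coeff 0 = c.bulk m k 0 0 := by
  rw [← evalZero_apply, bulkPoly, map_bulk, map_constHom_evalZero, evalZero_X_smul_map]
  congr 1
  funext i; simp [evalZero_apply]

theorem bdryPoly_coeff_zero (m k : ℕ) : (c.bdryPoly H D m k).coeff 0 = c.bdry m k 0 0 := by
  rw [← evalZero_apply, bdryPoly, map_bdry, map_constHom_evalZero, evalZero_X_smul_map]
  congr 1
  funext i; simp [evalZero_apply]

theorem confTerm_zero : c.confTerm 0 0 = 0 := by ext i j; simp [confTerm]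

theorem etaTerm_zero : c.etaTerm 0 = 0 := by simp [etaTerm]

theorem evalZero_epsDer_confTerm (i j : Fin (n + 1)) :
    evalZero A (epsDer A (((c.map (constHom A)).sch + (c.map (constHom A)).confTerm
      ((X : A[X]) • H.map C) fun i => X * C (D i)) i j)) = -H i j := by
  -- The Schouten term is linear in the Hessian and quadratic in the differential; `confTerm 0 D`
  -- isolates the quadratic part, which does not contribute to the first order.
  have e : ((c.map (constHom A)).sch + (c.map (constHom A)).confTerm
      ((X : A[X]) • H.map C) fun i => X * C (D i)) i j = C (c.sch i j) - X * C (H i j)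
      + X ^ 2 * C (c.confTerm 0 D i j) := by
    simp only [Matrix.add_apply, confTerm, map, Matrix.of_apply, Matrix.map_apply,
      Matrix.smul_apply, constHom_apply, smul_eq_mul, Matrix.zero_apply, neg_zero, zero_add,
      C_sub, C_mul, map_sum, Finset.mul_sum, Finset.sum_mul, Finset.smul_sum]
    have h3 : ∀ a : A, C ((1 / 2 : ℝ) • a) = (1 / 2 : ℝ) • C a := fun a => map_smul (constHom A) _ a
    simp only [h3, C_mul, mul_sub, Finset.mul_sum]
    have h2 : ∀ p q, (1 / 2 : ℝ) • (X * C (D p) * (C (c.inv p q) * (X * C (D q))) * C (c.met i j)) =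
        X ^ 2 * (1 / 2 : ℝ) • (C (D p) * (C (c.inv p q) * C (D q)) * C (c.met i j)) := by
      intro p q
      rw [mul_smul_comm]
      congr 1
      ring
    simp only [h2]
    ring
  rw [e, evalZero_epsDer]
  simp [coeff_X_pow_mul', coeff_C]

theorem evalZero_epsDer_etaTerm :
    evalZero A (epsDer A ((c.map (constHom A)).etaTerm fun i => X * C (D i))) = c.etaTerm D := by
  have e : ((c.map (constHom A)).etaTerm fun i => X * C (D i)) = X * C (c.etaTerm D) := by
    simp only [etaTerm, map, constHom_apply, C_neg, C_mul, C_sub, map_sum, mul_sub,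
      Finset.mul_sum, mul_neg]
    rw [mul_left_comm]
    congr 2
    refine Finset.sum_congr rfl fun i _ => by ring
  rw [e, evalZero_epsDer, coeff_X_mul, coeff_C_zero]

theorem evalZero_sch_add :
    ((c.map (constHom A)).sch + (c.map (constHom A)).confTerm
      ((X : A[X]) • H.map C) fun i => X * C (D i)).map (evalZero A) = c.sch := by
  have h1 : (((c.map (constHom A)).confTerm
      ((X : A[X]) • H.map C) fun i => X * C (D i)).map (evalZero A)) = 0 := by
    rw [map_confTerm, map_constHom_evalZero, evalZero_X_smul_map]
    have : (fun i => evalZero A (X * C (D i))) = 0 := by funext i; simp [evalZero_apply]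
    rw [this, confTerm_zero]
  rw [Matrix.map_add _ (map_add _), h1, add_zero]
  ext i j
  simp [map, constHom_apply, evalZero_apply]

theorem evalZero_met : ((c.map (constHom A)).met).map (evalZero A) = c.met := by
  ext i j
  simp [map, constHom_apply, evalZero_apply]

/-- Jacobi's formula for the derivation in the scaling parameter, evaluated at zero; the quadratic
gradient terms are gone at that order, so the Newton tensor is paired with minus the Hessian. -/
theorem bulkPoly_coeff_one (m k : ℕ) : (c.bulkPoly H D m k).coeff 1 =
    -(∑ i, ∑ j, coeffMat (m + k) (pencil c.met c.sch).adjugate i j * H j i) := by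
  rw [← evalZero_epsDer, bulkPoly, bulk, ← coeff_polyDer, derivation_det]
  set M := pencil (c.map (constHom A)).met ((c.map (constHom A)).sch
    + (c.map (constHom A)).confTerm ((X : A[X]) • H.map C) fun i => X * C (D i)) with hM
  have h1 : evalZero A ((M.adjugate * M.map (polyDer (epsDer A))).trace.coeff (m + k)) =
      ((mapRingHom (evalZero A : A[X] →+* A))
        (M.adjugate * M.map (polyDer (epsDer A))).trace).coeff (m + k) := by
    rw [coe_mapRingHom, coeff_map]; rfl
  have h2 : M.map (mapRingHom (evalZero A : A[X] →+* A)) = pencil c.met c.sch := by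
    rw [hM, map_pencil]
    exact congrArg₂ pencil (evalZero_met c) (evalZero_sch_add c H D)
  have h3 : (M.map (polyDer (epsDer A))).map (mapRingHom (evalZero A : A[X] →+* A)) =
      -H.map C := by
    ext i j : 2
    simp only [Matrix.map_apply, hM, pencil_apply, map_add, Derivation.leibniz, polyDer_C,
      polyDer_X, smul_zero, add_zero, Matrix.neg_apply, coe_mapRingHom, Polynomial.map_C,
      smul_eq_mul, Polynomial.map_mul, Polynomial.map_X, Polynomial.map_add, RingHom.coe_coe]
    rw [evalZero_epsDer_confTerm]
    have : epsDer A ((c.map (constHom A)).met i j) = 0 := by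
      rw [epsDer_apply]; exact derivative_C
    rw [this]
    simp
  have h4 : (mapRingHom (evalZero A : A[X] →+* A))
        (M.adjugate * M.map (polyDer (epsDer A))).trace =
      ((pencil c.met c.sch).adjugate * -H.map C).trace := by
    rw [← h2, ← h3, ← RingHom.mapMatrix_apply, ← RingHom.mapMatrix_apply, ← RingHom.map_adjugate,
      ← map_mul]
    exact AddMonoidHom.map_trace (mapRingHom (evalZero A : A[X] →+* A)) _
  rw [h1, h4, Matrix.mul_neg, Matrix.trace_neg, coeff_neg]
  congr 1
  simp [Matrix.trace, Matrix.mul_apply, coeffMat]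

/-- The same computation for the two-variable pencil, where in addition the second fundamental form
varies by a multiple of the metric. -/
theorem bdryPoly_coeff_one (m k : ℕ) : (c.bdryPoly H D m k).coeff 1 =
    hFun m k (((pencil2 (tang c.met) (tang c.sch) c.sff).adjugate *
      pencil2 0 (-tang H) (c.etaTerm D • tang c.met)).trace) := by
  rw [← evalZero_epsDer, bdryPoly, bdry, ← hFun_polyDer, derivation_det]
  set M := pencil2 (tang (c.map (constHom A)).met) (tang ((c.map (constHom A)).sch
    + (c.map (constHom A)).confTerm ((X : A[X]) • H.map C) fun i => X * C (D i)))
    ((c.map (constHom A)).sff + ((c.map (constHom A)).etaTerm fun i => X * C (D i)) •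
      tang (c.map (constHom A)).met) with hM
  have h2 : M.map (mapRingHom (mapRingHom (evalZero A : A[X] →+* A))) =
      pencil2 (tang c.met) (tang c.sch) c.sff := by
    rw [hM, map_pencil2]
    congr 1
    · exact congrArg tang (evalZero_met c)
    · exact congrArg tang (evalZero_sch_add c H D)
    · ext a b
      simp only [Matrix.map_apply, Matrix.add_apply, Matrix.smul_apply, map_add, smul_eq_mul,
        map_mul]
      rw [map_etaTerm, map_constHom_evalZero]
      have : (fun i => evalZero A (X * C (D i))) = 0 := by funext i; simp [evalZero_apply]
      rw [this, etaTerm_zero, zero_mul, add_zero, evalZero_apply]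
      exact coeff_C_zero
  have h3 : (M.map (polyDer (polyDer (epsDer A)))).map
      (mapRingHom (mapRingHom (evalZero A : A[X] →+* A))) =
      pencil2 0 (-tang H) (c.etaTerm D • tang c.met) := by
    ext a b : 2
    have t1 : epsDer A ((c.map (constHom A)).met a.succ b.succ) = 0 := by
      rw [epsDer_apply]; exact derivative_C
    have t2 : epsDer A ((c.map (constHom A)).sff a b) = 0 := by
      rw [epsDer_apply]; exact derivative_C
    have t3 : evalZero A ((c.map (constHom A)).met a.succ b.succ) = c.met a.succ b.succ :=
      congrFun (congrFun (evalZero_met c) a.succ) b.succ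
    have t4 := evalZero_epsDer_confTerm c H D a.succ b.succ
    have t5 := evalZero_epsDer_etaTerm c D
    simp only [Matrix.map_apply, hM, pencil2_apply, tang_apply, Matrix.add_apply,
      Matrix.smul_apply, Matrix.neg_apply, Matrix.zero_apply] at t4 ⊢
    simp only [map_add, map_mul, Derivation.leibniz, polyDer_C, polyDer_X, t1, t2, smul_zero,
      smul_eq_mul, map_zero, mul_zero, zero_add, add_zero, zero_mul, coe_mapRingHom,
      Polynomial.map_add, Polynomial.map_mul, Polynomial.map_C, Polynomial.map_X,
      Polynomial.map_zero, RingHom.coe_coe, t3, t5, mul_comm] at t4 ⊢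
    rw [← C_add, ← C_add, t4]
  rw [map_hFun]
  congr 1
  rw [← h2, ← h3, ← RingHom.mapMatrix_apply, ← RingHom.mapMatrix_apply, ← RingHom.map_adjugate,
      ← map_mul]
  exact AddMonoidHom.map_trace (mapRingHom (mapRingHom (evalZero A : A[X] →+* A))) _

/-- Evaluation of the polynomials. -/
theorem eval_bulkPoly (m k : ℕ) (ε : ℝ) :
    (c.bulkPoly H D m k).eval (algebraMap ℝ A ε) = c.bulk m k (ε • H) (ε • D) := by
  have h := (c.map (constHom A)).map_bulk ((aeval (algebraMap ℝ A ε)).restrictScalars ℝ) m k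
    ((X : A[X]) • H.map C) fun i => X * C (D i)
  have e1 : (c.map (constHom A)).map ((aeval (algebraMap ℝ A ε)).restrictScalars ℝ) = c := by
    cases c
    simp [map, constHom_apply, Matrix.map_map, Function.comp_def]
  have e2 : (((X : A[X]) • H.map C).map ((aeval (algebraMap ℝ A ε)).restrictScalars ℝ)) = ε • H := by
    ext i j
    rw [Matrix.smul_apply, Matrix.map_apply, Matrix.smul_apply, Algebra.smul_def ε]
    simp only [Matrix.map_apply, smul_eq_mul, AlgHom.restrictScalars_apply, map_mul, aeval_X,
      aeval_C, Algebra.algebraMap_self, RingHom.id_apply]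
  rw [e1, e2] at h
  refine Eq.trans ?_ (h.trans ?_)
  · simp [bulkPoly]
  · congr 1
    funext i
    rw [Pi.smul_apply, Algebra.smul_def]
    simp
    try ring

theorem eval_bdryPoly (m k : ℕ) (ε : ℝ) :
    (c.bdryPoly H D m k).eval (algebraMap ℝ A ε) = c.bdry m k (ε • H) (ε • D) := by
  have h := (c.map (constHom A)).map_bdry ((aeval (algebraMap ℝ A ε)).restrictScalars ℝ) m k
    ((X : A[X]) • H.map C) fun i => X * C (D i)
  have e1 : (c.map (constHom A)).map ((aeval (algebraMap ℝ A ε)).restrictScalars ℝ) = c := by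
    cases c
    simp [map, constHom_apply, Matrix.map_map, Function.comp_def]
  have e2 : (((X : A[X]) • H.map C).map ((aeval (algebraMap ℝ A ε)).restrictScalars ℝ)) = ε • H := by
    ext i j
    rw [Matrix.smul_apply, Matrix.map_apply, Matrix.smul_apply, Algebra.smul_def ε]
    simp only [Matrix.map_apply, smul_eq_mul, AlgHom.restrictScalars_apply, map_mul, aeval_X,
      aeval_C, Algebra.algebraMap_self, RingHom.id_apply]
  rw [e1, e2] at h
  refine Eq.trans ?_ (h.trans ?_)
  · simp [bdryPoly]
  · congr 1
    funext i
    rw [Pi.smul_apply, Algebra.smul_def]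
    simp
    try ring

/-- The algebra homomorphism which evaluates both variables. -/
def evalTwo (A : Type*) [CommRing A] [Algebra ℝ A] (a b : ℝ) : A[X][X] →ₐ[ℝ] A :=
  ((aeval (algebraMap ℝ A a)).restrictScalars ℝ).comp
    ((aeval (algebraMap ℝ A[X] b)).restrictScalars ℝ)

theorem evalTwo_apply (a b : ℝ) (p : A[X][X]) :
    evalTwo A a b p = (p.eval (algebraMap ℝ A[X] b)).eval (algebraMap ℝ A a) := by
  simp [evalTwo]

variable (H' : Matrix (Fin (n + 1)) (Fin (n + 1)) A) (D' : Fin (n + 1) → A)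

/-- Polynomial dependence on two directions at once. In the critical dimension it supplies the joint
smoothness in both parameters that the ray integral requires. -/
theorem exists_bulk_two (m k : ℕ) : ∃ p : A[X][X], ∀ a b : ℝ,
    c.bulk m k (a • H + b • H') (a • D + b • D') = evalTwo A a b p := by
  refine ⟨(c.map ((constHom A[X]).comp (constHom A))).bulk m k
    (Matrix.of fun i j => C (X * C (H i j)) + X * C (C (H' i j)))
    (fun i => C (X * C (D i)) + X * C (C (D' i))), fun a b => ?_⟩
  rw [map_bulk]
  have e1 : (c.map ((constHom A[X]).comp (constHom A))).map (evalTwo A a b) = c := by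
    cases c
    simp [map, constHom_apply, Matrix.map_map, Function.comp_def, evalTwo_apply]
  rw [e1]
  congr 1
  · ext i j
    rw [Matrix.add_apply, Matrix.smul_apply, Matrix.smul_apply, Algebra.smul_def, Algebra.smul_def]
    simp [evalTwo_apply]
    try ring
  · funext i
    rw [Pi.add_apply, Pi.smul_apply, Pi.smul_apply, Algebra.smul_def, Algebra.smul_def]
    simp [evalTwo_apply]
    try ring

theorem exists_bdry_two (m k : ℕ) : ∃ p : A[X][X], ∀ a b : ℝ,
    c.bdry m k (a • H + b • H') (a • D + b • D') = evalTwo A a b p := by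
  refine ⟨(c.map ((constHom A[X]).comp (constHom A))).bdry m k
    (Matrix.of fun i j => C (X * C (H i j)) + X * C (C (H' i j)))
    (fun i => C (X * C (D i)) + X * C (C (D' i))), fun a b => ?_⟩
  rw [map_bdry]
  have e1 : (c.map ((constHom A[X]).comp (constHom A))).map (evalTwo A a b) = c := by
    cases c
    simp [map, constHom_apply, Matrix.map_map, Function.comp_def, evalTwo_apply]
  rw [e1]
  congr 1
  · ext i j
    rw [Matrix.add_apply, Matrix.smul_apply, Matrix.smul_apply, Algebra.smul_def, Algebra.smul_def]
    simp [evalTwo_apply]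
    try ring
  · funext i
    rw [Pi.add_apply, Pi.smul_apply, Pi.smul_apply, Algebra.smul_def, Algebra.smul_def]
    simp [evalTwo_apply]
    try ring

end ConfData

end

section

/-! ## The first variation in a chart -/

open TopologicalSpace (Opens)
open Polynomial (C X)

section WeightDerivation

variable {R : Type*} [CommRing R] [Algebra ℝ R]

/-- Formally u = D^{-1/2}. Differentiate u u D = 1; division by 2 u D is multiplication by u/2, in
view of the relation itself. -/
theorem derivation_weight (δ : Derivation ℝ R R) {u D τ : R} (h : u * u * D = 1)
    (hD : δ D = 2 * τ * D) : δ u = -(τ * u) := by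
  have h1 : δ (u * u * D) = 0 := by rw [h]; exact δ.map_one_eq_zero
  rw [Derivation.leibniz, Derivation.leibniz, hD] at h1
  simp only [smul_eq_mul] at h1
  have h2 : (algebraMap ℝ R (1 / 2)) * 2 = 1 := by
    rw [← map_ofNat (algebraMap ℝ R) 2, ← map_mul]; norm_num
  linear_combination (algebraMap ℝ R (1 / 2)) * u * h1
    - (δ u + τ * u) * ((algebraMap ℝ R (1 / 2)) * 2 * h + h2)

end WeightDerivation

variable {n : ℕ} {O : Opens (Coord n)}
  {G : Coord n → Matrix (Fin (n + 1)) (Fin (n + 1)) ℝ} (hG : IsMetricOn O G)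

namespace IsMetricOn

/-- The data of the metric over the algebra of smooth functions. -/
def data : ConfData n (smoothFun O) where
  inv := hG.mat⁻¹
  met := hG.mat
  sch := hG.schoutenMat
  sff := hG.sffMat
  lapse := hG.lapse
  shift := shift hG.mat

include hG in
theorem contDiffOn_det : ContDiffOn ℝ ∞ (fun y => (G y).det) (half O) :=
  (contDiffOn_extFun hG.mat.det).congr fun y hy => by
    rw [extFun_apply _ hy, evalAt_det, map_mat]

include hG in
theorem contDiffOn_det_tangential : ContDiffOn ℝ ∞ (fun y => (tangential (G y)).det) (half O) :=
  (contDiffOn_extFun (tang hG.mat).det).congr fun y hy => by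
    rw [extFun_apply _ hy, evalAt_det]; rfl

/-- The reciprocal of the volume density. -/
def bulkWt : smoothFun O := toSmooth (fun y => (Real.sqrt (G y).det)⁻¹)
  ((hG.contDiffOn_det.sqrt fun y hy => (hG.posDef y hy).det_pos.ne').inv fun y hy =>
    (Real.sqrt_pos.2 (hG.posDef y hy).det_pos).ne')

/-- The reciprocal of the volume density of the hyperplanes. -/
def bdryWt : smoothFun O := toSmooth (fun y => (Real.sqrt (tangential (G y)).det)⁻¹)
  ((hG.contDiffOn_det_tangential.sqrt fun _ hy => (hG.tangential_posDef hy).det_pos.ne').inv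
    fun _ hy => (Real.sqrt_pos.2 (hG.tangential_posDef hy).det_pos).ne')

theorem inv_sqrt_mul {x : ℝ} (hx : 0 < x) : (Real.sqrt x)⁻¹ * (Real.sqrt x)⁻¹ * x = 1 := by
  rw [← mul_inv, Real.mul_self_sqrt hx.le, inv_mul_cancel₀ hx.ne']

theorem bulkWt_mul : hG.bulkWt * hG.bulkWt * hG.mat.det = 1 := smoothFun_ext fun y => by
  rw [map_mul, map_mul, evalAt_det, map_mat, map_one]
  exact inv_sqrt_mul (hG.posDef y y.2).det_pos

theorem bdryWt_mul : hG.bdryWt * hG.bdryWt * (tang hG.mat).det = 1 := smoothFun_ext fun y => by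
  rw [map_mul, map_mul, evalAt_det, map_one]
  exact inv_sqrt_mul (hG.tangential_posDef y.2).det_pos

/-- From det ḡ = g^{00} det g. It turns the factor ν times the boundary weight, with which the flux
enters `current_zero_add_bdryVar`, into the interior weight of the current. -/
theorem lapse_mul_bdryWt : hG.lapse * hG.bdryWt = hG.bulkWt := smoothFun_ext fun y => by
  have hd := (hG.posDef y y.2).det_pos
  have hi := hG.inv_zero_zero_pos y.2
  have h1 : (tangential (G y)).det = (G y).det * (G y)⁻¹ 0 0 :=
    det_tang (isUnit_iff_ne_zero.2 hd.ne')
  rw [map_mul, evalAt_lapse, bdryWt, bulkWt, evalAt_toSmooth, evalAt_toSmooth, h1,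
    Real.sqrt_mul hd.le, mul_inv]
  have := (Real.sqrt_pos.2 hi).ne'
  field_simp

theorem coordDer_bulkWt (a : Fin (n + 1)) :
    coordDer O a hG.bulkWt = -((hG.conn a).trace * hG.bulkWt) :=
  derivation_weight _ hG.bulkWt_mul (hG.isLeviCivita.det_map a)

theorem tangDer_bdryWt (a : Fin n) :
    tangDer (coordDer O) a hG.bdryWt = -((tangConn hG.mat hG.conn a).trace * hG.bdryWt) :=
  derivation_weight _ hG.bdryWt_mul
    ((isLeviCivita_tang hG.mat_isSymm hG.isUnit_det_tang hG.isLeviCivita).det_map a)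

/-- The Hessian over the algebra of smooth functions. -/
abbrev hs (w : smoothFun O) : Matrix (Fin (n + 1)) (Fin (n + 1)) (smoothFun O) :=
  hess (coordDer O) hG.conn w

/-- The differential over the algebra of smooth functions. -/
abbrev _root_.BdryCurv.dif (w : smoothFun O) (i : Fin (n + 1)) : smoothFun O := coordDer O i w

/-- The interior density along the line `ε w`. -/
def bulkQ (m k : ℕ) (w : smoothFun O) : Polynomial (smoothFun O) :=
  C hG.bulkWt * hG.data.bulkPoly (hG.hs w) (dif w) m k

/-- The boundary density along the line `ε w`. -/
def bdryQ (m k : ℕ) (w : smoothFun O) : Polynomial (smoothFun O) :=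
  C hG.bdryWt * hG.data.bdryPoly (hG.hs w) (dif w) m k

theorem bulkQ_coeff_zero (m k : ℕ) (w : smoothFun O) :
    (hG.bulkQ m k w).coeff 0 = hG.bulkWt * hG.data.bulk m k 0 0 := by
  rw [bulkQ, Polynomial.coeff_C_mul, ConfData.bulkPoly_coeff_zero]

theorem bdryQ_coeff_zero (m k : ℕ) (w : smoothFun O) :
    (hG.bdryQ m k w).coeff 0 = hG.bdryWt * hG.data.bdry m k 0 0 := by
  rw [bdryQ, Polynomial.coeff_C_mul, ConfData.bdryPoly_coeff_zero]

theorem bulkQ_coeff_one (m k : ℕ) (w : smoothFun O) :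
    (hG.bulkQ m k w).coeff 1 = -(hG.bulkWt * ∑ i, ∑ j,
      coeffMat (m + k) (pencil hG.mat hG.schoutenMat).adjugate i j * hG.hs w i j) := by
  rw [bulkQ, Polynomial.coeff_C_mul, ConfData.bulkPoly_coeff_one]
  have h : ∑ i, ∑ j, coeffMat (m + k) (pencil hG.data.met hG.data.sch).adjugate i j * hG.hs w j i =
      ∑ i, ∑ j, coeffMat (m + k) (pencil hG.mat hG.schoutenMat).adjugate i j * hG.hs w i j :=
    Finset.sum_congr rfl fun i _ => Finset.sum_congr rfl fun j _ =>
      congrArg _ ((hess_symm hG.isLeviCivita.symm coordDer_comm w).apply i j)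
  rw [h]
  generalize (∑ i, ∑ j, coeffMat (m + k) (pencil hG.mat hG.schoutenMat).adjugate i j * hG.hs w i j)
    = S
  ring

theorem bdryQ_coeff_one (m k : ℕ) (w : smoothFun O) :
    (hG.bdryQ m k w).coeff 1 = bdryVar (coordDer O) hG.mat hG.schoutenMat hG.conn hG.lapse
      hG.bdryWt hG.sffMat m k w := by
  rw [bdryQ, Polynomial.coeff_C_mul, ConfData.bdryPoly_coeff_one]
  rfl

variable {k m : ℕ} (hk : 1 ≤ k) (hN : n + 1 = 2 * k + m)
  (hW : 3 ≤ k → ∀ y ∈ half O, WeylFreeAt G y)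

include hk hN hW in
/-- Green's formula for the linearized curvature densities. -/
theorem integral_green {f v : smoothFun O} {K : Set (Coord n)} (hK : IsCompact K)
    (hKO : K ⊆ half O) (hf : ∀ y : half O, (y : Coord n) ∉ K → evalAt y f = 0) :
    (∫ y, extFun (f * (hG.bulkQ m k v).coeff 1 - v * (hG.bulkQ m k f).coeff 1) y) +
      ∫ z, extFun (f * (hG.bdryQ m k v).coeff 1 - v * (hG.bdryQ m k f).coeff 1) (hyperplane z)
      = 0 := by
  -- Only f has compact support; v may be arbitrary, because the current contains v and dv only next
  -- to df and f.
  have hdf : ∀ i, ∀ y : half O, (y : Coord n) ∉ K → evalAt y (coordDer O i f) = 0 :=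
    fun i y hy => evalAt_coordDer_eq_zero hK hKO hf i y hy
  set d := coordDer O
  set Z := coeffMat (m + k) (pencil hG.mat hG.schoutenMat).adjugate
  have hPs := hG.schoutenMat_isSymm
  have hP : 2 ≤ k → ric d hG.conn = (((n + 1 : ℕ) : ℝ) - 2) • hG.schoutenMat
      + (hG.mat⁻¹ * hG.schoutenMat).trace • hG.mat := fun h2 =>
    ric_eq_schoutenOf hG.isUnit_det (by omega)
  have hW' : 3 ≤ k → WeylFree hG.mat hG.conn d hG.schoutenMat := fun h3 =>
    (weylFree_iff hG).2 (hW h3)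
  set V : Fin (n + 1) → smoothFun O := fun a =>
    hG.bulkWt * ∑ j, Z a j * (f * d j v - v * d j f) with hV
  have hV0 : ∀ i, ∀ y : half O, (y : Coord n) ∉ K → evalAt y (V i) = 0 := fun i y hy => by
    simp [hV, hf y hy, hdf _ y hy]
  have hZs : Z.IsSymm := by
    have := (pencil_isSymm hG.mat_isSymm hPs).adjugate
    exact Matrix.ext fun a b => by simp only [Z, coeffMat, Matrix.transpose_apply, Matrix.map_apply,
      this.apply a b]
  have hbulk : ∑ a, d a (V a) =
      -(f * (hG.bulkQ m k v).coeff 1 - v * (hG.bulkQ m k f).coeff 1) := by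
    have hcur := sum_derivation_current (d := d) (Γ := hG.conn) (σ := hG.bulkWt) (Z := Z) hZs
      hG.coordDer_bulkWt (Y := 0) (fun b => by
        rw [Pi.zero_apply, add_zero]
        exact sum_derivation_newton hk (by rw [Fintype.card_fin]; exact hN) hG.isUnit_det
          hG.mat_isSymm hG.isLeviCivita coordDer_comm hPs
          (fun h2 => by rw [Fintype.card_fin]; exact hP h2) hW' b) f v
    rw [hV, hcur, bulkQ_coeff_one, bulkQ_coeff_one]
    simp only [Pi.zero_apply, zero_mul, Finset.sum_const_zero, add_zero, mul_sub,
      Finset.sum_sub_distrib, mul_left_comm _ f, mul_left_comm _ v, ← Finset.mul_sum, mul_neg]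
    ring
  set W : Fin n → smoothFun O := fun a => hG.bdryWt * ∑ b : Fin n,
        hFun m k ((pencil2 (tang hG.mat) (tang hG.schoutenMat) hG.sffMat).adjugate a b)
          * (f * d b.succ v - v * d b.succ f) with hWdef
  have hW0 : ∀ a, ∀ y : half O, (y : Coord n) ∉ K → evalAt y (W a) = 0 := fun a y hy => by
    simp [hWdef, hf y hy, hdf _ y hy]
  -- The interior integrand is minus the divergence of V, with integral ∫ V⁰ over the hyperplane;
  -- the boundary integrand is -V⁰ up to a tangential divergence. The two therefore cancel.
  have hbd : f * (hG.bdryQ m k v).coeff 1 - v * (hG.bdryQ m k f).coeff 1 =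
      -(V 0) - ∑ a : Fin n, d a.succ (W a) := by
    have hcur := current_zero_add_bdryVar (d := d) (Γ := hG.conn) hk hN hG.isUnit_det hG.mat_isSymm
      hG.isUnit_det_tang hG.isLeviCivita coordDer_comm hPs hP hW' hG.lapse_mul_self hG.isUnit_lapse
      hG.conn_zero hG.tangDer_bdryWt f v
    rw [hG.lapse_mul_bdryWt] at hcur
    rw [bdryQ_coeff_one, bdryQ_coeff_one]
    simp only [hV, hWdef]
    linear_combination hcur
  have i1 := integral_divergence hK hKO hV0
  have i2 := integral_divergence_hyperplane hK hKO hW0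
  rw [hbulk, ← extLin_apply, map_neg] at i1
  rw [hbd]
  have hc1 : IsCompact (hyperplane ⁻¹' K) := isClosedEmbedding_hyperplane.isCompact_preimage hK
  have hint : ∀ c : smoothFun O, (∀ y : half O, (y : Coord n) ∉ K → evalAt y c = 0) →
      Integrable fun z => extFun c (hyperplane z) := fun c hc =>
    ((contDiffOn_extFun_halfSpace hK hKO hc).2.continuousOn.comp_continuous continuous_hyperplane
      hyperplane_mem).integrable_of_hasCompactSupport
      (HasCompactSupport.intro hc1 fun z hz => (contDiffOn_extFun_halfSpace hK hKO hc).1 _ hz)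
  have e2 : ∀ z : EuclideanSpace ℝ (Fin n), extFun (-(V 0) - ∑ a : Fin n, d a.succ (W a)) (hyperplane z) =
      -extFun (V 0) (hyperplane z) - extFun (∑ a : Fin n, d a.succ (W a)) (hyperplane z) := fun z => by
    rw [← extLin_apply, map_sub, map_neg]; rfl
  simp only [e2]
  have h3 : Integrable fun z : EuclideanSpace ℝ (Fin n) => -extFun (V 0) (hyperplane z) :=
    (hint _ (hV0 0)).neg
  have h4 := hint (∑ a : Fin n, d a.succ (W a)) fun y hy => by
    rw [map_sum]
    exact Finset.sum_eq_zero fun a _ => evalAt_coordDer_eq_zero hK hKO (hW0 a) _ y hy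
  rw [integral_sub h3 h4, i2, integral_neg, ← i1]
  simp [extLin_apply, integral_neg]

end IsMetricOn

end

section

/-! ## The curvature functional in a chart -/

open TopologicalSpace (Opens)
open Polynomial (C X)

variable {n : ℕ} {O : Opens (Coord n)}

/-- Lebesgue measure on the boundary hyperplane. -/
def hypMeasure (n : ℕ) : Measure (Coord n) := Measure.map hyperplane volume

theorem integral_hypMeasure (F : Coord n → ℝ) :
    ∫ y, F y ∂(hypMeasure n) = ∫ z, F (hyperplane z) :=
  isClosedEmbedding_hyperplane.measurableEmbedding.integral_map F

instance : IsFiniteMeasureOnCompacts (hypMeasure n) where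
  lt_top_of_isCompact K hK := by
    rw [hypMeasure, isClosedEmbedding_hyperplane.measurableEmbedding.map_apply]
    exact (isClosedEmbedding_hyperplane.isCompact_preimage hK).measure_lt_top

theorem measurableSet_half : MeasurableSet (half O) :=
  measurableSet_halfSpace.inter O.isOpen.measurableSet

theorem measurable_extFun (f : smoothFun O) : Measurable (extFun f) := by
  classical
  have h : extFun f = (half O).piecewise (extFun f) 0 := by
    funext y
    by_cases hy : y ∈ half O
    · simp [hy]
    · simp [hy, extFun_of_notMem f hy]
  rw [h]
  exact (contDiffOn_extFun f).continuousOn.measurable_piecewise continuousOn_const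
    measurableSet_half

theorem extFun_mul (f g : smoothFun O) (y : Coord n) : extFun (f * g) y = extFun f y * extFun g y := by
  by_cases hy : y ∈ half O
  · simp [extFun_apply _ hy]
  · simp [extFun_of_notMem _ hy]

theorem extFun_add (f g : smoothFun O) (y : Coord n) : extFun (f + g) y = extFun f y + extFun g y :=
  congrFun (map_add (extLin O) f g) y

theorem extFun_smul (a : ℝ) (f : smoothFun O) (y : Coord n) : extFun (a • f) y = a * extFun f y :=
  congrFun (map_smul (extLin O) a f) y

/-! ### Integrals depending on a parameter. -/

section Integrals

variable {K : Set (Coord n)} (hK : IsCompact K) (hKO : K ⊆ half O)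
  (μ : Measure (Coord n)) [IsFiniteMeasureOnCompacts μ]

include hK hKO

theorem integrable_extFun {c : smoothFun O}
    (hc : ∀ y : half O, (y : Coord n) ∉ K → evalAt y c = 0) : Integrable (extFun c) μ := by
  have h1 : IntegrableOn (extFun c) K μ :=
    ((contDiffOn_extFun c).continuousOn.mono hKO).integrableOn_compact hK
  refine (integrableOn_iff_integrable_of_support_subset fun y hy => ?_).1 h1
  by_contra h
  exact hy ((contDiffOn_extFun_halfSpace hK hKO hc).1 y h)

/-- Dominated differentiation for |ε| < 1: c vanishes off K, and on K the function w is bounded by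
|B|, which gives the bound |c| e^{|B|} |B|. -/
theorem hasDerivAt_integral_exp {c w : smoothFun O}
    (hc : ∀ y : half O, (y : Coord n) ∉ K → evalAt y c = 0) :
    HasDerivAt (fun ε : ℝ => ∫ y, extFun c y * Real.exp (ε * extFun w y) ∂μ)
      (∫ y, extFun (c * w) y ∂μ) 0 := by
  obtain ⟨B, hB⟩ := hK.exists_bound_of_continuousOn ((contDiffOn_extFun w).continuousOn.mono hKO)
  have h0 := (contDiffOn_extFun_halfSpace hK hKO hc).1
  have hm : ∀ ε : ℝ, Measurable fun y => extFun c y * Real.exp (ε * extFun w y) := fun ε =>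
    (measurable_extFun c).mul ((measurable_extFun w).const_mul ε).exp
  have key := (hasDerivAt_integral_of_dominated_loc_of_deriv_le (μ := μ) (𝕜 := ℝ)
    (F := fun ε y => extFun c y * Real.exp (ε * extFun w y))
    (F' := fun ε y => extFun c y * (Real.exp (ε * extFun w y) * extFun w y))
    (x₀ := 0) (s := Metric.ball 0 1) (bound := fun y => |extFun c y| * (Real.exp |B| * |B|))
    (Metric.ball_mem_nhds 0 one_pos)
    (Filter.Eventually.of_forall fun ε => (hm ε).aestronglyMeasurable)
    (by simpa using integrable_extFun hK hKO μ hc)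
    (((measurable_extFun c).mul ((((measurable_extFun w).const_mul (0 : ℝ)).exp).mul
      (measurable_extFun w))).aestronglyMeasurable)
    (Filter.Eventually.of_forall fun y ε hε => by
      by_cases hy : y ∈ K
      · rw [norm_mul, norm_mul, Real.norm_eq_abs, Real.norm_eq_abs, Real.abs_exp]
        have h1 : |extFun w y| ≤ |B| := (hB y hy).trans (le_abs_self B)
        have h2 : ε * extFun w y ≤ |B| := by
          refine (le_abs_self _).trans ?_
          rw [abs_mul]
          have : |ε| ≤ 1 := by
            rw [mem_ball_zero_iff, Real.norm_eq_abs] at hε; exact hε.le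
          calc |ε| * |extFun w y| ≤ 1 * |B| := by gcongr
            _ = |B| := one_mul _
        rw [Real.norm_eq_abs]
        gcongr
      · simp [h0 y hy])
    ((integrable_extFun hK hKO μ hc).abs.mul_const _)
    (Filter.Eventually.of_forall fun y ε _ => by
      have := ((hasDerivAt_id ε).mul_const (extFun w y)).exp.const_mul (extFun c y)
      simpa using this)).2
  refine key.congr_deriv ?_
  refine integral_congr_ae (Filter.Eventually.of_forall fun y => ?_)
  simp [extFun_mul]

/-- Expand in powers of ε. Only the powers 0 and 1 affect the derivative at ε = 0: the first through
the exponential, the second through its own coefficient. -/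
theorem hasDerivAt_integral_poly {h : smoothFun O}
    (hh : ∀ y : half O, (y : Coord n) ∉ K → evalAt y h = 0) (w : smoothFun O)
    (q : Polynomial (smoothFun O)) (m : ℝ) :
    HasDerivAt (fun ε : ℝ => ∫ y, extFun (h * q.eval (algebraMap ℝ _ ε)) y
        * Real.exp (m * extFun (ε • w) y) ∂μ)
      (∫ y, extFun (h * (q.coeff 1 + m • (w * q.coeff 0))) y ∂μ) 0 := by
  have hv : ∀ c : smoothFun O, ∀ y : half O, (y : Coord n) ∉ K → evalAt y (h * c) = 0 :=
    fun c y hy => by rw [map_mul, hh y hy, zero_mul]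
  -- The sums run over N + 2 terms, so that the terms of degree 0 and 1 can be split off whatever
  -- the degree of q.
  set N := q.natDegree
  set I : ℕ → ℝ → ℝ := fun j ε =>
    ∫ y, extFun (h * q.coeff j) y * Real.exp (ε * extFun (m • w) y) ∂μ with hI
  have hint : ∀ j ε, Integrable
      (fun y => extFun (h * q.coeff j) y * Real.exp (ε * extFun (m • w) y)) μ := fun j ε => by
    have hs : ContDiffOn ℝ ∞ (fun y => Real.exp (ε * extFun (m • w) y)) (half O) :=
      (contDiffOn_const.mul (contDiffOn_extFun (m • w))).exp
    refine (integrable_extFun hK hKO μ (c := h * (q.coeff j * toSmooth _ hs)) (hv _)).congr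
      (Filter.Eventually.of_forall fun y => ?_)
    by_cases hy : y ∈ half O
    · simp only [extFun_apply _ hy, map_mul, evalAt_toSmooth, mul_assoc]
    · simp [extFun_of_notMem _ hy]
  have hfun : (fun ε : ℝ => ∫ y, extFun (h * q.eval (algebraMap ℝ _ ε)) y
        * Real.exp (m * extFun (ε • w) y) ∂μ) =
      fun ε => ∑ j ∈ Finset.range (N + 2), ε ^ j * I j ε := by
    funext ε
    have e1 : ∀ y, extFun (h * q.eval (algebraMap ℝ _ ε)) y * Real.exp (m * extFun (ε • w) y) =
        ∑ j ∈ Finset.range (N + 2), ε ^ j *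
          (extFun (h * q.coeff j) y * Real.exp (ε * extFun (m • w) y)) := fun y => by
      have e2 : h * q.eval (algebraMap ℝ _ ε) =
          ∑ j ∈ Finset.range (N + 2), ε ^ j • (h * q.coeff j) := by
        rw [Polynomial.eval_eq_sum_range' (n := N + 2) (by omega), Finset.mul_sum]
        refine Finset.sum_congr rfl fun j _ => ?_
        rw [← map_pow, mul_comm (q.coeff j), ← Algebra.smul_def, mul_smul_comm]
      rw [e2, ← extLin_apply, map_sum, Finset.sum_apply, Finset.sum_mul]
      refine Finset.sum_congr rfl fun j _ => ?_
      rw [extLin_apply, extFun_smul, extFun_smul, extFun_smul, mul_assoc, mul_left_comm m]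
    simp only [e1]
    rw [integral_finsetSum _ fun j _ => (hint j ε).const_mul _]
    simp only [integral_const_mul, hI]
  rw [hfun]
  have hd : ∀ j, HasDerivAt (fun ε : ℝ => ε ^ j * I j ε)
      ((j : ℝ) * 0 ^ (j - 1) * I j 0 + 0 ^ j * ∫ y, extFun (h * q.coeff j * (m • w)) y ∂μ) 0 :=
    fun j => (hasDerivAt_pow j (0 : ℝ)).mul
      (hasDerivAt_integral_exp hK hKO μ (hv (q.coeff j)))
  refine (HasDerivAt.fun_sum fun j _ => hd j).congr_deriv ?_
  rw [Finset.sum_range_succ', Finset.sum_range_succ', Finset.sum_eq_zero]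
  · have hI1 : I 1 0 = ∫ y, extFun (h * q.coeff 1) y ∂μ := by simp [hI]
    have e3 : h * (q.coeff 1 + m • (w * q.coeff 0)) =
        h * q.coeff 1 + h * q.coeff 0 * (m • w) := by
      rw [mul_smul_comm, mul_add, mul_smul_comm]; congr 2; ring
    simp only [e3, extFun_add]
    rw [integral_add (integrable_extFun hK hKO μ (hv _))
      (integrable_extFun hK hKO μ fun y hy => by rw [map_mul, hv _ y hy, zero_mul]), ← hI1]
    simp
  · intro j _
    simp

/-- The integral is itself a polynomial in the two parameters, with integrals of the coefficients as
coefficients. -/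
theorem contDiff_integral_poly {h : smoothFun O}
    (hh : ∀ y : half O, (y : Coord n) ∉ K → evalAt y h = 0)
    (q : Polynomial (Polynomial (smoothFun O))) :
    ContDiff ℝ ∞ fun p : ℝ × ℝ => ∫ y, extFun (h * ConfData.evalTwo _ p.1 p.2 q) y ∂μ := by
  have hv : ∀ c : smoothFun O, ∀ y : half O, (y : Coord n) ∉ K → evalAt y (h * c) = 0 :=
    fun c y hy => by rw [map_mul, hh y hy, zero_mul]
  have e1 : ∀ p : ℝ × ℝ, h * ConfData.evalTwo _ p.1 p.2 q =
      ∑ j ∈ Finset.range (q.natDegree + 1), ∑ i ∈ Finset.range ((q.coeff j).natDegree + 1),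
        (p.2 ^ j * p.1 ^ i) • (h * (q.coeff j).coeff i) := fun p => by
    rw [ConfData.evalTwo_apply, Polynomial.eval_eq_sum_range (p := q), Polynomial.eval_finsetSum,
      Finset.mul_sum]
    refine Finset.sum_congr rfl fun j _ => ?_
    rw [Polynomial.eval_mul, Polynomial.eval_eq_sum_range, ← map_pow,
      IsScalarTower.algebraMap_apply ℝ (smoothFun O) (Polynomial (smoothFun O)),
      Polynomial.algebraMap_eq, Polynomial.eval_C, mul_comm _ (algebraMap _ _ _),
      ← Algebra.smul_def, mul_smul_comm, Finset.mul_sum, Finset.smul_sum]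
    refine Finset.sum_congr rfl fun i _ => ?_
    rw [← map_pow, mul_comm _ (algebraMap _ _ _), ← Algebra.smul_def, mul_smul_comm, smul_smul]
  have e2 : (fun p : ℝ × ℝ => ∫ y, extFun (h * ConfData.evalTwo _ p.1 p.2 q) y ∂μ) = fun p =>
      ∑ j ∈ Finset.range (q.natDegree + 1), ∑ i ∈ Finset.range ((q.coeff j).natDegree + 1),
        (p.2 ^ j * p.1 ^ i) * ∫ y, extFun (h * (q.coeff j).coeff i) y ∂μ := by
    funext p
    have e3 : ∀ y, extFun (h * ConfData.evalTwo _ p.1 p.2 q) y =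
        ∑ j ∈ Finset.range (q.natDegree + 1), ∑ i ∈ Finset.range ((q.coeff j).natDegree + 1),
        (p.2 ^ j * p.1 ^ i) * extFun (h * (q.coeff j).coeff i) y := fun y => by
      rw [e1, ← extLin_apply, map_sum, Finset.sum_apply]
      refine Finset.sum_congr rfl fun j _ => ?_
      rw [map_sum, Finset.sum_apply]
      exact Finset.sum_congr rfl fun i _ => by rw [extLin_apply, extFun_smul]
    simp only [e3]
    have hi : ∀ i j, Integrable
        (fun y => (p.2 ^ j * p.1 ^ i) * extFun (h * (q.coeff j).coeff i) y) μ := fun i j =>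
      (integrable_extFun hK hKO μ (hv _)).const_mul _
    rw [integral_finsetSum _ fun j _ => integrable_finsetSum _ fun i _ => hi i j]
    refine Finset.sum_congr rfl fun j _ => ?_
    rw [integral_finsetSum _ fun i _ => hi i j]
    simp only [integral_const_mul]
  rw [e2]
  fun_prop

end Integrals

/-- The integral of the curvature densities against a function, in a chart. -/
def locPairing (k : ℕ) (G : Coord n → Matrix (Fin (n + 1)) (Fin (n + 1)) ℝ) (h : Coord n → ℝ) : ℝ :=
  (∫ y, h y * (Real.sqrt (G y).det * locSigma k G y)) +
    ∫ z, h (hyperplane z) * (Real.sqrt (tangential (G (hyperplane z))).det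
      * locH k G (hyperplane z))

/-- The metric `e^{2w} G`. -/
def confMetric (w : smoothFun O) (G : Coord n → Matrix (Fin (n + 1)) (Fin (n + 1)) ℝ) (y : Coord n) :
    Matrix (Fin (n + 1)) (Fin (n + 1)) ℝ := Real.exp (2 * extFun w y) • G y

variable {G : Coord n → Matrix (Fin (n + 1)) (Fin (n + 1)) ℝ} (hG : IsMetricOn O G)

namespace IsMetricOn

variable {k m : ℕ} (hk : 1 ≤ k) (hN : n + 1 = 2 * k + m)

include hG in
theorem confMetric (w : smoothFun O) : IsMetricOn O (confMetric w G) :=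
  hG.conformal (contDiffOn_extFun w)

theorem map_data (y : half O) : hG.data.map (evalAt y) =
    ⟨(G y)⁻¹, G y, schouten G y, secondFundForm G y, Real.sqrt ((G y)⁻¹ 0 0), shift (G y)⟩ := by
  rw [ConfData.map]
  congr 1
  · exact hG.map_inv y
  · exact hG.map_schoutenMat y
  · exact hG.map_sffMat y
  · exact funext fun a => hG.map_shift y a

theorem map_confTerm (w : smoothFun O) (y : half O) :
    (hG.data.confTerm (hG.hs w) (dif w)).map (evalAt y) = locConf G (extFun w) y := by
  have h := hG.map_confSchouten (contDiffOn_extFun w) y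
  rwa [toSmooth_extFun] at h

theorem map_etaTerm (w : smoothFun O) (y : half O) :
    evalAt y (hG.data.etaTerm (dif w)) = locEta G (extFun w) y := by
  have h := hG.map_normalPart (contDiffOn_extFun w) y
  rw [toSmooth_extFun] at h
  rw [locEta, ← h, ← hG.evalAt_lapse, ← map_mul, ← map_neg]
  rfl

theorem evalAt_bulk (w : smoothFun O) (y : half O) :
    evalAt y (hG.data.bulk m k (hG.hs w) (dif w)) =
      (pencil (G y) (schouten G y + locConf G (extFun w) y)).det.coeff (m + k) := by
  rw [ConfData.map_bulk, ConfData.bulk, ← ConfData.map_confTerm, map_confTerm, map_data]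

theorem evalAt_bdry (w : smoothFun O) (y : half O) :
    evalAt y (hG.data.bdry m k (hG.hs w) (dif w)) =
      hFun m k (pencil2 (tangential (G y)) (tangential (schouten G y + locConf G (extFun w) y))
          (secondFundForm G y + locEta G (extFun w) y • tangential (G y))).det := by
  rw [ConfData.map_bdry, ConfData.bdry, ← ConfData.map_confTerm, ← ConfData.map_etaTerm,
    map_confTerm, map_etaTerm, map_data]
  rfl

include hk hN

theorem locPairing_confMetric (w h : smoothFun O) :
    locPairing k (BdryCurv.confMetric w G) (extFun h) =
      (∫ y, extFun (h * (hG.bulkWt * hG.data.bulk m k (hG.hs w) (dif w))) y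
        * Real.exp (m * extFun w y)) +
      ∫ y, extFun (h * (hG.bdryWt * hG.data.bdry m k (hG.hs w) (dif w))) y
        * Real.exp (m * extFun w y) ∂(hypMeasure n) := by
  rw [integral_hypMeasure, locPairing]
  congr 1
  · refine integral_congr_ae (Filter.Eventually.of_forall fun y => ?_)
    by_cases hy : y ∈ half O
    · have h1 := hG.locSigma_conformal (contDiffOn_extFun w) hk hN hy
      rw [← hG.evalAt_bulk w ⟨y, hy⟩] at h1
      change Real.sqrt (BdryCurv.confMetric w G y).det
        * locSigma k (BdryCurv.confMetric w G) y = _ at h1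
      beta_reduce
      rw [h1, extFun_apply _ hy, extFun_apply _ hy, extFun_apply _ hy, map_mul, map_mul]
      simp only [bulkWt, evalAt_toSmooth]
      ring
    · simp [extFun_of_notMem _ hy]
  · refine integral_congr_ae (Filter.Eventually.of_forall fun z => ?_)
    by_cases hy : hyperplane z ∈ half O
    · have h1 := hG.locH_conformal (contDiffOn_extFun w) hk hN hy
      rw [← hG.evalAt_bdry w ⟨_, hy⟩] at h1
      change Real.sqrt (tangential (BdryCurv.confMetric w G (hyperplane z))).det
        * locH k (BdryCurv.confMetric w G) (hyperplane z) = _ at h1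
      beta_reduce
      rw [h1, extFun_apply _ hy, extFun_apply _ hy, extFun_apply _ hy, map_mul, map_mul]
      simp only [bdryWt, evalAt_toSmooth]
      ring
    · simp [extFun_of_notMem _ hy]

omit hk hN in
theorem hs_smul (a : ℝ) (w : smoothFun O) : hG.hs (a • w) = a • hG.hs w := by
  refine Matrix.ext fun i j => ?_
  simp only [hs, hess, Matrix.of_apply, Derivation.map_smul, mul_smul_comm, ← Finset.smul_sum,
    ← smul_sub, Matrix.smul_apply]

omit hk hN in
theorem hs_add (w w' : smoothFun O) : hG.hs (w + w') = hG.hs w + hG.hs w' := by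
  refine Matrix.ext fun i j => ?_
  simp only [hs, hess, Matrix.of_apply, map_add, mul_add, Finset.sum_add_distrib, Matrix.add_apply]
  ring

/-- The first variation of the curvature functional, in a chart. -/
def locVar (m k : ℕ) (w h : smoothFun O) : ℝ :=
  (∫ y, extFun (h * ((hG.bulkQ m k w).coeff 1 + (m : ℝ) • (w * (hG.bulkQ m k w).coeff 0))) y) +
    ∫ y, extFun (h * ((hG.bdryQ m k w).coeff 1 + (m : ℝ) • (w * (hG.bdryQ m k w).coeff 0))) y
      ∂(hypMeasure n)

variable {K : Set (Coord n)} (hK : IsCompact K) (hKO : K ⊆ half O)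

include hK hKO

theorem hasDerivAt_locPairing (w : smoothFun O) {h : smoothFun O}
    (hh : ∀ y : half O, (y : Coord n) ∉ K → evalAt y h = 0) :
    HasDerivAt (fun ε : ℝ => locPairing k (BdryCurv.confMetric (ε • w) G) (extFun h))
      (hG.locVar m k w h) 0 := by
  have e : (fun ε : ℝ => locPairing k (BdryCurv.confMetric (ε • w) G) (extFun h)) = fun ε =>
      (∫ y, extFun (h * (hG.bulkQ m k w).eval (algebraMap ℝ _ ε)) y
        * Real.exp (m * extFun (ε • w) y)) +
      ∫ y, extFun (h * (hG.bdryQ m k w).eval (algebraMap ℝ _ ε)) y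
        * Real.exp (m * extFun (ε • w) y) ∂(hypMeasure n) := by
    funext ε
    have hdif : dif (ε • w) = ε • dif w := funext fun i => Derivation.map_smul _ _ _
    rw [hG.locPairing_confMetric hk hN, bulkQ, bdryQ, Polynomial.eval_mul, Polynomial.eval_mul,
      Polynomial.eval_C, Polynomial.eval_C, ConfData.eval_bulkPoly, ConfData.eval_bdryPoly,
      hG.hs_smul, hdif]
  rw [e]
  exact (hasDerivAt_integral_poly hK hKO volume hh w _ m).add
    (hasDerivAt_integral_poly hK hKO (hypMeasure n) hh w _ m)

omit hk hN in
theorem evalAt_hs_eq_zero {h : smoothFun O}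
    (hh : ∀ y : half O, (y : Coord n) ∉ K → evalAt y h = 0) (i j : Fin (n + 1)) (y : half O)
    (hy : (y : Coord n) ∉ K) : evalAt y (hG.hs h i j) = 0 := by
  have hdh : ∀ i, ∀ y : half O, (y : Coord n) ∉ K → evalAt y (coordDer O i h) = 0 :=
    fun i y hy => evalAt_coordDer_eq_zero hK hKO hh i y hy
  simp [hs, hess, hdh _ y hy, evalAt_coordDer_eq_zero hK hKO (hdh j) i y hy]

omit hk hN in
-- The linear coefficient is a differential operator applied to h and so does not enlarge supports.
-- The boundary analogue follows.
theorem evalAt_bulkQ_coeff_one {h : smoothFun O}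
    (hh : ∀ y : half O, (y : Coord n) ∉ K → evalAt y h = 0) (y : half O)
    (hy : (y : Coord n) ∉ K) : evalAt y ((hG.bulkQ m k h).coeff 1) = 0 := by
  rw [bulkQ_coeff_one, map_neg, map_mul, map_sum]
  simp only [map_sum, map_mul, hG.evalAt_hs_eq_zero hK hKO hh _ _ y hy, mul_zero,
    Finset.sum_const_zero, neg_zero]

omit hk hN in
theorem evalAt_bdryQ_coeff_one {h : smoothFun O}
    (hh : ∀ y : half O, (y : Coord n) ∉ K → evalAt y h = 0) (y : half O)
    (hy : (y : Coord n) ∉ K) : evalAt y ((hG.bdryQ m k h).coeff 1) = 0 := by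
  rw [bdryQ, Polynomial.coeff_C_mul, map_mul, ConfData.bdryPoly_coeff_one, map_hFun]
  have e1 : (pencil2 0 (-tang (hG.hs h)) (hG.data.etaTerm (dif h) • tang hG.data.met)).map
      (Polynomial.mapRingHom (Polynomial.mapRingHom (evalAt y : smoothFun O →+* ℝ))) = 0 := by
    rw [ConfData.map_pencil2]
    have t1 : (0 : Matrix (Fin n) (Fin n) (smoothFun O)).map (evalAt y) = 0 := by ext; simp
    have t2 : (-tang (hG.hs h)).map (evalAt y) = 0 := by
      ext a b
      rw [Matrix.map_apply, Matrix.neg_apply, map_neg, tang_apply,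
        hG.evalAt_hs_eq_zero hK hKO hh _ _ y hy, neg_zero, Matrix.zero_apply]
    have t3 : (hG.data.etaTerm (dif h) • tang hG.data.met).map (evalAt y) = 0 := by
      ext a b
      rw [Matrix.map_apply, Matrix.smul_apply, smul_eq_mul, map_mul, ConfData.map_etaTerm]
      have : (fun i => evalAt y (dif h i)) = 0 :=
        funext fun i => evalAt_coordDer_eq_zero hK hKO hh i y hy
      rw [this, ConfData.etaTerm_zero, zero_mul, Matrix.zero_apply]
    rw [t1, t2, t3]
    ext a b : 2
    simp [pencil2_apply]
  have e2 : ((((pencil2 (tang hG.data.met) (tang hG.data.sch) hG.data.sff).adjugate *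
      pencil2 0 (-tang (hG.hs h)) (hG.data.etaTerm (dif h) • tang hG.data.met)).trace).map
      (Polynomial.mapRingHom (evalAt y : smoothFun O →+* ℝ))) = 0 := by
    have e3 := AddMonoidHom.map_trace
      (Polynomial.mapRingHom (Polynomial.mapRingHom (evalAt y : smoothFun O →+* ℝ)))
      ((pencil2 (tang hG.data.met) (tang hG.data.sch) hG.data.sff).adjugate *
      pencil2 0 (-tang (hG.hs h)) (hG.data.etaTerm (dif h) • tang hG.data.met))
    rw [← Polynomial.coe_mapRingHom]
    refine e3.trans ?_
    rw [Matrix.map_mul, e1, mul_zero, Matrix.trace_zero]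
  rw [e2]
  simp [hFun, cf]

omit hk hN in
theorem locVar_sum {w : smoothFun O} (hw : ∀ y : half O, (y : Coord n) ∉ K → evalAt y w = 0)
    {κ : Type*} (s : Finset κ) (f : κ → smoothFun O) :
    hG.locVar m k w (∑ i ∈ s, f i) = ∑ i ∈ s, hG.locVar m k w (f i) := by
  have h1 : ∀ (c a f : smoothFun O), (∀ y : half O, (y : Coord n) ∉ K → evalAt y c = 0) →
      ∀ y : half O, (y : Coord n) ∉ K → evalAt y (f * (c + (m : ℝ) • (w * a))) = 0 :=
    fun c a f hc y hy => by simp [hc y hy, hw y hy]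
  have h2 : ∀ (c : smoothFun O) y, extFun ((∑ i ∈ s, f i) * c) y = ∑ i ∈ s, extFun (f i * c) y :=
    fun c y => by
      rw [Finset.sum_mul, ← extLin_apply, map_sum, Finset.sum_apply]
      rfl
  simp only [locVar, h2, Finset.sum_add_distrib]
  rw [integral_finsetSum _ fun i _ => integrable_extFun hK hKO volume
      (h1 _ _ _ (hG.evalAt_bulkQ_coeff_one hK hKO hw)),
    integral_finsetSum _ fun i _ => integrable_extFun hK hKO (hypMeasure n)
      (h1 _ _ _ (hG.evalAt_bdryQ_coeff_one hK hKO hw))]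

/-- The zeroth-order terms are m w h times a coefficient independent of the direction, hence
symmetric; the difference of the rest is Green's formula. -/
theorem locVar_comm (hW : 3 ≤ k → ∀ y ∈ half O, WeylFreeAt G y) (w : smoothFun O) {h : smoothFun O}
    (hh : ∀ y : half O, (y : Coord n) ∉ K → evalAt y h = 0) :
    hG.locVar m k w h = hG.locVar m k h w := by
  have hg := hG.integral_green hk hN hW (v := w) hK hKO hh
  rw [← integral_hypMeasure] at hg
  have hb1 := hG.evalAt_bulkQ_coeff_one (m := m) (k := k) hK hKO hh
  have hb2 := hG.evalAt_bdryQ_coeff_one (m := m) (k := k) hK hKO hh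
  have hv1 : ∀ c : smoothFun O, ∀ y : half O, (y : Coord n) ∉ K → evalAt y (h * c) = 0 :=
    fun c y hy => by rw [map_mul, hh y hy, zero_mul]
  have hv2 : ∀ c a : smoothFun O, (∀ y : half O, (y : Coord n) ∉ K → evalAt y c = 0) →
      ∀ y : half O, (y : Coord n) ∉ K → evalAt y (w * (c + (m : ℝ) • (h * a))) = 0 :=
    fun c a hc y hy => by simp [hc y hy, hh y hy]
  have e0 : (hG.bulkQ m k w).coeff 0 = (hG.bulkQ m k h).coeff 0 := by
    rw [bulkQ_coeff_zero, bulkQ_coeff_zero]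
  have e0' : (hG.bdryQ m k w).coeff 0 = (hG.bdryQ m k h).coeff 0 := by
    rw [bdryQ_coeff_zero, bdryQ_coeff_zero]
  have alg : ∀ b b' a : smoothFun O, h * (b + (m : ℝ) • (w * a)) - w * (b' + (m : ℝ) • (h * a)) =
      h * b - w * b' := fun b b' a => by
    simp only [mul_add, mul_smul_comm, mul_left_comm w h a]; ring
  rw [← sub_eq_zero, locVar, locVar, e0, e0', add_sub_add_comm,
    ← integral_sub (integrable_extFun hK hKO volume (hv1 _))
      (integrable_extFun hK hKO volume (hv2 _ _ hb1)),
    ← integral_sub (integrable_extFun hK hKO (hypMeasure n) (hv1 _))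
      (integrable_extFun hK hKO (hypMeasure n) (hv2 _ _ hb2)), ← hg]
  congr 1
  · refine integral_congr_ae (Filter.Eventually.of_forall fun y => ?_)
    change (extLin O _ - extLin O _) y = extLin O _ y
    rw [← map_sub, alg]
  · refine integral_congr_ae (Filter.Eventually.of_forall fun y => ?_)
    change (extLin O _ - extLin O _) y = extLin O _ y
    rw [← map_sub, alg]

include hG in
-- With m = 0 the exponential weight disappears and the densities are polynomial in both parameters.
theorem contDiff_locPairing (hm : m = 0) (u v : smoothFun O) {h : smoothFun O}
    (hh : ∀ y : half O, (y : Coord n) ∉ K → evalAt y h = 0) :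
    ContDiff ℝ ∞ fun p : ℝ × ℝ =>
      locPairing k (BdryCurv.confMetric (p.1 • u + p.2 • v) G) (extFun h) := by
  obtain ⟨q1, hq1⟩ := hG.data.exists_bulk_two (hG.hs u) (dif u) (hG.hs v) (dif v) m k
  obtain ⟨q2, hq2⟩ := hG.data.exists_bdry_two (hG.hs u) (dif u) (hG.hs v) (dif v) m k
  have hv : ∀ c : smoothFun O, ∀ y : half O, (y : Coord n) ∉ K → evalAt y (h * c) = 0 :=
    fun c y hy => by rw [map_mul, hh y hy, zero_mul]
  have e : (fun p : ℝ × ℝ =>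
      locPairing k (BdryCurv.confMetric (p.1 • u + p.2 • v) G) (extFun h)) = fun p =>
      (∫ y, extFun (h * hG.bulkWt * ConfData.evalTwo _ p.1 p.2 q1) y) +
      ∫ y, extFun (h * hG.bdryWt * ConfData.evalTwo _ p.1 p.2 q2) y ∂(hypMeasure n) := by
    funext p
    have hdif : dif (p.1 • u + p.2 • v) = p.1 • dif u + p.2 • dif v := funext fun i => by
      simp [dif]
    rw [hG.locPairing_confMetric hk hN, hG.hs_add, hG.hs_smul, hG.hs_smul, hdif, hq1, hq2, hm]
    simp only [mul_assoc, Nat.cast_zero, zero_mul, Real.exp_zero, mul_one]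
  rw [e]
  exact (contDiff_integral_poly hK hKO volume (hv _) _).add
    (contDiff_integral_poly hK hKO (hypMeasure n) (hv _) _)

end IsMetricOn

end

section

/-! ## Charts -/

open TopologicalSpace (Opens)

variable {n : ℕ} {X : Type*} [TopologicalSpace X] [ChartedSpace (EuclideanHalfSpace (n + 1)) X]

local notation "ext[" p "]" => extChartAt (𝓡∂ (n + 1)) p

theorem range_model : range (𝓡∂ (n + 1)) = halfSpace n :=
  range_modelWithCornersEuclideanHalfSpace (n + 1)

/-- The open set which cuts out the target of the chart at `p`. -/
def chartOpens (p : X) : Opens (Coord n) :=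
  ⟨(𝓡∂ (n + 1)).symm ⁻¹' (chartAt (EuclideanHalfSpace (n + 1)) p).target,
    (chartAt _ p).open_target.preimage (𝓡∂ (n + 1)).continuous_symm⟩

theorem target_eq (p : X) : ext[p].target = half (chartOpens p) := by
  rw [extChartAt_target, range_model, inter_comm]
  rfl

theorem symm_mem {p : X} {y : Coord n} (hy : y ∈ half (chartOpens p)) :
    ext[p].symm y ∈ ext[p].source := ext[p].map_target (by rwa [target_eq])

theorem right_inv {p : X} {y : Coord n} (hy : y ∈ half (chartOpens p)) :
    ext[p] (ext[p].symm y) = y := ext[p].right_inv (by rwa [target_eq])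

theorem map_mem {p x : X} (hx : x ∈ ext[p].source) : ext[p] x ∈ half (chartOpens p) := by
  rw [← target_eq]; exact ext[p].map_source hx

/-- The part of the chart at `p` which is mapped into an open set `U`. -/
theorem exists_opens (p : X) {U : Set X} (hU : IsOpen U) :
    ∃ O : Opens (Coord n), half O = half (chartOpens p) ∩ ext[p].symm ⁻¹' U := by
  obtain ⟨V, hV, h⟩ := (continuousOn_iff'.1 (continuousOn_extChartAt_symm (I := 𝓡∂ (n + 1)) p)) U hU
  refine ⟨⟨V, hV⟩ ⊓ chartOpens p, ?_⟩
  rw [target_eq] at h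
  ext y
  have := Set.ext_iff.1 h y
  simp only [half, mem_inter_iff, mem_preimage] at this ⊢
  change y ∈ halfSpace n ∧ (y ∈ V ∧ y ∈ chartOpens p) ↔ _
  change _ ∧ (y ∈ halfSpace n ∧ y ∈ chartOpens p) ↔ _ ∧ (y ∈ halfSpace n ∧ y ∈ chartOpens p) at this
  change _ ↔ (y ∈ halfSpace n ∧ y ∈ chartOpens p) ∧ _
  tauto

theorem IsMetricOn.mono {O O' : Opens (Coord n)}
    {G : Coord n → Matrix (Fin (n + 1)) (Fin (n + 1)) ℝ} (hG : IsMetricOn O G)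
    (h : half O' ⊆ half O) : IsMetricOn O' G where
  smooth i j := (hG.smooth i j).mono h
  posDef y hy := hG.posDef y (h hy)

variable [IsManifold (𝓡∂ (n + 1)) ∞ X]

theorem contDiffOn_coordChange (p q : X) {O : Opens (Coord n)}
    (hO : half O ⊆ half (chartOpens p) ∩ ext[p].symm ⁻¹' ext[q].source) :
    ContDiffOn ℝ ∞ (ext[q] ∘ ext[p].symm) (half O) := by
  refine (contDiffOn_ext_coord_change (n := ∞) (I := 𝓡∂ (n + 1)) q p).mono fun y hy => ?_
  rw [PartialEquiv.trans_source, PartialEquiv.symm_source, target_eq]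
  exact hO hy

theorem contDiffOn_comp_symm {E : Type*} [NormedAddCommGroup E] [NormedSpace ℝ E] {F : X → E}
    {U : Set X} (hF : ContMDiffOn (𝓡∂ (n + 1)) 𝓘(ℝ, E) ∞ F U) (p : X) {O : Opens (Coord n)}
    (hO : half O ⊆ half (chartOpens p) ∩ ext[p].symm ⁻¹' U) :
    ContDiffOn ℝ ∞ (F ∘ ext[p].symm) (half O) := by
  refine contMDiffOn_iff_contDiffOn.1 (hF.comp
    ((contMDiffOn_extChartAt_symm (n := ∞) (I := 𝓡∂ (n + 1)) p).mono fun y hy => ?_)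
    fun y hy => (hO hy).2)
  rw [target_eq]; exact (hO hy).1

theorem mdifferentiableWithinAt_symm {p : X} {y : Coord n} (hy : y ∈ half (chartOpens p)) :
    MDifferentiableWithinAt 𝓘(ℝ, Coord n) (𝓡∂ (n + 1)) ext[p].symm (halfSpace n) y := by
  have h := (contMDiffOn_extChartAt_symm (n := ∞) (I := 𝓡∂ (n + 1)) p) y (by rwa [target_eq])
  rw [target_eq] at h
  exact (h.mdifferentiableWithinAt (by simp)).mono_of_mem_nhdsWithin (half_mem_nhdsWithin hy)

theorem uniqueMDiffWithinAt_halfSpace {y : Coord n} (hy : y ∈ halfSpace n) :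
    UniqueMDiffWithinAt 𝓘(ℝ, Coord n) (halfSpace n) y :=
  (uniqueDiffOn_halfSpace y hy).uniqueMDiffWithinAt

/-- The derivative of a function on the manifold along the coordinate vector fields. -/
theorem mfderiv_coordVector {E : Type*} [NormedAddCommGroup E] [NormedSpace ℝ E] {F : X → E} {p : X}
    {y : Coord n} (hy : y ∈ half (chartOpens p))
    (hF : MDifferentiableAt (𝓡∂ (n + 1)) 𝓘(ℝ, E) F (ext[p].symm y)) (i : Fin (n + 1)) :
    mfderiv (𝓡∂ (n + 1)) 𝓘(ℝ, E) F (ext[p].symm y) (coordVector p i y) =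
      fderivWithin ℝ (F ∘ ext[p].symm) (halfSpace n) y (EuclideanSpace.single i 1) := by
  have h := mfderiv_comp_mfderivWithin y hF (mdifferentiableWithinAt_symm hy)
    (uniqueMDiffWithinAt_halfSpace hy.1)
  rw [mfderivWithin_eq_fderivWithin] at h
  rw [h, coordVector, range_model]
  rfl

/-- The inner product of tangent vectors, as elements of the model space. -/
def innerAt (g : Metric n X) (x : X) : Coord n →L[ℝ] Coord n →L[ℝ] ℝ := g.inner x

/-- The coordinate vector fields, as elements of the model space. -/
def frame (p : X) (i : Fin (n + 1)) (y : Coord n) : Coord n := coordVector p i y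

/-- The derivative of the inverse of a chart, as an endomorphism of the model space. -/
def frameCLM (p : X) (y : Coord n) : Coord n →L[ℝ] Coord n :=
  mfderivWithin 𝓘(ℝ, Coord n) (𝓡∂ (n + 1)) ext[p].symm (halfSpace n) y

theorem frame_eq (p : X) (i : Fin (n + 1)) (y : Coord n) :
    frame p i y = frameCLM p y (EuclideanSpace.single i 1) := by
  rw [frame, coordVector, range_model]; rfl

/-- The chain rule for the inverse chart at p, written as the inverse chart at q after the
coordinate change, with derivatives within the half-space so that boundary points are covered. -/
theorem frameCLM_comp (p q : X) {O : Opens (Coord n)}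
    (hO : half O ⊆ half (chartOpens p) ∩ ext[p].symm ⁻¹' ext[q].source) {y : Coord n}
    (hy : y ∈ half O) :
    frameCLM p y = (frameCLM q ((ext[q] ∘ ext[p].symm) y)).comp
      (fderivWithin ℝ (ext[q] ∘ ext[p].symm) (halfSpace n) y) := by
  set φ := ext[q] ∘ ext[p].symm with hφd
  have hφ := contDiffOn_coordChange p q hO
  have hφy : φ y ∈ half (chartOpens q) := map_mem (hO hy).2
  have hd : MDifferentiableWithinAt 𝓘(ℝ, Coord n) 𝓘(ℝ, Coord n) φ (half O) y :=
    ((hφ.differentiableOn (by simp)) y hy).mdifferentiableWithinAt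
  have hu : UniqueMDiffWithinAt 𝓘(ℝ, Coord n) (half O) y :=
    (uniqueDiffOn_half y hy).uniqueMDiffWithinAt
  have h1 := mfderivWithin_comp y (mdifferentiableWithinAt_symm hφy) hd
    (fun z hz => (map_mem (hO hz).2).1) hu
  have h2 : mfderivWithin 𝓘(ℝ, Coord n) (𝓡∂ (n + 1)) (ext[q].symm ∘ φ) (half O) y =
      mfderivWithin 𝓘(ℝ, Coord n) (𝓡∂ (n + 1)) ext[p].symm (half O) y :=
    mfderivWithin_congr_of_mem (fun z hz => ext[q].left_inv (hO hz).2) hy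
  have h3 : mfderivWithin 𝓘(ℝ, Coord n) (𝓡∂ (n + 1)) ext[p].symm (half O) y =
      mfderivWithin 𝓘(ℝ, Coord n) (𝓡∂ (n + 1)) ext[p].symm (halfSpace n) y :=
    mfderivWithin_inter (O.isOpen.mem_nhds hy.2)
  have h5 : mfderivWithin 𝓘(ℝ, Coord n) 𝓘(ℝ, Coord n) φ (half O) y =
      fderivWithin ℝ φ (halfSpace n) y := by
    rw [mfderivWithin_eq_fderivWithin]; exact fderivWithin_half φ hy
  rw [← h5]
  exact (h3.symm.trans h2.symm).trans h1

theorem frame_eq_sum (p q : X) {O : Opens (Coord n)}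
    (hO : half O ⊆ half (chartOpens p) ∩ ext[p].symm ⁻¹' ext[q].source) {y : Coord n}
    (hy : y ∈ half O) (i : Fin (n + 1)) :
    frame p i y = ∑ a, jacobian (ext[q] ∘ ext[p].symm) y i a •
      frame q a ((ext[q] ∘ ext[p].symm) y) := by
  have hφ := contDiffOn_coordChange p q hO
  rw [frame_eq, frameCLM_comp p q hO hy, ContinuousLinearMap.comp_apply]
  conv_lhs => rw [sum_single (fderivWithin ℝ (ext[q] ∘ ext[p].symm) (halfSpace n) y
    (EuclideanSpace.single i 1))]
  rw [map_sum]
  refine Finset.sum_congr rfl fun a _ => ?_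
  rw [map_smul, frame_eq, jacobian, Matrix.of_apply, partialDeriv]
  congr 1
  exact (fderivWithin_coord hφ hy a _).symm

theorem chartMetric_eq_innerAt (g : Metric n X) (p : X) (y : Coord n) (i j : Fin (n + 1)) :
    chartMetric g p y i j = innerAt g (ext[p].symm y) (frame p i y) (frame p j y) := rfl

theorem bilin_sum {E : Type*} [NormedAddCommGroup E] [NormedSpace ℝ E] (B : E →L[ℝ] E →L[ℝ] ℝ)
    {κ : Type*} [Fintype κ] (c d : κ → ℝ) (v w : κ → E) :
    B (∑ a, c a • v a) (∑ b, d b • w b) = ∑ a, ∑ b, c a * B (v a) (w b) * d b := by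
  rw [map_sum B, _root_.sum_apply]
  refine Finset.sum_congr rfl fun a _ => ?_
  rw [map_smul, _root_.smul_apply, map_sum, smul_eq_mul, Finset.mul_sum]
  refine Finset.sum_congr rfl fun b _ => ?_
  rw [map_smul, smul_eq_mul]
  ring

theorem chartMetric_transition (g : Metric n X) (p q : X) {O : Opens (Coord n)}
    (hO : half O ⊆ half (chartOpens p) ∩ ext[p].symm ⁻¹' ext[q].source) {y : Coord n}
    (hy : y ∈ half O) :
    chartMetric g p y = jacobian (ext[q] ∘ ext[p].symm) y *
      chartMetric g q ((ext[q] ∘ ext[p].symm) y) * (jacobian (ext[q] ∘ ext[p].symm) y)ᵀ := by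
  ext i j
  rw [chartMetric_eq_innerAt, frame_eq_sum p q hO hy i, frame_eq_sum p q hO hy j,
    bilin_sum]
  simp only [Matrix.mul_apply, Matrix.transpose_apply, Finset.sum_mul]
  rw [Finset.sum_comm]
  refine Finset.sum_congr rfl fun b _ => Finset.sum_congr rfl fun a _ => ?_
  have : ext[q].symm ((ext[q] ∘ ext[p].symm) y) = ext[p].symm y := ext[q].left_inv (hO hy).2
  rw [chartMetric_eq_innerAt, this]

theorem contMDiffOn_coordVector (p : X) (i : Fin (n + 1)) :
    ContMDiffOn 𝓘(ℝ, Coord n) ((𝓡∂ (n + 1)).prod 𝓘(ℝ, Coord n)) ∞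
      (fun y : Coord n => TotalSpace.mk' (Coord n)
        (E := fun x : X => TangentSpace (𝓡∂ (n + 1)) x) (ext[p].symm y) (coordVector p i y))
      (half (chartOpens p)) := by
  have h1 : ContMDiffOn 𝓘(ℝ, Coord n) (𝓡∂ (n + 1)) ∞ ext[p].symm (half (chartOpens p)) := by
    rw [← target_eq]; exact contMDiffOn_extChartAt_symm p
  have hu : UniqueMDiffOn 𝓘(ℝ, Coord n) (half (chartOpens p)) := uniqueDiffOn_half.uniqueMDiffOn
  have h2 := h1.contMDiffOn_tangentMapWithin (m := ∞) (by simp) hu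
  have h3 : ContMDiff 𝓘(ℝ, Coord n) (𝓘(ℝ, Coord n).prod 𝓘(ℝ, Coord n)) ∞
      (fun y : Coord n => TotalSpace.mk' (Coord n)
        (E := fun x : Coord n => TangentSpace 𝓘(ℝ, Coord n) x) y
          (EuclideanSpace.single i 1 : Coord n)) :=
    contMDiff_vectorSpace_iff_contDiff.2 contDiff_const
  refine (h2.comp h3.contMDiffOn fun y hy => hy).congr fun y hy => ?_
  simp only [Function.comp_apply, tangentMapWithin]
  have h4 : mfderivWithin 𝓘(ℝ, Coord n) (𝓡∂ (n + 1)) ext[p].symm (half (chartOpens p)) y =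
      mfderivWithin 𝓘(ℝ, Coord n) (𝓡∂ (n + 1)) ext[p].symm (halfSpace n) y :=
    mfderivWithin_inter ((chartOpens p).isOpen.mem_nhds hy.2)
  rw [h4, coordVector, range_model]

/-- Smoothness holds because the coordinate fields are smooth sections of the tangent bundle;
definiteness because the derivative of an inverse chart is invertible, also at boundary points. -/
theorem isMetricOn_chartMetric (g : Metric n X) (p : X) :
    IsMetricOn (chartOpens p) (chartMetric g p) where
  smooth i j := by
    have h1 : ContMDiffOn 𝓘(ℝ, Coord n) (𝓡∂ (n + 1)) ∞ ext[p].symm (half (chartOpens p)) := by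
      rw [← target_eq]; exact contMDiffOn_extChartAt_symm p
    have hψ := g.contMDiff.comp_contMDiffOn h1
    have h2 := ContMDiffOn.clm_bundle_apply₂ (F₁ := Coord n) (F₂ := Coord n)
      (E₃ := Bundle.Trivial X ℝ) (F₃ := ℝ)
      hψ (contMDiffOn_coordVector p i) (contMDiffOn_coordVector p j)
    intro y hy
    have h3 := h2 y hy
    simp only [contMDiffWithinAt_totalSpace] at h3
    exact h3.2.contDiffWithinAt
  posDef y hy := by
    have hy' : y ∈ ext[p].target := by rwa [target_eq]
    obtain ⟨L, hL⟩ := isInvertible_mfderivWithin_extChartAt_symm (I := 𝓡∂ (n + 1)) hy'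
    refine Matrix.PosDef.of_dotProduct_mulVec_pos (Matrix.IsHermitian.ext fun i j => ?_) fun c hc => ?_
    · simp only [star_trivial]
      exact g.symm _ _ _
    · have h1 : innerAt g (ext[p].symm y) (∑ a, c a • frame p a y) (∑ a, c a • frame p a y) =
          star c ⬝ᵥ (chartMetric g p y).mulVec c := by
        rw [bilin_sum]
        simp only [dotProduct, Matrix.mulVec, Finset.mul_sum, star_trivial, chartMetric_eq_innerAt,
          mul_assoc]
      rw [← h1]
      refine g.pos _ _ ?_
      have h2 : (∑ a, c a • frame p a y) = frameCLM p y (WithLp.toLp 2 c) := by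
        conv_rhs => rw [sum_single (WithLp.toLp 2 c)]
        rw [map_sum]
        refine Finset.sum_congr rfl fun a _ => ?_
        rw [map_smul, frame_eq]
      have hinj : Function.Injective (frameCLM p y) := by
        rw [range_model] at hL
        have : (frameCLM p y : Coord n → Coord n) = L := congrArg DFunLike.coe hL.symm
        rw [this]
        exact L.injective
      intro h0
      have h3 : frameCLM p y (WithLp.toLp 2 c) = 0 := h2.symm.trans h0
      have h4 : (WithLp.toLp 2 c : Coord n) = 0 := (map_eq_zero_iff _ hinj).1 h3
      exact hc (congrArg WithLp.ofLp h4)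

theorem chartMetric_conformal (u : C^∞⟮𝓡∂ (n + 1), X; ℝ⟯) (g : Metric n X) (p : X) (y : Coord n) :
    chartMetric (conformal u g) p y = Real.exp (2 * u (ext[p].symm y)) • chartMetric g p y := rfl

/-- Boundary points are detected by any chart. -/
theorem mem_boundary_iff {p x : X} (hx : x ∈ ext[p].source) :
    x ∈ (𝓡∂ (n + 1)).boundary X ↔ ext[p] x 0 = 0 := by
  have h1 := ModelWithCorners.isInteriorPoint_iff_of_mem_atlas (I := 𝓡∂ (n + 1)) (M := X) (n := ∞)
    (by simp) (chart_mem_atlas _ p) (by rwa [extChartAt_source] at hx)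
  have h2 : (ext[p] x) ∈ interior (half (chartOpens p)) ↔ 0 < ext[p] x 0 := by
    have hm := map_mem hx
    rw [half, interior_inter, (chartOpens p).isOpen.interior_eq]
    have h3 : interior (halfSpace n) = {y : Coord n | 0 < y 0} := by
      have := interior_range_modelWithCornersEuclideanHalfSpace (n + 1)
      rwa [range_model] at this
    rw [h3]
    exact ⟨fun h => h.1, fun h => ⟨h, hm.2⟩⟩
  have h4 : x ∈ (𝓡∂ (n + 1)).boundary X ↔ ¬ (𝓡∂ (n + 1)).IsInteriorPoint x := by
    rw [← ModelWithCorners.compl_interior]; rfl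
  have h5 : (𝓡∂ (n + 1)).IsInteriorPoint x ↔ 0 < ext[p] x 0 := by
    rw [h1, ← h2, ← target_eq]; rfl
  rw [h4, h5, not_lt]
  exact ⟨fun h => le_antisymm h (map_mem hx).1, fun h => h.le⟩

theorem coordChange_boundary {p q : X} {O : Opens (Coord n)}
    (hO : half O ⊆ half (chartOpens p) ∩ ext[p].symm ⁻¹' ext[q].source) (y : Coord n)
    (hy : y ∈ half O) (hy0 : y 0 = 0) : (ext[q] ∘ ext[p].symm) y 0 = 0 := by
  refine (mem_boundary_iff (hO hy).2).1 ((mem_boundary_iff (symm_mem (hO hy).1)).2 ?_)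
  rw [right_inv (hO hy).1, hy0]

section Curvature

variable {k m : ℕ} (hN : n + 1 = 2 * k + m) (g : Metric n X)

include hN

/-- The definition evaluates at x in the preferred chart at x; the transformation law permits any
chart around x, which is needed for continuity and for integration. -/
theorem sigmaCurv_eq {q x : X} (hx : x ∈ ext[q].source) :
    sigmaCurv k g x = locSigma k (chartMetric g q) (ext[q] x) := by
  obtain ⟨O, hO⟩ := exists_opens (n := n) x (isOpen_extChartAt_source (I := 𝓡∂ (n + 1)) q)
  have hy : ext[x] x ∈ half O := by
    rw [hO]
    refine ⟨map_mem (mem_extChartAt_source x), ?_⟩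
    rw [mem_preimage, extChartAt_to_inv]; exact hx
  have h := locSigma_transition (contDiffOn_coordChange x q hO.subset)
    (fun y hy => map_mem (hO.subset hy).2) ((isMetricOn_chartMetric g x).mono
      (hO.subset.trans inter_subset_left)) (isMetricOn_chartMetric g q)
    (fun y hy => chartMetric_transition g x q hO.subset hy) hN hy
  rw [Function.comp_apply, extChartAt_to_inv] at h
  exact h

/-- Chart independence is available at boundary points only, since elsewhere the hyperplanes of
different charts are unrelated. -/
theorem hCurv_eq {q x : X} (hx : x ∈ ext[q].source) (hb : x ∈ (𝓡∂ (n + 1)).boundary X) :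
    hCurv k g x = locH k (chartMetric g q) (ext[q] x) := by
  obtain ⟨O, hO⟩ := exists_opens (n := n) x (isOpen_extChartAt_source (I := 𝓡∂ (n + 1)) q)
  have hy : ext[x] x ∈ half O := by
    rw [hO]
    refine ⟨map_mem (mem_extChartAt_source x), ?_⟩
    rw [mem_preimage, extChartAt_to_inv]; exact hx
  have h := locH_transition (contDiffOn_coordChange x q hO.subset)
    (fun y hy => map_mem (hO.subset hy).2) ((isMetricOn_chartMetric g x).mono
      (hO.subset.trans inter_subset_left)) (isMetricOn_chartMetric g q)
    (fun y hy => chartMetric_transition g x q hO.subset hy) (coordChange_boundary hO.subset) hN hy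
    ((mem_boundary_iff (mem_extChartAt_source x)).1 hb)
  rw [Function.comp_apply, extChartAt_to_inv] at h
  exact h

end Curvature

/-- The flat coordinates exist only near the given point, so the argument is carried out on the part
of the chart lying over that neighbourhood. -/
theorem weylFreeAt_chartMetric {g : Metric n X} (hn : 2 ≤ n) (hg : LocallyConformallyFlat g) (p : X)
    {y : Coord n} (hy : y ∈ half (chartOpens p)) : WeylFreeAt (chartMetric g p) y := by
  obtain ⟨U, hU, hyU, F, c, hF, hc⟩ := hg (ext[p].symm y)
  obtain ⟨O, hO⟩ := exists_opens (n := n) p hU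
  have hyO : y ∈ half O := by rw [hO]; exact ⟨hy, hyU⟩
  have hsm := contDiffOn_comp_symm hF p hO.subset
  have hG := (isMetricOn_chartMetric g p).mono (hO.subset.trans inter_subset_left)
  refine (weylFree_iff hG).1 (weylFree_of_conformallyFlat hn hG hsm
    (c := fun y => c (ext[p].symm y)) (fun y hy => (hc _ (hO.subset hy).2).1) fun z hz => ?_) y hyO
  ext i j
  have hz' := hO.subset hz
  have hd : MDifferentiableAt (𝓡∂ (n + 1)) 𝓘(ℝ, Coord n) F (ext[p].symm z) :=
    (hF.contMDiffAt (hU.mem_nhds hz'.2)).mdifferentiableAt (by simp)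
  have h1 := (hc _ hz'.2).2 (coordVector p i z) (coordVector p j z)
  rw [mfderiv_coordVector hz'.1 hd, mfderiv_coordVector hz'.1 hd] at h1
  rw [Matrix.smul_apply, smul_eq_mul]
  refine Eq.trans ?_ h1
  rw [Matrix.mul_apply, PiLp.inner_apply]
  refine Finset.sum_congr rfl fun a _ => ?_
  rw [Matrix.transpose_apply, jacobian, Matrix.of_apply, Matrix.of_apply, partialDeriv, partialDeriv,
    fderivWithin_coord hsm hz, fderivWithin_coord hsm hz]
  exact mul_comm _ _

/-- The same local maps serve, with the factor divided by e^{2u}; closedness of the one-form is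
needed at metrics other than g₀. -/
theorem LocallyConformallyFlat.conformal {g : Metric n X} (hg : LocallyConformallyFlat g)
    (u : C^∞⟮𝓡∂ (n + 1), X; ℝ⟯) : LocallyConformallyFlat (conformal u g) := fun p => by
  obtain ⟨U, hU, hp, F, c, hF, hc⟩ := hg p
  refine ⟨U, hU, hp, F, fun q => Real.exp (-(2 * u q)) * c q, hF, fun q hq =>
    ⟨mul_pos (Real.exp_pos _) (hc q hq).1, fun v w => ?_⟩⟩
  rw [(hc q hq).2 v w]
  change c q * g.inner q v w = Real.exp (-(2 * u q)) * c q * (Real.exp (2 * u q) * g.inner q v w)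
  rw [Real.exp_neg]
  have := Real.exp_pos (2 * u q)
  field_simp

end

/-! ## Measures glued from densities in charts -/

section Density

variable {α X : Type*} [MeasurableSpace α] [TopologicalSpace α] [OpensMeasurableSpace α]
  [TopologicalSpace X] [MeasurableSpace X] [BorelSpace X]

/-- The image under a parametrization of a measure with a density on a subset. -/
def densityMeasure (ν : Measure α) (T : Set α) (f : α → X) (ρ : α → ℝ) : Measure X :=
  Measure.map f ((ν.restrict T).withDensity fun y => ENNReal.ofReal (ρ y))

variable {ν : Measure α} {T : Set α} {f : α → X} {ρ : α → ℝ} (hT : MeasurableSet T)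
  (hf : ContinuousOn f T)

include hT hf in
theorem aemeasurable_withDensity : AEMeasurable f
    ((ν.restrict T).withDensity fun y => ENNReal.ofReal (ρ y)) :=
  (hf.aemeasurable hT).mono_ac (withDensity_absolutelyContinuous _ _)

include hT hf in
theorem densityMeasure_restrict {S : Set X} (hS : MeasurableSet S) (hfS : MapsTo f T S) :
    (densityMeasure ν T f ρ).restrict S = densityMeasure ν T f ρ := by
  refine Measure.restrict_eq_self_of_ae_mem ?_
  refine (ae_map_iff (aemeasurable_withDensity hT hf) hS).2 ?_
  exact (withDensity_absolutelyContinuous _ _).ae_le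
    ((ae_restrict_mem hT).mono fun y hy => hfS hy)

variable (hρ : ContinuousOn ρ T)

include hT hf hρ in
theorem lintegral_densityMeasure {F : X → ENNReal} (hF : Measurable F) :
    ∫⁻ x, F x ∂(densityMeasure ν T f ρ) = ∫⁻ y in T, ENNReal.ofReal (ρ y) * F (f y) ∂ν := by
  rw [densityMeasure, lintegral_map' hF.aemeasurable (aemeasurable_withDensity hT hf)]
  exact lintegral_withDensity_eq_lintegral_mul₀ (hρ.aemeasurable hT).ennreal_ofReal
    (hF.comp_aemeasurable (hf.aemeasurable hT))

variable (h0 : ∀ y ∈ T, 0 ≤ ρ y) {S : Set X} (hS : MeasurableSet S) (hfS : MapsTo f T S)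
  {φ : X → ℝ} (hφ : ContinuousOn φ S)

include hT hf hS hfS hφ in
theorem aestronglyMeasurable_densityMeasure :
    AEStronglyMeasurable φ (densityMeasure ν T f ρ) := by
  rw [← densityMeasure_restrict hT hf hS hfS]
  exact hφ.aestronglyMeasurable hS

include hT hf hS hfS hφ hρ h0

theorem integral_densityMeasure :
    ∫ x, φ x ∂(densityMeasure ν T f ρ) = ∫ y in T, φ (f y) * ρ y ∂ν := by
  have hm := aestronglyMeasurable_densityMeasure (ν := ν) (ρ := ρ) hT hf hS hfS hφ
  rw [densityMeasure, integral_map (aemeasurable_withDensity hT hf) hm,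
    integral_withDensity_eq_integral_toReal_smul₀ (hρ.aemeasurable hT).ennreal_ofReal
      (Filter.Eventually.of_forall fun _ => ENNReal.ofReal_lt_top)]
  refine setIntegral_congr_fun hT fun y hy => ?_
  simp only [ENNReal.toReal_ofReal (h0 y hy), smul_eq_mul]
  exact mul_comm _ _

theorem integrable_densityMeasure (hi : IntegrableOn (fun y => φ (f y) * ρ y) T ν) :
    Integrable φ (densityMeasure ν T f ρ) := by
  have hm := aestronglyMeasurable_densityMeasure (ν := ν) (ρ := ρ) hT hf hS hfS hφ
  rw [densityMeasure, integrable_map_measure hm (aemeasurable_withDensity hT hf),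
    integrable_withDensity_iff_integrable_smul₀' (hρ.aemeasurable hT).ennreal_ofReal
      (Filter.Eventually.of_forall fun _ => ENNReal.ofReal_lt_top)]
  refine IntegrableOn.congr_fun hi (fun y hy => ?_) hT
  simp only [ENNReal.toReal_ofReal (h0 y hy), smul_eq_mul, Function.comp_apply]
  exact mul_comm _ _

end Density

theorem setLIntegral_eq_of_subset {α : Type*} [MeasurableSpace α] {ν : Measure α} {S T : Set α}
    (hS : MeasurableSet S) (hT : MeasurableSet T) (hST : S ⊆ T) {F : α → ENNReal}
    (hF : ∀ y ∈ T, y ∉ S → F y = 0) : ∫⁻ y in T, F y ∂ν = ∫⁻ y in S, F y ∂ν := by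
  rw [← lintegral_indicator hT, ← lintegral_indicator hS]
  refine lintegral_congr fun y => ?_
  by_cases hy : y ∈ S
  · rw [indicator_of_mem hy, indicator_of_mem (hST hy)]
  · rw [indicator_of_notMem hy]
    by_cases hyT : y ∈ T
    · rw [indicator_of_mem hyT, hF y hyT hy]
    · rw [indicator_of_notMem hyT]

/-- Densities which are related by a change of variables define the same measure. -/
theorem densityMeasure_congr {E X : Type*} [NormedAddCommGroup E] [NormedSpace ℝ E]
    [FiniteDimensional ℝ E] [MeasurableSpace E] [BorelSpace E]
    [TopologicalSpace X] [MeasurableSpace X] [BorelSpace X]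
    {ν : Measure E} [ν.IsAddHaarMeasure] {T T' S : Set E} {f f' : E → X} {ρ ρ' : E → ℝ}
    (hT : MeasurableSet T) (hT' : MeasurableSet T') (hf : ContinuousOn f T)
    (hf' : ContinuousOn f' T') (hρ : ContinuousOn ρ T) (hρ' : ContinuousOn ρ' T')
    {V : Set X} (hV : MeasurableSet V)
    (hS : MeasurableSet S) (hST : S = T ∩ f ⁻¹' V) {φ : E → E} {D : E → E →L[ℝ] E}
    (hφ : ∀ y ∈ S, HasFDerivWithinAt φ (D y) S y) (hinj : InjOn φ S)
    (him : φ '' S = T' ∩ f' ⁻¹' V) (hff : ∀ y ∈ S, f' (φ y) = f y)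
    (hρρ : ∀ y ∈ S, ρ y = |(D y).det| * ρ' (φ y)) :
    (densityMeasure ν T f ρ).restrict V = (densityMeasure ν T' f' ρ').restrict V := by
  have hS' : MeasurableSet (φ '' S) := by
    exact measurable_image_of_fderivWithin hS hφ hinj
  refine Measure.ext fun A hA => ?_
  rw [Measure.restrict_apply hA, Measure.restrict_apply hA, ← lintegral_indicator_one (hA.inter hV),
    ← lintegral_indicator_one (hA.inter hV)]
  have hm : Measurable ((A ∩ V).indicator (1 : X → ENNReal)) :=
    measurable_one.indicator (hA.inter hV)
  rw [lintegral_densityMeasure hT hf hρ hm, lintegral_densityMeasure hT' hf' hρ' hm,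
    setLIntegral_eq_of_subset hS hT (hST ▸ inter_subset_left),
    setLIntegral_eq_of_subset hS' hT' (him ▸ inter_subset_left),
    lintegral_image_eq_lintegral_abs_det_fderiv_mul ν hS hφ hinj]
  · refine setLIntegral_congr_fun hS fun y hy => ?_
    rw [hff y hy, hρρ y hy, ENNReal.ofReal_mul (abs_nonneg _), mul_assoc]
  · intro y hy hyS
    rw [indicator_of_notMem, mul_zero]
    intro h
    exact hyS (him.symm ▸ ⟨hy, h.2⟩)
  · intro y hy hyS
    rw [indicator_of_notMem, mul_zero]
    intro h
    exact hyS (hST.symm ▸ ⟨hy, h.2⟩)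

/-- The supremum of a compatible family of measures carried by the sets of a cover restricts to each
of them. -/
theorem iSup_restrict {ι X : Type*} [MeasurableSpace X] {μ : ι → Measure X} {U : ι → Set X}
    (hU : ∀ p, MeasurableSet (U p)) (h0 : ∀ p, (μ p).restrict (U p) = μ p)
    (hc : ∀ p q, (μ p).restrict (U p ∩ U q) = (μ q).restrict (U p ∩ U q)) (s : ℕ → ι)
    (hs : ⋃ i, U (s i) = univ) (q : ι) : (⨆ p, μ p).restrict (U q) = μ q := by
  set A : ℕ → Set X := disjointed fun i => U (s i)
  have hA : ∀ i, MeasurableSet (A i) := fun i => .disjointed (fun i => hU (s i)) i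
  have hAs : ∀ i, A i ⊆ U (s i) := fun i => disjointed_subset _ i
  have hAu : ⋃ i, A i = univ := by rw [← hs]; exact iUnion_disjointed
  have hAd : Pairwise (Function.onFun Disjoint A) := disjoint_disjointed _
  -- The measures glued along a countable disjoint refinement of the cover. Compatibility shows that
  -- M restricts to each of them, and therefore M is their supremum.
  set M : Measure X := Measure.sum fun i => (μ (s i)).restrict (A i)
  have key : ∀ p, M.restrict (U p) = μ p := by
    intro p
    rw [Measure.restrict_sum _ (hU p)]
    conv_rhs => rw [← Measure.restrict_univ (μ := μ p), ← hAu, Measure.restrict_iUnion hAd hA]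
    congr 1
    ext1 i
    rw [Measure.restrict_restrict (hU p), ← h0 p, Measure.restrict_restrict (hA i)]
    have h1 := congrArg (fun ν : Measure X => ν.restrict (A i)) (hc (s i) p)
    simp only [Measure.restrict_restrict (hA i)] at h1
    have h2 : A i ∩ (U (s i) ∩ U p) = A i ∩ U p := by
      rw [← inter_assoc, inter_eq_left.2 (hAs i)]
    rw [h2] at h1
    rw [inter_comm, h1]
  have h1 : ⨆ p, μ p = M := by
    refine le_antisymm (iSup_le fun p => ?_) ?_
    · rw [← key p]; exact Measure.restrict_le_self
    · refine Measure.le_iff.2 fun B hB => ?_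
      have h2 : (⨆ p, μ p) B = Measure.sum (fun i => (⨆ p, μ p).restrict (A i)) B := by
        rw [← Measure.restrict_iUnion hAd hA, hAu, Measure.restrict_univ]
      rw [h2, Measure.sum_apply _ hB, Measure.sum_apply _ hB]
      exact ENNReal.tsum_le_tsum fun i =>
        Measure.restrict_mono le_rfl (le_iSup μ (s i)) B
  rw [h1, key]

section

/-! ## The Riemannian measures in charts -/

open TopologicalSpace (Opens)

theorem clm_det {d : ℕ} (D : EuclideanSpace ℝ (Fin d) →L[ℝ] EuclideanSpace ℝ (Fin d)) :
    D.det = (Matrix.of fun i a => D (EuclideanSpace.single i 1) a).det := by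
  rw [← Matrix.det_transpose, ContinuousLinearMap.det,
    ← LinearMap.det_toMatrix (EuclideanSpace.basisFun (Fin d) ℝ).toBasis]
  congr 1

variable {n : ℕ}

/-- The projection to the hyperplane. -/
def dropCLM (n : ℕ) : Coord n →L[ℝ] EuclideanSpace ℝ (Fin n) :=
  LinearMap.toContinuousLinearMap
    { toFun := fun y => WithLp.toLp 2 fun a => y a.succ
      map_add' := fun _ _ => rfl
      map_smul' := fun _ _ => rfl }

theorem dropCLM_apply (y : Coord n) (a : Fin n) : dropCLM n y a = y a.succ := rfl

theorem hyperplane_dropCLM {y : Coord n} (hy : y 0 = 0) : hyperplane (dropCLM n y) = y := by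
  ext i
  refine Fin.cases ?_ (fun a => ?_) i
  · rw [hyperplane_zero, hy]
  · rw [hyperplane_succ, dropCLM_apply]

theorem dropCLM_hyperplane (z : EuclideanSpace ℝ (Fin n)) : dropCLM n (hyperplane z) = z := by
  ext a; rw [dropCLM_apply, hyperplane_succ]

theorem sqrt_det_congr {d : ℕ} (J G : Matrix (Fin d) (Fin d) ℝ) :
    Real.sqrt (J * G * Jᵀ).det = |J.det| * Real.sqrt G.det := by
  rw [Matrix.det_mul, Matrix.det_mul, Matrix.det_transpose,
    show J.det * G.det * J.det = J.det ^ 2 * G.det by ring, Real.sqrt_mul (sq_nonneg _),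
    Real.sqrt_sq_eq_abs]

variable {X : Type*} [TopologicalSpace X] [ChartedSpace (EuclideanHalfSpace (n + 1)) X]
  [IsManifold (𝓡∂ (n + 1)) ∞ X]

local notation "ext[" p "]" => extChartAt (𝓡∂ (n + 1)) p

theorem hasFDerivWithinAt_coordChange (p q : X) {O : Opens (Coord n)}
    (hO : half O = half (chartOpens p) ∩ ext[p].symm ⁻¹' ext[q].source) {y : Coord n}
    (hy : y ∈ half O) : HasFDerivWithinAt (ext[q] ∘ ext[p].symm)
      (fderivWithin ℝ (ext[q] ∘ ext[p].symm) (halfSpace n) y) (half O) y := by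
  rw [← fderivWithin_half _ hy]
  exact ((contDiffOn_coordChange p q hO.subset).differentiableOn (by simp) y hy).hasFDerivWithinAt

theorem coordChange_inverse {p q : X} {y : Coord n}
    (hy : y ∈ half (chartOpens p) ∩ ext[p].symm ⁻¹' ext[q].source) :
    (ext[p] ∘ ext[q].symm) ((ext[q] ∘ ext[p].symm) y) = y := by
  simp only [Function.comp_apply]
  rw [ext[q].left_inv hy.2, right_inv hy.1]

theorem mapsTo_coordChange {p q : X} {y : Coord n}
    (hy : y ∈ half (chartOpens p) ∩ ext[p].symm ⁻¹' ext[q].source) :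
    (ext[q] ∘ ext[p].symm) y ∈ half (chartOpens q) ∩ ext[q].symm ⁻¹' ext[p].source := by
  refine ⟨map_mem hy.2, ?_⟩
  rw [mem_preimage, Function.comp_apply, ext[q].left_inv hy.2]
  exact symm_mem hy.1

theorem det_fderivWithin_coordChange (p q : X) {O : Opens (Coord n)}
    (hO : half O = half (chartOpens p) ∩ ext[p].symm ⁻¹' ext[q].source) {y : Coord n}
    (hy : y ∈ half O) :
    (Matrix.of fun i a => fderivWithin ℝ (ext[q] ∘ ext[p].symm) (halfSpace n) y
      (EuclideanSpace.single i 1) a) = jacobian (ext[q] ∘ ext[p].symm) y := by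
  ext i a
  rw [jacobian, Matrix.of_apply, Matrix.of_apply, partialDeriv,
    fderivWithin_coord (contDiffOn_coordChange p q hO.subset) hy]

variable [MeasurableSpace X]

/-- The volume measure of the chart at `p`. -/
def chartVol (g : Metric n X) (p : X) : Measure X :=
  densityMeasure volume ext[p].target ext[p].symm fun y => Real.sqrt (chartMetric g p y).det

/-- The boundary measure of the chart at `p`. -/
def chartBdryVol (g : Metric n X) (p : X) : Measure X :=
  densityMeasure volume (hyperplane ⁻¹' ext[p].target) (fun z => ext[p].symm (hyperplane z))
    fun z => Real.sqrt (tangential (chartMetric g p (hyperplane z))).det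

theorem measurableSet_target (p : X) : MeasurableSet ext[p].target := by
  rw [target_eq]; exact measurableSet_half

theorem measurableSet_hyperplane_target (p : X) : MeasurableSet
    (hyperplane ⁻¹' ext[p].target : Set (EuclideanSpace ℝ (Fin n))) :=
  (measurableSet_target p).preimage continuous_hyperplane.measurable

theorem continuousOn_symm_hyperplane (p : X) :
    ContinuousOn (fun z => ext[p].symm (hyperplane z)) (hyperplane ⁻¹' ext[p].target) :=
  (continuousOn_extChartAt_symm p).comp continuous_hyperplane.continuousOn fun _ hz => hz

theorem continuousOn_sqrt_det (g : Metric n X) (p : X) :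
    ContinuousOn (fun y => Real.sqrt (chartMetric g p y).det) ext[p].target := by
  rw [target_eq]
  exact (isMetricOn_chartMetric g p).contDiffOn_det.continuousOn.sqrt

theorem continuousOn_sqrt_det_tangential (g : Metric n X) (p : X) :
    ContinuousOn (fun z => Real.sqrt (tangential (chartMetric g p (hyperplane z))).det)
      (hyperplane ⁻¹' ext[p].target) := by
  refine ContinuousOn.sqrt ((isMetricOn_chartMetric g p).contDiffOn_det_tangential.continuousOn.comp
    continuous_hyperplane.continuousOn fun z hz => ?_)
  rw [← target_eq]; exact hz

variable [BorelSpace X]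

/-- The metric determinant transforms with the square of the Jacobian determinant, so its root
supplies the factor in the change of variables. -/
theorem chartVol_restrict (g : Metric n X) (p q : X) :
    (chartVol g p).restrict (ext[p].source ∩ ext[q].source) =
      (chartVol g q).restrict (ext[p].source ∩ ext[q].source) := by
  obtain ⟨O, hO⟩ := exists_opens (n := n) p (isOpen_extChartAt_source (I := 𝓡∂ (n + 1)) q)
  refine densityMeasure_congr (S := half O) (φ := ext[q] ∘ ext[p].symm)
    (D := fun y => fderivWithin ℝ (ext[q] ∘ ext[p].symm) (halfSpace n) y)
    (measurableSet_target p) (measurableSet_target q)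
    (continuousOn_extChartAt_symm p) (continuousOn_extChartAt_symm q)
    (continuousOn_sqrt_det g p) (continuousOn_sqrt_det g q)
    ((isOpen_extChartAt_source p).inter (isOpen_extChartAt_source q)).measurableSet
    measurableSet_half ?_ (fun y hy => hasFDerivWithinAt_coordChange p q hO hy) ?_ ?_ ?_ ?_
  · rw [hO, target_eq]
    ext y
    exact ⟨fun h => ⟨h.1, symm_mem h.1, h.2⟩, fun h => ⟨h.1, h.2.2⟩⟩
  · intro y hy z hz h
    rw [hO] at hy hz
    rw [← coordChange_inverse hy, ← coordChange_inverse hz, h]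
  · rw [target_eq, hO]
    ext y
    constructor
    · rintro ⟨z, hz, rfl⟩
      have := mapsTo_coordChange hz
      exact ⟨this.1, this.2, symm_mem this.1⟩
    · intro h
      have h' : y ∈ half (chartOpens q) ∩ ext[q].symm ⁻¹' ext[p].source := ⟨h.1, h.2.1⟩
      exact ⟨_, mapsTo_coordChange h', coordChange_inverse h'⟩
  · intro y hy
    rw [hO] at hy
    exact ext[q].left_inv hy.2
  · intro y hy
    rw [chartMetric_transition g p q hO.subset hy, sqrt_det_congr, clm_det,
      det_fderivWithin_coordChange p q hO hy]

/-- Coordinate changes preserve the hyperplane, and their restriction to it has the tangential block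
of the Jacobian as derivative; the tangential metric transforms by the same block. -/
theorem chartBdryVol_restrict (g : Metric n X) (p q : X) :
    (chartBdryVol g p).restrict (ext[p].source ∩ ext[q].source) =
      (chartBdryVol g q).restrict (ext[p].source ∩ ext[q].source) := by
  obtain ⟨O, hO⟩ := exists_opens (n := n) p (isOpen_extChartAt_source (I := 𝓡∂ (n + 1)) q)
  have hmaps : MapsTo hyperplane (hyperplane ⁻¹' half O : Set (EuclideanSpace ℝ (Fin n))) (half O) :=
    fun _ hz => hz
  have hφ0 : ∀ z : EuclideanSpace ℝ (Fin n), hyperplane z ∈ half O →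
      hyperplane (dropCLM n ((ext[q] ∘ ext[p].symm) (hyperplane z))) =
        (ext[q] ∘ ext[p].symm) (hyperplane z) := fun z hz =>
    hyperplane_dropCLM (coordChange_boundary hO.subset _ hz (hyperplane_zero z))
  have hD : ∀ z : EuclideanSpace ℝ (Fin n), hyperplane z ∈ half O →
      ((dropCLM n).comp ((fderivWithin ℝ (ext[q] ∘ ext[p].symm) (halfSpace n) (hyperplane z)).comp
        (hyperplaneCLM n))).det = (tangential (jacobian (ext[q] ∘ ext[p].symm) (hyperplane z))).det := by
    intro z hz
    rw [clm_det, ← det_fderivWithin_coordChange p q hO hz]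
    congr 1
    ext b a
    simp only [Matrix.of_apply, ContinuousLinearMap.comp_apply, hyperplaneCLM_single, tangential,
      Matrix.submatrix_apply, dropCLM_apply]
  refine densityMeasure_congr (S := hyperplane ⁻¹' half O)
    (φ := fun z => dropCLM n ((ext[q] ∘ ext[p].symm) (hyperplane z)))
    (D := fun z => (dropCLM n).comp
      ((fderivWithin ℝ (ext[q] ∘ ext[p].symm) (halfSpace n) (hyperplane z)).comp (hyperplaneCLM n)))
    (measurableSet_hyperplane_target p) (measurableSet_hyperplane_target q)
    (continuousOn_symm_hyperplane p) (continuousOn_symm_hyperplane q)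
    (continuousOn_sqrt_det_tangential g p) (continuousOn_sqrt_det_tangential g q)
    ((isOpen_extChartAt_source p).inter (isOpen_extChartAt_source q)).measurableSet
    (measurableSet_half.preimage continuous_hyperplane.measurable) ?_ (fun z hz => ?_) ?_ ?_ ?_ ?_
  · rw [hO, target_eq]
    ext y
    exact ⟨fun h => ⟨h.1, symm_mem h.1, h.2⟩, fun h => ⟨h.1, h.2.2⟩⟩
  · have h1 : HasFDerivWithinAt (hyperplane (n := n)) (hyperplaneCLM n) (hyperplane ⁻¹' half O) z :=
      (hyperplaneCLM n).hasFDerivWithinAt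
    exact (dropCLM n).hasFDerivAt.comp_hasFDerivWithinAt z
      ((hasFDerivWithinAt_coordChange p q hO hz).comp z h1 hmaps)
  · intro y hy z hz h
    have h1 := congrArg hyperplane h
    simp only [hφ0 _ hy, hφ0 _ hz] at h1
    have hy' := hO.subset hy
    have hz' := hO.subset hz
    have h2 : hyperplane y = hyperplane z := by
      rw [← coordChange_inverse hy', ← coordChange_inverse hz', h1]
    rw [← dropCLM_hyperplane y, h2, dropCLM_hyperplane]
  · rw [target_eq]
    ext y
    constructor
    · rintro ⟨z, hz, rfl⟩
      have := mapsTo_coordChange (hO.subset hz)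
      rw [← hφ0 z hz] at this
      exact ⟨this.1, this.2, symm_mem this.1⟩
    · intro h
      have h' : hyperplane y ∈ half (chartOpens q) ∩ ext[q].symm ⁻¹' ext[p].source := ⟨h.1, h.2.1⟩
      have h2 := mapsTo_coordChange h'
      obtain ⟨O', hO'⟩ := exists_opens (n := n) q (isOpen_extChartAt_source (I := 𝓡∂ (n + 1)) p)
      have h3 : hyperplane (dropCLM n ((ext[p] ∘ ext[q].symm) (hyperplane y))) =
          (ext[p] ∘ ext[q].symm) (hyperplane y) :=
        hyperplane_dropCLM (coordChange_boundary hO'.subset _ (hO'.symm.subset h') (hyperplane_zero y))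
      refine ⟨dropCLM n ((ext[p] ∘ ext[q].symm) (hyperplane y)), ?_, ?_⟩
      · rw [mem_preimage, h3, hO]; exact h2
      · simp only
        rw [h3, coordChange_inverse h', dropCLM_hyperplane]
  · intro y hy
    rw [hφ0 y hy]
    exact ext[q].left_inv (hO.subset hy).2
  · intro y hy
    rw [hD y hy, hφ0 y hy, chartMetric_transition g p q hO.subset hy,
      tangential_congr (contDiffOn_coordChange p q hO.subset)
        (coordChange_boundary hO.subset) hy (hyperplane_zero y), sqrt_det_congr]

variable [CompactSpace X]

/-- The point q ensures that X is nonempty, so that a finite subcover can be enumerated by the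
natural numbers as `iSup_restrict` requires. -/
theorem exists_nat_cover (q : X) : ∃ s : ℕ → X, ⋃ i, ext[s i].source = univ := by
  obtain ⟨t, -, h⟩ := isCompact_univ.elim_nhds_subcover
    (fun p : X => ext[p].source) fun p _ => extChartAt_source_mem_nhds p
  have hne : (t : Set X).Nonempty := by
    obtain ⟨p, hp, -⟩ := mem_iUnion₂.1 (h (mem_univ q))
    exact ⟨p, hp⟩
  obtain ⟨s, hs⟩ := t.countable_toSet.exists_eq_range hne
  refine ⟨s, eq_univ_of_univ_subset (h.trans (iUnion₂_subset fun p hp => ?_))⟩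
  obtain ⟨i, rfl⟩ : p ∈ range s := hs ▸ hp
  exact subset_iUnion (fun i => ext[s i].source) i

theorem vol_restrict (g : Metric n X) (q : X) : (vol g).restrict ext[q].source = chartVol g q := by
  obtain ⟨s, hs⟩ := exists_nat_cover (n := n) q
  exact iSup_restrict (U := fun p : X => ext[p].source)
    (fun p => (isOpen_extChartAt_source (I := 𝓡∂ (n + 1)) p).measurableSet)
    (fun p => densityMeasure_restrict (measurableSet_target p) (continuousOn_extChartAt_symm p)
      (isOpen_extChartAt_source p).measurableSet ext[p].mapsTo_symm) (chartVol_restrict g) s hs q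

theorem bdryVol_restrict (g : Metric n X) (q : X) :
    (bdryVol g).restrict ext[q].source = chartBdryVol g q := by
  obtain ⟨s, hs⟩ := exists_nat_cover (n := n) q
  exact iSup_restrict (U := fun p : X => ext[p].source)
    (fun p => (isOpen_extChartAt_source (I := 𝓡∂ (n + 1)) p).measurableSet)
    (fun p => densityMeasure_restrict (measurableSet_hyperplane_target p)
      (continuousOn_symm_hyperplane p) (isOpen_extChartAt_source p).measurableSet
      fun z hz => ext[p].mapsTo_symm hz) (chartBdryVol_restrict g) s hs q

end

section

/-! ## The curvature functional in charts -/

open TopologicalSpace (Opens)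

section Local

variable {n : ℕ} {O : Opens (Coord n)} {G G' : Coord n → Matrix (Fin (n + 1)) (Fin (n + 1)) ℝ}
  (hG : IsMetricOn O G) (hG' : IsMetricOn O G') (h : EqOn G G' (half O))
  {k m : ℕ} (hN : n + 1 = 2 * k + m)

theorem jacobian_id {y : Coord n} (hy : y ∈ half O) : jacobian id y = 1 := by
  ext i a
  rw [jacobian, Matrix.of_apply, partialDeriv,
    fderivWithin_coord (φ := id) (contDiffOn_id (s := half O)) hy,
    fderivWithin_id (uniqueDiffOn_halfSpace y hy.1)]
  simp [Matrix.one_apply, eq_comm]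

include hG hG' h hN

/-- The transformation law for the identity map: the curvature at y depends only on the metric on a
relative neighbourhood of y. -/
theorem locSigma_congr {y : Coord n} (hy : y ∈ half O) : locSigma k G y = locSigma k G' y :=
  locSigma_transition (φ := id) contDiffOn_id (fun _ hy => hy) hG hG'
    (fun y hy => by rw [jacobian_id hy, h hy]; simp) hN hy

theorem locH_congr {y : Coord n} (hy : y ∈ half O) (hy0 : y 0 = 0) :
    locH k G y = locH k G' y :=
  locH_transition (φ := id) contDiffOn_id (fun _ hy => hy) hG hG'
    (fun y hy => by rw [jacobian_id hy, h hy]; simp) (fun _ _ h => h) hN hy hy0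

theorem locPairing_congr (f : smoothFun O) :
    locPairing k G (extFun f) = locPairing k G' (extFun f) := by
  rw [locPairing, locPairing]
  congr 1
  · refine integral_congr_ae (Filter.Eventually.of_forall fun y => ?_)
    by_cases hy : y ∈ half O
    · simp only [h hy, locSigma_congr hG hG' h hN hy]
    · simp [extFun_of_notMem _ hy]
  · refine integral_congr_ae (Filter.Eventually.of_forall fun z => ?_)
    by_cases hy : hyperplane z ∈ half O
    · simp only [h hy, locH_congr hG hG' h hN hy (hyperplane_zero z)]
    · simp [extFun_of_notMem _ hy]

omit hG' h
variable (hk : 1 ≤ k)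
include hk

/-- The conformal formula with w = 0 exhibits the density as an element of the algebra of smooth
functions. -/
theorem exists_bulk_density : ∃ c : smoothFun O, ∀ y : half O,
    Real.sqrt (G y).det * locSigma k G y = evalAt y c := by
  refine ⟨hG.bulkWt * hG.data.bulk m k (hG.hs 0) (dif 0), fun y => ?_⟩
  have h1 := hG.locSigma_conformal (w := extFun (0 : smoothFun O)) (contDiffOn_extFun 0) hk hN y.2
  rw [← hG.evalAt_bulk 0 y] at h1
  have h0 : extFun (0 : smoothFun O) = 0 := (extLin O).map_zero
  have h2 : (fun y => Real.exp (2 * extFun (0 : smoothFun O) y) • G y) = G := by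
    funext y; simp [h0]
  rw [h2] at h1
  simp only [h0, Pi.zero_apply, mul_zero, Real.exp_zero, one_smul, one_mul] at h1
  rw [h1, map_mul]
  simp only [IsMetricOn.bulkWt, evalAt_toSmooth]

theorem exists_bdry_density : ∃ c : smoothFun O, ∀ y : half O,
    Real.sqrt (tangential (G y)).det * locH k G y = evalAt y c := by
  refine ⟨hG.bdryWt * hG.data.bdry m k (hG.hs 0) (dif 0), fun y => ?_⟩
  have h1 := hG.locH_conformal (w := extFun (0 : smoothFun O)) (contDiffOn_extFun 0) hk hN y.2
  rw [← hG.evalAt_bdry 0 y] at h1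
  have h0 : extFun (0 : smoothFun O) = 0 := (extLin O).map_zero
  have h2 : (fun y => Real.exp (2 * extFun (0 : smoothFun O) y) • G y) = G := by
    funext y; simp [h0]
  rw [h2] at h1
  simp only [h0, Pi.zero_apply, mul_zero, Real.exp_zero, one_smul, one_mul] at h1
  rw [h1, map_mul]
  simp only [IsMetricOn.bdryWt, evalAt_toSmooth]

theorem continuousOn_locSigma : ContinuousOn (locSigma k G) (half O) := by
  obtain ⟨c, hc⟩ := exists_bulk_density hG hN hk
  refine ((contDiffOn_extFun c).continuousOn.div hG.contDiffOn_det.continuousOn.sqrt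
    fun y hy => ?_).congr fun y hy => ?_
  · exact (Real.sqrt_pos.2 (hG.posDef y hy).det_pos).ne'
  · have := (Real.sqrt_pos.2 (hG.posDef y hy).det_pos).ne'
    rw [Pi.div_apply, extFun_apply c hy, ← hc ⟨y, hy⟩]
    field_simp

theorem continuousOn_locH : ContinuousOn (locH k G) (half O) := by
  obtain ⟨c, hc⟩ := exists_bdry_density hG hN hk
  refine ((contDiffOn_extFun c).continuousOn.div hG.contDiffOn_det_tangential.continuousOn.sqrt
    fun y hy => ?_).congr fun y hy => ?_
  · exact (Real.sqrt_pos.2 (hG.tangential_posDef hy).det_pos).ne'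
  · have := (Real.sqrt_pos.2 (hG.tangential_posDef hy).det_pos).ne'
    rw [Pi.div_apply, extFun_apply c hy, ← hc ⟨y, hy⟩]
    field_simp

end Local

theorem integral_of_densityMeasure {α X : Type*} [MeasurableSpace α] [TopologicalSpace α]
    [OpensMeasurableSpace α] [TopologicalSpace X] [MeasurableSpace X] [BorelSpace X]
    {ν : Measure α} {T : Set α} {f : α → X} {ρ : α → ℝ} (hT : MeasurableSet T)
    (hf : ContinuousOn f T) (hρ : ContinuousOn ρ T) (h0 : ∀ y ∈ T, 0 ≤ ρ y) {S U : Set X}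
    (hS : MeasurableSet S) (hfS : MapsTo f T S) {φ : X → ℝ} (hφ : ContinuousOn φ S)
    {μ : Measure X} (hμ : μ.restrict U = densityMeasure ν T f ρ) (hU : ∀ x ∉ U, φ x = 0)
    {F : α → ℝ} (hF : ∀ y ∈ T, φ (f y) * ρ y = F y) (hF0 : ∀ y ∉ T, F y = 0)
    (hFi : Integrable F ν) : Integrable φ μ ∧ ∫ x, φ x ∂μ = ∫ y, F y ∂ν := by
  constructor
  · rw [← integrableOn_iff_integrable_of_support_subset (s := U)
      fun x hx => by_contra fun h => hx (hU x h), IntegrableOn, hμ]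
    exact integrable_densityMeasure hT hf hρ h0 hS hfS hφ
      (hFi.integrableOn.congr_fun (fun y hy => (hF y hy).symm) hT)
  · rw [← setIntegral_eq_integral_of_forall_compl_eq_zero hU, hμ,
      integral_densityMeasure hT hf hρ h0 hS hfS hφ, setIntegral_congr_fun hT hF,
      setIntegral_eq_integral_of_forall_compl_eq_zero hF0]

variable {n : ℕ} {X : Type*} [TopologicalSpace X] [ChartedSpace (EuclideanHalfSpace (n + 1)) X]

local notation "C^∞X" => C^∞⟮𝓡∂ (n + 1), X; ℝ⟯

local notation "ext[" p "]" => extChartAt (𝓡∂ (n + 1)) p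

variable [IsManifold (𝓡∂ (n + 1)) ∞ X]

/-- The function `h` is supported in the chart at `q`. -/
def SuppIn (q : X) (h : C^∞X) : Prop :=
  ∃ L : Set X, IsCompact L ∧ L ⊆ ext[q].source ∧ ∀ x ∉ L, h x = 0

theorem SuppIn.mul_right {q : X} {h : C^∞X} (hh : SuppIn q h)
    (f : C^∞X) : SuppIn q (h * f) := by
  obtain ⟨L, hL, hLs, h0⟩ := hh
  exact ⟨L, hL, hLs, fun x hx => by
    rw [ContMDiffMap.coe_mul, Pi.mul_apply, h0 x hx, zero_mul]⟩

/-- A function on the manifold in the coordinates of a chart. -/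
def pull (q : X) : C^∞X →ₗ[ℝ] smoothFun (chartOpens (n := n) q) where
  toFun u := toSmooth (fun y => u (ext[q].symm y))
    (contDiffOn_comp_symm (U := univ) u.contMDiff.contMDiffOn q fun _ hy => ⟨hy, mem_univ _⟩)
  map_add' _ _ := rfl
  map_smul' _ _ := rfl

theorem evalAt_pull (q : X) (u : C^∞X) (y : half (chartOpens (n := n) q)) :
    evalAt y (pull q u) = u (ext[q].symm y) := rfl

theorem SuppIn.pull {q : X} {h : C^∞X} (hh : SuppIn q h) :
    ∃ K, IsCompact K ∧ K ⊆ half (chartOpens (n := n) q) ∧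
      ∀ y : half (chartOpens (n := n) q), (y : Coord n) ∉ K → evalAt y (pull q h) = 0 := by
  obtain ⟨L, hL, hLs, h0⟩ := hh
  refine ⟨ext[q] '' L, hL.image_of_continuousOn ((continuousOn_extChartAt q).mono hLs), ?_, ?_⟩
  · rintro _ ⟨x, hx, rfl⟩
    exact map_mem (hLs hx)
  · intro y hy
    rw [evalAt_pull]
    refine h0 _ fun hL => hy ⟨_, hL, right_inv y.2⟩

theorem SuppIn.eq_zero {q : X} {h : C^∞X} (hh : SuppIn q h) {x : X} (hx : x ∉ ext[q].source) :
    h x = 0 := by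
  obtain ⟨L, hL, hLs, h0⟩ := hh
  exact h0 x fun h => hx (hLs h)

variable {k m : ℕ} (hk : 1 ≤ k) (hN : n + 1 = 2 * k + m) (g : Metric n X)

include hk hN

theorem continuousOn_sigmaCurv (q : X) : ContinuousOn (sigmaCurv k g) ext[q].source :=
  ((continuousOn_locSigma (isMetricOn_chartMetric g q) hN hk).comp (continuousOn_extChartAt q)
    fun _ hx => map_mem hx).congr fun _ hx => sigmaCurv_eq hN g hx

theorem continuousOn_hCurv (q : X) :
    ContinuousOn (hCurv k g) (ext[q].source ∩ (𝓡∂ (n + 1)).boundary X) :=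
  ((continuousOn_locH (isMetricOn_chartMetric g q) hN hk).comp
    ((continuousOn_extChartAt q).mono inter_subset_left)
    fun _ hx => map_mem hx.1).congr fun _ hx => hCurv_eq hN g hx.1 hx.2

variable [MeasurableSpace X] [BorelSpace X] [CompactSpace X]

theorem vol_pairing {q : X} {h : C^∞X} (hh : SuppIn q h) :
    Integrable (fun x => h x * sigmaCurv k g x) (vol g) ∧
      ∫ x, h x * sigmaCurv k g x ∂(vol g) = ∫ y, extFun (pull q h) y *
        (Real.sqrt (chartMetric g q y).det * locSigma k (chartMetric g q) y) := by
  obtain ⟨K, hK, hKO, hK0⟩ := hh.pull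
  obtain ⟨c, hc⟩ := exists_bulk_density (isMetricOn_chartMetric g q) hN hk
  refine integral_of_densityMeasure (measurableSet_target q) (continuousOn_extChartAt_symm q)
    (continuousOn_sqrt_det g q) (fun y _ => Real.sqrt_nonneg _)
    (isOpen_extChartAt_source (I := 𝓡∂ (n + 1)) q).measurableSet ext[q].mapsTo_symm
    (h.contMDiff.continuous.continuousOn.mul (continuousOn_sigmaCurv hk hN g q))
    (vol_restrict g q) (fun x hx => by rw [Pi.mul_apply, hh.eq_zero hx, zero_mul]) (fun y hy => ?_)
    (fun y hy => ?_) ((integrable_extFun hK hKO volume (c := pull q h * c) fun y hy => by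
      rw [map_mul, hK0 y hy, zero_mul]).congr (Filter.Eventually.of_forall fun y => ?_))
  · rw [target_eq] at hy
    rw [Pi.mul_apply, sigmaCurv_eq hN g (symm_mem hy), right_inv hy, extFun_apply _ hy, evalAt_pull]
    ring
  · rw [target_eq] at hy
    rw [extFun_of_notMem _ hy, zero_mul]
  · by_cases hy : y ∈ half (chartOpens (n := n) q)
    · simp only [extFun_apply _ hy, map_mul, ← hc ⟨y, hy⟩]
    · simp only [extFun_of_notMem _ hy, zero_mul]

theorem bdryVol_pairing {q : X} {h : C^∞X} (hh : SuppIn q h) :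
    Integrable (fun x => h x * hCurv k g x) (bdryVol g) ∧
      ∫ x, h x * hCurv k g x ∂(bdryVol g) = ∫ z, extFun (pull q h) (hyperplane z) *
        (Real.sqrt (tangential (chartMetric g q (hyperplane z))).det *
          locH k (chartMetric g q) (hyperplane z)) := by
  obtain ⟨K, hK, hKO, hK0⟩ := hh.pull
  obtain ⟨c, hc⟩ := exists_bdry_density (isMetricOn_chartMetric g q) hN hk
  have hint : Integrable (fun z => extFun (pull q h * c) (hyperplane z)) :=
    isClosedEmbedding_hyperplane.measurableEmbedding.integrable_map_iff.1
      (integrable_extFun hK hKO (hypMeasure n) (c := pull q h * c) fun y hy => by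
        rw [map_mul, hK0 y hy, zero_mul])
  have hbd : ∀ z, hyperplane z ∈ half (chartOpens (n := n) q) →
      ext[q].symm (hyperplane z) ∈ (𝓡∂ (n + 1)).boundary X := fun z hz => by
    rw [mem_boundary_iff (symm_mem hz), right_inv hz, hyperplane_zero]
  refine integral_of_densityMeasure (S := ext[q].source ∩ (𝓡∂ (n + 1)).boundary X)
    (measurableSet_hyperplane_target q) (continuousOn_symm_hyperplane q)
    (continuousOn_sqrt_det_tangential g q) (fun y _ => Real.sqrt_nonneg _)
    ((isOpen_extChartAt_source (I := 𝓡∂ (n + 1)) q).measurableSet.inter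
      ((𝓡∂ (n + 1)).isClosed_boundary (n := ∞) (by simp)).measurableSet) (fun z hz => ?_)
    (h.contMDiff.continuous.continuousOn.mul (continuousOn_hCurv hk hN g q))
    (bdryVol_restrict g q) (fun x hx => by rw [Pi.mul_apply, hh.eq_zero hx, zero_mul]) (fun z hy => ?_)
    (fun z hy => ?_) (hint.congr (Filter.Eventually.of_forall fun z => ?_))
  · refine ⟨ext[q].mapsTo_symm hz, hbd z ?_⟩
    rw [← target_eq]; exact hz
  · rw [mem_preimage, target_eq] at hy
    rw [Pi.mul_apply, hCurv_eq hN g (symm_mem hy) (hbd z hy), right_inv hy, extFun_apply _ hy, evalAt_pull]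
    ring
  · rw [mem_preimage, target_eq] at hy
    rw [extFun_of_notMem _ hy, zero_mul]
  · by_cases hy : hyperplane z ∈ half (chartOpens (n := n) q)
    · simp only [extFun_apply _ hy, map_mul, ← hc ⟨_, hy⟩]
    · simp only [extFun_of_notMem _ hy, zero_mul]

theorem curvPairing_eq {q : X} {h : C^∞X} (hh : SuppIn q h) :
    curvPairing k g h = locPairing k (chartMetric g q) (extFun (pull q h)) := by
  rw [curvPairing, (vol_pairing hk hN g hh).2, (bdryVol_pairing hk hN g hh).2, locPairing]

theorem curvPairing_conformal_eq {q : X} (w : C^∞X) {h : C^∞X}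
    (hh : SuppIn q h) : curvPairing k (conformal w g) h =
      locPairing k (confMetric (pull q w) (chartMetric g q)) (extFun (pull q h)) := by
  rw [curvPairing_eq hk hN _ hh]
  refine locPairing_congr (isMetricOn_chartMetric _ q)
    ((isMetricOn_chartMetric g q).confMetric (pull q w)) (fun y hy => ?_) hN _
  rw [chartMetric_conformal, confMetric, extFun_apply _ hy, evalAt_pull]

omit hk hN in
/-- A finite partition of unity by functions supported in charts. -/
theorem exists_partition [T2Space X] : ∃ (s : Finset X) (χ : X → C^∞X),
    (∀ q ∈ s, SuppIn q (χ q)) ∧ ∀ f : C^∞X, f = ∑ q ∈ s, χ q * f := by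
  classical
  obtain ⟨t, -, h⟩ := isCompact_univ.elim_nhds_subcover
    (fun p : X => ext[p].source) fun p _ => extChartAt_source_mem_nhds p
  obtain ⟨F, hF⟩ := SmoothPartitionOfUnity.exists_isSubordinate (𝓡∂ (n + 1)) isClosed_univ
    (fun p : t => ext[(p : X)].source) (fun p => isOpen_extChartAt_source _) fun x hx => by
      obtain ⟨p, hp, hx⟩ := mem_iUnion₂.1 (h hx)
      exact mem_iUnion.2 ⟨⟨p, hp⟩, hx⟩
  refine ⟨t, fun q => if hq : q ∈ t then F ⟨q, hq⟩ else 0, fun q hq => ?_, fun f => ?_⟩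
  · beta_reduce
    rw [dif_pos hq]
    exact ⟨_, (isClosed_tsupport _).isCompact, hF ⟨q, hq⟩, fun x hx => image_eq_zero_of_notMem_tsupport hx⟩
  · ext x
    have h1 : ∑ p : t, F p x = 1 := by
      rw [← finsum_eq_sum_of_fintype]; exact F.sum_eq_one (mem_univ x)
    rw [← Finset.sum_coe_sort]
    have h2 : (∑ q : t, (if hq : (q : X) ∈ t then F ⟨q, hq⟩ else 0) * f) = ∑ q : t, F q * f :=
      Finset.sum_congr rfl fun q _ => by rw [dif_pos q.2]
    rw [h2, ← Finset.sum_mul]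
    have h3 : (∑ q : t, F q) x = 1 := by
      rw [← h1]
      exact map_sum (ContMDiffMap.evalRingHom (I := 𝓡∂ (n + 1)) (n := ∞) (R := ℝ) x) (fun q => F q) _
    change f x = (∑ q : t, F q) x * f x
    rw [h3, one_mul]

variable [T2Space X]

/-- Linearity of the functional in h depends on this, since the integral of a non-integrable
function is zero by convention. -/
theorem integrable_vol (h : C^∞X) :
    Integrable (fun x => h x * sigmaCurv k g x) (vol g) := by
  obtain ⟨s, χ, hs, hf⟩ := exists_partition (n := n) (X := X)
  have h1 : (fun x => h x * sigmaCurv k g x) =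
      fun x => ∑ q ∈ s, (χ q * h) x * sigmaCurv k g x := by
    funext x
    rw [← Finset.sum_mul]
    congr 1
    conv_lhs => rw [hf h]
    exact map_sum (ContMDiffMap.evalRingHom (I := 𝓡∂ (n + 1)) (n := ∞) (R := ℝ) x) _ _
  rw [h1]
  exact integrable_finsetSum _ fun q hq => (vol_pairing hk hN g ((hs q hq).mul_right h)).1

theorem integrable_bdryVol (h : C^∞X) :
    Integrable (fun x => h x * hCurv k g x) (bdryVol g) := by
  obtain ⟨s, χ, hs, hf⟩ := exists_partition (n := n) (X := X)
  have h1 : (fun x => h x * hCurv k g x) = fun x => ∑ q ∈ s, (χ q * h) x * hCurv k g x := by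
    funext x
    rw [← Finset.sum_mul]
    congr 1
    conv_lhs => rw [hf h]
    exact map_sum (ContMDiffMap.evalRingHom (I := 𝓡∂ (n + 1)) (n := ∞) (R := ℝ) x) _ _
  rw [h1]
  exact integrable_finsetSum _ fun q hq => (bdryVol_pairing hk hN g ((hs q hq).mul_right h)).1

/-- The curvature functional as a linear form. -/
def pairing : C^∞X →ₗ[ℝ] ℝ where
  toFun h := curvPairing k g h
  map_add' f h := by
    have h1 := integral_add (integrable_vol hk hN g f) (integrable_vol hk hN g h)
    have h2 := integral_add (integrable_bdryVol hk hN g f) (integrable_bdryVol hk hN g h)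
    simp only [curvPairing, ContMDiffMap.coe_add, Pi.add_apply, add_mul]
    rw [h1, h2]
    ring
  map_smul' a h := by
    simp only [curvPairing, ContMDiffMap.coe_smul, Pi.smul_apply, smul_eq_mul, mul_assoc,
      integral_const_mul, RingHom.id_apply]
    ring

end

section

/-! ## The first variation of the curvature functional -/

open TopologicalSpace (Opens)

section Local

variable {n : ℕ} {O : Opens (Coord n)} {G : Coord n → Matrix (Fin (n + 1)) (Fin (n + 1)) ℝ}
  (hG : IsMetricOn O G) {k m : ℕ} {K : Set (Coord n)} (hK : IsCompact K) (hKO : K ⊆ half O)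

include hK hKO in
-- Every term of the variation in the direction w is supported where w is, so values of the test
-- function off that set do not count.
theorem IsMetricOn.locVar_eq_zero {w h : smoothFun O}
    (hw : ∀ y : half O, (y : Coord n) ∉ K → evalAt y w = 0)
    (hh : ∀ y : half O, (y : Coord n) ∈ K → evalAt y h = 0) : hG.locVar m k w h = 0 := by
  have key : ∀ c a : smoothFun O, (∀ y : half O, (y : Coord n) ∉ K → evalAt y c = 0) →
      extFun (h * (c + (m : ℝ) • (w * a))) = 0 := fun c a hc => by
    have : h * (c + (m : ℝ) • (w * a)) = 0 := smoothFun_ext fun y => by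
      by_cases hy : (y : Coord n) ∈ K
      · simp [hh y hy]
      · simp [hc y hy, hw y hy]
    rw [this]
    exact (extLin O).map_zero
  rw [locVar, key _ _ (hG.evalAt_bulkQ_coeff_one hK hKO hw),
    key _ _ (hG.evalAt_bdryQ_coeff_one hK hKO hw)]
  simp

include hG in
-- A constant has zero differential and zero Hessian, so only the weight e^{mε} changes.
theorem IsMetricOn.locPairing_const (hk : 1 ≤ k) (hN : n + 1 = 2 * k + m) (ε : ℝ)
    (h : smoothFun O) : locPairing k (BdryCurv.confMetric (ε • (1 : smoothFun O)) G) (extFun h) =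
      Real.exp (m * ε) * locPairing k G (extFun h) := by
  have key : ∀ a : ℝ, hG.hs (a • (1 : smoothFun O)) = 0 ∧ dif (a • (1 : smoothFun O)) = 0 := by
    intro a
    have h1 : ∀ i, coordDer O i (a • (1 : smoothFun O)) = 0 := fun i => by
      rw [Derivation.map_smul, Derivation.map_one_eq_zero, smul_zero]
    constructor
    · refine Matrix.ext fun i j => ?_
      simp only [IsMetricOn.hs, hess, Matrix.of_apply, h1, map_zero, mul_zero,
        Finset.sum_const_zero, sub_zero, Matrix.zero_apply]
    · funext i; exact h1 i
  have h0 : locPairing k G (extFun h) = locPairing k (BdryCurv.confMetric (0 : smoothFun O) G) (extFun h) := by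
    congr 1
    funext y
    have : extFun (0 : smoothFun O) y = 0 := congrFun (extLin O).map_zero y
    simp [BdryCurv.confMetric, this]
  have hexp : ∀ (c : smoothFun O) (a : ℝ) (y : Coord n), extFun (h * c) y
      * Real.exp (m * extFun (a • (1 : smoothFun O)) y) = Real.exp (m * a) * extFun (h * c) y := by
    intro c a y
    by_cases hy : y ∈ half O
    · rw [extFun_smul, extFun_apply 1 hy, map_one, mul_one, mul_comm]
    · simp [extFun_of_notMem _ hy]
  have h2 := hG.locPairing_confMetric hk hN (ε • (1 : smoothFun O)) h
  have h3 := hG.locPairing_confMetric hk hN ((0 : ℝ) • (1 : smoothFun O)) h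
  simp only [(key _).1, (key _).2, hexp, integral_const_mul] at h2 h3
  rw [zero_smul, mul_zero, Real.exp_zero, one_mul, one_mul] at h3
  rw [h0, h2, h3]
  ring

end Local

variable {n : ℕ} {X : Type*} [TopologicalSpace X] [ChartedSpace (EuclideanHalfSpace (n + 1)) X]
  [IsManifold (𝓡∂ (n + 1)) ∞ X] [T2Space X] [CompactSpace X] [MeasurableSpace X] [BorelSpace X]
  {k m : ℕ} (hk : 1 ≤ k) (hN : n + 1 = 2 * k + m) (g : Metric n X)

local notation "C^∞X" => C^∞⟮𝓡∂ (n + 1), X; ℝ⟯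

local notation "ext[" p "]" => extChartAt (𝓡∂ (n + 1)) p

theorem conformal_conformal (u v : C^∞X) (g : Metric n X) :
    conformal u (conformal v g) = conformal (v + u) g := by
  simp only [conformal]
  congr 1
  funext x
  rw [smul_smul, ← Real.exp_add]
  congr 2
  change _ = 2 * (v x + u x)
  ring

include hk hN

theorem curvPairing_sum {s : Finset X} {χ : X → C^∞X}
    (hχ : ∀ f : C^∞X, f = ∑ q ∈ s, χ q * f) (f : C^∞X) :
    curvPairing k g f = ∑ q ∈ s, curvPairing k g (χ q * f : C^∞X) := by
  change pairing hk hN g f = ∑ q ∈ s, pairing hk hN g (χ q * f)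
  rw [← map_sum, ← hχ]

/-- A conformal change does not affect the curvature where the conformal factor is locally `1`. -/
theorem curvPairing_local {q : X} {w h : C^∞X} (hh : SuppIn q h)
    (hw : ∀ x, h x ≠ 0 → ∀ᶠ z in 𝓝 x, w z = 0) :
    curvPairing k (conformal w g) h = curvPairing k g h := by
  have key : ∀ y ∈ half (chartOpens (n := n) q), extFun (pull q h) y ≠ 0 →
      ∃ O : Opens (Coord n), y ∈ half O ∧ IsMetricOn O (chartMetric (conformal w g) q) ∧
        IsMetricOn O (chartMetric g q) ∧
        EqOn (chartMetric (conformal w g) q) (chartMetric g q) (half O) := by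
    intro y hy h0
    rw [extFun_apply _ hy, evalAt_pull] at h0
    obtain ⟨U, hU, hUo, hyU⟩ := eventually_nhds_iff.1 (hw _ h0)
    obtain ⟨O, hO⟩ := exists_opens (n := n) q hUo
    have hsub : half O ⊆ half (chartOpens (n := n) q) := hO.subset.trans inter_subset_left
    refine ⟨O, hO.symm.subset ⟨hy, hyU⟩, (isMetricOn_chartMetric _ q).mono hsub,
      (isMetricOn_chartMetric _ q).mono hsub, fun z hz => ?_⟩
    rw [chartMetric_conformal, hU _ (hO.subset hz).2]
    simp
  rw [curvPairing_eq hk hN _ hh, curvPairing_eq hk hN _ hh, locPairing, locPairing]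
  congr 1
  · refine integral_congr_ae (Filter.Eventually.of_forall fun y => ?_)
    by_cases h0 : extFun (pull q h) y = 0
    · simp only [h0, zero_mul]
    · have hy : y ∈ half (chartOpens (n := n) q) := by
        by_contra hy; exact h0 (extFun_of_notMem _ hy)
      obtain ⟨O, hyO, h1, h2, h3⟩ := key y hy h0
      simp only [h3 hyO, locSigma_congr h1 h2 h3 hN hyO]
  · refine integral_congr_ae (Filter.Eventually.of_forall fun z => ?_)
    by_cases h0 : extFun (pull q h) (hyperplane z) = 0
    · simp only [h0, zero_mul]
    · have hy : hyperplane z ∈ half (chartOpens (n := n) q) := by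
        by_contra hy; exact h0 (extFun_of_notMem _ hy)
      obtain ⟨O, hyO, h1, h2, h3⟩ := key _ hy h0
      simp only [h3 hyO, locH_congr h1 h2 h3 hN hyO (hyperplane_zero z)]

omit hk hN in
/-- The first variation of the curvature functional in the chart at `q`. -/
def chartVar (m k : ℕ) (g : Metric n X) (q : X) (w h : C^∞X) : ℝ :=
  (isMetricOn_chartMetric g q).locVar m k (pull q w) (pull q h)

theorem hasDerivAt_curvPairing_of_suppIn {q : X} (w : C^∞X)
    {h : C^∞X} (hh : SuppIn q h) :
    HasDerivAt (fun ε : ℝ => curvPairing k (conformal (ε • w) g) h) (chartVar m k g q w h) 0 := by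
  obtain ⟨K, hK, hKO, hK0⟩ := hh.pull
  simp only [curvPairing_conformal_eq hk hN g _ hh, map_smul]
  exact (isMetricOn_chartMetric g q).hasDerivAt_locPairing hk hN hK hKO _ hK0

variable {g}
variable (hg : 3 ≤ k → LocallyConformallyFlat g)
include hg

theorem chartVar_comm {q : X} (w : C^∞X)
    {h : C^∞X} (hh : SuppIn q h) :
    chartVar m k g q w h = chartVar m k g q h w := by
  obtain ⟨K, hK, hKO, hK0⟩ := hh.pull
  exact (isMetricOn_chartMetric g q).locVar_comm hk hN hK hKO
    (fun h3 y hy => weylFreeAt_chartMetric (by omega) (hg h3) q hy) _ hK0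

omit hk hN hg in
theorem chartVar_sum {q : X} {w : C^∞X} (hw : SuppIn q w) {κ : Type*}
    (s : Finset κ) (f : κ → C^∞X) :
    chartVar m k g q w (∑ i ∈ s, f i) = ∑ i ∈ s, chartVar m k g q w (f i) := by
  obtain ⟨K, hK, hKO, hK0⟩ := hw.pull
  rw [chartVar, map_sum]
  exact (isMetricOn_chartMetric g q).locVar_sum hK hKO hK0 s _

omit hg in
/-- The first variation in a direction supported in a chart. -/
theorem hasDerivAt_curvPairing_of_direction {q : X} {h : C^∞X}
    (hh : SuppIn q h) (f : C^∞X) :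
    HasDerivAt (fun ε : ℝ => curvPairing k (conformal (ε • h) g) f) (chartVar m k g q h f) 0 := by
  obtain ⟨s, χ, hs, hχ⟩ := exists_partition (n := n) (X := X)
  obtain ⟨L, hL, hLs, hL0⟩ := id hh
  obtain ⟨T, hT, hLT, hTs⟩ := exists_compact_between hL (isOpen_extChartAt_source q) hLs
  obtain ⟨η, h1, h0, -⟩ := exists_contMDiffMap_one_nhds_of_subset_interior (n := ⊤) (𝓡∂ (n + 1))
    hL.isClosed hLT
  have hη : SuppIn q η := ⟨T, hT, hTs, h0⟩
  have hη1 : ∀ x ∈ L, η x = 1 := fun x hx => h1.self_of_nhdsSet x hx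
  -- The first part is supported in the chart. Where the second part is nonzero, the point lies off
  -- L, hence h vanishes nearby and the conformal change has no effect.
  have hf : f = η * f + (1 - η) * f := by ring
  have hconst : ∀ ε : ℝ, curvPairing k (conformal (ε • h) g) ((1 - η) * f : C^∞X) =
      curvPairing k g ((1 - η) * f : C^∞X) := by
    intro ε
    rw [curvPairing_sum hk hN _ hχ, curvPairing_sum hk hN g hχ]
    refine Finset.sum_congr rfl fun r hr => curvPairing_local hk hN g ((hs r hr).mul_right _) ?_
    intro x hx
    have hxL : x ∉ L := fun hxL => hx (by
      change χ r x * ((1 - η x) * f x) = 0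
      rw [hη1 x hxL]; ring)
    filter_upwards [hL.isClosed.isOpen_compl.mem_nhds hxL] with z hz
    change ε * h z = 0
    rw [hL0 z hz, mul_zero]
  have hsplit : ∀ ε : ℝ, curvPairing k (conformal (ε • h) g) f =
      curvPairing k (conformal (ε • h) g) (η * f : C^∞X) + curvPairing k g ((1 - η) * f : C^∞X) := by
    intro ε
    rw [← hconst ε]
    conv_lhs => rw [hf]
    exact (pairing hk hN (conformal (ε • h) g)).map_add (η * f) ((1 - η) * f)
  have hvar : chartVar m k g q h f = chartVar m k g q h (η * f) := by
    have h2 := chartVar_sum (m := m) (k := k) (g := g) hh Finset.univ ![η * f, (1 - η) * f]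
    simp only [Fin.sum_univ_two, Matrix.cons_val_zero, Matrix.cons_val_one] at h2
    rw [← hf] at h2
    rw [h2]
    obtain ⟨K, hK, hKO, hK0⟩ : ∃ K, IsCompact K ∧ K ⊆ half (chartOpens (n := n) q) ∧
        (∀ y : half (chartOpens (n := n) q), (y : Coord n) ∉ K → evalAt y (pull q h) = 0) ∧
        ∀ y : half (chartOpens (n := n) q), (y : Coord n) ∈ K →
          evalAt y (pull q ((1 - η) * f)) = 0 := by
      refine ⟨ext[q] '' L, hL.image_of_continuousOn ((continuousOn_extChartAt q).mono hLs), ?_,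
        fun y hy => ?_, fun y hy => ?_⟩
      · rintro _ ⟨x, hx, rfl⟩
        exact map_mem (hLs hx)
      · exact hL0 _ fun hL => hy ⟨_, hL, right_inv y.2⟩
      · obtain ⟨x, hx, hxy⟩ := hy
        rw [evalAt_pull, ← hxy, ext[q].left_inv (hLs hx)]
        change (1 - η x) * f x = 0
        rw [hη1 x hx]; ring
    rw [add_eq_left]
    exact (isMetricOn_chartMetric g q).locVar_eq_zero hK hKO hK0.1 hK0.2
  simp only [hsplit, hvar]
  exact (hasDerivAt_curvPairing_of_suppIn hk hN g h (hη.mul_right f)).add_const _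

/-- The first variation of the curvature functional is symmetric. -/
theorem exists_symmetric_variation : ∃ B : C^∞X → C^∞X → ℝ,
    (∀ v f : C^∞X, HasDerivAt (fun ε : ℝ => curvPairing k (conformal (ε • v) g) f)
      (B v f) 0) ∧
      ∀ v f, B v f = B f v := by
  obtain ⟨s, χ, hs, hχ⟩ := exists_partition (n := n) (X := X)
  have hsupp : ∀ q ∈ s, ∀ f : C^∞X, SuppIn q (χ q * f) := fun q hq f =>
    (hs q hq).mul_right f
  have hB : ∀ v f : C^∞X, HasDerivAt (fun ε : ℝ => curvPairing k (conformal (ε • v) g) f)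
      (∑ q ∈ s, chartVar m k g q v (χ q * f)) 0 := by
    intro v f
    simp only [fun ε : ℝ => curvPairing_sum hk hN (conformal (ε • v) g) hχ f]
    exact HasDerivAt.fun_sum fun q hq =>
      hasDerivAt_curvPairing_of_suppIn hk hN g v (hsupp q hq f)
  refine ⟨_, hB, fun v f => ?_⟩
  -- Symmetry in a chart is available only when one argument is supported there. In the chart at q
  -- the roles are exchanged, so that χ_q f becomes the direction. Its variation tested on v is a
  -- derivative of the global functional, hence may be recomputed by splitting v; a second exchange
  -- in each chart at r allows the sum over q to be carried out.
  calc ∑ q ∈ s, chartVar m k g q v (χ q * f)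
      = ∑ q ∈ s, ∑ r ∈ s, chartVar m k g r (χ q * f) (χ r * v) := by
        refine Finset.sum_congr rfl fun q hq => ?_
        rw [chartVar_comm hk hN hg v (hsupp q hq f)]
        exact (hasDerivAt_curvPairing_of_direction hk hN (hsupp q hq f) v).unique (hB _ _)
    _ = ∑ r ∈ s, chartVar m k g r f (χ r * v) := by
        rw [Finset.sum_comm]
        refine Finset.sum_congr rfl fun r hr => ?_
        rw [chartVar_comm hk hN hg f (hsupp r hr v)]
        conv_rhs => rw [hχ f, chartVar_sum (hsupp r hr v)]
        exact Finset.sum_congr rfl fun q _ => chartVar_comm hk hN hg _ (hsupp r hr v)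

omit hg in
theorem curvPairing_const (ε : ℝ) (f : C^∞X) :
    curvPairing k (conformal (ε • (1 : C^∞X)) g) f =
      Real.exp (m * ε) * curvPairing k g f := by
  obtain ⟨s, χ, hs, hχ⟩ := exists_partition (n := n) (X := X)
  rw [curvPairing_sum hk hN _ hχ, curvPairing_sum hk hN g hχ, Finset.mul_sum]
  refine Finset.sum_congr rfl fun q hq => ?_
  have hh := (hs q hq).mul_right f
  have h1 := curvPairing_conformal_eq hk hN g (ε • (1 : C^∞X)) (h := χ q * f) hh
  have h2 := curvPairing_eq hk hN g (h := χ q * f) hh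
  refine h1.trans (Eq.trans ?_ (congrArg (Real.exp (m * ε) * ·) h2.symm))
  rw [map_smul]
  exact (isMetricOn_chartMetric g q).locPairing_const hk hN ε _

omit hg in
theorem contDiff_curvPairing (hm : m = 0) (u v f : C^∞X) :
    ContDiff ℝ ∞ fun p : ℝ × ℝ => curvPairing k (conformal (p.1 • u + p.2 • v) g) f := by
  obtain ⟨s, χ, hs, hχ⟩ := exists_partition (n := n) (X := X)
  simp only [fun p : ℝ × ℝ => curvPairing_sum hk hN (conformal (p.1 • u + p.2 • v) g) hχ f]
  refine ContDiff.sum fun q hq => ?_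
  have hh : SuppIn q (χ q * f : C^∞X) := (hs q hq).mul_right f
  obtain ⟨K, hK, hKO, hK0⟩ := hh.pull
  simp only [fun p : ℝ × ℝ => curvPairing_conformal_eq hk hN g (p.1 • u + p.2 • v) hh, map_add,
    map_smul]
  exact (isMetricOn_chartMetric g q).contDiff_locPairing hk hN hK hKO hm _ _ hK0

end

section

/-! ## The derivative of the functional -/

open TopologicalSpace (Opens)

theorem hasDerivAt_intervalIntegral {Ψ : ℝ × ℝ → ℝ} (hΨ : ContDiff ℝ ∞ Ψ) :
    HasDerivAt (fun t => ∫ s in (0 : ℝ)..1, Ψ (t, s))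
      (∫ s in (0 : ℝ)..1, fderiv ℝ Ψ (0, s) (1, 0)) 0 := by
  have hD : Continuous fun p : ℝ × ℝ => fderiv ℝ Ψ p (1, 0) :=
    (hΨ.continuous_fderiv (by simp)).clm_apply continuous_const
  obtain ⟨C, hC⟩ := ((isCompact_closedBall (0 : ℝ) 1).prod (isCompact_Icc (a := (0 : ℝ)) (b := 1))
    ).exists_bound_of_continuousOn hD.continuousOn
  have hslice : ∀ t : ℝ, Continuous fun s : ℝ => (t, s) := fun t => by fun_prop
  refine (intervalIntegral.hasDerivAt_integral_of_dominated_loc_of_deriv_le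
    (F := fun t s => Ψ (t, s)) (F' := fun t s => fderiv ℝ Ψ (t, s) (1, 0)) (bound := fun _ => C)
    (Metric.closedBall_mem_nhds 0 one_pos) ?_ ?_ ?_ ?_ ?_ ?_).2
  · exact Filter.Eventually.of_forall fun t =>
      (hΨ.continuous.comp (hslice t)).aestronglyMeasurable
  · exact (hΨ.continuous.comp (hslice 0)).intervalIntegrable _ _
  · exact (hD.comp (hslice 0)).aestronglyMeasurable
  · refine Filter.Eventually.of_forall fun s hs t ht => hC (t, s) ⟨ht, ?_⟩
    rw [uIoc_of_le zero_le_one] at hs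
    exact Ioc_subset_Icc_self hs
  · exact intervalIntegrable_const
  · refine Filter.Eventually.of_forall fun s _ t _ => ?_
    have h1 : HasDerivAt (fun t : ℝ => (t, s)) (1, 0) t :=
      (hasDerivAt_id t).prodMk (hasDerivAt_const t s)
    exact ((hΨ.differentiable (by simp)).differentiableAt.hasFDerivAt (x := (t, s))).comp_hasDerivAt
      t h1

/-- If the one-form `p dx + q dy` is closed along the axis `y = 0`, then the derivative at `t = 0` of
its integral over the segment from the origin to `(1, t)` is `q (1, 0)`. -/
theorem hasDerivAt_ray_integral {p q : ℝ × ℝ → ℝ} (hp : ContDiff ℝ ∞ p) (hq : ContDiff ℝ ∞ q)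
    {β : ℝ → ℝ} (h1 : ∀ s, HasDerivAt (fun ε => p (s, ε)) (β s) 0)
    (h2 : ∀ s, HasDerivAt (fun ε => q (s + ε, 0)) (β s) 0) :
    HasDerivAt (fun t => ∫ s in (0 : ℝ)..1, (p (s, s * t) + t * q (s, s * t))) (q (1, 0)) 0 := by
  set Ψ : ℝ × ℝ → ℝ := fun x => p (x.2, x.2 * x.1) + x.1 * q (x.2, x.2 * x.1)
  have hray : ContDiff ℝ ∞ fun x : ℝ × ℝ => (x.2, x.2 * x.1) :=
    contDiff_snd.prodMk (contDiff_snd.mul contDiff_fst)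
  have hΨ : ContDiff ℝ ∞ Ψ := (hp.comp hray).add (contDiff_fst.mul (hq.comp hray))
  have hD : Continuous fun p : ℝ × ℝ => fderiv ℝ Ψ p (1, 0) :=
    (hΨ.continuous_fderiv (by simp)).clm_apply continuous_const
  -- At t = 0 the chain rule gives s β(s) from p, while the product t q contributes only q. By `h2`
  -- the sum is the derivative in s of s q(s, 0), to which the fundamental theorem of calculus
  -- applies.
  have h3 : ∀ s, fderiv ℝ Ψ (0, s) (1, 0) = s * β s + q (s, 0) := by
    intro s
    have e1 : HasDerivAt (fun t : ℝ => (t, s)) (1, 0) 0 :=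
      (hasDerivAt_id 0).prodMk (hasDerivAt_const 0 s)
    have e0 : HasFDerivAt Ψ (fderiv ℝ Ψ (0, s)) (0, s) :=
      (hΨ.differentiable (by simp)).differentiableAt.hasFDerivAt
    have e2 : HasDerivAt (fun t => Ψ (t, s)) (fderiv ℝ Ψ (0, s) (1, 0)) 0 :=
      e0.comp_hasDerivAt (f := fun t : ℝ => (t, s)) 0 e1
    have e3 : HasDerivAt (fun t : ℝ => s * t) s 0 := by
      simpa using (hasDerivAt_id (0 : ℝ)).const_mul s
    have e4 : HasDerivAt (fun t : ℝ => p (s, s * t)) (β s * s) 0 := by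
      have := h1 s
      rw [← mul_zero s] at this
      exact this.comp 0 e3
    have e5 : DifferentiableAt ℝ (fun t : ℝ => q (s, s * t)) 0 :=
      ((hq.comp (contDiff_const.prodMk (contDiff_const.mul contDiff_id))).differentiable
        (by simp)).differentiableAt
    have e6 := e4.add ((hasDerivAt_id (0 : ℝ)).mul e5.hasDerivAt)
    rw [e2.unique e6]
    simp
    ring
  have h4 : ∀ s, HasDerivAt (fun s => s * q (s, 0)) (fderiv ℝ Ψ (0, s) (1, 0)) s := by
    intro s
    have e1 : HasDerivAt (fun s => q (s, 0)) (β s) s := by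
      have e2 : HasDerivAt (fun t : ℝ => t - s) 1 s := (hasDerivAt_id s).sub_const s
      have e3 : HasDerivAt (fun ε => q (s + ε, 0)) (β s) (s - s) := by
        rw [sub_self]; exact h2 s
      have e4 := e3.comp (h := fun t : ℝ => t - s) s e2
      simpa [Function.comp_def] using e4
    have e2 : HasDerivAt (fun s => s * q (s, 0)) (1 * q (s, 0) + s * β s) s :=
      (hasDerivAt_id s).mul e1
    rw [h3, show s * β s + q (s, 0) = 1 * q (s, 0) + s * β s by ring]
    exact e2
  have h5 := hasDerivAt_intervalIntegral hΨ
  rw [intervalIntegral.integral_eq_sub_of_hasDerivAt (fun s _ => h4 s)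
    ((hD.comp (by fun_prop : Continuous fun s : ℝ => ((0 : ℝ), s))).intervalIntegrable _ _)] at h5
  simpa using h5

variable {n : ℕ} {X : Type*} [TopologicalSpace X] [ChartedSpace (EuclideanHalfSpace (n + 1)) X]
  [IsManifold (𝓡∂ (n + 1)) ∞ X] [T2Space X] [CompactSpace X] [MeasurableSpace X] [BorelSpace X]

/-- The first variation of the functional. -/
theorem hasDerivAt_functionalS {k m : ℕ} (hk : 1 ≤ k) (hN : n + 1 = 2 * k + m) (g₀ : Metric n X)
    (hg₀ : 3 ≤ k → LocallyConformallyFlat g₀) (u Υ : C^∞⟮𝓡∂ (n + 1), X; ℝ⟯) :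
    HasDerivAt (fun t : ℝ => functionalS k g₀ (conformal (t • Υ) (conformal u g₀)))
      (curvPairing k (conformal u g₀) Υ) 0 := by
  have hflat : ∀ w : C^∞⟮𝓡∂ (n + 1), X; ℝ⟯, 3 ≤ k → LocallyConformallyFlat (conformal w g₀) :=
    fun w h3 => (hg₀ h3).conformal w
  rcases Nat.eq_zero_or_pos m with hm | hm
  -- The critical case. In the plane of the metrics e^{2(xu + yΥ)} g₀, testing on u gives the
  -- component p of the one-form and testing on Υ gives q; the symmetric variation at e^{2su} g₀
  -- supplies closedness along the axis.
  · have hp := contDiff_curvPairing (g := g₀) hk hN hm u Υ u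
    have hq := contDiff_curvPairing (g := g₀) hk hN hm u Υ Υ
    choose B hB hBs using fun s : ℝ => exists_symmetric_variation hk hN (hflat (s • u))
    have h1 : ∀ s : ℝ, HasDerivAt (fun ε : ℝ => curvPairing k (conformal (s • u + ε • Υ) g₀) u)
        (B s Υ u) 0 := fun s => by
      simpa only [conformal_conformal] using hB s Υ u
    have h2 : ∀ s : ℝ, HasDerivAt
        (fun ε : ℝ => curvPairing k (conformal ((s + ε) • u + (0 : ℝ) • Υ) g₀) Υ) (B s Υ u) 0 :=
      fun s => by
        rw [hBs]
        simpa only [conformal_conformal, add_smul, zero_smul, add_zero] using hB s u Υ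
    have h3 := hasDerivAt_ray_integral hp hq h1 h2
    simp only [one_smul, zero_smul, add_zero] at h3
    convert h3 using 2 with t
    rw [functionalS, if_pos (by omega), conformal_conformal, logFactor_conformal]
    refine intervalIntegral.integral_congr fun s _ => ?_
    have h4 : s • (u + t • Υ) = s • u + (s * t) • Υ := by rw [smul_add, smul_smul]
    rw [h4]
    have h5 := (pairing hk hN (conformal (s • u + (s * t) • Υ) g₀)).map_add u (t • Υ)
    rw [map_smul] at h5
    exact h5
  -- Away from the critical dimension the functional is F(1)/m. By symmetry its variation in the
  -- direction Υ equals the variation of F(Υ)/m under constant rescaling.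
  · obtain ⟨B, hB, hBs⟩ := exists_symmetric_variation hk hN (hflat u)
    have h1 : B 1 Υ = m * curvPairing k (conformal u g₀) Υ := by
      refine (hB 1 Υ).unique ?_
      simp only [curvPairing_const hk hN]
      have e1 : HasDerivAt (fun ε : ℝ => (m : ℝ) * ε) m 0 := by
        simpa using (hasDerivAt_id (0 : ℝ)).const_mul (m : ℝ)
      simpa using (e1.exp.mul_const (curvPairing k (conformal u g₀) Υ))
    have hm' : (n : ℝ) + 1 - 2 * k = m := by
      have : (n : ℝ) + 1 = 2 * k + m := by exact_mod_cast hN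
      rw [this]; ring
    have h2 := (hB Υ 1).const_mul (((n : ℝ) + 1 - 2 * k)⁻¹)
    rw [hBs, h1, hm', inv_mul_cancel_left₀ (by exact_mod_cast hm.ne')] at h2
    refine h2.congr_of_eventuallyEq (Filter.Eventually.of_forall fun t => ?_)
    beta_reduce
    rw [functionalS, if_neg (by omega), hm']
    rfl

end

end BdryCurv

end

theorem proposition2p2 (n k : ℕ) (hk : 1 ≤ k) (hkn : 2 * k ≤ n + 1)
    (X : Type*) [TopologicalSpace X] [T2Space X] [CompactSpace X]
    [ChartedSpace (EuclideanHalfSpace (n + 1)) X] [IsManifold (𝓡∂ (n + 1)) ∞ X]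
    [MeasurableSpace X] [BorelSpace X]
    (hbdry : ((𝓡∂ (n + 1)).boundary X).Nonempty)
    (g₀ : BdryCurv.Metric n X)
    (hflat : 3 ≤ k → BdryCurv.LocallyConformallyFlat g₀)
    (g : BdryCurv.Metric n X) (hg : g ∈ BdryCurv.conformalClass g₀)
    (Υ : C^∞⟮𝓡∂ (n + 1), X; ℝ⟯) :
    HasDerivAt
      (fun t : ℝ => BdryCurv.functionalS k g₀ (BdryCurv.conformal (t • Υ) g))
      ((∫ x, Υ x * BdryCurv.sigmaCurv k g x ∂(BdryCurv.vol g))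
        + ∫ x, Υ x * BdryCurv.hCurv k g x ∂(BdryCurv.bdryVol g)) 0 := by
  obtain ⟨u, rfl⟩ := hg
  -- The natural-number subtraction defining m is exact because of `hkn`.
  exact BdryCurv.hasDerivAt_functionalS hk (m := n + 1 - 2 * k) (by omega) g₀ hflat u Υ
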